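/- Let $A\to M$ and $B\to N$ be (real, finite rank, smooth) Lie algebroids over smooth manifolds, let $I\subseteq\mathbb R$ be an open interval containing $0$ and $1$, and let $TI\times A\to I\times M$ be the product Lie algebroid. For $t\in I$ let $\mathcal I_t\colon A\to TI\times A$, $a\mapsto(0_t,a)$, be the inclusion over $\iota_t\colon M\to I\times M$, $m\mapsto(t,m)$. Let $\Phi\colon TI\times A\to B$ be a Lie algebroid morphism over $\phi\colon I\times M\to N$, and put $\Phi_t:=\Phi\circ\mathcal I_t\colon A\to B$, a Lie algebroid morphism over $\phi_t:=\phi\circ\iota_t\colon M\to N$; thus $\Phi$ is an LA-homotopy between $(\Phi_0,\phi_0)$ and $(\Phi_1,\phi_1)$. Let $E\to N$ be a smooth vector bundle with a flat $B$-connection $\nabla$. For a flat connection $\nabla$ of a Lie algebroid $A$ on a vector bundle $V$ let $H^\bullet_\nabla(A,V)$ be the cohomology of $\Omega^\bullet(A,V)=\Gamma(\wedge^\bullet A^*\otimes V)$ with the Koszul differential $d_\nabla$. For a Lie algebroid morphism $\Psi\colon A\to B$ over $\psi$, the pullback connection $\Psi^*\nabla$ on $\psi^!E$ is the flat $A$-connection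 given on pullback sections by $(\Psi^*\nabla)_v(\psi^!e)=\nabla_{\Psi(v)}e$, and $\overline{\Psi^*}\colon H^\bullet_\nabla(B,E)\to H^\bullet_{\Psi^*\nabla}(A,\psi^!E)$ denotes the map in cohomology induced by the pullback of forms. A gauge equivalence from a connection $\nabla$ on $V$ to a connection $\nabla'$ on $V'$ is a vector bundle isomorphism $\theta\colon V\to V'$ over the identity with $\nabla_a e=\theta^{-1}(\nabla'_a(\theta(e)))$ for all sections $a$ of $A$ and $e$ of $V$; it induces the isomorphism $\theta_*\colon H^\bullet_\nabla(A,V)\to H^\bullet_{\nabla'}(A,V')$, $[\omega]\mapsto[\theta\circ\omega]$. Then for every $t\in I$ the map $$\overline{\mathcal I_t^*}\colon H^\bullet_{\Phi^*\nabla}(TI\times A,\phi^!E)\to H^\bullet_{\Phi_t^*\nabla}(A,\phi_t^!E)$$ is an isomorphism, and $$\overline{\Phi_1^*}=\overline{\mathcal I_1^*}\circ(\overline{\mathcal I_0^*})^{-1}\circ\overline{\Phi_0^*}\colon H^\bullet_\nabla(B,E)\to H^\bullet_{\Phi_1^*\nabla}(A,\phi_1^!E).$$ Moreover, there is a gauge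 equivalence $\theta\colon\phi_0^!E\to\phi_1^!E$ from $\Phi_0^*\nabla$ to $\Phi_1^*\nabla$ such that $$\overline{\mathcal I_1^*}\circ(\overline{\mathcal I_0^*})^{-1}=\theta_*,$$ so that $\theta_*\circ\overline{\Phi_0^*}=\overline{\Phi_1^*}$. Here $\theta$ can be taken to be the flow, from time $0$ to time $1$, of the linear vector field on $\phi^!E$ defined by the derivation $(\Phi^*\nabla)_{(\partial_t,0)}$: every section of $\phi_0^!E$ is of the form $\iota_0^!s$ for a section $s$ of $\phi^!E$ with $(\Phi^*\nabla)_{(\partial_t,0)}s=0$, and $\theta\circ\iota_0^!s=\iota_1^!s$ for every such $s$. -/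

import Mathlib

open Bundle Set Filter
open scoped Manifold ContDiff Topology

noncomputable section

namespace LA

set_option linter.unusedSectionVars false

/-! ### Vector bundles, sections, smooth functions -/

instance pullbackAddCommGroup {B B' : Type*} {E : B → Type*} {K : Type*} [FunLike K B' B] (f : K)
    [∀ x, AddCommGroup (E x)] (x : B') : AddCommGroup ((f *ᵖ E) x) :=
  inferInstanceAs (AddCommGroup (E (f x)))

section Basic

variable {EM HM M : Type*} [NormedAddCommGroup EM] [NormedSpace ℝ EM] [TopologicalSpace HM]
  {IM : ModelWithCorners ℝ EM HM} [TopologicalSpace M] [ChartedSpace HM M]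
  {EP HP P : Type*} [NormedAddCommGroup EP] [NormedSpace ℝ EP] [TopologicalSpace HP]
  {IP : ModelWithCorners ℝ EP HP} [TopologicalSpace P] [ChartedSpace HP P]
  {FA : Type*} [NormedAddCommGroup FA] [NormedSpace ℝ FA]
  {A : M → Type*} [TopologicalSpace (TotalSpace FA A)] [∀ x, AddCommGroup (A x)]
  [∀ x, Module ℝ (A x)] [∀ x, TopologicalSpace (A x)] [FiberBundle FA A] [VectorBundle ℝ FA A]

/-- The product `f • s` of a smooth function and a smooth section. -/
def fsmul (f : C^∞⟮IM, M; ℝ⟯) (s : Cₛ^∞⟮IM; FA, A⟯) : Cₛ^∞⟮IM; FA, A⟯ :=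
  ⟨fun m => f m • s m, f.contMDiff.smul_section s.contMDiff⟩

@[simp] lemma fsmul_apply (f : C^∞⟮IM, M; ℝ⟯) (s : Cₛ^∞⟮IM; FA, A⟯) (m : M) :
    fsmul f s m = f m • s m := rfl

variable (IM) in
/-- The derivative `v(f)` of a function `f` at `m` in the direction `v ∈ T_m M`. -/
def dirDeriv (f : M → ℝ) (m : M) : TangentSpace IM m →ₗ[ℝ] ℝ :=
  (mfderiv IM 𝓘(ℝ, ℝ) f m).toLinearMap

lemma contMDiffAt_pullback_section {φ : C^∞⟮IP, P; IM, M⟯} {σ : ∀ p, A (φ p)} {p : P} :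
    ContMDiffAt IP (IP.prod 𝓘(ℝ, FA)) ∞
        (fun p => (⟨p, σ p⟩ : TotalSpace FA (φ *ᵖ A))) p ↔
      ContMDiffAt IP (IM.prod 𝓘(ℝ, FA)) ∞ (fun p => (⟨φ p, σ p⟩ : TotalSpace FA A)) p := by
  rw [contMDiffAt_totalSpace, contMDiffAt_totalSpace]
  constructor
  · rintro ⟨_, h⟩
    exact ⟨φ.contMDiff.contMDiffAt, h⟩
  · rintro ⟨_, h⟩
    exact ⟨contMDiffAt_id, h⟩

/-- A section `σ` of the pullback bundle `φ^!A` is smooth iff `p ↦ σ(p) ∈ A` is smooth. -/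
lemma contMDiff_pullback_section {φ : C^∞⟮IP, P; IM, M⟯} {σ : ∀ p, A (φ p)} :
    ContMDiff IP (IP.prod 𝓘(ℝ, FA)) ∞ (fun p => (⟨p, σ p⟩ : TotalSpace FA (φ *ᵖ A))) ↔
      ContMDiff IP (IM.prod 𝓘(ℝ, FA)) ∞ (fun p => (⟨φ p, σ p⟩ : TotalSpace FA A)) :=
  forall_congr' fun _ => contMDiffAt_pullback_section

/-- The pullback section `φ^! s`. -/
def pullbackSection (φ : C^∞⟮IP, P; IM, M⟯) (s : Cₛ^∞⟮IM; FA, A⟯) : Cₛ^∞⟮IP; FA, φ *ᵖ A⟯ :=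
  ⟨fun p => s (φ p), contMDiff_pullback_section.2 (s.contMDiff.comp φ.contMDiff)⟩

variable [FiniteDimensional ℝ EM] [T2Space M] [IsManifold IM ∞ M]

lemma exists_bump {y : M} {U : Set M} (hU : U ∈ 𝓝 y) :
    ∃ ψ : C^∞⟮IM, M; ℝ⟯, (∀ᶠ x in 𝓝 y, ψ x = 1) ∧ tsupport ψ ⊆ U := by
  obtain ⟨ψ, -, h⟩ := (SmoothBumpFunction.nhds_basis_tsupport (I := IM) (c := y)).mem_iff.1 hU
  exact ⟨⟨ψ, ψ.contMDiff⟩, ψ.eventuallyEq_one, h⟩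

variable [ContMDiffVectorBundle ∞ FA A IM] [FiniteDimensional ℝ FA]

variable (IM FA A) in
/-- Global sections which frame the bundle near `y`, with smooth fibrewise linear coefficients. -/
lemma exists_frame (y : M) : ∃ (n : ℕ) (s : Fin n → Cₛ^∞⟮IM; FA, A⟯)
    (κ : Fin n → ∀ x, A x →ₗ[ℝ] ℝ),
    (∀ i, ContMDiff (IM.prod 𝓘(ℝ, FA)) 𝓘(ℝ, ℝ) ∞ (fun v : TotalSpace FA A => κ i v.1 v.2)) ∧
    ∀ᶠ x in 𝓝 y, ∀ v : A x, v = ∑ i, κ i x v • s i x := by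
  set e := trivializationAt FA A y
  have hy : e.baseSet ∈ 𝓝 y := e.open_baseSet.mem_nhds (mem_baseSet_trivializationAt FA A y)
  obtain ⟨ψ, h1, hψ⟩ := exists_bump (IM := IM) hy
  let b := Module.finBasis ℝ FA
  let κ : Fin (Module.finrank ℝ FA) → ∀ x, A x →ₗ[ℝ] ℝ := fun i x =>
    ψ x • (b.coord i ∘ₗ (e.linearMapAt ℝ x))
  refine ⟨_, fun i => ⟨(ψ : M → ℝ) • e.localFrame b i, ?_⟩, κ, fun i => ?_, ?_⟩
  · exact ψ.contMDiff.contMDiffOn.smul_section_of_tsupport e.open_baseSet hψ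
      (e.contMDiffOn_localFrame_baseSet _ b i)
  · intro v
    by_cases hv : v.proj ∈ e.baseSet
    · have h2 : ContMDiffAt (IM.prod 𝓘(ℝ, FA)) 𝓘(ℝ, FA) ∞ (fun w => (e w).2) v :=
        contMDiffAt_snd.comp v ((e.contMDiffOn (IB := IM) (n := ∞)).contMDiffAt
          (e.open_source.mem_nhds (e.mem_source.2 hv)))
      have h3 : ContMDiffAt (IM.prod 𝓘(ℝ, FA)) 𝓘(ℝ, ℝ) ∞
          (fun w : TotalSpace FA A => ψ w.proj • (b.coord i).toContinuousLinearMap (e w).2) v :=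
        (ψ.contMDiff.contMDiffAt.comp v (contMDiffAt_proj A)).smul
          ((b.coord i).toContinuousLinearMap.contMDiff.contMDiffAt.comp v h2)
      refine h3.congr_of_eventuallyEq ?_
      filter_upwards [e.open_source.mem_nhds (e.mem_source.2 hv)] with w hw
      simp [κ, e.coe_linearMapAt_of_mem (R := ℝ) (e.mem_source.1 hw)]
    · have h4 : ∀ᶠ w : TotalSpace FA A in 𝓝 v, ψ w.proj = 0 := by
        have : v.proj ∈ (tsupport ψ)ᶜ := fun h => hv (hψ h)
        have h5 := (FiberBundle.continuous_proj FA A).continuousAt.preimage_mem_nhds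
          ((isClosed_tsupport ψ).isOpen_compl.mem_nhds this)
        filter_upwards [h5] with w hw
        exact image_eq_zero_of_notMem_tsupport hw
      refine (contMDiffAt_const (c := (0 : ℝ))).congr_of_eventuallyEq ?_
      filter_upwards [h4] with w hw
      simp [κ, hw]
  · filter_upwards [h1, hy] with x hx hxe v
    conv_lhs => rw [← (e.basisAt b hxe).sum_repr v]
    refine Finset.sum_congr rfl fun i _ => ?_
    simp [κ, hx, Trivialization.basisAt, Trivialization.localFrame, hxe,
      e.coe_linearMapAt_of_mem (R := ℝ) hxe]

end Basic

section Defs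

variable {EM HM M : Type*} [NormedAddCommGroup EM] [NormedSpace ℝ EM] [TopologicalSpace HM]
  (IM : ModelWithCorners ℝ EM HM) [TopologicalSpace M] [ChartedSpace HM M] [IsManifold IM ∞ M]
  (FA : Type*) [NormedAddCommGroup FA] [NormedSpace ℝ FA]
  (A : M → Type*) [TopologicalSpace (TotalSpace FA A)] [∀ x, AddCommGroup (A x)]
  [∀ x, Module ℝ (A x)] [∀ x, TopologicalSpace (A x)] [FiberBundle FA A] [VectorBundle ℝ FA A]

/-- A Lie algebroid structure on the vector bundle `A → M`: a vector bundle morphism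
`anchor : A → TM` and an anchored `ℝ`-Lie bracket on `Γ(A)`. -/
structure LieAlgebroid where
  anchor : ∀ m, A m →ₗ[ℝ] TangentSpace IM m
  contMDiff_anchor : ContMDiff (IM.prod 𝓘(ℝ, FA)) (IM.prod 𝓘(ℝ, EM)) ∞
    (fun v : TotalSpace FA A => (⟨v.1, anchor v.1 v.2⟩ : TangentBundle IM M))
  bracket : Cₛ^∞⟮IM; FA, A⟯ →ₗ[ℝ] Cₛ^∞⟮IM; FA, A⟯ →ₗ[ℝ] Cₛ^∞⟮IM; FA, A⟯
  bracket_self : ∀ a, bracket a a = 0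
  jacobi : ∀ a b c, bracket a (bracket b c) = bracket (bracket a b) c + bracket b (bracket a c)
  leibniz : ∀ (a b : Cₛ^∞⟮IM; FA, A⟯) (f : C^∞⟮IM, M; ℝ⟯) (m : M),
    bracket a (fsmul f b) m = f m • bracket a b m + dirDeriv IM f m (anchor m (a m)) • b m

end Defs

section Lemmas

variable {EM HM M : Type*} [NormedAddCommGroup EM] [NormedSpace ℝ EM] [TopologicalSpace HM]
  {IM : ModelWithCorners ℝ EM HM} [TopologicalSpace M] [ChartedSpace HM M] [IsManifold IM ∞ M]
  {EP HP P : Type*} [NormedAddCommGroup EP] [NormedSpace ℝ EP] [TopologicalSpace HP]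
  {IP : ModelWithCorners ℝ EP HP} [TopologicalSpace P] [ChartedSpace HP P]

lemma dirDeriv_congr {f g : M → ℝ} {m : M} (h : f =ᶠ[𝓝 m] g) :
    dirDeriv IM f m = dirDeriv IM g m := by
  unfold dirDeriv; rw [h.mfderiv_eq]

lemma dirDeriv_const (c : ℝ) (m : M) (v : TangentSpace IM m) :
    dirDeriv IM (fun _ => c) m v = 0 := by
  unfold dirDeriv; rw [mfderiv_const]; rfl

lemma dirDeriv_add {f g : M → ℝ} {m : M} (hf : MDifferentiableAt IM 𝓘(ℝ, ℝ) f m)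
    (hg : MDifferentiableAt IM 𝓘(ℝ, ℝ) g m) (v : TangentSpace IM m) :
    dirDeriv IM (fun x => f x + g x) m v = dirDeriv IM f m v + dirDeriv IM g m v := by
  have := (hf.hasMFDerivAt.add hg.hasMFDerivAt).mfderiv
  unfold dirDeriv
  exact congrArg (fun L => L v) this

lemma dirDeriv_sub {f g : M → ℝ} {m : M} (hf : MDifferentiableAt IM 𝓘(ℝ, ℝ) f m)
    (hg : MDifferentiableAt IM 𝓘(ℝ, ℝ) g m) (v : TangentSpace IM m) :
    dirDeriv IM (fun x => f x - g x) m v = dirDeriv IM f m v - dirDeriv IM g m v := by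
  have := (hf.hasMFDerivAt.sub hg.hasMFDerivAt).mfderiv
  unfold dirDeriv
  exact congrArg (fun L => L v) this

lemma dirDeriv_mul {f g : M → ℝ} {m : M} (hf : MDifferentiableAt IM 𝓘(ℝ, ℝ) f m)
    (hg : MDifferentiableAt IM 𝓘(ℝ, ℝ) g m) (v : TangentSpace IM m) :
    dirDeriv IM (fun x => f x * g x) m v = f m * dirDeriv IM g m v + g m * dirDeriv IM f m v := by
  have := (hf.hasMFDerivAt.mul hg.hasMFDerivAt).mfderiv
  unfold dirDeriv
  exact congrArg (fun L => L v) this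

lemma dirDeriv_sum {ι : Type*} (s : Finset ι) {f : ι → M → ℝ} {m : M}
    (hf : ∀ i ∈ s, MDifferentiableAt IM 𝓘(ℝ, ℝ) (f i) m) (v : TangentSpace IM m) :
    dirDeriv IM (fun x => ∑ i ∈ s, f i x) m v = ∑ i ∈ s, dirDeriv IM (f i) m v := by
  classical
  have key : MDifferentiableAt IM 𝓘(ℝ, ℝ) (fun x => ∑ i ∈ s, f i x) m ∧
    dirDeriv IM (fun x => ∑ i ∈ s, f i x) m v = ∑ i ∈ s, dirDeriv IM (f i) m v := by
    induction s using Finset.induction_on with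
    | empty => simpa using ⟨mdifferentiableAt_const, dirDeriv_const 0 m v⟩
    | insert a s ha ih =>
      have ih' := ih fun i hi => hf i (Finset.mem_insert_of_mem hi)
      have h1 := hf a (Finset.mem_insert_self a s)
      simp only [Finset.sum_insert ha]
      exact ⟨h1.add ih'.1, by rw [dirDeriv_add h1 ih'.1, ih'.2]⟩
  exact key.2

lemma dirDeriv_comp {f : M → ℝ} {φ : P → M} {p : P}
    (hf : MDifferentiableAt IM 𝓘(ℝ, ℝ) f (φ p)) (hφ : MDifferentiableAt IP IM φ p)
    (v : TangentSpace IP p) :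
    dirDeriv IP (fun x => f (φ x)) p v = dirDeriv IM f (φ p) (mfderiv IP IM φ p v) := by
  unfold dirDeriv
  have := mfderiv_comp p hf hφ
  exact congrArg (fun L => L v) this

/-- The derivative of a smooth function along a smooth family of tangent vectors is smooth. -/
lemma contMDiff_dirDeriv (f : C^∞⟮IM, M; ℝ⟯) {φ : P → M} {X : ∀ p, TangentSpace IM (φ p)}
    (hX : ContMDiff IP (IM.prod 𝓘(ℝ, EM)) ∞ (fun p => (⟨φ p, X p⟩ : TangentBundle IM M))) :
    ContMDiff IP 𝓘(ℝ, ℝ) ∞ (fun p => dirDeriv IM f (φ p) (X p)) := by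
  have h1 := (f.contMDiff.contMDiff_tangentMap (m := ∞) (by simp)).comp hX
  have h2 := (contMDiff_snd_tangentBundle_modelSpace ℝ 𝓘(ℝ, ℝ) (n := ∞)).comp h1
  exact h2

end Lemmas

section Defs

variable {EM HM M : Type*} [NormedAddCommGroup EM] [NormedSpace ℝ EM] [TopologicalSpace HM]
  {IM : ModelWithCorners ℝ EM HM} [TopologicalSpace M] [ChartedSpace HM M] [IsManifold IM ∞ M]
  {EN HN N : Type*} [NormedAddCommGroup EN] [NormedSpace ℝ EN] [TopologicalSpace HN]
  {IN : ModelWithCorners ℝ EN HN} [TopologicalSpace N] [ChartedSpace HN N] [IsManifold IN ∞ N]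
  {FA : Type*} [NormedAddCommGroup FA] [NormedSpace ℝ FA]
  {A : M → Type*} [TopologicalSpace (TotalSpace FA A)] [∀ x, AddCommGroup (A x)]
  [∀ x, Module ℝ (A x)] [∀ x, TopologicalSpace (A x)] [FiberBundle FA A] [VectorBundle ℝ FA A]
  {FB : Type*} [NormedAddCommGroup FB] [NormedSpace ℝ FB]
  {B : N → Type*} [TopologicalSpace (TotalSpace FB B)] [∀ x, AddCommGroup (B x)]
  [∀ x, Module ℝ (B x)] [∀ x, TopologicalSpace (B x)] [FiberBundle FB B] [VectorBundle ℝ FB B]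

/-- An anchored vector bundle morphism `(Φ, φ)` between Lie algebroids. -/
structure AnchoredHom (LA : LieAlgebroid IM FA A) (LB : LieAlgebroid IN FB B) where
  base : C^∞⟮IM, M; IN, N⟯
  fiber : ∀ m, A m →ₗ[ℝ] B (base m)
  contMDiff_fiber : ContMDiff (IM.prod 𝓘(ℝ, FA)) (IN.prod 𝓘(ℝ, FB)) ∞
    (fun v : TotalSpace FA A => (⟨base v.1, fiber v.1 v.2⟩ : TotalSpace FB B))
  anchor_fiber : ∀ m (v : A m),
    LB.anchor (base m) (fiber m v) = mfderiv IM IN base m (LA.anchor m v)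

/-- The bracket condition for a Lie algebroid morphism. -/
def AnchoredHom.IsLieAlgebroidHom {LA : LieAlgebroid IM FA A} {LB : LieAlgebroid IN FB B}
    (Φ : AnchoredHom LA LB) : Prop :=
  ∀ (a₁ a₂ : Cₛ^∞⟮IM; FA, A⟯) (p q : ℕ)
    (f₁ : Fin p → C^∞⟮IM, M; ℝ⟯) (b₁ : Fin p → Cₛ^∞⟮IN; FB, B⟯)
    (f₂ : Fin q → C^∞⟮IM, M; ℝ⟯) (b₂ : Fin q → Cₛ^∞⟮IN; FB, B⟯),
    (∀ m, Φ.fiber m (a₁ m) = ∑ i, f₁ i m • b₁ i (Φ.base m)) →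
    (∀ m, Φ.fiber m (a₂ m) = ∑ j, f₂ j m • b₂ j (Φ.base m)) →
    ∀ m, Φ.fiber m (LA.bracket a₁ a₂ m) =
      ∑ i, ∑ j, (f₁ i m * f₂ j m) • LB.bracket (b₁ i) (b₂ j) (Φ.base m)
      + ∑ j, dirDeriv IM (f₂ j) m (LA.anchor m (a₁ m)) • b₂ j (Φ.base m)
      - ∑ i, dirDeriv IM (f₁ i) m (LA.anchor m (a₂ m)) • b₁ i (Φ.base m)

/-- A linear connection of the Lie algebroid `A` on a vector bundle `E` over the same base. -/
structure Connection (LA : LieAlgebroid IM FA A) (FE : Type*) [NormedAddCommGroup FE]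
    [NormedSpace ℝ FE] (E : M → Type*) [TopologicalSpace (TotalSpace FE E)]
    [∀ x, AddCommGroup (E x)] [∀ x, Module ℝ (E x)] [∀ x, TopologicalSpace (E x)]
    [FiberBundle FE E] [VectorBundle ℝ FE E] where
  toFun : Cₛ^∞⟮IM; FA, A⟯ →ₗ[ℝ] Cₛ^∞⟮IM; FE, E⟯ →ₗ[ℝ] Cₛ^∞⟮IM; FE, E⟯
  smul_left : ∀ f a e, toFun (fsmul f a) e = fsmul f (toFun a e)
  leibniz : ∀ (a : Cₛ^∞⟮IM; FA, A⟯) (e : Cₛ^∞⟮IM; FE, E⟯) (f : C^∞⟮IM, M; ℝ⟯) (m : M),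
    toFun a (fsmul f e) m = f m • toFun a e m + dirDeriv IM f m (LA.anchor m (a m)) • e m

variable {LA : LieAlgebroid IM FA A} {LB : LieAlgebroid IN FB B}
  {FE : Type*} [NormedAddCommGroup FE] [NormedSpace ℝ FE]
  {E : N → Type*} [TopologicalSpace (TotalSpace FE E)] [∀ x, AddCommGroup (E x)]
  [∀ x, Module ℝ (E x)] [∀ x, TopologicalSpace (E x)] [FiberBundle FE E] [VectorBundle ℝ FE E]

/-- Flatness: the curvature vanishes. -/
def Connection.IsFlat (D : Connection LB FE E) : Prop :=
  ∀ (b₁ b₂ : Cₛ^∞⟮IN; FB, B⟯) (e : Cₛ^∞⟮IN; FE, E⟯),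
    D.toFun b₁ (D.toFun b₂ e) - D.toFun b₂ (D.toFun b₁ e) - D.toFun (LB.bracket b₁ b₂) e = 0

/-! #### Locality -/

@[simp] lemma section_sum_apply {ι : Type*} (t : Finset ι) (s : ι → Cₛ^∞⟮IN; FE, E⟯) (y : N) :
    (∑ i ∈ t, s i) y = ∑ i ∈ t, s i y := by
  classical
  induction t using Finset.induction_on with
  | empty => simp
  | insert a t ha ih => simp [Finset.sum_insert ha, ih]

variable [FiniteDimensional ℝ EN] [T2Space N]

lemma Connection.congr_right (D : Connection LB FE E) (b : Cₛ^∞⟮IN; FB, B⟯)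
    {e e' : Cₛ^∞⟮IN; FE, E⟯} {y : N} (h : ∀ᶠ x in 𝓝 y, e x = e' x) :
    D.toFun b e y = D.toFun b e' y := by
  obtain ⟨ψ, h1, h2⟩ := exists_bump (IM := IN) h
  have h3 : fsmul ψ e = fsmul ψ e' := by
    ext x
    by_cases hx : x ∈ tsupport ψ
    · have := h2 hx
      simp only [mem_ofPred_eq] at this
      simp [this]
    · simp [image_eq_zero_of_notMem_tsupport hx]
  have h4 : dirDeriv IN ψ y = 0 := by
    have : ψ =ᶠ[𝓝 y] fun _ => (1 : ℝ) := h1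
    rw [dirDeriv_congr this]; ext v; exact dirDeriv_const 1 y v
  have := congrArg (fun s => D.toFun b s y) h3
  simpa [D.leibniz, h4, h1.self_of_nhds] using this

variable [ContMDiffVectorBundle ∞ FB B IN] [FiniteDimensional ℝ FB]

lemma Connection.congr_left (D : Connection LB FE E) {b b' : Cₛ^∞⟮IN; FB, B⟯}
    (e : Cₛ^∞⟮IN; FE, E⟯) {y : N} (h : b y = b' y) :
    D.toFun b e y = D.toFun b' e y := by
  obtain ⟨n, s, κ, hκ, hs⟩ := exists_frame IN FB B y
  obtain ⟨ψ, h1, h2⟩ := exists_bump (IM := IN) hs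
  have key : ∀ c : Cₛ^∞⟮IN; FB, B⟯, D.toFun c e y = ∑ i, κ i y (c y) • D.toFun (s i) e y := by
    intro c
    let f : Fin n → C^∞⟮IN, N; ℝ⟯ := fun i => ⟨fun x => κ i x (c x), (hκ i).comp c.contMDiff⟩
    have hf : ∀ i x, f i x = κ i x (c x) := fun _ _ => rfl
    have h3 : fsmul ψ c = ∑ i, fsmul ψ (fsmul (f i) (s i)) := by
      ext x
      by_cases hx : x ∈ tsupport ψ
      · have := h2 hx (c x)
        conv_lhs => rw [fsmul_apply, this]
        simp [hf, Finset.smul_sum]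
      · simp [image_eq_zero_of_notMem_tsupport hx]
    have := congrArg (fun s => D.toFun s e y) h3
    simpa [D.smul_left, h1.self_of_nhds, map_sum, LinearMap.sum_apply, hf] using this
  rw [key, key, h]

end Defs

section PullbackConn

variable {EM HM M : Type*} [NormedAddCommGroup EM] [NormedSpace ℝ EM] [TopologicalSpace HM]
  {IM : ModelWithCorners ℝ EM HM} [TopologicalSpace M] [ChartedSpace HM M] [IsManifold IM ∞ M]
  {EN HN N : Type*} [NormedAddCommGroup EN] [NormedSpace ℝ EN] [TopologicalSpace HN]
  {IN : ModelWithCorners ℝ EN HN} [TopologicalSpace N] [ChartedSpace HN N] [IsManifold IN ∞ N]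
  {FA : Type*} [NormedAddCommGroup FA] [NormedSpace ℝ FA]
  {A : M → Type*} [TopologicalSpace (TotalSpace FA A)] [∀ x, AddCommGroup (A x)]
  [∀ x, Module ℝ (A x)] [∀ x, TopologicalSpace (A x)] [FiberBundle FA A] [VectorBundle ℝ FA A]
  {FB : Type*} [NormedAddCommGroup FB] [NormedSpace ℝ FB] [FiniteDimensional ℝ FB]
  {B : N → Type*} [TopologicalSpace (TotalSpace FB B)] [∀ x, AddCommGroup (B x)]
  [∀ x, Module ℝ (B x)] [∀ x, TopologicalSpace (B x)] [FiberBundle FB B] [VectorBundle ℝ FB B]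
  [ContMDiffVectorBundle ∞ FB B IN]
  {FE : Type*} [NormedAddCommGroup FE] [NormedSpace ℝ FE] [FiniteDimensional ℝ FE]
  {E : N → Type*} [TopologicalSpace (TotalSpace FE E)] [∀ x, AddCommGroup (E x)]
  [∀ x, Module ℝ (E x)] [∀ x, TopologicalSpace (E x)] [FiberBundle FE E] [VectorBundle ℝ FE E]
  [ContMDiffVectorBundle ∞ FE E IN]
  [FiniteDimensional ℝ EN] [T2Space N]
  {LA : LieAlgebroid IM FA A} {LB : LieAlgebroid IN FB B}

lemma contMDiff_toFunction (f : C^∞⟮IM, M; ℝ⟯) (m : M) : MDifferentiableAt IM 𝓘(ℝ, ℝ) f m :=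
  f.contMDiff.mdifferentiableAt (by simp)

/-- Independence of the local expression of the pullback connection. -/
lemma pullback_aux (Φ : AnchoredHom LA LB) (D : Connection LB FE E)
    (s : ∀ x, E (Φ.base x)) (m : M) (v : A m)
    {n : ℕ} {t : Fin n → Cₛ^∞⟮IN; FE, E⟯} {κ : Fin n → ∀ x, E x →ₗ[ℝ] ℝ}
    (hκ : ∀ i, ContMDiff (IN.prod 𝓘(ℝ, FE)) 𝓘(ℝ, ℝ) ∞
      (fun v : TotalSpace FE E => κ i v.1 v.2))
    (ht : ∀ᶠ x in 𝓝 (Φ.base m), ∀ v : E x, v = ∑ i, κ i x v • t i x)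
    {ι : Type*} [Fintype ι] (f : ι → C^∞⟮IM, M; ℝ⟯) (e : ι → Cₛ^∞⟮IN; FE, E⟯)
    (hs : ∀ᶠ x in 𝓝 m, s x = ∑ i, f i x • e i (Φ.base x))
    (b : Cₛ^∞⟮IN; FB, B⟯) (hb : Φ.fiber m v = b (Φ.base m)) :
    ∑ i, (dirDeriv IM (f i) m (LA.anchor m v) • e i (Φ.base m)
        + f i m • D.toFun b (e i) (Φ.base m)) =
      ∑ j, (dirDeriv IM (fun x => κ j (Φ.base x) (s x)) m (LA.anchor m v) • t j (Φ.base m)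
        + κ j (Φ.base m) (s m) • D.toFun b (t j) (Φ.base m)) := by
  let h : ι → Fin n → C^∞⟮IN, N; ℝ⟯ := fun i j =>
    ⟨fun y => κ j y (e i y), (hκ j).comp (e i).contMDiff⟩
  have hh : ∀ i j y, h i j y = κ j y (e i y) := fun _ _ _ => rfl
  have he : ∀ i, ∀ᶠ y in 𝓝 (Φ.base m), e i y = (∑ j, fsmul (h i j) (t j)) y := by
    intro i
    filter_upwards [ht] with y hy
    conv_lhs => rw [hy (e i y)]
    simp [hh]
  have hmd : ∀ i j, MDifferentiableAt IM 𝓘(ℝ, ℝ) (fun x => h i j (Φ.base x)) m := fun i j =>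
    (((h i j).contMDiff.comp Φ.base.contMDiff) m).mdifferentiableAt (by simp)
  have hD : ∀ i, D.toFun b (e i) (Φ.base m) = ∑ j, (h i j (Φ.base m) • D.toFun b (t j) (Φ.base m)
      + dirDeriv IM (fun x => h i j (Φ.base x)) m (LA.anchor m v) • t j (Φ.base m)) := by
    intro i
    rw [D.congr_right b (he i), map_sum, section_sum_apply]
    refine Finset.sum_congr rfl fun j _ => ?_
    rw [D.leibniz, ← hb, Φ.anchor_fiber, dirDeriv_comp (contMDiff_toFunction _ _)
      (Φ.base.contMDiff.mdifferentiableAt (by simp))]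
  have hc : ∀ j, (fun x => κ j (Φ.base x) (s x)) =ᶠ[𝓝 m]
      fun x => ∑ i, f i x * h i j (Φ.base x) := by
    intro j
    filter_upwards [hs] with x hx
    simp [hx, hh]
  have hc' : ∀ j, dirDeriv IM (fun x => κ j (Φ.base x) (s x)) m (LA.anchor m v) =
      ∑ i, (f i m * dirDeriv IM (fun x => h i j (Φ.base x)) m (LA.anchor m v)
        + h i j (Φ.base m) * dirDeriv IM (f i) m (LA.anchor m v)) := by
    intro j
    have hmul : ∀ i ∈ Finset.univ,
        MDifferentiableAt IM 𝓘(ℝ, ℝ) (fun x => f i x * h i j (Φ.base x)) m := fun i _ =>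
      (contMDiff_toFunction (f i) m).mul (hmd i j)
    rw [dirDeriv_congr (hc j), dirDeriv_sum _ hmul]
    exact Finset.sum_congr rfl fun i _ => dirDeriv_mul (contMDiff_toFunction _ _) (hmd i j) _
  have hem : ∀ i, e i (Φ.base m) = ∑ j, h i j (Φ.base m) • t j (Φ.base m) := by
    intro i
    rw [(he i).self_of_nhds]; simp
  have hcm : ∀ j, κ j (Φ.base m) (s m) = ∑ i, f i m * h i j (Φ.base m) := fun j =>
    (hc j).self_of_nhds
  simp only [hc', hcm, hD, Finset.sum_smul]
  simp_rw [← Finset.sum_add_distrib]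
  rw [Finset.sum_comm]
  refine Finset.sum_congr rfl fun i _ => ?_
  conv_lhs => rw [hem i]
  simp only [Finset.smul_sum, ← Finset.sum_add_distrib]
  refine Finset.sum_congr rfl fun j _ => ?_
  module

/-- Existence of the pullback connection: there is an `A`-connection on `φ^!E` which on pullback
sections is given by `(Φ^*∇)_v (φ^! e) = ∇_{Φ(v)} e`. -/
theorem exists_pullbackConnection (Φ : AnchoredHom LA LB) (D : Connection LB FE E) :
    ∃ D' : Connection LA FE (Φ.base *ᵖ E), ∀ (a : Cₛ^∞⟮IM; FA, A⟯) (e : Cₛ^∞⟮IN; FE, E⟯)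
      (b : Cₛ^∞⟮IN; FB, B⟯) (m : M), Φ.fiber m (a m) = b (Φ.base m) →
      D'.toFun a (pullbackSection Φ.base e) m = D.toFun b e (Φ.base m) := by
  choose n t κ hκ ht using fun y : N => exists_frame IN FE E y
  choose k β μ hμ hβ using fun y : N => exists_frame IN FB B y
  have hsm : ∀ (s : Cₛ^∞⟮IM; FE, Φ.base *ᵖ E⟯),
      ContMDiff IM (IN.prod 𝓘(ℝ, FE)) ∞ (fun x => (⟨Φ.base x, s x⟩ : TotalSpace FE E)) :=
    fun s => contMDiff_pullback_section.1 s.contMDiff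
  -- coefficients of a section of the pullback bundle
  let c : ∀ (s : Cₛ^∞⟮IM; FE, Φ.base *ᵖ E⟯) (y : N), Fin (n y) → C^∞⟮IM, M; ℝ⟯ := fun s y j =>
    ⟨fun x => κ y j (Φ.base x) (s x), (hκ y j).comp (hsm s)⟩
  have hc : ∀ s y j x, c s y j x = κ y j (Φ.base x) (s x) := fun _ _ _ _ => rfl
  -- the extension of a vector of `B`
  let ext : ∀ (y : N), B y → Cₛ^∞⟮IN; FB, B⟯ := fun y w => ∑ l, μ y l y w • β y l
  have hext : ∀ y w, w = ext y w y := by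
    intro y w
    conv_lhs => rw [(hβ y).self_of_nhds w]
    simp [ext]
  let raw : ∀ (m : M) (v : A m) (s : Cₛ^∞⟮IM; FE, Φ.base *ᵖ E⟯), E (Φ.base m) := fun m v s =>
    ∑ j, (dirDeriv IM (c s (Φ.base m) j) m (LA.anchor m v) • t (Φ.base m) j (Φ.base m)
        + c s (Φ.base m) j m • D.toFun (ext _ (Φ.fiber m v)) (t (Φ.base m) j) (Φ.base m))
  have raw_eq : ∀ (m : M) (v : A m) (s : Cₛ^∞⟮IM; FE, Φ.base *ᵖ E⟯) {ι : Type} [Fintype ι]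
      (f : ι → C^∞⟮IM, M; ℝ⟯) (e : ι → Cₛ^∞⟮IN; FE, E⟯)
      (_ : ∀ᶠ x in 𝓝 m, (s x : E (Φ.base x)) = ∑ i, f i x • e i (Φ.base x))
      (b : Cₛ^∞⟮IN; FB, B⟯) (_ : Φ.fiber m v = b (Φ.base m)),
      raw m v s = ∑ i, (dirDeriv IM (f i) m (LA.anchor m v) • e i (Φ.base m)
        + f i m • D.toFun b (e i) (Φ.base m)) := by
    intro m v s ι _ f e hs b hb
    rw [pullback_aux Φ D (fun x => s x) m v (hκ _) (ht _) f e hs b hb]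
    refine Finset.sum_congr rfl fun j _ => ?_
    rw [D.congr_left (b' := b) _ ((hext _ _).symm.trans hb)]
    rfl
  have dec : ∀ (s : Cₛ^∞⟮IM; FE, Φ.base *ᵖ E⟯) (m : M), ∀ᶠ x in 𝓝 m,
      (s x : E (Φ.base x)) = ∑ j, c s (Φ.base m) j x • t (Φ.base m) j (Φ.base x) := by
    intro s m
    filter_upwards [Φ.base.contMDiff.continuous.continuousAt.eventually (ht (Φ.base m))] with x hx
    exact hx (s x)
  have hraw : ∀ (a : Cₛ^∞⟮IM; FA, A⟯) (s : Cₛ^∞⟮IM; FE, Φ.base *ᵖ E⟯),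
      ContMDiff IM (IM.prod 𝓘(ℝ, FE)) ∞
        (fun m => (⟨m, raw m (a m) s⟩ : TotalSpace FE (Φ.base *ᵖ E))) := by
    intro a s m₀
    have hΦa : ContMDiff IM (IN.prod 𝓘(ℝ, FB)) ∞
      (fun m => (⟨Φ.base m, Φ.fiber m (a m)⟩ : TotalSpace FB B)) := Φ.contMDiff_fiber.comp a.contMDiff
    let g : Fin (k (Φ.base m₀)) → C^∞⟮IM, M; ℝ⟯ := fun l =>
      ⟨fun m => μ (Φ.base m₀) l (Φ.base m) (Φ.fiber m (a m)), (hμ _ l).comp hΦa⟩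
    let da : Fin (n (Φ.base m₀)) → C^∞⟮IM, M; ℝ⟯ := fun j =>
      ⟨fun m => dirDeriv IM (c s (Φ.base m₀) j) m (LA.anchor m (a m)),
        contMDiff_dirDeriv _ (LA.contMDiff_anchor.comp a.contMDiff)⟩
    let S : Cₛ^∞⟮IM; FE, Φ.base *ᵖ E⟯ := ∑ j,
      (fsmul (da j) (pullbackSection Φ.base (t (Φ.base m₀) j))
        + fsmul (c s (Φ.base m₀) j)
          (∑ l, fsmul (g l) (pullbackSection Φ.base
            (D.toFun (β (Φ.base m₀) l) (t (Φ.base m₀) j)))))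
    refine (S.contMDiff m₀).congr_of_eventuallyEq ?_
    filter_upwards [(dec s m₀).eventually_nhds, Φ.base.contMDiff.continuous.continuousAt.eventually
      (hβ (Φ.base m₀))] with m hm hm'
    congr 1
    have := raw_eq m (a m) s _ _ hm (∑ l, g l m • β (Φ.base m₀) l)
      (by conv_lhs => rw [hm' (Φ.fiber m (a m))]
          simp [g])
    rw [this]
    simp only [S, section_sum_apply, ContMDiffSection.coe_add, Pi.add_apply, fsmul_apply]
    refine Finset.sum_congr rfl fun j _ => ?_
    simp only [map_sum, map_smul, LinearMap.sum_apply, LinearMap.smul_apply, section_sum_apply,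
      ContMDiffSection.coe_smul, Pi.smul_apply]
    rfl
  have hcadd : ∀ s s' y j, (c (s + s') y j : M → ℝ) = fun x => c s y j x + c s' y j x := by
    intro s s' y j; ext x; exact map_add (κ y j (Φ.base x)) (s x) (s' x)
  have hcmul : ∀ (f : C^∞⟮IM, M; ℝ⟯) s y j, (c (fsmul f s) y j : M → ℝ) =
      fun x => f x * c s y j x := by
    intro f s y j; ext x; exact map_smul (κ y j (Φ.base x)) (f x) (s x)
  have hraw_lin : ∀ m s (r r' : ℝ) (v w : A m), raw m (r • v + r' • w) s =
      r • raw m v s + r' • raw m w s := by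
    intro m s r r' v w
    rw [raw_eq m _ s _ _ (dec s m) (r • ext _ (Φ.fiber m v) + r' • ext _ (Φ.fiber m w))
      (by
        rw [map_add, map_smul, map_smul]
        conv_lhs => rw [hext _ (Φ.fiber m v), hext _ (Φ.fiber m w)]
        rfl)]
    simp only [raw, Finset.smul_sum, ← Finset.sum_add_distrib]
    refine Finset.sum_congr rfl fun j _ => ?_
    simp only [map_add, map_smul, LinearMap.add_apply, LinearMap.smul_apply,
      ContMDiffSection.coe_add, ContMDiffSection.coe_smul, Pi.add_apply, Pi.smul_apply,
      smul_eq_mul]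
    module
  have hraw_add : ∀ m v s s', raw m v (s + s') = raw m v s + raw m v s' := by
    intro m v s s'
    simp only [raw, ← Finset.sum_add_distrib]
    refine Finset.sum_congr rfl fun j _ => ?_
    rw [hcadd, dirDeriv_add (contMDiff_toFunction _ _) (contMDiff_toFunction _ _)]
    module
  let sv : ∀ (_ : Cₛ^∞⟮IM; FE, Φ.base *ᵖ E⟯) x, E (Φ.base x) := fun s x => s x
  have dec' : ∀ s m, sv s m = ∑ j, c s (Φ.base m) j m • t (Φ.base m) j (Φ.base m) :=
    fun s m => (dec s m).self_of_nhds
  have hraw_leib : ∀ m v (f : C^∞⟮IM, M; ℝ⟯) s, raw m v (fsmul f s) =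
      f m • raw m v s + dirDeriv IM f m (LA.anchor m v) • sv s m := by
    intro m v f s
    rw [dec' s m]
    simp only [raw, Finset.smul_sum, ← Finset.sum_add_distrib]
    refine Finset.sum_congr rfl fun j _ => ?_
    rw [hcmul, dirDeriv_mul (contMDiff_toFunction _ _) (contMDiff_toFunction _ _)]
    module
  refine ⟨⟨LinearMap.mk₂ ℝ (fun a s => ⟨fun m => raw m (a m) s, hraw a s⟩) ?_ ?_ ?_ ?_, ?_, ?_⟩, ?_⟩
  · intro a a' s
    ext m
    simpa using! hraw_lin m s 1 1 (a m) (a' m)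
  · intro r a s
    ext m
    simpa using! hraw_lin m s r 0 (a m) 0
  · intro a s s'
    ext m
    exact hraw_add m (a m) s s'
  · intro r a s
    ext m
    have h1 := hraw_leib m (a m) ⟨fun _ => r, contMDiff_const⟩ s
    have h2 : dirDeriv IM (fun _ : M => r) m (LA.anchor m (a m)) = 0 := dirDeriv_const _ _ _
    have h3 : raw m (a m) (fsmul ⟨fun _ => r, contMDiff_const⟩ s) = r • raw m (a m) s +
        dirDeriv IM (fun _ : M => r) m (LA.anchor m (a m)) • sv s m := h1
    rw [h2, zero_smul, add_zero] at h3
    exact h3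
  · intro f a s
    ext m
    simpa using! hraw_lin m s (f m) 0 (a m) 0
  · intro a s f m
    exact hraw_leib m (a m) f s
  · intro a e b m hb
    have := raw_eq m (a m) (pullbackSection Φ.base e) (ι := Unit)
      (fun _ => ⟨fun _ => 1, contMDiff_const⟩) (fun _ => e)
      (Filter.Eventually.of_forall fun x => by
        simp only [Finset.univ_unique, Finset.sum_singleton]
        exact (one_smul ℝ (e (Φ.base x))).symm) b hb
    refine Eq.trans this ?_
    rw [Finset.univ_unique, Finset.sum_singleton]
    have h2 : dirDeriv IM (fun _ : M => (1 : ℝ)) m (LA.anchor m (a m)) = 0 := dirDeriv_const _ _ _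
    have h5 : ∀ w w' : E (Φ.base m), dirDeriv IM (fun _ : M => (1 : ℝ)) m (LA.anchor m (a m)) • w'
        + (1 : ℝ) • w = w := by
      intro w w'
      rw [h2, zero_smul, zero_add, one_smul]
    exact h5 _ _

end PullbackConn

section PullbackConn2

variable {EM HM M : Type*} [NormedAddCommGroup EM] [NormedSpace ℝ EM] [TopologicalSpace HM]
  {IM : ModelWithCorners ℝ EM HM} [TopologicalSpace M] [ChartedSpace HM M] [IsManifold IM ∞ M]
  {EN HN N : Type*} [NormedAddCommGroup EN] [NormedSpace ℝ EN] [TopologicalSpace HN]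
  {IN : ModelWithCorners ℝ EN HN} [TopologicalSpace N] [ChartedSpace HN N] [IsManifold IN ∞ N]
  {EP HP P : Type*} [NormedAddCommGroup EP] [NormedSpace ℝ EP] [TopologicalSpace HP]
  {IP : ModelWithCorners ℝ EP HP} [TopologicalSpace P] [ChartedSpace HP P] [IsManifold IP ∞ P]
  {FA : Type*} [NormedAddCommGroup FA] [NormedSpace ℝ FA]
  {A : M → Type*} [TopologicalSpace (TotalSpace FA A)] [∀ x, AddCommGroup (A x)]
  [∀ x, Module ℝ (A x)] [∀ x, TopologicalSpace (A x)] [FiberBundle FA A] [VectorBundle ℝ FA A]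
  {FB : Type*} [NormedAddCommGroup FB] [NormedSpace ℝ FB]
  {B : N → Type*} [TopologicalSpace (TotalSpace FB B)] [∀ x, AddCommGroup (B x)]
  [∀ x, Module ℝ (B x)] [∀ x, TopologicalSpace (B x)] [FiberBundle FB B] [VectorBundle ℝ FB B]
  {FC : Type*} [NormedAddCommGroup FC] [NormedSpace ℝ FC]
  {C : P → Type*} [TopologicalSpace (TotalSpace FC C)] [∀ x, AddCommGroup (C x)]
  [∀ x, Module ℝ (C x)] [∀ x, TopologicalSpace (C x)] [FiberBundle FC C] [VectorBundle ℝ FC C]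
  {FE : Type*} [NormedAddCommGroup FE] [NormedSpace ℝ FE]
  {E : N → Type*} [TopologicalSpace (TotalSpace FE E)] [∀ x, AddCommGroup (E x)]
  [∀ x, Module ℝ (E x)] [∀ x, TopologicalSpace (E x)] [FiberBundle FE E] [VectorBundle ℝ FE E]
  [ContMDiffVectorBundle ∞ FE E IN]
  {LA : LieAlgebroid IM FA A} {LB : LieAlgebroid IN FB B} {LC : LieAlgebroid IP FC C}

/-- Composition of anchored vector bundle morphisms. -/
def AnchoredHom.comp (Φ : AnchoredHom LC LB) (Ψ : AnchoredHom LA LC) : AnchoredHom LA LB where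
  base := Φ.base.comp Ψ.base
  fiber m := Φ.fiber (Ψ.base m) ∘ₗ Ψ.fiber m
  contMDiff_fiber := Φ.contMDiff_fiber.comp Ψ.contMDiff_fiber
  anchor_fiber m v := by
    have h := mfderiv_comp m (Φ.base.contMDiff.mdifferentiableAt (by simp) :
        MDifferentiableAt IP IN Φ.base (Ψ.base m))
      (Ψ.base.contMDiff.mdifferentiableAt (by simp) : MDifferentiableAt IM IP Ψ.base m)
    have h1 := Φ.anchor_fiber (Ψ.base m) (Ψ.fiber m v)
    rw [Ψ.anchor_fiber] at h1
    exact h1.trans (congrArg (fun L => L (LA.anchor m v)) h).symm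

lemma contMDiff_pullback_lift (φ : C^∞⟮IP, P; IN, N⟯) :
    ContMDiff (IP.prod 𝓘(ℝ, FE)) (IN.prod 𝓘(ℝ, FE)) ∞
      (fun v : TotalSpace FE (φ *ᵖ E) => (⟨φ v.1, v.2⟩ : TotalSpace FE E)) := by
  intro v
  rw [contMDiffAt_totalSpace]
  refine ⟨φ.contMDiff.contMDiffAt.comp v (contMDiffAt_proj _), ?_⟩
  exact ((contMDiffAt_totalSpace (f := id)).1 (contMDiffAt_id (x := v))).2

/-- For a section `s` of `φ^!E`, the section `ψ^! s` of `ψ^!φ^!E = (φ ∘ ψ)^!E`. -/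
def AnchoredHom.restrictSection (Φ : AnchoredHom LC LB) (Ψ : AnchoredHom LA LC)
    (s : Cₛ^∞⟮IP; FE, Φ.base *ᵖ E⟯) : Cₛ^∞⟮IM; FE, (Φ.comp Ψ).base *ᵖ E⟯ :=
  ⟨fun m => s (Ψ.base m), (contMDiff_pullback_section (φ := (Φ.comp Ψ).base) (A := E)).2
    ((contMDiff_pullback_lift Φ.base).comp (s.contMDiff.comp Ψ.base.contMDiff))⟩

variable [FiniteDimensional ℝ FE] [FiniteDimensional ℝ FB] [ContMDiffVectorBundle ∞ FB B IN]
  [FiniteDimensional ℝ EN] [T2Space N]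

/-- The pullback connection `Φ^*∇` on `φ^!E`, given by `(Φ^*∇)_v (φ^! e) = ∇_{Φ(v)} e`. -/
def Connection.pullback (D : Connection LB FE E) (Φ : AnchoredHom LA LB) :
    Connection LA FE (Φ.base *ᵖ E) :=
  (exists_pullbackConnection Φ D).choose

theorem Connection.pullback_apply (D : Connection LB FE E) (Φ : AnchoredHom LA LB)
    (a : Cₛ^∞⟮IM; FA, A⟯) (e : Cₛ^∞⟮IN; FE, E⟯) (b : Cₛ^∞⟮IN; FB, B⟯) (m : M)
    (h : Φ.fiber m (a m) = b (Φ.base m)) :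
    (D.pullback Φ).toFun a (pullbackSection Φ.base e) m = D.toFun b e (Φ.base m) :=
  (exists_pullbackConnection Φ D).choose_spec a e b m h

/-- The pullback connection is determined by its values on pullback sections. -/
theorem Connection.pullback_unique [FiniteDimensional ℝ EM] [T2Space M]
    (D : Connection LB FE E) (Φ : AnchoredHom LA LB) (D' : Connection LA FE (Φ.base *ᵖ E))
    (h : ∀ (a : Cₛ^∞⟮IM; FA, A⟯) (e : Cₛ^∞⟮IN; FE, E⟯) (b : Cₛ^∞⟮IN; FB, B⟯) (m : M),
      Φ.fiber m (a m) = b (Φ.base m) →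
      D'.toFun a (pullbackSection Φ.base e) m = D.toFun b e (Φ.base m)) :
    D' = D.pullback Φ := by
  have key : ∀ a s, D'.toFun a s = (D.pullback Φ).toFun a s := by
    intro a s
    ext m
    obtain ⟨n, t, κ, hκ, ht⟩ := exists_frame IN FE E (Φ.base m)
    obtain ⟨k, β, μ, hμ, hβ⟩ := exists_frame IN FB B (Φ.base m)
    let c : Fin n → C^∞⟮IM, M; ℝ⟯ := fun j => ⟨fun x => κ j (Φ.base x) (s x),
      (hκ j).comp (contMDiff_pullback_section.1 s.contMDiff)⟩
    have hs : ∀ᶠ x in 𝓝 m, s x = (∑ j, fsmul (c j) (pullbackSection Φ.base (t j))) x := by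
      filter_upwards [Φ.base.contMDiff.continuous.continuousAt.eventually ht] with x hx
      rw [section_sum_apply]
      exact hx (s x)
    obtain ⟨b, hb⟩ : ∃ b : Cₛ^∞⟮IN; FB, B⟯, Φ.fiber m (a m) = b (Φ.base m) := by
      refine ⟨∑ l, μ l _ (Φ.fiber m (a m)) • β l, ?_⟩
      conv_lhs => rw [hβ.self_of_nhds (Φ.fiber m (a m))]
      simp
    rw [D'.congr_right a hs, (D.pullback Φ).congr_right a hs, map_sum, map_sum,
      section_sum_apply, section_sum_apply]
    refine Finset.sum_congr rfl fun j _ => ?_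
    rw [D'.leibniz, (D.pullback Φ).leibniz, h a _ b m hb, D.pullback_apply Φ a _ b m hb]
  obtain ⟨F, h1, h2⟩ := D'
  cases hD : D.pullback Φ with
  | mk G h3 h4 =>
    congr
    ext1 a; ext1 s
    simpa [hD] using key a s

end PullbackConn2

section Forms

variable {EM HM M : Type*} [NormedAddCommGroup EM] [NormedSpace ℝ EM] [TopologicalSpace HM]
  (IM : ModelWithCorners ℝ EM HM) [TopologicalSpace M] [ChartedSpace HM M] [IsManifold IM ∞ M]
  (FA : Type*) [NormedAddCommGroup FA] [NormedSpace ℝ FA]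
  (A : M → Type*) [TopologicalSpace (TotalSpace FA A)] [∀ x, AddCommGroup (A x)]
  [∀ x, Module ℝ (A x)] [∀ x, TopologicalSpace (A x)] [FiberBundle FA A] [VectorBundle ℝ FA A]
  (FV : Type*) [NormedAddCommGroup FV] [NormedSpace ℝ FV]
  (V : M → Type*) [TopologicalSpace (TotalSpace FV V)] [∀ x, AddCommGroup (V x)]
  [∀ x, Module ℝ (V x)] [∀ x, TopologicalSpace (V x)] [FiberBundle FV V] [VectorBundle ℝ FV V]

/-- `Ω^k(A, V)`: smooth families of alternating `k`-linear maps `A_m × ⋯ × A_m → V_m`. A family is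
smooth if it sends smooth sections of `A` to smooth sections of `V`. -/
def formSubmodule (k : ℕ) : Submodule ℝ (∀ m, A m [⋀^Fin k]→ₗ[ℝ] V m) where
  carrier := {α | ∀ a : Fin k → Cₛ^∞⟮IM; FA, A⟯, ContMDiff IM (IM.prod 𝓘(ℝ, FV)) ∞
    (fun m => (⟨m, α m (fun i => a i m)⟩ : TotalSpace FV V))}
  add_mem' h h' a := (h a).add_section (h' a)
  zero_mem' _ := contMDiff_zeroSection _ _
  smul_mem' _ _ h a := (h a).const_smul_section

/-- The space `Ω^k(A, V) = Γ(∧^k A^* ⊗ V)` of `V`-valued `A`-forms. -/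
def Form (k : ℕ) : Type _ := formSubmodule IM FA A FV V k

instance (k : ℕ) : AddCommGroup (Form IM FA A FV V k) :=
  inferInstanceAs (AddCommGroup (formSubmodule IM FA A FV V k))

instance (k : ℕ) : Module ℝ (Form IM FA A FV V k) :=
  inferInstanceAs (Module ℝ (formSubmodule IM FA A FV V k))

variable {IM FA A FV V}

/-- The section `α(a₁, …, a_k)` of `V`. -/
def Form.eval {k : ℕ} (α : Form IM FA A FV V k) (a : Fin k → Cₛ^∞⟮IM; FA, A⟯) :
    Cₛ^∞⟮IM; FV, V⟯ :=
  ⟨fun m => α.1 m (fun i => a i m), α.2 a⟩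

variable {LA : LieAlgebroid IM FA A}

/-- The bracket terms of the Koszul formula; the indices other than `j` are `j.succAbove l`. -/
def LieAlgebroid.koszulBracket (LA : LieAlgebroid IM FA A) : ∀ {k : ℕ}, Form IM FA A FV V k →
    (Fin (k + 1) → Cₛ^∞⟮IM; FA, A⟯) → Cₛ^∞⟮IM; FV, V⟯
  | 0, _, _ => 0
  | k + 1, α, a => ∑ j : Fin (k + 2), ∑ l : Fin (k + 1),
      if j < j.succAbove l then
        (-1 : ℝ) ^ ((j : ℕ) + (j.succAbove l : ℕ)) •
          α.eval (Fin.cons (LA.bracket (a j) (a (j.succAbove l)))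
            (fun i => a (j.succAbove (l.succAbove i))))
      else 0

/-- The Koszul formula for `(d_∇ α)(a₀, …, a_k)`. -/
def Connection.koszul (D : Connection LA FV V) (k : ℕ) : Form IM FA A FV V k →ₗ[ℝ]
    ((Fin (k + 1) → Cₛ^∞⟮IM; FA, A⟯) → Cₛ^∞⟮IM; FV, V⟯) where
  toFun α a := ∑ j : Fin (k + 1), (-1 : ℝ) ^ (j : ℕ) • D.toFun (a j) (α.eval fun i => a (j.succAbove i))
    + LA.koszulBracket α a
  map_add' α η := by
    have h : ∀ {k : ℕ} (α η : Form IM FA A FV V k) a, (α + η).eval a = α.eval a + η.eval a :=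
      fun _ _ _ => rfl
    funext a
    cases k with
    | zero => simp [h, LieAlgebroid.koszulBracket]
    | succ k =>
      simp only [h, LieAlgebroid.koszulBracket, map_add, smul_add, Finset.sum_add_distrib, Pi.add_apply]
      have : ∀ (p : Prop) [Decidable p] (x y : Cₛ^∞⟮IM; FV, V⟯),
        (if p then x + y else 0) = (if p then x else 0) + (if p then y else 0) := by
        intro p _ x y; split_ifs <;> simp
      simp only [this, Finset.sum_add_distrib]
      abel
  map_smul' r α := by
    have h : ∀ {k : ℕ} (α : Form IM FA A FV V k) a, (r • α).eval a = r • α.eval a :=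
      fun _ _ => rfl
    funext a
    cases k with
    | zero => simp [h, LieAlgebroid.koszulBracket]
    | succ k =>
      simp only [h, LieAlgebroid.koszulBracket, map_smul, Finset.smul_sum, smul_add, smul_ite, smul_zero,
        RingHom.id_apply, Pi.smul_apply, smul_comm r]

/-- Closed `k`-forms: `d_∇ α = 0`. -/
def Connection.closedForms (D : Connection LA FV V) (k : ℕ) :
    Submodule ℝ (Form IM FA A FV V k) :=
  LinearMap.ker (D.koszul k)

/-- Exact `k`-forms: `α = d_∇ η` for a `(k-1)`-form `η` (and only `0` for `k = 0`). -/
def Connection.exactForms (D : Connection LA FV V) : ∀ k : ℕ, Submodule ℝ (Form IM FA A FV V k)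
  | 0 => ⊥
  | k + 1 =>
    { carrier := {α | ∃ η : Form IM FA A FV V k, ∀ a, α.eval a = D.koszul k η a}
      add_mem' := by
        rintro α α' ⟨η, h⟩ ⟨η', h'⟩
        refine ⟨η + η', fun a => ?_⟩
        rw [map_add, Pi.add_apply, ← h, ← h']
        rfl
      zero_mem' := ⟨0, fun a => by rw [map_zero]; rfl⟩
      smul_mem' := by
        rintro r α ⟨η, h⟩
        refine ⟨r • η, fun a => ?_⟩
        rw [map_smul, Pi.smul_apply, ← h]
        rfl }

/-- The twisted Lie algebroid cohomology `H^k_∇(A, V)`. -/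
abbrev Connection.Cohomology (D : Connection LA FV V) (k : ℕ) : Type _ :=
  D.closedForms k ⧸ (D.exactForms k).submoduleOf (D.closedForms k)

/-- The cohomology class of a closed form. -/
def Connection.cohomologyClass (D : Connection LA FV V) {k : ℕ} (α : Form IM FA A FV V k)
    (h : α ∈ D.closedForms k) : D.Cohomology k :=
  Submodule.Quotient.mk ⟨α, h⟩

end Forms

section FormMaps

variable {EM HM M : Type*} [NormedAddCommGroup EM] [NormedSpace ℝ EM] [TopologicalSpace HM]
  {IM : ModelWithCorners ℝ EM HM} [TopologicalSpace M] [ChartedSpace HM M] [IsManifold IM ∞ M]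
  {EN HN N : Type*} [NormedAddCommGroup EN] [NormedSpace ℝ EN] [TopologicalSpace HN]
  {IN : ModelWithCorners ℝ EN HN} [TopologicalSpace N] [ChartedSpace HN N] [IsManifold IN ∞ N]
  {EP HP P : Type*} [NormedAddCommGroup EP] [NormedSpace ℝ EP] [TopologicalSpace HP]
  {IP : ModelWithCorners ℝ EP HP} [TopologicalSpace P] [ChartedSpace HP P] [IsManifold IP ∞ P]
  {FA : Type*} [NormedAddCommGroup FA] [NormedSpace ℝ FA]
  {A : M → Type*} [TopologicalSpace (TotalSpace FA A)] [∀ x, AddCommGroup (A x)]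
  [∀ x, Module ℝ (A x)] [∀ x, TopologicalSpace (A x)] [FiberBundle FA A] [VectorBundle ℝ FA A]
  {FB : Type*} [NormedAddCommGroup FB] [NormedSpace ℝ FB]
  {B : N → Type*} [TopologicalSpace (TotalSpace FB B)] [∀ x, AddCommGroup (B x)]
  [∀ x, Module ℝ (B x)] [∀ x, TopologicalSpace (B x)] [FiberBundle FB B] [VectorBundle ℝ FB B]
  {FC : Type*} [NormedAddCommGroup FC] [NormedSpace ℝ FC]
  {C : P → Type*} [TopologicalSpace (TotalSpace FC C)] [∀ x, AddCommGroup (C x)]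
  [∀ x, Module ℝ (C x)] [∀ x, TopologicalSpace (C x)] [FiberBundle FC C] [VectorBundle ℝ FC C]
  {FE : Type*} [NormedAddCommGroup FE] [NormedSpace ℝ FE]
  {E : N → Type*} [TopologicalSpace (TotalSpace FE E)] [∀ x, AddCommGroup (E x)]
  [∀ x, Module ℝ (E x)] [∀ x, TopologicalSpace (E x)] [FiberBundle FE E] [VectorBundle ℝ FE E]
  [ContMDiffVectorBundle ∞ FE E IN]
  {LA : LieAlgebroid IM FA A} {LB : LieAlgebroid IN FB B} {LC : LieAlgebroid IP FC C}
  {k : ℕ}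

lemma contMDiff_pullbackForm [FiniteDimensional ℝ FB] [ContMDiffVectorBundle ∞ FB B IN]
    [FiniteDimensional ℝ EN] [T2Space N]
    (Φ : AnchoredHom LA LB) (α : Form IN FB B FE E k)
    (a : Fin k → Cₛ^∞⟮IM; FA, A⟯) :
    ContMDiff IM (IN.prod 𝓘(ℝ, FE)) ∞
      (fun m => (⟨Φ.base m, α.1 (Φ.base m) (fun i => Φ.fiber m (a i m))⟩ : TotalSpace FE E)) := by
  intro m
  obtain ⟨n, β, μ, hμ, hβ⟩ := exists_frame IN FB B (Φ.base m)
  let g : Fin k → Fin n → C^∞⟮IM, M; ℝ⟯ := fun i l =>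
    ⟨fun x => μ l (Φ.base x) (Φ.fiber x (a i x)),
      (hμ l).comp (Φ.contMDiff_fiber.comp (a i).contMDiff)⟩
  let G : (Fin k → Fin n) → C^∞⟮IM, M; ℝ⟯ := fun r =>
    ⟨fun x => ∏ i, g i (r i) x, contMDiff_finsetProd fun i _ => (g i (r i)).contMDiff⟩
  let S : Cₛ^∞⟮IM; FE, Φ.base *ᵖ E⟯ :=
    ∑ r : Fin k → Fin n, fsmul (G r) (pullbackSection Φ.base (α.eval fun i => β (r i)))
  have hS := contMDiff_pullback_section.1 S.contMDiff m
  refine hS.congr_of_eventuallyEq ?_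
  filter_upwards [Φ.base.contMDiff.continuous.continuousAt.eventually hβ] with x hx
  congr 1
  have h1 : (fun i => Φ.fiber x (a i x)) = fun i => ∑ l, g i l x • β l (Φ.base x) := by
    funext i
    conv_lhs => rw [hx (Φ.fiber x (a i x))]
    rfl
  rw [h1]
  have h2 := (α.1 (Φ.base x)).toMultilinearMap.map_sum (fun i l => g i l x • β l (Φ.base x))
  refine h2.trans ?_
  simp only [S, section_sum_apply]
  refine Finset.sum_congr rfl fun r _ => ?_
  have h3 := (α.1 (Φ.base x)).toMultilinearMap.map_smul_univ (fun i => g i (r i) x)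
    (fun i => β (r i) (Φ.base x))
  exact h3

variable [FiniteDimensional ℝ FB] [ContMDiffVectorBundle ∞ FB B IN] [FiniteDimensional ℝ EN]
  [T2Space N]

/-- The pullback `Φ^* : Ω^k(B, E) → Ω^k(A, φ^!E)` of forms. -/
def AnchoredHom.pullbackForm (Φ : AnchoredHom LA LB) (k : ℕ) :
    Form IN FB B FE E k →ₗ[ℝ] Form IM FA A FE (Φ.base *ᵖ E) k where
  toFun α := ⟨fun m => (α.1 (Φ.base m)).compLinearMap (Φ.fiber m), fun a =>
    contMDiff_pullback_section.2 (contMDiff_pullbackForm Φ α a)⟩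
  map_add' _ _ := rfl
  map_smul' _ _ := rfl

variable [FiniteDimensional ℝ FC] [ContMDiffVectorBundle ∞ FC C IP] [FiniteDimensional ℝ EP]
  [T2Space P]

/-- For `Ψ : A → C` and `Φ : C → B` over `ψ` and `φ`, the pullback
`Ψ^* : Ω^k(C, φ^!E) → Ω^k(A, ψ^!φ^!E) = Ω^k(A, (φ ∘ ψ)^!E)` of forms. -/
def AnchoredHom.restrictForm (Φ : AnchoredHom LC LB) (Ψ : AnchoredHom LA LC) (k : ℕ) :
    Form IP FC C FE (Φ.base *ᵖ E) k →ₗ[ℝ] Form IM FA A FE ((Φ.comp Ψ).base *ᵖ E) k where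
  toFun α := ⟨fun m => (α.1 (Ψ.base m)).compLinearMap (Ψ.fiber m), fun a =>
    (contMDiff_pullback_section (φ := (Φ.comp Ψ).base) (A := E)).2
      ((contMDiff_pullback_lift Φ.base).comp (contMDiff_pullbackForm Ψ α a))⟩
  map_add' _ _ := rfl
  map_smul' _ _ := rfl

end FormMaps

section Gauge

variable {EM HM M : Type*} [NormedAddCommGroup EM] [NormedSpace ℝ EM] [TopologicalSpace HM]
  {IM : ModelWithCorners ℝ EM HM} [TopologicalSpace M] [ChartedSpace HM M] [IsManifold IM ∞ M]
  {FA : Type*} [NormedAddCommGroup FA] [NormedSpace ℝ FA]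
  {A : M → Type*} [TopologicalSpace (TotalSpace FA A)] [∀ x, AddCommGroup (A x)]
  [∀ x, Module ℝ (A x)] [∀ x, TopologicalSpace (A x)] [FiberBundle FA A] [VectorBundle ℝ FA A]
  {LA : LieAlgebroid IM FA A}
  {FV : Type*} [NormedAddCommGroup FV] [NormedSpace ℝ FV]
  {V : M → Type*} [TopologicalSpace (TotalSpace FV V)] [∀ x, AddCommGroup (V x)]
  [∀ x, Module ℝ (V x)] [∀ x, TopologicalSpace (V x)] [FiberBundle FV V] [VectorBundle ℝ FV V]
  {FW : Type*} [NormedAddCommGroup FW] [NormedSpace ℝ FW]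
  {W : M → Type*} [TopologicalSpace (TotalSpace FW W)] [∀ x, AddCommGroup (W x)]
  [∀ x, Module ℝ (W x)] [∀ x, TopologicalSpace (W x)] [FiberBundle FW W] [VectorBundle ℝ FW W]

variable (IM FV V FW W) in
/-- Smooth vector bundle isomorphisms `V ≅ W` over the identity of `M`. -/
structure BundleIso where
  fiber : ∀ m, V m ≃ₗ[ℝ] W m
  contMDiff_fiber : ContMDiff (IM.prod 𝓘(ℝ, FV)) (IM.prod 𝓘(ℝ, FW)) ∞
    (fun v : TotalSpace FV V => (⟨v.1, fiber v.1 v.2⟩ : TotalSpace FW W))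
  contMDiff_symm : ContMDiff (IM.prod 𝓘(ℝ, FW)) (IM.prod 𝓘(ℝ, FV)) ∞
    (fun w : TotalSpace FW W => (⟨w.1, (fiber w.1).symm w.2⟩ : TotalSpace FV V))

/-- The section `θ ∘ s`. -/
def BundleIso.mapSection (θ : BundleIso IM FV V FW W) (s : Cₛ^∞⟮IM; FV, V⟯) : Cₛ^∞⟮IM; FW, W⟯ :=
  ⟨fun m => θ.fiber m (s m), θ.contMDiff_fiber.comp s.contMDiff⟩

/-- The map `θ_* : Ω^k(A, V) → Ω^k(A, W)`, `ω ↦ θ ∘ ω`. -/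
def BundleIso.mapForm (θ : BundleIso IM FV V FW W) (k : ℕ) :
    Form IM FA A FV V k →ₗ[ℝ] Form IM FA A FW W k where
  toFun α := ⟨fun m => (θ.fiber m).toLinearMap.compAlternatingMap (α.1 m), fun a =>
    θ.contMDiff_fiber.comp (α.2 a)⟩
  map_add' α β := Subtype.ext <| funext fun m => by ext; exact map_add (θ.fiber m) _ _
  map_smul' r α := Subtype.ext <| funext fun m => by ext; exact map_smul (θ.fiber m) _ _

/-- `θ` is a gauge equivalence from `∇` to `∇'`: `∇_a e = θ⁻¹(∇'_a (θ(e)))`. -/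
def BundleIso.IsGaugeEquivalence (θ : BundleIso IM FV V FW W) (D : Connection LA FV V)
    (D' : Connection LA FW W) : Prop :=
  ∀ (a : Cₛ^∞⟮IM; FA, A⟯) (e : Cₛ^∞⟮IM; FV, V⟯) (m : M),
    D.toFun a e m = (θ.fiber m).symm (D'.toFun a (θ.mapSection e) m)

end Gauge

section Induced

variable {EM HM M : Type*} [NormedAddCommGroup EM] [NormedSpace ℝ EM] [TopologicalSpace HM]
  {IM : ModelWithCorners ℝ EM HM} [TopologicalSpace M] [ChartedSpace HM M] [IsManifold IM ∞ M]
  {EN HN N : Type*} [NormedAddCommGroup EN] [NormedSpace ℝ EN] [TopologicalSpace HN]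
  {IN : ModelWithCorners ℝ EN HN} [TopologicalSpace N] [ChartedSpace HN N] [IsManifold IN ∞ N]
  {FA : Type*} [NormedAddCommGroup FA] [NormedSpace ℝ FA]
  {A : M → Type*} [TopologicalSpace (TotalSpace FA A)] [∀ x, AddCommGroup (A x)]
  [∀ x, Module ℝ (A x)] [∀ x, TopologicalSpace (A x)] [FiberBundle FA A] [VectorBundle ℝ FA A]
  {LA : LieAlgebroid IM FA A}
  {FV : Type*} [NormedAddCommGroup FV] [NormedSpace ℝ FV]
  {V : M → Type*} [TopologicalSpace (TotalSpace FV V)] [∀ x, AddCommGroup (V x)]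
  [∀ x, Module ℝ (V x)] [∀ x, TopologicalSpace (V x)] [FiberBundle FV V] [VectorBundle ℝ FV V]
  {FB : Type*} [NormedAddCommGroup FB] [NormedSpace ℝ FB]
  {B : N → Type*} [TopologicalSpace (TotalSpace FB B)] [∀ x, AddCommGroup (B x)]
  [∀ x, Module ℝ (B x)] [∀ x, TopologicalSpace (B x)] [FiberBundle FB B] [VectorBundle ℝ FB B]
  {LB : LieAlgebroid IN FB B}
  {FW : Type*} [NormedAddCommGroup FW] [NormedSpace ℝ FW]
  {W : N → Type*} [TopologicalSpace (TotalSpace FW W)] [∀ x, AddCommGroup (W x)]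
  [∀ x, Module ℝ (W x)] [∀ x, TopologicalSpace (W x)] [FiberBundle FW W] [VectorBundle ℝ FW W]

/-- The map `F` in cohomology is induced by the map `f` of forms: `f` maps closed forms to closed
forms, and `F [ω] = [f ω]`. -/
def InducedBy {D : Connection LA FV V} {D' : Connection LB FW W} {k : ℕ}
    (F : D.Cohomology k → D'.Cohomology k)
    (f : Form IM FA A FV V k →ₗ[ℝ] Form IN FB B FW W k) : Prop :=
  ∀ (α : Form IM FA A FV V k) (h : α ∈ D.closedForms k), ∃ h' : f α ∈ D'.closedForms k,
    F (D.cohomologyClass α h) = D'.cohomologyClass (f α) h'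

end Induced

section TJ
variable {EP HP P : Type*} [NormedAddCommGroup EP] [NormedSpace ℝ EP] [TopologicalSpace HP]
  {IP : ModelWithCorners ℝ EP HP} [TopologicalSpace P] [ChartedSpace HP P]
  {J : TopologicalSpace.Opens ℝ}

lemma trivializationAt_opens (t : J) (v : TangentBundle 𝓘(ℝ, ℝ) J) :
    (trivializationAt ℝ (TangentSpace 𝓘(ℝ, ℝ) : J → Type) t v).2 = v.2 := by
  have h : v.1 ∈ (extChartAt 𝓘(ℝ, ℝ) v.1).source := mem_extChartAt_source _
  exact tangentCoordChange_self (I := 𝓘(ℝ, ℝ)) (x := v.1) (z := v.1) (v := v.2) h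

lemma contMDiff_tangent_opens {τ : P → J} {r : P → ℝ} :
    ContMDiff IP (𝓘(ℝ, ℝ).prod 𝓘(ℝ, ℝ)) ∞ (fun p => (⟨τ p, r p⟩ : TangentBundle 𝓘(ℝ, ℝ) J)) ↔
      ContMDiff IP 𝓘(ℝ, ℝ) ∞ τ ∧ ContMDiff IP 𝓘(ℝ, ℝ) ∞ r := by
  constructor
  · intro h
    refine ⟨(contMDiff_proj _).comp h, fun p => ?_⟩
    have := (contMDiffAt_totalSpace.1 (h p)).2
    simpa only [trivializationAt_opens] using this
  · rintro ⟨h1, h2⟩ p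
    rw [contMDiffAt_totalSpace]
    refine ⟨h1 p, ?_⟩
    simpa only [trivializationAt_opens] using h2 p

end TJ

section ProdSection
variable {EP HP P : Type*} [NormedAddCommGroup EP] [NormedSpace ℝ EP] [TopologicalSpace HP]
  {IP : ModelWithCorners ℝ EP HP} [TopologicalSpace P] [ChartedSpace HP P]
  {EM HM M : Type*} [NormedAddCommGroup EM] [NormedSpace ℝ EM] [TopologicalSpace HM]
  {IM : ModelWithCorners ℝ EM HM} [TopologicalSpace M] [ChartedSpace HM M]
  {FV : Type*} [NormedAddCommGroup FV] [NormedSpace ℝ FV]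
  {V : M → Type*} [TopologicalSpace (TotalSpace FV V)] [∀ x, AddCommGroup (V x)]
  [∀ x, Module ℝ (V x)] [∀ x, TopologicalSpace (V x)] [FiberBundle FV V] [VectorBundle ℝ FV V]
  {FW : Type*} [NormedAddCommGroup FW] [NormedSpace ℝ FW]
  {W : M → Type*} [TopologicalSpace (TotalSpace FW W)] [∀ x, AddCommGroup (W x)]
  [∀ x, Module ℝ (W x)] [∀ x, TopologicalSpace (W x)] [FiberBundle FW W] [VectorBundle ℝ FW W]

lemma contMDiff_prod_bundle {φ : P → M} {v : ∀ p, V (φ p)} {w : ∀ p, W (φ p)} :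
    ContMDiff IP (IM.prod 𝓘(ℝ, FV × FW)) ∞
        (fun p => (⟨φ p, (v p, w p)⟩ : TotalSpace (FV × FW) (V ×ᵇ W))) ↔
      ContMDiff IP (IM.prod 𝓘(ℝ, FV)) ∞ (fun p => (⟨φ p, v p⟩ : TotalSpace FV V)) ∧
      ContMDiff IP (IM.prod 𝓘(ℝ, FW)) ∞ (fun p => (⟨φ p, w p⟩ : TotalSpace FW W)) := by
  simp only [ContMDiff, contMDiffAt_totalSpace]
  rw [← forall_and]
  refine forall_congr' fun p => ?_
  have : ContMDiffAt IP 𝓘(ℝ, FV × FW) ∞ (fun x => ((trivializationAt (FV × FW) (V ×ᵇ W) (φ p))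
      ⟨φ x, (v x, w x)⟩).2) p ↔ _ := contMDiffAt_prod_module_iff _
  rw [this]
  exact ⟨fun ⟨a, b, c⟩ => ⟨⟨a, b⟩, ⟨a, c⟩⟩, fun ⟨⟨a, b⟩, ⟨_, c⟩⟩ => ⟨a, b, c⟩⟩
end ProdSection

section Calc
variable {EM M : Type*} [NormedAddCommGroup EM] [NormedSpace ℝ EM]
  [TopologicalSpace M] [ChartedSpace EM M] [IsManifold 𝓘(ℝ, EM) ∞ M]
  {J : TopologicalSpace.Opens ℝ}

/-- The tangent vector `∂_t` of the interval `J` at `t`. -/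
def ddt (t : J) : TangentSpace 𝓘(ℝ, ℝ) t := (1 : ℝ)

/-- The functions `u(t, ·)` on `M`. -/
def sliceFun (u : C^∞⟮𝓘(ℝ, ℝ).prod 𝓘(ℝ, EM), J × M; ℝ⟯) (t : J) : C^∞⟮𝓘(ℝ, EM), M; ℝ⟯ :=
  ⟨fun m => u (t, m), u.contMDiff.comp (contMDiff_const.prodMk contMDiff_id)⟩

@[simp] lemma sliceFun_apply (u : C^∞⟮𝓘(ℝ, ℝ).prod 𝓘(ℝ, EM), J × M; ℝ⟯) (t : J) (m : M) :
  sliceFun u t m = u (t, m) := rfl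

lemma dirDeriv_prod (u : C^∞⟮𝓘(ℝ, ℝ).prod 𝓘(ℝ, EM), J × M; ℝ⟯) (t : J) (m : M) (r : ℝ)
    (v : TangentSpace 𝓘(ℝ, EM) m) :
    dirDeriv (𝓘(ℝ, ℝ).prod 𝓘(ℝ, EM)) u (t, m) (r, v) =
      r * dirDeriv 𝓘(ℝ, ℝ) (fun τ : J => u (τ, m)) t (ddt t) + dirDeriv 𝓘(ℝ, EM) (sliceFun u t) m v := by
  have h1 := mfderiv_prod_eq_add_apply (I := 𝓘(ℝ, ℝ)) (I' := 𝓘(ℝ, EM)) (f := u) (p := (t, m))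
    (v := (r, v)) (u.contMDiff.mdifferentiableAt (by simp))
  refine h1.trans ?_
  have h2 := (dirDeriv 𝓘(ℝ, ℝ) (fun τ : J => u (τ, m)) t).map_smul r (1 : ℝ)
  have h3 : (r • (1 : ℝ)) = r := by simp
  congr 1
  change dirDeriv 𝓘(ℝ, ℝ) (fun τ : J => u (τ, m)) t r = _
  refine Eq.trans ?_ h2
  congr 1
  exact h3.symm

lemma contMDiff_tangent_prod {EP HP P : Type*} [NormedAddCommGroup EP] [NormedSpace ℝ EP]
    [TopologicalSpace HP] {IP : ModelWithCorners ℝ EP HP} [TopologicalSpace P] [ChartedSpace HP P]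
    {τ : P → J} {μ : P → M} {r : P → ℝ} {v : ∀ p, TangentSpace 𝓘(ℝ, EM) (μ p)}
    (hτ : ContMDiff IP 𝓘(ℝ, ℝ) ∞ τ) (hr : ContMDiff IP 𝓘(ℝ, ℝ) ∞ r)
    (hv : ContMDiff IP (𝓘(ℝ, EM).prod 𝓘(ℝ, EM)) ∞ (fun p => (⟨μ p, v p⟩ : TangentBundle 𝓘(ℝ, EM) M))) :
    ContMDiff IP ((𝓘(ℝ, ℝ).prod 𝓘(ℝ, EM)).prod 𝓘(ℝ, ℝ × EM)) ∞
      (fun p => (⟨(τ p, μ p), (r p, v p)⟩ : TangentBundle (𝓘(ℝ, ℝ).prod 𝓘(ℝ, EM)) (J × M))) :=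
  contMDiff_equivTangentBundleProd_symm.comp ((contMDiff_tangent_opens.2 ⟨hτ, hr⟩).prodMk hv)

/-- The partial derivative `∂u/∂t`. -/
def timeDerivFun (u : C^∞⟮𝓘(ℝ, ℝ).prod 𝓘(ℝ, EM), J × M; ℝ⟯) :
    C^∞⟮𝓘(ℝ, ℝ).prod 𝓘(ℝ, EM), J × M; ℝ⟯ :=
  ⟨fun p => dirDeriv 𝓘(ℝ, ℝ) (fun τ : J => u (τ, p.2)) p.1 (ddt p.1), by
    have h := contMDiff_dirDeriv u (contMDiff_tangent_prod (J := J) (M := M)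
      (IP := 𝓘(ℝ, ℝ).prod 𝓘(ℝ, EM)) contMDiff_fst (contMDiff_const (c := (1 : ℝ)))
      ((contMDiff_zeroSection ℝ (TangentSpace 𝓘(ℝ, EM) : M → Type _)).comp contMDiff_snd))
    refine h.congr fun p => ?_
    rw [dirDeriv_prod]
    erw [map_zero]
    simp⟩

lemma two_le : (1 : WithTop ℕ∞) + 1 ≤ ∞ := by
  exact WithTop.coe_le_coe.2 (le_top : (1 + 1 : ℕ∞) ≤ ⊤)

lemma fderiv_mixed {H : ℝ × EM → ℝ} {s₀ : ℝ} {x₀ : EM} (hH : ContDiffAt ℝ ∞ H (s₀, x₀)) (v : EM) :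
    fderiv ℝ (fun s => fderiv ℝ (fun x => H (s, x)) x₀ v) s₀ 1 =
      fderiv ℝ (fun x => fderiv ℝ (fun s => H (s, x)) s₀ 1) x₀ v := by
  have hd : ∀ᶠ p in 𝓝 (s₀, x₀), DifferentiableAt ℝ H p := by
    filter_upwards [(hH.of_le (m := 1) (by simp)).eventually (by simp)] with p hp
    exact hp.differentiableAt (by simp)
  have hdd : DifferentiableAt ℝ (fderiv ℝ H) (s₀, x₀) :=
    (hH.fderiv_right (m := 1) two_le).differentiableAt (by simp)
  have h1 : (fun s => fderiv ℝ (fun x => H (s, x)) x₀ v) =ᶠ[𝓝 s₀]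
      fun s => fderiv ℝ H (s, x₀) (0, v) := by
    have hc : ContinuousAt (fun s : ℝ => (s, x₀)) s₀ := by fun_prop
    filter_upwards [hc.eventually hd] with s hs
    have := (hs.hasFDerivAt.comp x₀ (hasFDerivAt_prodMk_right (𝕜 := ℝ) s x₀)).fderiv
    exact congrArg (fun L => L v) this
  have h2 : (fun x => fderiv ℝ (fun s => H (s, x)) s₀ 1) =ᶠ[𝓝 x₀]
      fun x => fderiv ℝ H (s₀, x) (1, 0) := by
    have hc : ContinuousAt (fun x : EM => (s₀, x)) x₀ := by fun_prop
    filter_upwards [hc.eventually hd] with x hx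
    have := (hx.hasFDerivAt.comp s₀ (hasFDerivAt_prodMk_left (𝕜 := ℝ) s₀ x)).fderiv
    exact congrArg (fun L => L (1 : ℝ)) this
  rw [h1.fderiv_eq, h2.fderiv_eq]
  have h3 := ((hdd.hasFDerivAt.comp s₀ (hasFDerivAt_prodMk_left (𝕜 := ℝ) s₀ x₀)).clm_apply
    (hasFDerivAt_const ((0 : ℝ), v) s₀)).fderiv
  have h4 := ((hdd.hasFDerivAt.comp x₀ (hasFDerivAt_prodMk_right (𝕜 := ℝ) s₀ x₀)).clm_apply
    (hasFDerivAt_const ((1 : ℝ), (0 : EM)) x₀)).fderiv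
  have h3' := congrArg (fun L => L (1 : ℝ)) h3
  have h4' := congrArg (fun L => L v) h4
  simp only [Function.comp_apply, add_apply, ContinuousLinearMap.comp_apply,
    zero_apply, map_zero, ContinuousLinearMap.flip_apply, zero_add,
    ContinuousLinearMap.inl_apply, ContinuousLinearMap.inr_apply] at h3' h4'
  refine h3'.trans (Eq.trans ?_ h4'.symm)
  exact (hH.isSymmSndFDerivAt (by simpa [one_add_one_eq_two] using two_le)) _ _

lemma dirDeriv_eq_fderiv {f : M → ℝ} {m : M} (hf : MDifferentiableAt 𝓘(ℝ, EM) 𝓘(ℝ, ℝ) f m)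
    (v : TangentSpace 𝓘(ℝ, EM) m) :
    dirDeriv 𝓘(ℝ, EM) f m v = fderiv ℝ (fun x => f ((chartAt EM m).symm x)) (chartAt EM m m) v := by
  unfold dirDeriv
  simp only [mfderiv, hf, writtenInExtChartAt]
  simp [fderivWithin_univ]
  rfl

/-- Mixed partial derivatives commute. -/
lemma timeDeriv_comm (u : C^∞⟮𝓘(ℝ, ℝ).prod 𝓘(ℝ, EM), J × M; ℝ⟯) (t : J) (m : M)
    (v : TangentSpace 𝓘(ℝ, EM) m) :
    MDifferentiableAt 𝓘(ℝ, ℝ) 𝓘(ℝ, ℝ) (fun τ : J => dirDeriv 𝓘(ℝ, EM) (sliceFun u τ) m v) t ∧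
    dirDeriv 𝓘(ℝ, ℝ) (fun τ : J => dirDeriv 𝓘(ℝ, EM) (sliceFun u τ) m v) t (ddt t) =
      dirDeriv 𝓘(ℝ, EM) (sliceFun (timeDerivFun u) t) m v := by
  have h0 : MDifferentiableAt 𝓘(ℝ, ℝ) 𝓘(ℝ, ℝ)
      (fun τ : J => dirDeriv 𝓘(ℝ, EM) (sliceFun u τ) m v) t := by
    have h := contMDiff_dirDeriv u (contMDiff_tangent_prod (J := J) (M := M) (μ := fun _ => m)
      (IP := 𝓘(ℝ, ℝ)) contMDiff_id (contMDiff_const (c := (0 : ℝ)))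
      (contMDiff_const (c := (⟨m, v⟩ : TangentBundle 𝓘(ℝ, EM) M))))
    refine MDifferentiableAt.congr_of_eventuallyEq (h.mdifferentiableAt (by simp)) (Eventually.of_forall fun τ => ?_)
    exact ((dirDeriv_prod u τ m 0 v).trans (by simp)).symm
  refine ⟨h0, ?_⟩
  rw [dirDeriv_eq_fderiv h0, dirDeriv_eq_fderiv (contMDiff_toFunction _ _)]
  let T := chartAt ℝ t
  let X := chartAt EM m
  let H : ℝ × EM → ℝ := fun p => u (T.symm p.1, X.symm p.2)
  have hH : ContDiffAt ℝ ∞ H (T t, X m) := by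
    rw [← contMDiffAt_iff_contDiffAt]
    have hT : ContMDiffAt 𝓘(ℝ, ℝ) 𝓘(ℝ, ℝ) ∞ T.symm (T t) :=
      (contMDiffOn_chart_symm (I := 𝓘(ℝ, ℝ)) (x := t)).contMDiffAt
        (T.open_target.mem_nhds (mem_chart_target ℝ t))
    have hX : ContMDiffAt 𝓘(ℝ, EM) 𝓘(ℝ, EM) ∞ X.symm (X m) :=
      (contMDiffOn_chart_symm (I := 𝓘(ℝ, EM)) (x := m)).contMDiffAt
        (X.open_target.mem_nhds (mem_chart_target EM m))
    have h1 : ContMDiffAt 𝓘(ℝ, ℝ × EM) 𝓘(ℝ, ℝ) ∞ (fun p : ℝ × EM => T.symm p.1) (T t, X m) :=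
      ContMDiffAt.comp (g := T.symm) (f := Prod.fst) (T t, X m) hT
        (contDiff_fst.contMDiff.contMDiffAt)
    have h2 : ContMDiffAt 𝓘(ℝ, ℝ × EM) 𝓘(ℝ, EM) ∞ (fun p : ℝ × EM => X.symm p.2) (T t, X m) :=
      ContMDiffAt.comp (g := X.symm) (f := Prod.snd) (T t, X m) hX
        (contDiff_snd.contMDiff.contMDiffAt)
    exact u.contMDiff.contMDiffAt.comp (T t, X m) (h1.prodMk h2)
  have e1 : (fun s => dirDeriv 𝓘(ℝ, EM) (sliceFun u (T.symm s)) m v) =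
      fun s => fderiv ℝ (fun x => H (s, x)) (X m) v := by
    funext s
    exact dirDeriv_eq_fderiv (contMDiff_toFunction _ _) v
  have e2 : (fun x => sliceFun (timeDerivFun u) t (X.symm x)) =
      fun x => fderiv ℝ (fun s => H (s, x)) (T t) 1 := by
    funext x
    refine dirDeriv_eq_fderiv (M := J) (f := fun τ : J => u (τ, X.symm x)) ?_ (ddt t)
    exact (u.contMDiff.comp (contMDiff_id.prodMk contMDiff_const)).mdifferentiableAt (by simp)
  erw [e1, e2]
  exact fderiv_mixed hH v

end Calc

section AlgebroidLemmas

variable {EM HM M : Type*} [NormedAddCommGroup EM] [NormedSpace ℝ EM] [TopologicalSpace HM]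
  {IM : ModelWithCorners ℝ EM HM} [TopologicalSpace M] [ChartedSpace HM M] [IsManifold IM ∞ M]
  {FA : Type*} [NormedAddCommGroup FA] [NormedSpace ℝ FA]
  {A : M → Type*} [TopologicalSpace (TotalSpace FA A)] [∀ x, AddCommGroup (A x)]
  [∀ x, Module ℝ (A x)] [∀ x, TopologicalSpace (A x)] [FiberBundle FA A] [VectorBundle ℝ FA A]
  (LA : LieAlgebroid IM FA A)

lemma LieAlgebroid.bracket_symm (a b : Cₛ^∞⟮IM; FA, A⟯) : LA.bracket a b = - LA.bracket b a := by
  have h := LA.bracket_self (a + b)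
  simp only [map_add, LinearMap.add_apply, LA.bracket_self, zero_add, add_zero] at h
  exact eq_neg_of_add_eq_zero_right h

lemma LieAlgebroid.leibniz_left (a b : Cₛ^∞⟮IM; FA, A⟯) (f : C^∞⟮IM, M; ℝ⟯) (m : M) :
    LA.bracket (fsmul f a) b m =
      f m • LA.bracket a b m - dirDeriv IM f m (LA.anchor m (b m)) • a m := by
  rw [LA.bracket_symm, LA.bracket_symm a b]
  have := LA.leibniz b a f m
  simp only [ContMDiffSection.coe_neg, Pi.neg_apply, this]
  module

/-- The derivative `ρ(a) f` of a function along the anchor of a section. -/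
def LieAlgebroid.act (a : Cₛ^∞⟮IM; FA, A⟯) (f : C^∞⟮IM, M; ℝ⟯) : C^∞⟮IM, M; ℝ⟯ :=
  ⟨fun m => dirDeriv IM f m (LA.anchor m (a m)),
    contMDiff_dirDeriv _ (LA.contMDiff_anchor.comp a.contMDiff)⟩

lemma LieAlgebroid.bracket_fsmul (a b : Cₛ^∞⟮IM; FA, A⟯) (f : C^∞⟮IM, M; ℝ⟯) :
    LA.bracket a (fsmul f b) = fsmul f (LA.bracket a b) + fsmul (LA.act a f) b := by
  ext m; exact LA.leibniz a b f m

variable [FiniteDimensional ℝ EM] [T2Space M] [ContMDiffVectorBundle ∞ FA A IM]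
  [FiniteDimensional ℝ FA]

variable (IM FA A) in
lemma exists_bump_frame (y : M) : ∃ (n : ℕ) (s : Fin n → Cₛ^∞⟮IM; FA, A⟯)
    (κ : Fin n → ∀ x, A x →ₗ[ℝ] ℝ) (ψ : C^∞⟮IM, M; ℝ⟯),
    (∀ i, ContMDiff (IM.prod 𝓘(ℝ, FA)) 𝓘(ℝ, ℝ) ∞ (fun v : TotalSpace FA A => κ i v.1 v.2)) ∧
    (∀ᶠ x in 𝓝 y, ψ x = 1) ∧ ∀ (x : M) (v : A x), ψ x • v = ∑ i, κ i x v • s i x := by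
  obtain ⟨n, s, κ, hκ, hs⟩ := exists_frame IM FA A y
  obtain ⟨ψ, h1, h2⟩ := exists_bump (IM := IM) hs
  refine ⟨n, fun i => fsmul ψ (s i), κ, ψ, hκ, h1, fun x v => ?_⟩
  by_cases hx : x ∈ tsupport ψ
  · have := h2 hx v
    conv_lhs => rw [this]
    simp [Finset.smul_sum, smul_comm (ψ x)]
  · simp [image_eq_zero_of_notMem_tsupport hx]

lemma dirDeriv_bump {ψ : C^∞⟮IM, M; ℝ⟯} {y : M} (h : ∀ᶠ x in 𝓝 y, ψ x = 1)
    (v : TangentSpace IM y) : dirDeriv IM ψ y v = 0 := by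
  have : ψ =ᶠ[𝓝 y] fun _ => (1 : ℝ) := h
  rw [dirDeriv_congr this]; exact dirDeriv_const 1 y v

/-- The anchor preserves brackets. -/
lemma LieAlgebroid.anchor_bracket (a b : Cₛ^∞⟮IM; FA, A⟯) (f : C^∞⟮IM, M; ℝ⟯) (m : M) :
    dirDeriv IM f m (LA.anchor m (LA.bracket a b m)) =
      LA.act a (LA.act b f) m - LA.act b (LA.act a f) m := by
  obtain ⟨n, s, κ, -, hs⟩ := exists_frame IM FA A m
  have hs := hs.self_of_nhds
  by_cases hc : ∃ c : Cₛ^∞⟮IM; FA, A⟯, c m ≠ 0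
  · obtain ⟨c, hc⟩ := hc
    have h1 := congrArg (fun σ : Cₛ^∞⟮IM; FA, A⟯ => σ m) (LA.jacobi a b (fsmul f c))
    have h2 := congrArg (fun σ : Cₛ^∞⟮IM; FA, A⟯ => σ m) (LA.jacobi a b c)
    simp only [LA.bracket_fsmul, map_add, ContMDiffSection.coe_add, Pi.add_apply, fsmul_apply]
      at h1 h2
    change _ = _ + LA.act (LA.bracket a b) f m • c m + _ at h1
    rw [h2] at h1
    have h3 : (LA.act (LA.bracket a b) f m - (LA.act a (LA.act b f) m - LA.act b (LA.act a f) m))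
        • c m = 0 := by
      have h4 := sub_eq_zero.2 h1
      rw [← neg_eq_zero, ← h4]
      module
    rcases smul_eq_zero.1 h3 with h | h
    · exact sub_eq_zero.1 h
    · exact absurd h hc
  · push Not at hc
    have h0 : ∀ v : A m, v = 0 := fun v => by rw [hs v]; simp [hc]
    have h5 : ∀ (a : Cₛ^∞⟮IM; FA, A⟯) g, LA.act a g m = 0 := fun a g => by
      change dirDeriv IM g m (LA.anchor m (a m)) = 0
      rw [h0 (a m)]; simp
    rw [h5, h5, h0 (LA.bracket a b m)]; simp

end AlgebroidLemmas

section TimeDeriv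
variable {EM M : Type*} [NormedAddCommGroup EM] [NormedSpace ℝ EM]
  [TopologicalSpace M] [ChartedSpace EM M] [IsManifold 𝓘(ℝ, EM) ∞ M]
  {J : TopologicalSpace.Opens ℝ}
  {FA : Type*} [NormedAddCommGroup FA] [NormedSpace ℝ FA]
  {A : M → Type*} [TopologicalSpace (TotalSpace FA A)] [∀ x, AddCommGroup (A x)]
  [∀ x, Module ℝ (A x)] [∀ x, TopologicalSpace (A x)] [FiberBundle FA A] [VectorBundle ℝ FA A]

variable (FA) in
/-- The velocity `c'(t) ∈ A_m` of a curve `c : J → A_m`. -/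
def timeDeriv {m : M} (c : J → A m) (t : J) : A m :=
  let L := (trivializationAt FA A m).continuousLinearEquivAt ℝ m
    (mem_baseSet_trivializationAt FA A m)
  L.symm (mfderiv 𝓘(ℝ, ℝ) 𝓘(ℝ, FA) (fun τ => L (c τ)) t (ddt t))

lemma timeDeriv_eq_sum {m : M} {c : J → A m} {t : J} {ι : Type} [Fintype ι]
    {f : ι → J → ℝ} {w : ι → A m} (hf : ∀ i, MDifferentiableAt 𝓘(ℝ, ℝ) 𝓘(ℝ, ℝ) (f i) t)
    (hc : ∀ τ, c τ = ∑ i, f i τ • w i) :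
    timeDeriv FA c t = ∑ i, dirDeriv 𝓘(ℝ, ℝ) (f i) t (ddt t) • w i := by
  unfold timeDeriv
  set L := (trivializationAt FA A m).continuousLinearEquivAt ℝ m
    (mem_baseSet_trivializationAt FA A m)
  have h0 : (fun τ => L (c τ)) = ∑ i, fun τ => f i τ • L (w i) := by
    funext τ; simp [hc]
  obtain ⟨g, hg⟩ : ∃ g : ι → (ℝ →L[ℝ] ℝ), ∀ i, HasMFDerivAt 𝓘(ℝ, ℝ) 𝓘(ℝ, ℝ) (f i) t (g i) ∧
      dirDeriv 𝓘(ℝ, ℝ) (f i) t (ddt t) = g i 1 :=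
    ⟨fun i => mfderiv 𝓘(ℝ, ℝ) 𝓘(ℝ, ℝ) (f i) t, fun i => ⟨(hf i).hasMFDerivAt, rfl⟩⟩
  have h1 : HasMFDerivAt 𝓘(ℝ, ℝ) 𝓘(ℝ, FA) (fun τ => L (c τ)) t
      (∑ i, (ContinuousLinearMap.toSpanSingleton ℝ (L (w i))).comp (g i) : ℝ →L[ℝ] FA) := by
    rw [h0]
    refine HasMFDerivAt.sum (I := 𝓘(ℝ, ℝ)) (E' := FA)
      (f := fun i (τ : J) => f i τ • L (w i)) fun i _ => ?_
    exact (ContinuousLinearMap.toSpanSingleton ℝ (L (w i))).hasMFDerivAt.comp t (hg i).1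
  have h2 : (∑ i, (ContinuousLinearMap.toSpanSingleton ℝ (L (w i))).comp (g i) : ℝ →L[ℝ] FA) 1 =
      ∑ i, g i 1 • L (w i) := by
    simp
  refine (congrArg L.symm ((congrArg (fun D : ℝ →L[ℝ] FA => D 1) h1.mfderiv).trans h2)).trans ?_
  simp [fun i => (hg i).2]

variable (J FA A) in
/-- The pullback of `A → M` along the projection `J × M → M`. -/
abbrev SndPullback : J × M → Type _ :=
  (ContMDiffMap.snd : C^∞⟮𝓘(ℝ, ℝ).prod 𝓘(ℝ, EM), J × M; 𝓘(ℝ, EM), M⟯) *ᵖ A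

end TimeDeriv

section Curves
variable {M : Type*} [TopologicalSpace M] {J : TopologicalSpace.Opens ℝ}
  {FA : Type*} [NormedAddCommGroup FA] [NormedSpace ℝ FA]
  {A : M → Type*} [TopologicalSpace (TotalSpace FA A)] [∀ x, AddCommGroup (A x)]
  [∀ x, Module ℝ (A x)] [∀ x, TopologicalSpace (A x)] [FiberBundle FA A] [VectorBundle ℝ FA A]

/-- Curves in a fibre which are combinations of vectors with coefficients differentiable at `t`. -/
def IsCurve {m : M} (c : J → A m) (t : J) : Prop :=
  ∃ (n : ℕ) (f : Fin n → J → ℝ) (w : Fin n → A m),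
    (∀ i, MDifferentiableAt 𝓘(ℝ, ℝ) 𝓘(ℝ, ℝ) (f i) t) ∧ ∀ τ, c τ = ∑ i, f i τ • w i

variable {m : M} {c c' : J → A m} {t : J}

lemma timeDeriv_add (h : IsCurve c t) (h' : IsCurve c' t) :
    timeDeriv FA (fun τ => c τ + c' τ) t = timeDeriv FA c t + timeDeriv FA c' t := by
  obtain ⟨n, f, w, hf, hc⟩ := h
  obtain ⟨n', f', w', hf', hc'⟩ := h'
  rw [timeDeriv_eq_sum hf hc, timeDeriv_eq_sum hf' hc',
    timeDeriv_eq_sum (ι := Fin n ⊕ Fin n') (f := Sum.elim f f') (w := Sum.elim w w')]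
  · simp
  · rintro (i | i)
    exacts [hf i, hf' i]
  · intro τ
    simp [hc, hc']

lemma timeDeriv_smul {h : J → ℝ} (hh : MDifferentiableAt 𝓘(ℝ, ℝ) 𝓘(ℝ, ℝ) h t) (hc : IsCurve c t) :
    timeDeriv FA (fun τ => h τ • c τ) t =
      h t • timeDeriv FA c t + dirDeriv 𝓘(ℝ, ℝ) h t (ddt t) • c t := by
  obtain ⟨n, f, w, hf, hc⟩ := hc
  rw [timeDeriv_eq_sum hf hc, timeDeriv_eq_sum (ι := Fin n) (f := fun i τ => h τ * f i τ) (w := w)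
    (fun i => hh.mul (hf i)) (fun τ => by simp [hc, Finset.smul_sum, mul_smul]), hc]
  simp only [Finset.smul_sum, ← Finset.sum_add_distrib]
  refine Finset.sum_congr rfl fun i _ => ?_
  rw [dirDeriv_mul hh (hf i)]
  module

lemma timeDeriv_const (w : A m) : timeDeriv FA (fun _ : J => w) t = 0 := by
  rw [timeDeriv_eq_sum (ι := Fin 1) (f := fun _ _ => (1 : ℝ)) (w := fun _ => w)
    (fun _ => mdifferentiableAt_const) (fun τ => by simp)]
  simp [dirDeriv_const]

lemma dirDeriv_apply {Q : J → A m →ₗ[ℝ] ℝ}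
    (hQ : ∀ w, MDifferentiableAt 𝓘(ℝ, ℝ) 𝓘(ℝ, ℝ) (fun τ => Q τ w) t) (hc : IsCurve c t) :
    dirDeriv 𝓘(ℝ, ℝ) (fun τ => Q τ (c τ)) t (ddt t) =
      Q t (timeDeriv FA c t) + dirDeriv 𝓘(ℝ, ℝ) (fun τ => Q τ (c t)) t (ddt t) := by
  obtain ⟨n, f, w, hf, hc⟩ := hc
  rw [timeDeriv_eq_sum hf hc]
  simp only [hc, map_sum, map_smul, smul_eq_mul]
  rw [dirDeriv_sum (f := fun i τ => f i τ * Q τ (w i)) _ fun i _ => (hf i).mul (hQ (w i)),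
    dirDeriv_sum (f := fun i τ => f i t * Q τ (w i)) _
      fun i _ => mdifferentiableAt_const.mul (hQ (w i)),
    ← Finset.sum_add_distrib]
  refine Finset.sum_congr rfl fun i _ => ?_
  rw [dirDeriv_mul (hf i) (hQ (w i)), dirDeriv_mul mdifferentiableAt_const (hQ (w i)),
    dirDeriv_const]
  ring

end Curves

section Sections
variable {EM M : Type*} [NormedAddCommGroup EM] [NormedSpace ℝ EM]
  [TopologicalSpace M] [ChartedSpace EM M] [IsManifold 𝓘(ℝ, EM) ∞ M]
  {J : TopologicalSpace.Opens ℝ}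
  {FA : Type*} [NormedAddCommGroup FA] [NormedSpace ℝ FA]
  {A : M → Type*} [TopologicalSpace (TotalSpace FA A)] [∀ x, AddCommGroup (A x)]
  [∀ x, Module ℝ (A x)] [∀ x, TopologicalSpace (A x)] [FiberBundle FA A] [VectorBundle ℝ FA A]

/-- Sections over `J × M` of the pullback of `A → M`, i.e. time-dependent sections of `A`. -/
abbrev TSec (EM : Type*) {M : Type*} [NormedAddCommGroup EM] [NormedSpace ℝ EM]
    [TopologicalSpace M] [ChartedSpace EM M] (J : TopologicalSpace.Opens ℝ)
    (FA : Type*) [NormedAddCommGroup FA] [NormedSpace ℝ FA]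
    (A : M → Type*) [TopologicalSpace (TotalSpace FA A)] [∀ x, AddCommGroup (A x)]
    [∀ x, Module ℝ (A x)] [∀ x, TopologicalSpace (A x)] [FiberBundle FA A] [VectorBundle ℝ FA A] :=
  Cₛ^∞⟮𝓘(ℝ, ℝ).prod 𝓘(ℝ, EM); FA, SndPullback (EM := EM) J A⟯

/-- The section `a(t, ·)` of `A`. -/
def sliceSection (a : TSec EM J FA A) (t : J) : Cₛ^∞⟮𝓘(ℝ, EM); FA, A⟯ :=
  ⟨fun m => a (t, m), (contMDiff_pullback_section.1 a.contMDiff).comp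
    (contMDiff_const.prodMk contMDiff_id)⟩

/-- Time-independent sections. -/
def constSection (J : TopologicalSpace.Opens ℝ) (s : Cₛ^∞⟮𝓘(ℝ, EM); FA, A⟯) : TSec EM J FA A :=
  pullbackSection ContMDiffMap.snd s

variable (LA : LieAlgebroid 𝓘(ℝ, EM) FA A)

/-- The derivative of a time-dependent function along a time-dependent section. -/
def tAct (a : TSec EM J FA A) (u : C^∞⟮𝓘(ℝ, ℝ).prod 𝓘(ℝ, EM), J × M; ℝ⟯) :
    C^∞⟮𝓘(ℝ, ℝ).prod 𝓘(ℝ, EM), J × M; ℝ⟯ :=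
  ⟨fun p => dirDeriv 𝓘(ℝ, EM) (sliceFun u p.1) p.2 (LA.anchor p.2 (a p)), by
    have h := contMDiff_dirDeriv u (contMDiff_tangent_prod (J := J) (M := M)
      (IP := 𝓘(ℝ, ℝ).prod 𝓘(ℝ, EM)) contMDiff_fst (contMDiff_const (c := (0 : ℝ)))
      (LA.contMDiff_anchor.comp (contMDiff_pullback_section.1 a.contMDiff)))
    refine h.congr fun p => ?_
    exact ((dirDeriv_prod u p.1 p.2 0 _).trans (by simp; rfl)).symm⟩

lemma sliceFun_tAct (a : TSec EM J FA A) (u : C^∞⟮𝓘(ℝ, ℝ).prod 𝓘(ℝ, EM), J × M; ℝ⟯) (t : J) :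
    sliceFun (tAct LA a u) t = LA.act (sliceSection a t) (sliceFun u t) := rfl

lemma timeDerivFun_mul (u v : C^∞⟮𝓘(ℝ, ℝ).prod 𝓘(ℝ, EM), J × M; ℝ⟯) :
    timeDerivFun (u * v) = u * timeDerivFun v + v * timeDerivFun u := by
  ext p
  have h : ∀ u : C^∞⟮𝓘(ℝ, ℝ).prod 𝓘(ℝ, EM), J × M; ℝ⟯,
    MDifferentiableAt 𝓘(ℝ, ℝ) 𝓘(ℝ, ℝ) (fun τ : J => u (τ, p.2)) p.1 := fun u =>
    (u.contMDiff.comp (contMDiff_id.prodMk contMDiff_const)).mdifferentiableAt (by simp)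
  exact dirDeriv_mul (h u) (h v) _

lemma timeDerivFun_sub (u v : C^∞⟮𝓘(ℝ, ℝ).prod 𝓘(ℝ, EM), J × M; ℝ⟯) :
    timeDerivFun (u - v) = timeDerivFun u - timeDerivFun v := by
  ext p
  have h : ∀ u : C^∞⟮𝓘(ℝ, ℝ).prod 𝓘(ℝ, EM), J × M; ℝ⟯,
    MDifferentiableAt 𝓘(ℝ, ℝ) 𝓘(ℝ, ℝ) (fun τ : J => u (τ, p.2)) p.1 := fun u =>
    (u.contMDiff.comp (contMDiff_id.prodMk contMDiff_const)).mdifferentiableAt (by simp)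
  exact dirDeriv_sub (h u) (h v) _

lemma timeDerivFun_add (u v : C^∞⟮𝓘(ℝ, ℝ).prod 𝓘(ℝ, EM), J × M; ℝ⟯) :
    timeDerivFun (u + v) = timeDerivFun u + timeDerivFun v := by
  ext p
  have h : ∀ u : C^∞⟮𝓘(ℝ, ℝ).prod 𝓘(ℝ, EM), J × M; ℝ⟯,
    MDifferentiableAt 𝓘(ℝ, ℝ) 𝓘(ℝ, ℝ) (fun τ : J => u (τ, p.2)) p.1 := fun u =>
    (u.contMDiff.comp (contMDiff_id.prodMk contMDiff_const)).mdifferentiableAt (by simp)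
  exact dirDeriv_add (h u) (h v) _

lemma tAct_mul (a : TSec EM J FA A) (u v : C^∞⟮𝓘(ℝ, ℝ).prod 𝓘(ℝ, EM), J × M; ℝ⟯) :
    tAct LA a (u * v) = u * tAct LA a v + v * tAct LA a u := by
  ext p
  exact dirDeriv_mul (contMDiff_toFunction (sliceFun u p.1) p.2)
    (contMDiff_toFunction (sliceFun v p.1) p.2) _

lemma tAct_add (a : TSec EM J FA A) (u v : C^∞⟮𝓘(ℝ, ℝ).prod 𝓘(ℝ, EM), J × M; ℝ⟯) :
    tAct LA a (u + v) = tAct LA a u + tAct LA a v := by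
  ext p
  exact dirDeriv_add (contMDiff_toFunction (sliceFun u p.1) p.2)
    (contMDiff_toFunction (sliceFun v p.1) p.2) _

lemma tAct_sub (a : TSec EM J FA A) (u v : C^∞⟮𝓘(ℝ, ℝ).prod 𝓘(ℝ, EM), J × M; ℝ⟯) :
    tAct LA a (u - v) = tAct LA a u - tAct LA a v := by
  ext p
  exact dirDeriv_sub (contMDiff_toFunction (sliceFun u p.1) p.2)
    (contMDiff_toFunction (sliceFun v p.1) p.2) _

variable [FiniteDimensional ℝ EM] [T2Space M] [ContMDiffVectorBundle ∞ FA A 𝓘(ℝ, EM)]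
  [FiniteDimensional ℝ FA]

lemma exists_tframe (m₀ : M) : ∃ (n : ℕ) (s : Fin n → Cₛ^∞⟮𝓘(ℝ, EM); FA, A⟯)
    (ψ : C^∞⟮𝓘(ℝ, EM), M; ℝ⟯)
    (u : Fin n → TSec EM J FA A → C^∞⟮𝓘(ℝ, ℝ).prod 𝓘(ℝ, EM), J × M; ℝ⟯),
    (∀ᶠ x in 𝓝 m₀, ψ x = 1) ∧
      ∀ (a : TSec EM J FA A) (t : J) (x : M), ψ x • sliceSection a t x = ∑ i, u i a (t, x) • s i x := by
  obtain ⟨n, s, κ, ψ, hκ, h1, h⟩ := exists_bump_frame 𝓘(ℝ, EM) FA A m₀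
  exact ⟨n, s, ψ, fun i a => ⟨fun p => κ i p.2 (a p),
    (hκ i).comp (contMDiff_pullback_section.1 a.contMDiff)⟩, h1, fun a t x => h x _⟩

lemma isCurve_section (a : TSec EM J FA A) (t : J) (m : M) :
    IsCurve (fun τ => sliceSection a τ m) t := by
  obtain ⟨n, s, ψ, u, h1, h⟩ := exists_tframe (EM := EM) (J := J) (FA := FA) (A := A) m
  refine ⟨n, fun i τ => u i a (τ, m), fun i => s i m, fun i =>
    ((u i a).contMDiff.comp (contMDiff_id.prodMk contMDiff_const)).mdifferentiableAt (by simp),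
    fun τ => ?_⟩
  rw [← h a τ m, h1.self_of_nhds, one_smul]

lemma contMDiff_timeDeriv (a : TSec EM J FA A) :
    ContMDiff (𝓘(ℝ, ℝ).prod 𝓘(ℝ, EM)) (𝓘(ℝ, EM).prod 𝓘(ℝ, FA)) ∞ (fun p : J × M =>
      (⟨p.2, timeDeriv FA (fun τ => sliceSection a τ p.2) p.1⟩ : TotalSpace FA A)) := by
  rintro ⟨t₀, m₀⟩
  obtain ⟨n, s, ψ, u, h1, h⟩ := exists_tframe (EM := EM) (J := J) (FA := FA) (A := A) m₀
  let S : TSec EM J FA A := ∑ i, fsmul (timeDerivFun (u i a)) (constSection J (s i))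
  refine ((contMDiff_pullback_section.1 S.contMDiff) (t₀, m₀)).congr_of_eventuallyEq ?_
  filter_upwards [continuousAt_snd.eventually h1] with p hp
  have h2 : ∀ τ, sliceSection a τ p.2 = ∑ i, u i a (τ, p.2) • s i p.2 := fun τ => by
    rw [← h, hp, one_smul]
  have h3 := timeDeriv_eq_sum (FA := FA) (t := p.1) (fun i =>
    ((u i a).contMDiff.comp (contMDiff_id.prodMk contMDiff_const)).mdifferentiableAt (by simp)) h2
  rw [h3]
  congr 1
  simp only [S, section_sum_apply]
  rfl

/-- The time derivative `∂a/∂t` of a time-dependent section. -/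
def tDeriv : TSec EM J FA A →ₗ[ℝ] TSec EM J FA A where
  toFun a := ⟨fun p => (timeDeriv FA (fun τ => sliceSection a τ p.2) p.1 : A p.2),
    (contMDiff_pullback_section (φ := ContMDiffMap.snd) (A := A)).2 (contMDiff_timeDeriv a)⟩
  map_add' a b := by
    ext p
    exact timeDeriv_add (FA := FA) (isCurve_section a p.1 p.2) (isCurve_section b p.1 p.2)
  map_smul' r a := by
    ext p
    have := timeDeriv_smul (FA := FA) (mdifferentiableAt_const (c := r)) (isCurve_section a p.1 p.2)
    refine this.trans ?_
    rw [dirDeriv_const]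
    simp
    rfl

lemma tDeriv_fsmul (u : C^∞⟮𝓘(ℝ, ℝ).prod 𝓘(ℝ, EM), J × M; ℝ⟯) (a : TSec EM J FA A) :
    tDeriv (fsmul u a) = fsmul u (tDeriv a) + fsmul (timeDerivFun u) a := by
  ext p
  have h : MDifferentiableAt 𝓘(ℝ, ℝ) 𝓘(ℝ, ℝ) (fun τ : J => u (τ, p.2)) p.1 :=
    (u.contMDiff.comp (contMDiff_id.prodMk contMDiff_const)).mdifferentiableAt (by simp)
  exact timeDeriv_smul (FA := FA) h (isCurve_section a p.1 p.2)

lemma tDeriv_const (s : Cₛ^∞⟮𝓘(ℝ, EM); FA, A⟯) : tDeriv (constSection J s) = 0 := by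
  ext p
  exact timeDeriv_const (FA := FA) (s p.2)

lemma timeDerivFun_tAct (a : TSec EM J FA A) (u : C^∞⟮𝓘(ℝ, ℝ).prod 𝓘(ℝ, EM), J × M; ℝ⟯) :
    timeDerivFun (tAct LA a u) = tAct LA (tDeriv a) u + tAct LA a (timeDerivFun u) := by
  ext p
  have h := dirDeriv_apply (FA := FA) (t := p.1)
    (Q := fun τ => (dirDeriv 𝓘(ℝ, EM) (sliceFun u τ) p.2) ∘ₗ (LA.anchor p.2))
    (fun w => (timeDeriv_comm u p.1 p.2 (LA.anchor p.2 w)).1) (isCurve_section a p.1 p.2)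
  refine h.trans ?_
  have h2 := (timeDeriv_comm u p.1 p.2 (LA.anchor p.2 (sliceSection a p.1 p.2))).2
  exact congrArg (_ + ·) h2

lemma contMDiff_tBracket (a b : TSec EM J FA A) :
    ContMDiff (𝓘(ℝ, ℝ).prod 𝓘(ℝ, EM)) (𝓘(ℝ, EM).prod 𝓘(ℝ, FA)) ∞ (fun p : J × M =>
      (⟨p.2, LA.bracket (sliceSection a p.1) (sliceSection b p.1) p.2⟩ : TotalSpace FA A)) := by
  rintro ⟨t₀, m₀⟩
  obtain ⟨n, s, ψ, u, h1, h⟩ := exists_tframe (EM := EM) (J := J) (FA := FA) (A := A) m₀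
  let S : TSec EM J FA A := ∑ i, (fsmul (u i a) (∑ j, (fsmul (u j b)
    (constSection J (LA.bracket (s i) (s j))) + fsmul (tAct LA (constSection J (s i)) (u j b))
      (constSection J (s j)))) - fsmul (tAct LA b (u i a)) (constSection J (s i)))
  refine ((contMDiff_pullback_section.1 S.contMDiff) (t₀, m₀)).congr_of_eventuallyEq ?_
  filter_upwards [continuousAt_snd.eventually h1.eventually_nhds] with p hp
  have hps := hp.self_of_nhds
  have hd := fun v => dirDeriv_bump hp v
  have e : ∀ a : TSec EM J FA A, fsmul ψ (sliceSection a p.1) =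
      ∑ i, fsmul (sliceFun (u i a) p.1) (s i) := fun a => by
    ext x
    rw [section_sum_apply]
    exact h a p.1 x
  have h2 : LA.bracket (sliceSection a p.1) (sliceSection b p.1) p.2 =
      LA.bracket (fsmul ψ (sliceSection a p.1)) (fsmul ψ (sliceSection b p.1)) p.2 := by
    rw [LA.leibniz_left, LA.leibniz, hd, hd, hps]
    simp
  have h4 : fsmul ψ (sliceSection b p.1) p.2 = sliceSection b p.1 p.2 := by
    rw [fsmul_apply, hps, one_smul]
  have h5 : LA.bracket (sliceSection a p.1) (sliceSection b p.1) p.2 =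
      ∑ i, (u i a p • ∑ j, (u j b p • LA.bracket (s i) (s j) p.2
        + dirDeriv 𝓘(ℝ, EM) (sliceFun (u j b) p.1) p.2 (LA.anchor p.2 (s i p.2)) • s j p.2)
        - dirDeriv 𝓘(ℝ, EM) (sliceFun (u i a) p.1) p.2
          (LA.anchor p.2 (sliceSection b p.1 p.2)) • s i p.2) := by
    rw [h2, e a, map_sum, LinearMap.sum_apply, section_sum_apply]
    refine Finset.sum_congr rfl fun i _ => ?_
    rw [LA.leibniz_left, h4, e b, map_sum, section_sum_apply]
    simp only [LA.leibniz]
    rfl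
  rw [h5]
  have h6 : S p = ∑ i, ((fsmul (u i a) (∑ j, (fsmul (u j b)
    (constSection J (LA.bracket (s i) (s j))) + fsmul (tAct LA (constSection J (s i)) (u j b))
      (constSection J (s j)))) p) - (fsmul (tAct LA b (u i a)) (constSection J (s i))) p) := by
    simp only [S, section_sum_apply]
    rfl
  simp only [fsmul_apply, section_sum_apply] at h6
  exact congrArg (TotalSpace.mk' FA p.2) h6.symm

/-- The bracket of time-dependent sections: `[a, b](t, ·) = [a(t, ·), b(t, ·)]`. -/
def tBracket : TSec EM J FA A →ₗ[ℝ] TSec EM J FA A →ₗ[ℝ] TSec EM J FA A :=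
  LinearMap.mk₂ ℝ (fun a b => ⟨fun p => LA.bracket (sliceSection a p.1) (sliceSection b p.1) p.2,
    (contMDiff_pullback_section (φ := ContMDiffMap.snd) (A := A)).2 (contMDiff_tBracket LA a b)⟩)
    (fun a a' b => by
      ext p
      have : sliceSection (a + a') p.1 = sliceSection a p.1 + sliceSection a' p.1 := rfl
      change LA.bracket (sliceSection (a + a') p.1) (sliceSection b p.1) p.2 = _
      rw [this, map_add]; rfl)
    (fun r a b => by
      ext p
      have : sliceSection (r • a) p.1 = r • sliceSection a p.1 := rfl
      change LA.bracket (sliceSection (r • a) p.1) (sliceSection b p.1) p.2 = _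
      rw [this, map_smul]; rfl)
    (fun a b b' => by
      ext p
      have : sliceSection (b + b') p.1 = sliceSection b p.1 + sliceSection b' p.1 := rfl
      change LA.bracket (sliceSection a p.1) (sliceSection (b + b') p.1) p.2 = _
      rw [this, map_add]; rfl)
    (fun r a b => by
      ext p
      have : sliceSection (r • b) p.1 = r • sliceSection b p.1 := rfl
      change LA.bracket (sliceSection a p.1) (sliceSection (r • b) p.1) p.2 = _
      rw [this, map_smul]; rfl)

lemma slice_tBracket (a b : TSec EM J FA A) (t : J) : sliceSection (tBracket LA a b) t =
    LA.bracket (sliceSection a t) (sliceSection b t) := rfl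

lemma tBracket_self (a : TSec EM J FA A) : tBracket LA a a = 0 := by
  ext p
  exact congrArg (fun s : Cₛ^∞⟮𝓘(ℝ, EM); FA, A⟯ => s p.2) (LA.bracket_self (sliceSection a p.1))

lemma tBracket_symm (a b : TSec EM J FA A) : tBracket LA a b = - tBracket LA b a := by
  ext p
  exact congrArg (fun s : Cₛ^∞⟮𝓘(ℝ, EM); FA, A⟯ => s p.2) (LA.bracket_symm _ _)

lemma tBracket_jacobi (a b c : TSec EM J FA A) : tBracket LA a (tBracket LA b c) =
    tBracket LA (tBracket LA a b) c + tBracket LA b (tBracket LA a c) := by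
  ext p
  exact congrArg (fun s : Cₛ^∞⟮𝓘(ℝ, EM); FA, A⟯ => s p.2)
    (LA.jacobi (sliceSection a p.1) (sliceSection b p.1) (sliceSection c p.1))

lemma tBracket_fsmul (a b : TSec EM J FA A) (u : C^∞⟮𝓘(ℝ, ℝ).prod 𝓘(ℝ, EM), J × M; ℝ⟯) :
    tBracket LA a (fsmul u b) = fsmul u (tBracket LA a b) + fsmul (tAct LA a u) b := by
  ext p
  exact LA.leibniz (sliceSection a p.1) (sliceSection b p.1) (sliceFun u p.1) p.2

lemma tAct_bracket (a b : TSec EM J FA A) (u : C^∞⟮𝓘(ℝ, ℝ).prod 𝓘(ℝ, EM), J × M; ℝ⟯) :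
    tAct LA (tBracket LA a b) u = tAct LA a (tAct LA b u) - tAct LA b (tAct LA a u) := by
  ext p
  exact LA.anchor_bracket (sliceSection a p.1) (sliceSection b p.1) (sliceFun u p.1) p.2

lemma tDeriv_tBracket (a b : TSec EM J FA A) : tDeriv (tBracket LA a b) =
    tBracket LA (tDeriv a) b + tBracket LA a (tDeriv b) := by
  let P : TSec EM J FA A → TSec EM J FA A → TSec EM J FA A := fun a b =>
    tDeriv (tBracket LA a b) - tBracket LA (tDeriv a) b - tBracket LA a (tDeriv b)
  have hP2 : ∀ u a b, P a (fsmul u b) = fsmul u (P a b) := by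
    intro u a b
    simp only [P, tDeriv_fsmul, tBracket_fsmul, map_add, timeDerivFun_tAct]
    ext p
    simp only [ContMDiffSection.coe_sub, Pi.sub_apply, fsmul_apply,
      ContMDiffSection.coe_add, Pi.add_apply, ContMDiffMap.coe_add]
    module
  have hPs : ∀ a b, P a b = - P b a := by
    intro a b
    simp only [P]
    rw [tBracket_symm LA a b, tBracket_symm LA (tDeriv a) b, tBracket_symm LA a (tDeriv b), map_neg]
    abel
  have hP1 : ∀ u a b, P (fsmul u a) b = fsmul u (P a b) := by
    intro u a b
    rw [hPs, hP2, hPs a b]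
    ext p
    simp
  have hsum2 : ∀ {n : ℕ} a (b : Fin n → TSec EM J FA A), P a (∑ i, b i) = ∑ i, P a (b i) := by
    intro n a b
    simp only [P, map_sum, Finset.sum_sub_distrib]
  have hsum1 : ∀ {n : ℕ} b (a : Fin n → TSec EM J FA A), P (∑ i, a i) b = ∑ i, P (a i) b := by
    intro n b a
    simp only [P, map_sum, LinearMap.sum_apply, Finset.sum_sub_distrib]
  have hP0 : ∀ s s', P (constSection J s) (constSection J s') = 0 := by
    intro s s'
    have : tBracket LA (constSection J s) (constSection J s') = constSection J (LA.bracket s s') := rfl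
    simp [P, this, tDeriv_const]
  suffices h : P a b = 0 by
    rw [← sub_eq_zero, ← h]; simp only [P]; abel
  ext p
  obtain ⟨n, s, ψ, u, h1, h⟩ := exists_tframe (EM := EM) (J := J) (FA := FA) (A := A) p.2
  let Ψ : C^∞⟮𝓘(ℝ, ℝ).prod 𝓘(ℝ, EM), J × M; ℝ⟯ := ⟨fun p => ψ p.2, ψ.contMDiff.comp contMDiff_snd⟩
  have e : ∀ a : TSec EM J FA A, fsmul Ψ a = ∑ i, fsmul (u i a) (constSection J (s i)) := fun a => by
    ext x
    rw [section_sum_apply]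
    exact h a x.1 x.2
  have h3 : fsmul Ψ (fsmul Ψ (P a b)) = 0 := by
    rw [← hP2, ← hP1, e a, e b, hsum1]
    simp only [hsum2, hP1, hP2, hP0]
    ext p
    simp [section_sum_apply]
  have h4 := congrArg (fun σ : TSec EM J FA A => σ p) h3
  have h5 : Ψ p = 1 := h1.self_of_nhds
  simpa [h5] using h4

end Sections

section Product
variable {EM M : Type*} [NormedAddCommGroup EM] [NormedSpace ℝ EM]
  [TopologicalSpace M] [ChartedSpace EM M] [IsManifold 𝓘(ℝ, EM) ∞ M]
  {J : TopologicalSpace.Opens ℝ}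
  {FA : Type*} [NormedAddCommGroup FA] [NormedSpace ℝ FA]
  {A : M → Type*} [TopologicalSpace (TotalSpace FA A)] [∀ x, AddCommGroup (A x)]
  [∀ x, Module ℝ (A x)] [∀ x, TopologicalSpace (A x)] [FiberBundle FA A] [VectorBundle ℝ FA A]

/-- The pullback of `TJ → J` along the projection `J × M → J`. -/
abbrev FstPullback (EM : Type*) (M : Type*) [NormedAddCommGroup EM] [NormedSpace ℝ EM]
    [TopologicalSpace M] [ChartedSpace EM M] (J : TopologicalSpace.Opens ℝ) : J × M → Type :=
  (ContMDiffMap.fst : C^∞⟮𝓘(ℝ, ℝ).prod 𝓘(ℝ, EM), J × M; 𝓘(ℝ, ℝ), J⟯) *ᵖ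
    (TangentSpace 𝓘(ℝ, ℝ) : J → Type)

/-- The vector bundle `TJ × A → J × M`; its fibre over `(t, m)` is `T_t J × A_m`. -/
abbrev TProd (EM : Type*) {M : Type*} [NormedAddCommGroup EM] [NormedSpace ℝ EM]
    [TopologicalSpace M] [ChartedSpace EM M] (J : TopologicalSpace.Opens ℝ) (A : M → Type*) :
    J × M → Type _ :=
  FstPullback EM M J ×ᵇ SndPullback (EM := EM) J A

/-- The sections of `TJ × A`. -/
abbrev PSec (EM : Type*) {M : Type*} [NormedAddCommGroup EM] [NormedSpace ℝ EM]
    [TopologicalSpace M] [ChartedSpace EM M] (J : TopologicalSpace.Opens ℝ)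
    (FA : Type*) [NormedAddCommGroup FA] [NormedSpace ℝ FA]
    (A : M → Type*) [TopologicalSpace (TotalSpace FA A)] [∀ x, AddCommGroup (A x)]
    [∀ x, Module ℝ (A x)] [∀ x, TopologicalSpace (A x)] [FiberBundle FA A] [VectorBundle ℝ FA A] :=
  Cₛ^∞⟮𝓘(ℝ, ℝ).prod 𝓘(ℝ, EM); ℝ × FA, TProd EM J A⟯

lemma contMDiff_fstPullback {r : J × M → ℝ} :
    ContMDiff (𝓘(ℝ, ℝ).prod 𝓘(ℝ, EM)) ((𝓘(ℝ, ℝ).prod 𝓘(ℝ, EM)).prod 𝓘(ℝ, ℝ)) ∞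
      (fun p => (⟨p, r p⟩ : TotalSpace ℝ (FstPullback EM M J))) ↔
      ContMDiff (𝓘(ℝ, ℝ).prod 𝓘(ℝ, EM)) 𝓘(ℝ, ℝ) ∞ r := by
  refine (contMDiff_pullback_section (φ := ContMDiffMap.fst)
    (A := (TangentSpace 𝓘(ℝ, ℝ) : J → Type))).trans ?_
  refine (contMDiff_tangent_opens (τ := Prod.fst) (r := r)).trans ?_
  exact ⟨fun h => h.2, fun h => ⟨contMDiff_fst, h⟩⟩

/-- The section `f ∂_t + a` of `TJ × A`. -/
def mkPSec (f : C^∞⟮𝓘(ℝ, ℝ).prod 𝓘(ℝ, EM), J × M; ℝ⟯) (a : TSec EM J FA A) : PSec EM J FA A :=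
  ⟨fun p => ((f p : ℝ), a p), (contMDiff_prod_bundle (V := FstPullback EM M J)
    (W := SndPullback (EM := EM) J A) (v := fun p => (f p : ℝ)) (w := fun p => a p)).2
    ⟨contMDiff_fstPullback.2 f.contMDiff, a.contMDiff⟩⟩

/-- The coefficient of `∂_t` in a section of `TJ × A`. -/
def PSec.coeff (X : PSec EM J FA A) : C^∞⟮𝓘(ℝ, ℝ).prod 𝓘(ℝ, EM), J × M; ℝ⟯ :=
  ⟨fun p => (X p).1, contMDiff_fstPullback.1 (contMDiff_prod_bundle.1 X.contMDiff).1⟩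

/-- The component along `A` of a section of `TJ × A`. -/
def PSec.part (X : PSec EM J FA A) : TSec EM J FA A :=
  ⟨fun p => (X p).2, (contMDiff_prod_bundle.1 X.contMDiff).2⟩

lemma PSec.ext' {X Y : PSec EM J FA A} (h1 : PSec.coeff X = PSec.coeff Y)
    (h2 : PSec.part X = PSec.part Y) : X = Y := by
  refine ContMDiffSection.ext fun p => ?_
  exact Prod.ext (congrArg (fun f : C^∞⟮𝓘(ℝ, ℝ).prod 𝓘(ℝ, EM), J × M; ℝ⟯ => f p) h1)
    (congrArg (fun a : TSec EM J FA A => a p) h2)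

lemma coeff_mk (f : C^∞⟮𝓘(ℝ, ℝ).prod 𝓘(ℝ, EM), J × M; ℝ⟯) (a : TSec EM J FA A) :
    PSec.coeff (mkPSec f a) = f := rfl

lemma part_mk (f : C^∞⟮𝓘(ℝ, ℝ).prod 𝓘(ℝ, EM), J × M; ℝ⟯) (a : TSec EM J FA A) :
    PSec.part (mkPSec f a) = a := rfl

lemma coeff_add (X Y : PSec EM J FA A) :
    PSec.coeff (X + Y) = PSec.coeff X + PSec.coeff Y := rfl

lemma part_add (X Y : PSec EM J FA A) :
    PSec.part (X + Y) = PSec.part X + PSec.part Y := rfl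

variable (LA : LieAlgebroid 𝓘(ℝ, EM) FA A)

/-- The derivative `X u` of a function `u` along (the anchor of) a section `X` of `TJ × A`. -/
def pAct (X : PSec EM J FA A) (u : C^∞⟮𝓘(ℝ, ℝ).prod 𝓘(ℝ, EM), J × M; ℝ⟯) :
    C^∞⟮𝓘(ℝ, ℝ).prod 𝓘(ℝ, EM), J × M; ℝ⟯ :=
  PSec.coeff X * timeDerivFun u + tAct LA (PSec.part X) u

/-- The anchor of `TJ × A`, `(v, a) ↦ (v, ρ(a))`. -/
def pAnchor (p : J × M) : TProd EM J A p →ₗ[ℝ] TangentSpace (𝓘(ℝ, ℝ).prod 𝓘(ℝ, EM)) p :=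
  LinearMap.prodMap (M := ℝ) (M₂ := A p.2) (M₃ := ℝ) (M₄ := EM) LinearMap.id (LA.anchor p.2)

lemma pAct_apply (X : PSec EM J FA A) (u : C^∞⟮𝓘(ℝ, ℝ).prod 𝓘(ℝ, EM), J × M; ℝ⟯) (p : J × M) :
    pAct LA X u p = dirDeriv (𝓘(ℝ, ℝ).prod 𝓘(ℝ, EM)) u p (pAnchor LA p (X p)) :=
  (dirDeriv_prod u p.1 p.2 _ _).symm

variable [FiniteDimensional ℝ EM] [T2Space M] [ContMDiffVectorBundle ∞ FA A 𝓘(ℝ, EM)]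
  [FiniteDimensional ℝ FA]

/-- The bracket of `TJ × A`:
`[f ∂_t + a, g ∂_t + b] = (X g - Y f) ∂_t + ([a, b] + f ∂_t b - g ∂_t a)`
for `X = f ∂_t + a`, `Y = g ∂_t + b`. -/
def pBracketFun (X Y : PSec EM J FA A) : PSec EM J FA A :=
  mkPSec (pAct LA X (PSec.coeff Y) - pAct LA Y (PSec.coeff X))
    (tBracket LA (PSec.part X) (PSec.part Y) + fsmul (PSec.coeff X) (tDeriv (PSec.part Y))
      - fsmul (PSec.coeff Y) (tDeriv (PSec.part X)))

lemma pBracketFun_symm (X Y : PSec EM J FA A) : pBracketFun LA X Y = - pBracketFun LA Y X := by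
  refine PSec.ext' ?_ ?_
  · change pAct LA X (PSec.coeff Y) - pAct LA Y (PSec.coeff X) =
      - (pAct LA Y (PSec.coeff X) - pAct LA X (PSec.coeff Y))
    ring
  · change tBracket LA (PSec.part X) (PSec.part Y) + fsmul (PSec.coeff X) (tDeriv (PSec.part Y))
      - fsmul (PSec.coeff Y) (tDeriv (PSec.part X)) =
      - (tBracket LA (PSec.part Y) (PSec.part X) + fsmul (PSec.coeff Y) (tDeriv (PSec.part X))
      - fsmul (PSec.coeff X) (tDeriv (PSec.part Y)))
    rw [tBracket_symm]
    abel

lemma tAct_add_left (a b : TSec EM J FA A) (u : C^∞⟮𝓘(ℝ, ℝ).prod 𝓘(ℝ, EM), J × M; ℝ⟯) :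
    tAct LA (a + b) u = tAct LA a u + tAct LA b u := by
  ext p
  change dirDeriv 𝓘(ℝ, EM) (sliceFun u p.1) p.2 (LA.anchor p.2
    (sliceSection a p.1 p.2 + sliceSection b p.1 p.2)) = _
  rw [map_add, map_add]; rfl

lemma tAct_sub_left (a b : TSec EM J FA A) (u : C^∞⟮𝓘(ℝ, ℝ).prod 𝓘(ℝ, EM), J × M; ℝ⟯) :
    tAct LA (a - b) u = tAct LA a u - tAct LA b u := by
  ext p
  change dirDeriv 𝓘(ℝ, EM) (sliceFun u p.1) p.2 (LA.anchor p.2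
    (sliceSection a p.1 p.2 - sliceSection b p.1 p.2)) = _
  rw [map_sub, map_sub]; rfl

lemma tAct_fsmul_left (f : C^∞⟮𝓘(ℝ, ℝ).prod 𝓘(ℝ, EM), J × M; ℝ⟯) (a : TSec EM J FA A)
    (u : C^∞⟮𝓘(ℝ, ℝ).prod 𝓘(ℝ, EM), J × M; ℝ⟯) :
    tAct LA (fsmul f a) u = f * tAct LA a u := by
  ext p
  change dirDeriv 𝓘(ℝ, EM) (sliceFun u p.1) p.2 (LA.anchor p.2
    (f p • sliceSection a p.1 p.2)) = _
  rw [map_smul, map_smul]; rfl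

lemma pBracketFun_add (X Y Z : PSec EM J FA A) :
    pBracketFun LA X (Y + Z) = pBracketFun LA X Y + pBracketFun LA X Z := by
  refine PSec.ext' ?_ ?_
  · simp only [coeff_add, pBracketFun, coeff_mk, pAct, part_add, timeDerivFun_add, tAct_add,
      tAct_add_left]
    ring
  · simp only [coeff_add, pBracketFun, part_mk, part_add, map_add]
    ext p
    simp only [ContMDiffSection.coe_sub, Pi.sub_apply, fsmul_apply,
      ContMDiffSection.coe_add, Pi.add_apply, ContMDiffMap.coe_add]
    module

lemma pBracketFun_leibniz (X Y : PSec EM J FA A)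
    (u : C^∞⟮𝓘(ℝ, ℝ).prod 𝓘(ℝ, EM), J × M; ℝ⟯) :
    pBracketFun LA X (fsmul u Y) = fsmul u (pBracketFun LA X Y) + fsmul (pAct LA X u) Y := by
  have h1 : PSec.coeff (fsmul u Y) = u * PSec.coeff Y := rfl
  have h2 : PSec.part (fsmul u Y) = fsmul u (PSec.part Y) := rfl
  refine PSec.ext' ?_ ?_
  · change _ = u * PSec.coeff (pBracketFun LA X Y) + pAct LA X u * PSec.coeff Y
    simp only [h1, h2, pBracketFun, coeff_mk, pAct, timeDerivFun_mul, tAct_mul, tAct_fsmul_left]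
    ring
  · change _ = fsmul u (PSec.part (pBracketFun LA X Y)) + fsmul (pAct LA X u) (PSec.part Y)
    simp only [h1, h2, pBracketFun, part_mk, pAct, tBracket_fsmul, tDeriv_fsmul]
    ext p
    simp only [ContMDiffSection.coe_sub, Pi.sub_apply, fsmul_apply,
      ContMDiffSection.coe_add, Pi.add_apply, ContMDiffMap.coe_add, ContMDiffMap.coe_mul,
      Pi.mul_apply]
    module

lemma pAct_bracket (X Y : PSec EM J FA A) (u : C^∞⟮𝓘(ℝ, ℝ).prod 𝓘(ℝ, EM), J × M; ℝ⟯) :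
    pAct LA (pBracketFun LA X Y) u = pAct LA X (pAct LA Y u) - pAct LA Y (pAct LA X u) := by
  simp only [pBracketFun, pAct, coeff_mk, part_mk, tAct_sub_left, tAct_add_left, tAct_fsmul_left,
    tAct_bracket, timeDerivFun_add, timeDerivFun_mul, timeDerivFun_tAct, tAct_add, tAct_mul]
  ring

lemma pAct_sub (X : PSec EM J FA A) (u v : C^∞⟮𝓘(ℝ, ℝ).prod 𝓘(ℝ, EM), J × M; ℝ⟯) :
    pAct LA X (u - v) = pAct LA X u - pAct LA X v := by
  simp only [pAct, timeDerivFun_sub, tAct_sub]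
  ring

lemma tBracket_fsmul_left (u : C^∞⟮𝓘(ℝ, ℝ).prod 𝓘(ℝ, EM), J × M; ℝ⟯) (a b : TSec EM J FA A) :
    tBracket LA (fsmul u a) b = fsmul u (tBracket LA a b) - fsmul (tAct LA b u) a := by
  rw [tBracket_symm, tBracket_fsmul, tBracket_symm LA a b]
  ext p
  simp only [ContMDiffSection.coe_sub, Pi.sub_apply, fsmul_apply,
    ContMDiffSection.coe_add, Pi.add_apply, ContMDiffSection.coe_neg, Pi.neg_apply]
  module

lemma jacobi_aux (f g h : C^∞⟮𝓘(ℝ, ℝ).prod 𝓘(ℝ, EM), J × M; ℝ⟯) (a b c : TSec EM J FA A) :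
    tBracket LA a (tBracket LA b c + fsmul g (tDeriv c) - fsmul h (tDeriv b))
      + fsmul f (tDeriv (tBracket LA b c + fsmul g (tDeriv c) - fsmul h (tDeriv b)))
      - fsmul (g * timeDerivFun h + tAct LA b h - (h * timeDerivFun g + tAct LA c g)) (tDeriv a) =
    tBracket LA (tBracket LA a b + fsmul f (tDeriv b) - fsmul g (tDeriv a)) c
      + fsmul (f * timeDerivFun g + tAct LA a g - (g * timeDerivFun f + tAct LA b f)) (tDeriv c)
      - fsmul h (tDeriv (tBracket LA a b + fsmul f (tDeriv b) - fsmul g (tDeriv a)))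
    + (tBracket LA b (tBracket LA a c + fsmul f (tDeriv c) - fsmul h (tDeriv a))
      + fsmul g (tDeriv (tBracket LA a c + fsmul f (tDeriv c) - fsmul h (tDeriv a)))
      - fsmul (f * timeDerivFun h + tAct LA a h - (h * timeDerivFun f + tAct LA c f)) (tDeriv b)) := by
  have e1 := tBracket_symm LA b (tDeriv a)
  simp only [map_add, map_sub, LinearMap.add_apply, LinearMap.sub_apply, tBracket_fsmul,
    tBracket_fsmul_left, tDeriv_fsmul, tDeriv_tBracket, tBracket_jacobi LA a b c, e1]
  ext p
  simp only [ContMDiffSection.coe_sub, Pi.sub_apply, fsmul_apply,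
    ContMDiffSection.coe_add, Pi.add_apply, ContMDiffMap.coe_add, ContMDiffMap.coe_mul,
    Pi.mul_apply, ContMDiffSection.coe_neg, Pi.neg_apply, ContMDiffMap.coe_sub]
  module

lemma pBracketFun_jacobi (X Y Z : PSec EM J FA A) :
    pBracketFun LA X (pBracketFun LA Y Z) =
      pBracketFun LA (pBracketFun LA X Y) Z + pBracketFun LA Y (pBracketFun LA X Z) := by
  have hc : ∀ X Y : PSec EM J FA A, PSec.coeff (pBracketFun LA X Y) =
    pAct LA X (PSec.coeff Y) - pAct LA Y (PSec.coeff X) := fun _ _ => rfl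
  have hp : ∀ X Y : PSec EM J FA A, PSec.part (pBracketFun LA X Y) =
    tBracket LA (PSec.part X) (PSec.part Y) + fsmul (PSec.coeff X) (tDeriv (PSec.part Y))
      - fsmul (PSec.coeff Y) (tDeriv (PSec.part X)) := fun _ _ => rfl
  refine PSec.ext' ?_ ?_
  · simp only [coeff_add, hc, pAct_bracket, pAct_sub]
    ring
  · simp only [part_add, hc, hp]
    exact jacobi_aux LA _ _ _ _ _ _

/-- The bracket of `TJ × A` as a bilinear map. -/
def pBracket : PSec EM J FA A →ₗ[ℝ] PSec EM J FA A →ₗ[ℝ] PSec EM J FA A :=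
  have h2 : ∀ (r : ℝ) X Y, pBracketFun LA X (r • Y) = r • pBracketFun LA X Y := by
    intro r X Y
    have h := pBracketFun_leibniz LA X Y (ContMDiffMap.const r)
    have h0 : pAct LA X (ContMDiffMap.const r) = 0 := by
      ext p
      rw [pAct_apply]
      exact dirDeriv_const r p _
    rw [h0] at h
    refine h.trans (ContMDiffSection.ext fun p => ?_)
    simp only [ContMDiffSection.coe_add, Pi.add_apply, fsmul_apply]
    change r • _ + (0 : ℝ) • _ = _
    rw [zero_smul, add_zero]
    rfl
  LinearMap.mk₂ ℝ (pBracketFun LA)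
    (fun X X' Y => by
      rw [pBracketFun_symm, pBracketFun_add, pBracketFun_symm LA X, pBracketFun_symm LA X']; abel)
    (fun r X Y => by rw [pBracketFun_symm, h2, pBracketFun_symm LA X, smul_neg])
    (pBracketFun_add LA)
    h2

variable (J) in
/-- The product Lie algebroid `TJ × A → J × M` of the tangent Lie algebroid of the interval `J`
and the Lie algebroid `A → M`. -/
def LieAlgebroid.intervalProd : LieAlgebroid (𝓘(ℝ, ℝ).prod 𝓘(ℝ, EM)) (ℝ × FA) (TProd EM J A) where
  anchor := pAnchor LA
  contMDiff_anchor := by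
    have h1 := (contMDiff_prod_bundle (V := FstPullback EM M J) (W := SndPullback (EM := EM) J A)
      (φ := fun v : TotalSpace (ℝ × FA) (TProd EM J A) => v.1) (v := fun v => v.2.1)
      (w := fun v => v.2.2)).1
      (contMDiff_id (I := (𝓘(ℝ, ℝ).prod 𝓘(ℝ, EM)).prod 𝓘(ℝ, ℝ × FA)))
    have h2 : ContMDiff ((𝓘(ℝ, ℝ).prod 𝓘(ℝ, EM)).prod 𝓘(ℝ, ℝ × FA)) (𝓘(ℝ, ℝ).prod 𝓘(ℝ, ℝ)) ∞
        (fun v : TotalSpace (ℝ × FA) (TProd EM J A) =>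
          (⟨v.1.1, v.2.1⟩ : TangentBundle 𝓘(ℝ, ℝ) J)) :=
      (contMDiff_pullback_lift (ContMDiffMap.fst : C^∞⟮𝓘(ℝ, ℝ).prod 𝓘(ℝ, EM), J × M; 𝓘(ℝ, ℝ), J⟯)
        (E := (TangentSpace 𝓘(ℝ, ℝ) : J → Type))).comp h1.1
    have h3 : ContMDiff ((𝓘(ℝ, ℝ).prod 𝓘(ℝ, EM)).prod 𝓘(ℝ, ℝ × FA)) (𝓘(ℝ, EM).prod 𝓘(ℝ, EM)) ∞
        (fun v : TotalSpace (ℝ × FA) (TProd EM J A) =>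
          (⟨v.1.2, LA.anchor v.1.2 v.2.2⟩ : TangentBundle 𝓘(ℝ, EM) M)) :=
      LA.contMDiff_anchor.comp ((contMDiff_pullback_lift
        (ContMDiffMap.snd : C^∞⟮𝓘(ℝ, ℝ).prod 𝓘(ℝ, EM), J × M; 𝓘(ℝ, EM), M⟯) (E := A)).comp h1.2)
    exact contMDiff_equivTangentBundleProd_symm.comp (h2.prodMk h3)
  bracket := pBracket LA
  bracket_self X := by
    have h := pBracketFun_symm LA X X
    have h' : (2 : ℝ) • pBracketFun LA X X = 0 := by
      rw [two_smul]; exact add_eq_zero_iff_eq_neg.2 h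
    exact (smul_eq_zero.1 h').resolve_left two_ne_zero
  jacobi := pBracketFun_jacobi LA
  leibniz X Y u p := by
    have h := congrArg (fun Z : PSec EM J FA A => Z p) (pBracketFun_leibniz LA X Y u)
    refine h.trans ?_
    rw [← pAct_apply]
    rfl

end Product

section Inclusion
variable {EM M : Type*} [NormedAddCommGroup EM] [NormedSpace ℝ EM]
  [TopologicalSpace M] [ChartedSpace EM M] [IsManifold 𝓘(ℝ, EM) ∞ M]
  {J : TopologicalSpace.Opens ℝ}
  {FA : Type*} [NormedAddCommGroup FA] [NormedSpace ℝ FA]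
  {A : M → Type*} [TopologicalSpace (TotalSpace FA A)] [∀ x, AddCommGroup (A x)]
  [∀ x, Module ℝ (A x)] [∀ x, TopologicalSpace (A x)] [FiberBundle FA A] [VectorBundle ℝ FA A]
  (LA : LieAlgebroid 𝓘(ℝ, EM) FA A)
  [FiniteDimensional ℝ EM] [T2Space M] [ContMDiffVectorBundle ∞ FA A 𝓘(ℝ, EM)]
  [FiniteDimensional ℝ FA]

/-- The inclusion `𝓘_t : A → TJ × A`, `a ↦ (0_t, a)`, over `m ↦ (t, m)`. -/
def LieAlgebroid.incl (t : J) : AnchoredHom LA (LA.intervalProd J) where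
  base := ⟨fun m => (t, m), contMDiff_const.prodMk contMDiff_id⟩
  fiber m := LinearMap.inr ℝ ℝ (A m)
  contMDiff_fiber := by
    have hb : ContMDiff (𝓘(ℝ, EM).prod 𝓘(ℝ, FA)) (𝓘(ℝ, ℝ).prod 𝓘(ℝ, EM)) ∞
        (fun v : TotalSpace FA A => ((t, v.1) : J × M)) :=
      contMDiff_const.prodMk (contMDiff_proj A)
    refine (contMDiff_prod_bundle (V := FstPullback EM M J) (W := SndPullback (EM := EM) J A)
      (φ := fun v : TotalSpace FA A => ((t, v.1) : J × M)) (v := fun v => (0 : ℝ))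
      (w := fun v => v.2)).2 ⟨?_, ?_⟩
    · exact (contMDiff_zeroSection ℝ (FstPullback EM M J)).comp hb
    · intro v
      rw [contMDiffAt_totalSpace]
      refine ⟨hb v, ?_⟩
      exact ((contMDiffAt_totalSpace (f := id)).1 (contMDiffAt_id (x := v))).2
  anchor_fiber m v := by
    have h : HasMFDerivAt 𝓘(ℝ, EM) (𝓘(ℝ, ℝ).prod 𝓘(ℝ, EM)) (fun x : M => ((t, x) : J × M)) m
        ((0 : EM →L[ℝ] ℝ).prod (ContinuousLinearMap.id ℝ EM)) :=
      (hasMFDerivAt_const t m).prodMk (hasMFDerivAt_id m)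
    exact (congrArg (fun L : EM →L[ℝ] ℝ × EM => L (LA.anchor m v)) h.mfderiv).symm

variable (EM J FA A) in
/-- The section `(∂_t, 0)` of `TJ × A`. -/
def ddtSection : PSec EM J FA A := mkPSec 1 0

end Inclusion

end LA

end

open LA

/-! On `J × M` the section `∂_t` of `TJ × A` commutes with every time-independent section of `A`,
and together these sections span all fibres. The connection `Φ^*∇` is flat, so `∇_∂t` commutes with
`∇_a` for time-independent `a`, and hence with the Koszul differential evaluated on such sections.
The analytic input is that along a line `J × {m}` the equation `∇_∂t s = g` is a linear ordinary
differential equation: for given initial values on one slice it has exactly one solution, defined on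
all of `J` and smooth in `m` (`Connection.exists_solution`, `Connection.eq_of_ddt_eq`).

Restriction to the slice at time `t` is bijective in cohomology for the following reason. Let `γ` be
closed with restriction `dη`, and solve `i_∂t ζ = 0`, `L_∂t ζ = i_∂t γ` with `ζ = η` on the slice
(`Connection.exists_form`). Then `dζ = γ`. Indeed both have the contraction `i_∂t γ` with `∂_t`, and
on time-independent sections both have the time derivative `d i_∂t γ`, by Cartan's formula, while
they agree at time `t` (`Connection.exists_primitive`). This is injectivity in positive degree; in
degree zero a closed form is parallel, hence determined by one slice. The case `γ = 0` extends a
closed `η` to a closed form that is parallel in time, which is surjectivity.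

The inverse of restriction is thus represented by parallel extension, and restricting a parallel
extension to another slice is parallel transport. So the comparison of two slices is `θ_*` already
for forms (`flowIso_mapForm`), and `θ` is a gauge equivalence because `∇_a` of a parallel section is
parallel. The formula for the pullbacks follows, since the pullback along each slice morphism
factors through the pullback along `Φ`.

Two general facts support this. Pullback along a morphism commutes with the differentials: once the
bracket part of the Koszul formula is written as half a sum over all pairs, the derivatives of
coefficients enter symmetrically and cancel (`Connection.koszul_pullbackForm`,
`sum_update_eq_zero_of_symm`). For the identity morphism this is tensoriality of the differential;
for the 1-form `∇e` it gives flatness of the pullback. Smooth dependence of linear equations on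
parameters comes from inverting `1 - V` for a Volterra operator `V` on continuous paths, inversion
being smooth on units. -/

noncomputable section

namespace LA

set_option linter.unusedSectionVars false

/-! ### Smooth families of paths and Volterra equations -/

section CurveSpace

open unitInterval

set_option synthInstance.maxHeartbeats 200000

variable {F : Type*} [NormedAddCommGroup F] [NormedSpace ℝ F]
  {G : Type*} [NormedAddCommGroup G] [NormedSpace ℝ G]
  {P : Type*} [NormedAddCommGroup P] [NormedSpace ℝ P]

/-- The path `u ↦ f (u, p)` on the unit interval. -/
def pathOf (f : ℝ × P → F) (hf : Continuous f) (p : P) : C(I, F) :=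
  ⟨fun u => f (u, p), by fun_prop⟩

lemma continuous_pathOf {f : ℝ × P → F} (hf : Continuous f) : Continuous (pathOf f hf) := by
  refine ContinuousMap.continuous_of_continuous_uncurry _ ?_
  change Continuous fun q : P × I => f (q.2, q.1)
  fun_prop

variable (F P) in
/-- Evaluation of a path of linear maps at a fixed vector. -/
def pathApply : C(I, P →L[ℝ] F) →L[ℝ] P →L[ℝ] C(I, F) :=
  LinearMap.mkContinuous₂
    (LinearMap.mk₂ ℝ
      (fun (A : C(I, P →L[ℝ] F)) (v : P) => (⟨fun u => A u v, by fun_prop⟩ : C(I, F)))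
      (fun _ _ _ => by ext; simp) (fun _ _ _ => by ext; simp)
      (fun _ _ _ => by ext; simp) (fun _ _ _ => by ext; simp)) 1
    (fun A v => by
      refine (ContinuousMap.norm_le _ (by positivity)).2 fun u => ?_
      rw [one_mul]
      exact ((A u).le_opNorm v).trans
        (mul_le_mul_of_nonneg_right (A.norm_coe_le_norm u) (norm_nonneg v)))

/-- At each `u` the remainder is bounded by the mean value inequality on a ball about `p`. One
radius serves all `u` because the path of derivatives depends continuously on the parameter for the
sup norm; compactness of `I` enters here. -/
lemma hasFDerivAt_pathOf {f : ℝ × P → F} {f' : ℝ × P → P →L[ℝ] F} (hf : Continuous f)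
    (hf' : Continuous f') (h : ∀ u p, HasFDerivAt (fun q => f (u, q)) (f' (u, p)) p) (p : P) :
    HasFDerivAt (pathOf f hf) (pathApply F P (pathOf f' hf' p)) p := by
  rw [hasFDerivAt_iff_isLittleO, Asymptotics.isLittleO_iff]
  intro ε hε
  obtain ⟨δ, hδ, hb⟩ := Metric.continuousAt_iff.1 (continuous_pathOf hf').continuousAt ε hε
  filter_upwards [Metric.ball_mem_nhds p hδ] with q hq
  refine (ContinuousMap.norm_le _ (by positivity)).2 fun u => ?_
  change ‖f (u, q) - f (u, p) - f' (u, p) (q - p)‖ ≤ _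
  refine (convex_ball p δ).norm_image_sub_le_of_norm_hasFDerivWithin_le' (f := fun q => f (u, q))
    (fun x _ => (h u x).hasFDerivWithinAt) (fun x hx => ?_) (Metric.mem_ball_self hδ) hq
  have h1 := (dist_eq_norm (pathOf f' hf' x) _ ▸ hb hx).le
  exact ((pathOf f' hf' x - pathOf f' hf' p).norm_coe_le_norm u).trans h1

/-- The derivative in a fixed direction `v` is the path map of a partial derivative of `f`, so the
hypothesis reproduces itself and induction on the order applies. Finite dimension of `P` allows
smoothness of the derivative to be tested on single vectors. -/
lemma contDiff_pathOf [FiniteDimensional ℝ P] {f : ℝ × P → F} (hf : ContDiff ℝ ∞ f) :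
    ContDiff ℝ ∞ (pathOf f hf.continuous) := by
  rw [contDiff_infty]
  intro n
  induction n generalizing f with
  | zero => exact contDiff_zero.2 (continuous_pathOf _)
  | succ n ih =>
    have hd : ContDiff ℝ ∞ (fun q : ℝ × P => (fderiv ℝ f q).comp (ContinuousLinearMap.inr ℝ ℝ P)) :=
      (hf.fderiv_right (m := ∞) (by simp)).clm_comp contDiff_const
    have h := hasFDerivAt_pathOf hf.continuous hd.continuous fun u p =>
      ((hf.differentiable (by simp)).differentiableAt.hasFDerivAt).comp p
        (hasFDerivAt_prodMk_right u p)
    have hn : ((n + 1 : ℕ) : WithTop ℕ∞) = (n : WithTop ℕ∞) + 1 := by norm_cast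
    rw [hn, contDiff_succ_iff_fderiv_apply]
    refine ⟨fun p => (h p).differentiableAt, by simp, fun v => ?_⟩
    simp only [fun p => (h p).fderiv]
    exact ih (f := fun q => (fderiv ℝ f q).comp (ContinuousLinearMap.inr ℝ ℝ P) v)
      (hd.clm_apply contDiff_const)

variable (F) in
/-- Integration of paths from `0`. -/
def pathIntegral [CompleteSpace F] : C(I, F) →L[ℝ] C(I, F) :=
  LinearMap.mkContinuous
    { toFun := fun z => ⟨fun u => ∫ v in (0 : ℝ)..u, IccExtend zero_le_one z v,
        (intervalIntegral.continuous_primitive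
          (fun _ _ => (z.continuous.Icc_extend' (h := zero_le_one)).intervalIntegrable _ _) 0).comp
          continuous_subtype_val⟩
      map_add' := fun z w => by
        ext u
        exact intervalIntegral.integral_add
          ((z.continuous.Icc_extend' (h := zero_le_one)).intervalIntegrable _ _)
          ((w.continuous.Icc_extend' (h := zero_le_one)).intervalIntegrable _ _)
      map_smul' := fun r z => by
        ext u
        exact intervalIntegral.integral_smul r _ } 1
    (fun z => by
      refine (ContinuousMap.norm_le _ (by positivity)).2 fun u => ?_
      have h := intervalIntegral.norm_integral_le_of_norm_le_const (a := (0 : ℝ)) (b := u)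
        (f := IccExtend zero_le_one z) (C := ‖z‖) fun x _ => z.norm_coe_le_norm _
      refine h.trans ?_
      rw [one_mul, sub_zero, abs_of_nonneg u.2.1]
      exact mul_le_of_le_one_right (norm_nonneg _) u.2.2)

lemma pathIntegral_apply [CompleteSpace F] (z : C(I, F)) (u : I) :
    pathIntegral F z u = ∫ v in (0 : ℝ)..u, IccExtend zero_le_one z v := rfl

variable (F) in
/-- Pointwise application of a path of operators to a path of vectors. -/
def pathMul : C(I, F →L[ℝ] F) →L[ℝ] C(I, F) →L[ℝ] C(I, F) :=
  LinearMap.mkContinuous₂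
    (LinearMap.mk₂ ℝ
      (fun (A : C(I, F →L[ℝ] F)) (z : C(I, F)) => (⟨fun u => A u (z u), by fun_prop⟩ : C(I, F)))
      (fun _ _ _ => by ext; simp) (fun _ _ _ => by ext; simp)
      (fun _ _ _ => by ext; simp) (fun _ _ _ => by ext; simp)) 1
    (fun A z => by
      refine (ContinuousMap.norm_le _ (by positivity)).2 fun u => ?_
      rw [one_mul]
      exact ((A u).le_opNorm (z u)).trans
        (mul_le_mul (A.norm_coe_le_norm u) (z.norm_coe_le_norm u) (norm_nonneg _) (norm_nonneg A)))

lemma pathMul_apply (A : C(I, F →L[ℝ] F)) (z : C(I, F)) (u : I) :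
    pathMul F A z u = A u (z u) := rfl

variable (F) in
/-- The Volterra operator `z ↦ ∫₀ A z`. -/
def volterra [CompleteSpace F] : C(I, F →L[ℝ] F) →L[ℝ] (C(I, F) →L[ℝ] C(I, F)) :=
  (ContinuousLinearMap.compL ℝ C(I, F) C(I, F) C(I, F) (pathIntegral F)).comp (pathMul F)

variable [CompleteSpace F]

lemma volterra_apply (A : C(I, F →L[ℝ] F)) (z : C(I, F)) :
    volterra F A z = pathIntegral F (pathMul F A z) := rfl

/-- Each application integrates the previous bound over `[0, u]` and gains a factor `1 / (n + 1)`.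
The resulting factorial makes some power of the operator a contraction, whatever the size of `A`. -/
lemma norm_volterra_pow_apply_le (A : C(I, F →L[ℝ] F)) (z : C(I, F)) (n : ℕ) (u : I) :
    ‖(volterra F A ^ n) z u‖ ≤ (‖A‖ ^ n / n.factorial * ‖z‖) * (u : ℝ) ^ n := by
  induction n generalizing u with
  | zero => simpa using z.norm_coe_le_norm u
  | succ n ih =>
    set w := (volterra F A ^ n) z
    have h0 : (volterra F A ^ (n + 1)) z u =
        ∫ v in (0 : ℝ)..u, IccExtend zero_le_one (pathMul F A w) v := by
      rw [pow_succ']; rfl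
    have hb : ∀ v ∈ Ioc (0 : ℝ) u, ‖IccExtend zero_le_one (pathMul F A w) v‖ ≤
        ‖A‖ * (‖A‖ ^ n / n.factorial * ‖z‖) * v ^ n := by
      intro v hv
      have hv' : v ∈ Icc (0 : ℝ) 1 := ⟨hv.1.le, hv.2.trans u.2.2⟩
      rw [IccExtend_of_mem _ _ hv', pathMul_apply]
      refine ((A _).le_opNorm _).trans ?_
      rw [mul_assoc]
      exact mul_le_mul (A.norm_coe_le_norm _) (ih _) (norm_nonneg _) (norm_nonneg A)
    rw [h0]
    refine (intervalIntegral.norm_integral_le_of_norm_le u.2.1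
      (MeasureTheory.ae_of_all _ hb)
      (Continuous.intervalIntegrable (by fun_prop) _ _)).trans ?_
    rw [intervalIntegral.integral_const_mul, integral_pow, Nat.factorial_succ]
    push_cast
    refine le_of_eq ?_
    field_simp
    ring

/-- `1 - S ^ n` is `1 - S` times a geometric sum commuting with it, and a commuting factor of a unit
is a unit. -/
lemma isUnit_one_sub_of_norm_pow_lt_one {S : F →L[ℝ] F} {n : ℕ}
    (h : ‖S ^ n‖ < 1) : IsUnit (1 - S) := by
  have h2 := isUnit_one_sub_of_norm_lt_one h
  rw [← mul_neg_geom_sum] at h2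
  exact ((Commute.isUnit_mul_iff
    ((Commute.one_left _).sub_left ((Commute.sum_right _ _ _ fun i _ =>
      (Commute.refl _).pow_right i)))).1 h2).1

/-- Inversion is smooth on the units of the Banach algebra of operators; this is the source of
smooth dependence of solutions on parameters. -/
lemma contDiff_inverse_apply {S : P → F →L[ℝ] F} {w : P → F} (hS : ContDiff ℝ ∞ S)
    (hu : ∀ p, IsUnit (S p)) (hw : ContDiff ℝ ∞ w) :
    ContDiff ℝ ∞ (fun p => Ring.inverse (S p) (w p)) := by
  refine ContDiff.clm_apply (contDiff_iff_contDiffAt.2 fun p => ?_) hw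
  obtain ⟨x, hx⟩ := hu p
  have h1 := contDiffAt_ringInverse ℝ (n := ∞) x
  rw [hx] at h1
  exact h1.comp p hS.contDiffAt

lemma isUnit_one_sub_volterra (A : C(I, F →L[ℝ] F)) : IsUnit (1 - volterra F A) := by
  obtain ⟨n, hn⟩ := ((FloorSemiring.tendsto_pow_div_factorial_atTop ‖A‖).eventually_lt_const
    (zero_lt_one (α := ℝ))).exists
  have h1 : ‖volterra F A ^ n‖ < 1 := by
    refine lt_of_le_of_lt (ContinuousLinearMap.opNorm_le_bound _ (by positivity) fun z => ?_) hn
    refine (ContinuousMap.norm_le _ (by positivity)).2 fun u => ?_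
    refine (norm_volterra_pow_apply_le A z n u).trans ?_
    exact mul_le_of_le_one_right (by positivity) (pow_le_one₀ u.2.1 u.2.2)
  exact isUnit_one_sub_of_norm_pow_lt_one h1

/-- The solution of `z = w + ∫₀ A z`. -/
def volterraSolve (A : C(I, F →L[ℝ] F)) (w : C(I, F)) : C(I, F) :=
  Ring.inverse (1 - volterra F A) w

lemma volterraSolve_eq_iff (A : C(I, F →L[ℝ] F)) (w z : C(I, F)) :
    z = volterraSolve A w ↔ z = w + volterra F A z := by
  have hu := isUnit_one_sub_volterra A
  have h1 : ∀ x, (1 - volterra F A) (Ring.inverse (1 - volterra F A) x) = x := fun x =>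
    congrArg (fun T : C(I, F) →L[ℝ] C(I, F) => T x) (Ring.mul_inverse_cancel _ hu)
  have h2 : ∀ x, Ring.inverse (1 - volterra F A) ((1 - volterra F A) x) = x := fun x =>
    congrArg (fun T : C(I, F) →L[ℝ] C(I, F) => T x) (Ring.inverse_mul_cancel _ hu)
  have h3 : z = w + volterra F A z ↔ (1 - volterra F A) z = w := by
    rw [sub_apply, one_apply_eq_self, sub_eq_iff_eq_add]
  rw [h3, volterraSolve]
  constructor
  · rintro rfl
    exact h1 _
  · rintro rfl
    exact (h2 _).symm

lemma contDiff_volterraSolve {A : P → C(I, F →L[ℝ] F)} {w : P → C(I, F)} (hA : ContDiff ℝ ∞ A)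
    (hw : ContDiff ℝ ∞ w) : ContDiff ℝ ∞ (fun p => volterraSolve (A p) (w p)) := by
  have h := ContinuousLinearMap.contDiff (𝕜 := ℝ) (n := ∞) (E := C(I, F →L[ℝ] F))
    (F := C(I, F) →L[ℝ] C(I, F)) (volterra F)
  exact contDiff_inverse_apply (contDiff_const.sub (h.comp hA))
    (fun p => isUnit_one_sub_volterra (A p)) hw

end CurveSpace

/-! ### Linear differential equations with parameters -/

section LinearODE

open unitInterval

variable {F : Type*} [NormedAddCommGroup F] [NormedSpace ℝ F] [CompleteSpace F]
  {P : Type*} [NormedAddCommGroup P] [NormedSpace ℝ P] [FiniteDimensional ℝ P]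

/-- Passes from the fixed point equation in the space of paths to the pointwise integral equation.
Only times in `[0, u] ⊆ [0, 1]` are integrated over, so the extension of paths beyond the unit
interval does not matter. -/
lemma volterraSolve_apply {A : ℝ → F →L[ℝ] F} {b : ℝ → F} (hA : Continuous A) (hb : Continuous b)
    (c : F) (z : C(I, F)) :
    z = volterraSolve ⟨fun u : I => A u, by fun_prop⟩
        (ContinuousMap.const I c + pathIntegral F ⟨fun u : I => b u, by fun_prop⟩) ↔
      ∀ u : I, z u = c + ∫ v in (0 : ℝ)..u, (b v + A v (IccExtend zero_le_one z v)) := by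
  rw [volterraSolve_eq_iff, ContinuousMap.ext_iff]
  refine forall_congr' fun u => ?_
  have hz : Continuous (IccExtend zero_le_one z) := z.continuous.Icc_extend' (h := zero_le_one)
  have h : ∀ v ∈ uIcc (0 : ℝ) u, ∃ hv : v ∈ Icc (0 : ℝ) 1, True := fun v hv => by
    rw [uIcc_of_le u.2.1] at hv
    exact ⟨⟨hv.1, hv.2.trans u.2.2⟩, trivial⟩
  rw [intervalIntegral.integral_add (hb.intervalIntegrable _ _)
    ((hA.clm_apply hz).intervalIntegrable _ _), ← add_assoc]
  have h1 : pathIntegral F ⟨fun u : I => b u, by fun_prop⟩ u = ∫ v in (0 : ℝ)..u, b v := by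
    rw [pathIntegral_apply]
    refine intervalIntegral.integral_congr fun v hv => ?_
    obtain ⟨hv, -⟩ := h v hv
    exact IccExtend_of_mem _ _ hv
  have h2 : volterra F ⟨fun u : I => A u, by fun_prop⟩ z u =
      ∫ v in (0 : ℝ)..u, A v (IccExtend zero_le_one z v) := by
    rw [volterra_apply, pathIntegral_apply]
    refine intervalIntegral.integral_congr fun v hv => ?_
    obtain ⟨hv, -⟩ := h v hv
    simp only [IccExtend_of_mem _ _ hv]
    rfl
  rw [← h1, ← h2]
  rfl

/-- Linear differential equations have global solutions depending smoothly on parameters. -/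
theorem exists_linearODE_solution {C : ℝ × P → F →L[ℝ] F} {b : ℝ × P → F} {x₀ : P → F}
    (hC : ContDiff ℝ ∞ C) (hb : ContDiff ℝ ∞ b) (hx₀ : ContDiff ℝ ∞ x₀) (t₀ : ℝ) :
    ∃ x : ℝ × P → F, ContDiff ℝ ∞ x ∧ (∀ y, x (t₀, y) = x₀ y) ∧
      ∀ t y, HasDerivAt (fun t => x (t, y)) (C (t, y) (x (t, y)) + b (t, y)) t := by
  -- The substitution `τ = t₀ + u * (t - t₀)` turns the final time `t` into a parameter: the
  -- equation runs over `u ∈ [0, 1]`, and the value sought is the one at `u = 1`. Final times before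
  -- `t₀` are covered as well.
  let A' : ℝ × (ℝ × P) → F →L[ℝ] F := fun q => (q.2.1 - t₀) • C (t₀ + q.1 * (q.2.1 - t₀), q.2.2)
  let b' : ℝ × (ℝ × P) → F := fun q => (q.2.1 - t₀) • b (t₀ + q.1 * (q.2.1 - t₀), q.2.2)
  have hA' : ContDiff ℝ ∞ A' := by fun_prop
  have hb' : ContDiff ℝ ∞ b' := by fun_prop
  have hCc := hC.continuous
  have hbc := hb.continuous
  let w : ℝ × P → C(I, F) := fun p =>
    ContinuousMap.const I (x₀ p.2) + pathIntegral F (pathOf b' hb'.continuous p)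
  have hw : ContDiff ℝ ∞ w := by
    refine ContDiff.add ?_ ((pathIntegral F).contDiff.comp (contDiff_pathOf hb'))
    exact contDiff_pathOf (f := fun q : ℝ × (ℝ × P) => x₀ q.2.2) (by fun_prop)
  let z : ℝ × P → C(I, F) := fun p => volterraSolve (pathOf A' hA'.continuous p) (w p)
  have hz : ContDiff ℝ ∞ z := contDiff_volterraSolve (contDiff_pathOf hA') hw
  let x : ℝ × P → F := fun p => z p 1
  have hx : ContDiff ℝ ∞ x := ContDiff.comp (ContinuousLinearMap.contDiff (𝕜 := ℝ)
    (E := C(I, F)) (F := F) (ContinuousMap.evalCLM ℝ (1 : I))) hz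
  have hcA : ∀ p, Continuous fun u => A' (u, p) := fun p => by fun_prop
  have hcb : ∀ p, Continuous fun u => b' (u, p) := fun p => by fun_prop
  have key : ∀ p (y : C(I, F)), y = z p ↔ ∀ u : I, y u =
      x₀ p.2 + ∫ v in (0 : ℝ)..u, (b' (v, p) + A' (v, p) (IccExtend zero_le_one y v)) :=
    fun p y => volterraSolve_apply (hcA p) (hcb p) (x₀ p.2) y
  -- The part of the rescaled path over `[0, u]`, rescaled again, solves the equation with final
  -- time `t₀ + u * (t - t₀)`; uniqueness identifies the two. This consistency yields the integral
  -- equation in the original time.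
  have hs : ∀ t y (u : I), z (t, y) u = x (t₀ + u * (t - t₀), y) := by
    intro t y u
    set p' : ℝ × P := (t₀ + u * (t - t₀), y)
    have h : (⟨fun v => z (t, y) (u * v), by fun_prop⟩ : C(I, F)) = z p' := by
      rw [key]
      intro v
      have h1 := (key (t, y) _).1 rfl (u * v)
      refine h1.trans ?_
      congr 1
      have h2 := intervalIntegral.smul_integral_comp_mul_left (a := 0) (b := (v : ℝ))
        (fun r => b' (r, (t, y)) + A' (r, (t, y)) (IccExtend zero_le_one (z (t, y)) r)) (u : ℝ)
      rw [mul_zero] at h2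
      refine h2.symm.trans ?_
      rw [← intervalIntegral.integral_smul]
      refine intervalIntegral.integral_congr fun r hr => ?_
      rw [uIcc_of_le v.2.1] at hr
      have hr1 : r ∈ Icc (0 : ℝ) 1 := ⟨hr.1, hr.2.trans v.2.2⟩
      have hr2 : u * r ∈ Icc (0 : ℝ) 1 := ⟨mul_nonneg u.2.1 hr1.1, mul_le_one₀ u.2.2 hr1.1 hr1.2⟩
      simp only [IccExtend_of_mem _ _ hr1, IccExtend_of_mem _ _ hr2]
      simp only [A', b', p', add_sub_cancel_left, smul_add, smul_smul, mul_assoc,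
        FunLike.coe_smul, Pi.smul_apply, mul_left_comm]
      rfl
    have h1 := congrArg (fun f : C(I, F) => f 1) h
    refine Eq.trans ?_ h1
    change _ = z (t, y) (u * 1)
    rw [mul_one]
  have hint : ∀ t y, x (t, y) = x₀ y + ∫ τ in t₀..t, (C (τ, y) (x (τ, y)) + b (τ, y)) := by
    intro t y
    refine ((key (t, y) _).1 rfl 1).trans ?_
    congr 1
    have h2 := intervalIntegral.smul_integral_comp_add_mul (a := 0) (b := 1)
      (fun τ => C (τ, y) (x (τ, y)) + b (τ, y)) (t - t₀) t₀
    rw [mul_zero, mul_one, add_zero, add_sub_cancel] at h2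
    rw [← h2, ← intervalIntegral.integral_smul]
    refine intervalIntegral.integral_congr fun r hr => ?_
    rw [uIcc_of_le (by simp)] at hr
    have hr1 : r ∈ Icc (0 : ℝ) 1 := hr
    simp only [IccExtend_of_mem _ _ hr1, hs, A', b', smul_add, FunLike.coe_smul, Pi.smul_apply]
    rw [add_comm, mul_comm r]
  have hxc := hx.continuous
  refine ⟨x, hx, fun y => by rw [hint]; simp, fun t y => ?_⟩
  have hcont : Continuous fun τ => C (τ, y) (x (τ, y)) + b (τ, y) := by fun_prop
  have h3 := (hcont.integral_hasStrictDerivAt t₀ t).hasDerivAt.const_add (x₀ y)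
  exact h3.congr_of_eventuallyEq (Eventually.of_forall fun τ => hint τ y)

end LinearODE

/-! ### Cutting off the identity of a normed space -/

section Retract

/-- A smooth map into a ball which is the identity on a smaller ball. -/
lemma exists_smooth_retract {E : Type*} [NormedAddCommGroup E] [NormedSpace ℝ E]
    [FiniteDimensional ℝ E] (c : E) {r R : ℝ} (hr : 0 < r) (hR : r < R) :
    ∃ q : E → E, ContDiff ℝ ∞ q ∧ (∀ y ∈ Metric.closedBall c r, q y = y) ∧
      ∀ y, q y ∈ Metric.ball c R := by
  let ρ : ContDiffBump c := ⟨r, R, hr, hR⟩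
  refine ⟨fun y => c + ρ y • (y - c), ?_, fun y hy => ?_, fun y => ?_⟩
  · exact contDiff_const.add (ρ.contDiff.smul (contDiff_id.sub contDiff_const))
  · have : ρ y = 1 := ρ.one_of_mem_closedBall hy
    simp [this]
  · rw [Metric.mem_ball, dist_eq_norm, add_sub_cancel_left, norm_smul, Real.norm_eq_abs,
      abs_of_nonneg ρ.nonneg]
    by_cases h : y ∈ Metric.ball c R
    · rw [Metric.mem_ball, dist_eq_norm] at h
      exact lt_of_le_of_lt (mul_le_of_le_one_left (norm_nonneg _) ρ.le_one) h
    · have : ρ y = 0 := ρ.zero_of_le_dist (not_lt.1 h)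
      simp [this, hr.trans hR]

end Retract

/-! ### Spanning sections near a compact set -/

section CompactFrame

variable {EM HM M : Type*} [NormedAddCommGroup EM] [NormedSpace ℝ EM] [TopologicalSpace HM]
  (IM : ModelWithCorners ℝ EM HM) [TopologicalSpace M] [ChartedSpace HM M] [IsManifold IM ∞ M]
  (FA : Type*) [NormedAddCommGroup FA] [NormedSpace ℝ FA]
  (A : M → Type*) [TopologicalSpace (TotalSpace FA A)] [∀ x, AddCommGroup (A x)]
  [∀ x, Module ℝ (A x)] [∀ x, TopologicalSpace (A x)] [FiberBundle FA A] [VectorBundle ℝ FA A]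
  [FiniteDimensional ℝ EM] [T2Space M] [ContMDiffVectorBundle ∞ FA A IM] [FiniteDimensional ℝ FA]

/-- Near a compact set the bundle is a direct summand of a trivial bundle. -/
lemma exists_compact_frame {K : Set M} (hK : IsCompact K) :
    ∃ (n : ℕ) (s : Fin n → Cₛ^∞⟮IM; FA, A⟯)
    (κ : Fin n → ∀ x, A x →ₗ[ℝ] ℝ) (ψ : C^∞⟮IM, M; ℝ⟯),
    (∀ i, ContMDiff (IM.prod 𝓘(ℝ, FA)) 𝓘(ℝ, ℝ) ∞ (fun v : TotalSpace FA A => κ i v.1 v.2)) ∧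
    (∀ y ∈ K, ∀ᶠ x in 𝓝 y, ψ x = 1) ∧ ∀ (x : M) (v : A x), ψ x • v = ∑ i, κ i x v • s i x := by
  refine hK.induction_on ?_ ?_ ?_ ?_
  · exact ⟨0, Fin.elim0, Fin.elim0, 0, fun i => i.elim0, by simp, fun x v => by simp⟩
  · rintro K K' hKK' ⟨n, s, κ, ψ, h1, h2, h3⟩
    exact ⟨n, s, κ, ψ, h1, fun y hy => h2 y (hKK' hy), h3⟩
  · rintro K K' ⟨n, s, κ, ψ, h1, h2, h3⟩ ⟨n', s', κ', ψ', h1', h2', h3'⟩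
    -- The second family only has to reproduce the defect `(1 - ψ) • v` left by the first. The
    -- combined cut-off is `1 - (1 - ψ) * (1 - ψ')`, which is `1` wherever one of the two is.
    refine ⟨n + n', Fin.append s s', Fin.append κ fun i x => (1 - ψ x) • κ' i x,
      ψ + (1 - ψ) * ψ', fun i => ?_, ?_, fun x v => ?_⟩
    · refine Fin.addCases (fun i => ?_) (fun i => ?_) i
      · simpa using h1 i
      · simp only [Fin.append_right]
        have h : ContMDiff IM 𝓘(ℝ, ℝ) ∞ (fun x => 1 - ψ x) := contMDiff_const.sub ψ.contMDiff
        exact (h.comp (contMDiff_proj A)).mul (h1' i)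
    · rintro y (hy | hy)
      · filter_upwards [h2 y hy] with x hx
        simp [hx]
      · filter_upwards [h2' y hy] with x hx
        simp [hx]
    · rw [Fin.sum_univ_add]
      simp only [Fin.append_left, Fin.append_right, LinearMap.smul_apply, smul_assoc,
        ← Finset.smul_sum, ← h3, ← h3']
      simp only [ContMDiffMap.coe_add, ContMDiffMap.coe_mul, ContMDiffMap.coe_sub, Pi.add_apply,
        Pi.mul_apply, Pi.sub_apply, ContMDiffMap.coe_one, Pi.one_apply]
      module
  · intro y _
    obtain ⟨n, s, κ, ψ, h1, h2, h3⟩ := exists_bump_frame IM FA A y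
    exact ⟨{x | ∀ᶠ z in 𝓝 x, ψ z = 1}, mem_nhdsWithin_of_mem_nhds h2.eventually_nhds, n, s, κ, ψ,
      h1, fun x hx => hx, h3⟩

end CompactFrame

/-! ### Extending time intervals and charts to the model space -/

section Retracts

/-- Smooth extension of the identity of a closed subinterval to a map `ℝ → J`. -/
lemma exists_time_retract {J : TopologicalSpace.Opens ℝ} (hJ : (J : Set ℝ).OrdConnected)
    (t₀ t₁ : J) : ∃ (a b : ℝ) (q : ℝ → J), ContMDiff 𝓘(ℝ, ℝ) 𝓘(ℝ, ℝ) ∞ q ∧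
      (t₀ : ℝ) ∈ Ioo a b ∧ (t₁ : ℝ) ∈ Ioo a b ∧ ∀ t ∈ Icc a b, (q t : ℝ) = t := by
  obtain ⟨ε₀, hε₀, h₀⟩ := Metric.isOpen_iff.1 J.isOpen t₀ t₀.2
  obtain ⟨ε₁, hε₁, h₁⟩ := Metric.isOpen_iff.1 J.isOpen t₁ t₁.2
  -- The interval spanned by the two times stays in `J` when widened by `2 * δ`. The retraction
  -- takes values there and is the identity on the widening by `δ`, so both times are interior to
  -- the interval on which it is the identity.
  obtain ⟨δ, hδ, hδ₀, hδ₁⟩ : ∃ δ, 0 < δ ∧ 2 * δ < ε₀ ∧ 2 * δ < ε₁ :=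
    ⟨min ε₀ ε₁ / 3, by positivity, by linarith [min_le_left ε₀ ε₁, lt_min hε₀ hε₁],
      by linarith [min_le_right ε₀ ε₁, lt_min hε₀ hε₁]⟩
  rw [Real.ball_eq_Ioo] at h₀ h₁
  have hsub : Icc (min (t₀ : ℝ) t₁ - 2 * δ) (max (t₀ : ℝ) t₁ + 2 * δ) ⊆ J := by
    have hmin : min (t₀ : ℝ) t₁ - 2 * δ ∈ (J : Set ℝ) := by
      rcases min_choice (t₀ : ℝ) t₁ with h | h <;> rw [h]
      · exact h₀ ⟨by linarith, by linarith⟩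
      · exact h₁ ⟨by linarith, by linarith⟩
    have hmax : max (t₀ : ℝ) t₁ + 2 * δ ∈ (J : Set ℝ) := by
      rcases max_choice (t₀ : ℝ) t₁ with h | h <;> rw [h]
      · exact h₀ ⟨by linarith, by linarith⟩
      · exact h₁ ⟨by linarith, by linarith⟩
    exact hJ.out hmin hmax
  have hmm := min_le_max (a := (t₀ : ℝ)) (b := t₁)
  set lo := min (t₀ : ℝ) t₁
  set hi := max (t₀ : ℝ) t₁
  obtain ⟨q, hq, hid, hball⟩ := exists_smooth_retract ((lo + hi) / 2)
    (r := (hi - lo) / 2 + δ) (R := (hi - lo) / 2 + 2 * δ) (by linarith) (by linarith)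
  have hqJ : ∀ t, q t ∈ J := fun t => hsub (by
    have := hball t
    rw [Real.ball_eq_Ioo] at this
    exact ⟨by linarith [this.1], by linarith [this.2]⟩)
  -- A chart of an open subset of `ℝ` is the inclusion, so smoothness as a map into `J` follows by
  -- factoring through the inverse of a chart.
  have hval : ∀ t : ℝ, ((chartAt ℝ t₀).symm (q t) : J) = ⟨q t, hqJ t⟩ := fun t => by
    have h := (chartAt ℝ t₀).left_inv (x := (⟨q t, hqJ t⟩ : J)) (by
      rw [TopologicalSpace.Opens.chartAt_eq]; simp; trivial)
    exact h
  refine ⟨lo - δ, hi + δ, fun t => ⟨q t, hqJ t⟩, ?_, ⟨?_, ?_⟩, ⟨?_, ?_⟩, fun t ht => ?_⟩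
  · simp only [← hval]
    refine (contMDiffOn_chart_symm (I := 𝓘(ℝ, ℝ)) (x := t₀)).comp_contMDiff hq.contMDiff fun t => ?_
    have h := (chartAt ℝ t₀).map_source (x := (⟨q t, hqJ t⟩ : J)) (by
      rw [TopologicalSpace.Opens.chartAt_eq]; simp; trivial)
    exact h
  · linarith [min_le_left (t₀ : ℝ) t₁]
  · linarith [le_max_left (t₀ : ℝ) t₁]
  · linarith [min_le_right (t₀ : ℝ) t₁]
  · linarith [le_max_right (t₀ : ℝ) t₁]
  · refine hid t ?_
    rw [Real.closedBall_eq_Icc]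
    exact ⟨by linarith [ht.1], by linarith [ht.2]⟩

variable {EM M : Type*} [NormedAddCommGroup EM] [NormedSpace ℝ EM]
  [TopologicalSpace M] [ChartedSpace EM M] [IsManifold 𝓘(ℝ, EM) ∞ M]

/-- The inverse of a chart, shrunk and extended to the model space. -/
lemma exists_chart_retract [FiniteDimensional ℝ EM] (m₁ : M) :
    ∃ q : EM → M, ContMDiff 𝓘(ℝ, EM) 𝓘(ℝ, EM) ∞ q ∧
      ∀ᶠ m in 𝓝 m₁, q (chartAt EM m₁ m) = m := by
  set X := chartAt EM m₁
  obtain ⟨R, hR, hball⟩ := Metric.isOpen_iff.1 X.open_target (X m₁) (mem_chart_target EM m₁)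
  obtain ⟨q, hq, hid, hq'⟩ := exists_smooth_retract (X m₁) (half_pos hR) (half_lt_self hR)
  refine ⟨fun y => X.symm (q y), (contMDiffOn_chart_symm (I := 𝓘(ℝ, EM)) (x := m₁)).comp_contMDiff
    hq.contMDiff fun y => hball (hq' y), ?_⟩
  have hc : ContinuousAt X m₁ := X.continuousAt (mem_chart_source EM m₁)
  filter_upwards [hc.preimage_mem_nhds (Metric.closedBall_mem_nhds _ (half_pos hR)),
    X.open_source.mem_nhds (mem_chart_source EM m₁)] with m hm hm'
  rw [hid _ hm, X.left_inv hm']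

/-- Converts the derivative on the manifold `J` into an ordinary derivative on `ℝ`, as needed for
differential equations. Only the germ of `q` at `t` matters. -/
lemma hasDerivAt_slice {J : TopologicalSpace.Opens ℝ}
    (u : C^∞⟮𝓘(ℝ, ℝ).prod 𝓘(ℝ, EM), J × M; ℝ⟯) (t : J) (m : M) {q : ℝ → J}
    (hq : ∀ᶠ τ in 𝓝 (t : ℝ), (q τ : ℝ) = τ) :
    HasDerivAt (fun τ => u (q τ, m)) (timeDerivFun u (t, m)) t := by
  have hsl : ContMDiff 𝓘(ℝ, ℝ) 𝓘(ℝ, ℝ) ∞ (fun τ : J => u (τ, m)) :=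
    u.contMDiff.comp (contMDiff_id.prodMk contMDiff_const)
  have h1 : timeDerivFun u (t, m) =
      fderiv ℝ (fun x => u ((chartAt ℝ t).symm x, m)) (chartAt ℝ t t) 1 :=
    dirDeriv_eq_fderiv (M := J) (f := fun τ : J => u (τ, m)) (hsl.mdifferentiableAt (by simp)) (ddt t)
  have hval : ∀ t' : J, chartAt ℝ t t' = (t' : ℝ) := fun t' => by
    rw [TopologicalSpace.Opens.chartAt_eq]; rfl
  have hsrc : ∀ t' : J, t' ∈ (chartAt ℝ t).source := fun t' => by
    rw [TopologicalSpace.Opens.chartAt_eq]; simp; trivial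
  have h2 : ContMDiffAt 𝓘(ℝ, ℝ) 𝓘(ℝ, ℝ) ∞ (fun x => u ((chartAt ℝ t).symm x, m))
      (chartAt ℝ t t) :=
    hsl.contMDiffAt.comp _ ((contMDiffOn_chart_symm (I := 𝓘(ℝ, ℝ)) (x := t)).contMDiffAt
        ((chartAt ℝ t).open_target.mem_nhds (mem_chart_target ℝ t)))
  have h3 := (contMDiffAt_iff_contDiffAt.1 h2).differentiableAt (by simp)
  rw [h1, fderiv_apply_one_eq_deriv]
  rw [hval] at h3 ⊢
  refine h3.hasDerivAt.congr_of_eventuallyEq ?_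
  filter_upwards [hq] with τ hτ
  have h4 := (chartAt ℝ t).left_inv (hsrc (q τ))
  rw [hval, hτ] at h4
  rw [h4]

end Retracts

/-! ### Uniqueness of parallel sections in the time direction -/

section Parallel

variable {EM M : Type*} [NormedAddCommGroup EM] [NormedSpace ℝ EM] [FiniteDimensional ℝ EM]
  [TopologicalSpace M] [ChartedSpace EM M] [IsManifold 𝓘(ℝ, EM) ∞ M] [T2Space M]
  {J : TopologicalSpace.Opens ℝ}
  {FA : Type*} [NormedAddCommGroup FA] [NormedSpace ℝ FA] [FiniteDimensional ℝ FA]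
  {A : M → Type*} [TopologicalSpace (TotalSpace FA A)] [∀ x, AddCommGroup (A x)]
  [∀ x, Module ℝ (A x)] [∀ x, TopologicalSpace (A x)] [FiberBundle FA A] [VectorBundle ℝ FA A]
  [ContMDiffVectorBundle ∞ FA A 𝓘(ℝ, EM)]
  {lA : LieAlgebroid 𝓘(ℝ, EM) FA A}
  {FV : Type*} [NormedAddCommGroup FV] [NormedSpace ℝ FV] [FiniteDimensional ℝ FV]
  {V : J × M → Type*} [TopologicalSpace (TotalSpace FV V)] [∀ x, AddCommGroup (V x)]
  [∀ x, Module ℝ (V x)] [∀ x, TopologicalSpace (V x)] [FiberBundle FV V] [VectorBundle ℝ FV V]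
  [ContMDiffVectorBundle ∞ FV V (𝓘(ℝ, ℝ).prod 𝓘(ℝ, EM))]

/-- The operator `∇_(∂_t, 0)` on sections. -/
def Connection.ddt (D : Connection (lA.intervalProd J) FV V) :
    Cₛ^∞⟮𝓘(ℝ, ℝ).prod 𝓘(ℝ, EM); FV, V⟯ →ₗ[ℝ] Cₛ^∞⟮𝓘(ℝ, ℝ).prod 𝓘(ℝ, EM); FV, V⟯ :=
  D.toFun (ddtSection EM J FA A)

variable (lA) in
lemma timeDerivFun_eq_dirDeriv (u : C^∞⟮𝓘(ℝ, ℝ).prod 𝓘(ℝ, EM), J × M; ℝ⟯) (p : J × M) :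
    timeDerivFun u p = dirDeriv (𝓘(ℝ, ℝ).prod 𝓘(ℝ, EM)) u p
      ((lA.intervalProd J).anchor p (ddtSection EM J FA A p)) := by
  have h : tAct lA (0 : TSec EM J FA A) u = 0 := by
    have := tAct_sub_left lA (0 : TSec EM J FA A) 0 u
    simpa using this
  have h1 : pAct lA (ddtSection EM J FA A) u = timeDerivFun u := by
    have h2 : pAct lA (ddtSection EM J FA A) u = 1 * timeDerivFun u + tAct lA 0 u := rfl
    rw [h2, h, one_mul, add_zero]
  rw [← h1]
  exact pAct_apply lA _ u p

lemma Connection.ddt_fsmul (D : Connection (lA.intervalProd J) FV V)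
    (u : C^∞⟮𝓘(ℝ, ℝ).prod 𝓘(ℝ, EM), J × M; ℝ⟯) (s : Cₛ^∞⟮𝓘(ℝ, ℝ).prod 𝓘(ℝ, EM); FV, V⟯)
    (p : J × M) : D.ddt (fsmul u s) p = u p • D.ddt s p + timeDerivFun u p • s p := by
  rw [timeDerivFun_eq_dirDeriv lA]
  exact D.leibniz _ _ _ _

lemma timeDerivFun_eq_zero {ψ : C^∞⟮𝓘(ℝ, ℝ).prod 𝓘(ℝ, EM), J × M; ℝ⟯} {p : J × M}
    (h : ∀ᶠ x in 𝓝 p, ψ x = 1) : timeDerivFun ψ p = 0 := by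
  have hc : ContinuousAt (fun τ : J => (τ, p.2)) p.1 := by fun_prop
  have h1 : (fun τ : J => ψ (τ, p.2)) =ᶠ[𝓝 p.1] fun _ => (1 : ℝ) := hc.eventually h
  exact (congrArg (fun L => L (LA.ddt p.1)) (dirDeriv_congr h1)).trans (dirDeriv_const 1 _ _)

lemma timeDerivFun_sum {ι : Type*} (S : Finset ι)
    (u : ι → C^∞⟮𝓘(ℝ, ℝ).prod 𝓘(ℝ, EM), J × M; ℝ⟯) :
    timeDerivFun (∑ i ∈ S, u i) = ∑ i ∈ S, timeDerivFun (u i) := by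
  classical
  induction S using Finset.induction_on with
  | empty =>
    have := timeDerivFun_sub (0 : C^∞⟮𝓘(ℝ, ℝ).prod 𝓘(ℝ, EM), J × M; ℝ⟯) 0
    simpa using this
  | insert a S ha ih => rw [Finset.sum_insert ha, Finset.sum_insert ha, timeDerivFun_add, ih]

lemma fun_sum_apply {ι : Type*} (S : Finset ι)
    (u : ι → C^∞⟮𝓘(ℝ, ℝ).prod 𝓘(ℝ, EM), J × M; ℝ⟯) (p : J × M) :
    (∑ i ∈ S, u i) p = ∑ i ∈ S, u i p := by
  classical
  induction S using Finset.induction_on with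
  | empty => simp
  | insert a S ha ih => rw [Finset.sum_insert ha, Finset.sum_insert ha, ← ih]; rfl

/-- A section which is parallel in the direction `∂_t` along a line `J × {m}` and vanishes at one
point of it vanishes along the line. -/
lemma Connection.eq_zero_of_ddt_eq_zero (hJ : (J : Set ℝ).OrdConnected)
    (D : Connection (lA.intervalProd J) FV V) {s : Cₛ^∞⟮𝓘(ℝ, ℝ).prod 𝓘(ℝ, EM); FV, V⟯} {m : M}
    {a b : ℝ} {t₀ t₁ : J} (h₀ : (t₀ : ℝ) ∈ Ioo a b) (h₁ : (t₁ : ℝ) ∈ Ioo a b)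
    (hD : ∀ t : J, (t : ℝ) ∈ Ioo a b → D.ddt s (t, m) = 0)
    (hs : s (t₀, m) = 0) : s (t₁, m) = 0 := by
  obtain ⟨a', b', q, hq, h₀', h₁', hid⟩ := exists_time_retract hJ t₀ t₁
  have hqc := hq.continuous
  obtain ⟨n, e, κ, ψ, hκ, h1, hψ⟩ := exists_compact_frame (𝓘(ℝ, ℝ).prod 𝓘(ℝ, EM)) FV V
    ((isCompact_Icc (a := a') (b := b')).image (f := fun t => (q t, m)) (by fun_prop))
  -- The sections `e` span but need not be independent, so the coordinates of `s` satisfy a relation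
  -- `y = P y` where `ψ = 1`. Differentiating it and inserting `∇_∂t s = 0` gives the closed linear
  -- system `y' = (P' - Q) y`, where `Q` holds the coordinates of `∇_∂t e`.
  let y : Fin n → C^∞⟮𝓘(ℝ, ℝ).prod 𝓘(ℝ, EM), J × M; ℝ⟯ := fun i =>
    ⟨fun p => κ i p (s p), (hκ i).comp s.contMDiff⟩
  let P : Fin n → Fin n → C^∞⟮𝓘(ℝ, ℝ).prod 𝓘(ℝ, EM), J × M; ℝ⟯ := fun i j =>
    ⟨fun p => κ i p (e j p), (hκ i).comp (e j).contMDiff⟩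
  let Q : Fin n → Fin n → C^∞⟮𝓘(ℝ, ℝ).prod 𝓘(ℝ, EM), J × M; ℝ⟯ := fun i j =>
    ⟨fun p => κ i p (D.ddt (e j) p), (hκ i).comp (D.ddt (e j)).contMDiff⟩
  have e1 : fsmul ψ s = ∑ j, fsmul (y j) (e j) := by
    ext p
    rw [section_sum_apply]
    exact hψ p (s p)
  have e2 : ∀ i, ψ * y i = ∑ j, P i j * y j := by
    intro i
    ext p
    rw [fun_sum_apply]
    have := congrArg (κ i p) (hψ p (s p))
    rw [map_smul, map_sum] at this
    refine this.trans (Finset.sum_congr rfl fun j _ => ?_)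
    rw [map_smul, smul_eq_mul, mul_comm]
    rfl
  have ode : ∀ t : J, (t : ℝ) ∈ Ioo a b → (t : ℝ) ∈ Ioo a' b' → ∀ i, timeDerivFun (y i) (t, m) =
      ∑ j, (timeDerivFun (P i j) (t, m) - Q i j (t, m)) * y j (t, m) := by
    intro t ht ht' i
    have hψt : ∀ᶠ x in 𝓝 ((t, m) : J × M), ψ x = 1 := by
      refine h1 _ ⟨t, Ioo_subset_Icc_self ht', ?_⟩
      exact Prod.ext (Subtype.ext (hid t (Ioo_subset_Icc_self ht'))) rfl
    have e3 := congrArg (fun σ : Cₛ^∞⟮𝓘(ℝ, ℝ).prod 𝓘(ℝ, EM); FV, V⟯ => D.ddt σ (t, m)) e1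
    simp only [map_sum, section_sum_apply, D.ddt_fsmul, hψt.self_of_nhds,
      timeDerivFun_eq_zero hψt, hD t ht, smul_zero, zero_smul, add_zero] at e3
    have e4 := congrArg (fun u => timeDerivFun u (t, m)) (e2 i)
    simp only [timeDerivFun_sum, timeDerivFun_mul, fun_sum_apply, ContMDiffMap.coe_add,
      ContMDiffMap.coe_mul, Pi.add_apply, Pi.mul_apply, hψt.self_of_nhds,
      timeDerivFun_eq_zero hψt, mul_zero, add_zero, one_mul] at e4
    have e5 := congrArg (κ i (t, m)) e3
    rw [map_zero, map_sum] at e5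
    have e6 : ∀ j, κ i (t, m) (y j (t, m) • D.ddt (e j) (t, m) + timeDerivFun (y j) (t, m) • e j (t, m))
        = y j (t, m) * Q i j (t, m) + timeDerivFun (y j) (t, m) * P i j (t, m) := fun j => by
      rw [map_add, map_smul, map_smul]; rfl
    simp only [e6] at e5
    rw [e4, ← sub_zero (∑ j, _), e5, ← Finset.sum_sub_distrib]
    exact Finset.sum_congr rfl fun j _ => by ring
  let c : Fin n → Fin n → ℝ → ℝ := fun i j τ => timeDerivFun (P i j) (q τ, m) - Q i j (q τ, m)
  have hc : ∀ i j, Continuous (c i j) := fun i j => by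
    have := (timeDerivFun (P i j)).contMDiff.continuous
    have := (Q i j).contMDiff.continuous
    fun_prop
  let C : ℝ → (Fin n → ℝ) →L[ℝ] (Fin n → ℝ) := fun τ =>
    ContinuousLinearMap.pi fun i => ∑ j, c i j τ • ContinuousLinearMap.proj j
  have hCapp : ∀ τ x i, C τ x i = ∑ j, c i j τ * x j := fun τ x i => by simp [C]
  have hC : Continuous C := by
    refine continuous_clm_apply.2 fun v => continuous_pi fun i => ?_
    simp only [hCapp]
    exact continuous_finsetSum _ fun j _ => (hc i j).mul continuous_const
  -- A bound for the coefficients on a compact interval is the uniform Lipschitz constant needed for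
  -- uniqueness.
  obtain ⟨K, hK⟩ := (isCompact_Icc (a := max a a') (b := min b b')).exists_bound_of_continuousOn
    hC.continuousOn
  have hI : ∀ {τ}, τ ∈ Ioo (max a a') (min b b') → τ ∈ Ioo a b ∧ τ ∈ Ioo a' b' := fun h =>
    ⟨⟨(le_max_left _ _).trans_lt h.1, h.2.trans_le (min_le_left _ _)⟩,
      ⟨(le_max_right _ _).trans_lt h.1, h.2.trans_le (min_le_right _ _)⟩⟩
  have huniq := ODE_solution_unique_of_mem_Ioo (E := Fin n → ℝ) (v := fun τ x => C τ x)
    (s := fun _ => univ) (K := K.toNNReal) (f := fun τ i => y i (q τ, m)) (g := fun _ => 0)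
    (a := max a a') (b := min b b') (t₀ := t₀)
    (fun τ hτ => (ContinuousLinearMap.lipschitzWith_of_opNorm_le
      ((hK τ (Ioo_subset_Icc_self hτ)).trans (Real.le_coe_toNNReal K))).lipschitzOnWith)
    ⟨max_lt h₀.1 h₀'.1, lt_min h₀.2 h₀'.2⟩
    (fun τ hτ => ⟨by
      obtain ⟨hτ1, hτ2⟩ := hI hτ
      have hqτ := hid τ (Ioo_subset_Icc_self hτ2)
      refine hasDerivAt_pi.2 fun i => ?_
      have h := hasDerivAt_slice (y i) (q τ) m (q := q) (by
        rw [hqτ]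
        filter_upwards [Ioo_mem_nhds hτ2.1 hτ2.2] with x hx using hid x (Ioo_subset_Icc_self hx))
      rw [ode (q τ) (by rwa [hqτ]) (by rwa [hqτ]) i, hqτ] at h
      exact h.congr_deriv (hCapp τ _ i).symm, trivial⟩)
    (fun τ _ => ⟨by simpa using hasDerivAt_const τ (0 : Fin n → ℝ), trivial⟩)
    (by
      have : q t₀ = t₀ := Subtype.ext (hid t₀ (Ioo_subset_Icc_self h₀'))
      funext i
      change κ i (q t₀, m) (s (q t₀, m)) = 0
      rw [this, hs, map_zero])
    (show (t₁ : ℝ) ∈ _ from ⟨max_lt h₁.1 h₁'.1, lt_min h₁.2 h₁'.2⟩)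
  have hq1 : q t₁ = t₁ := Subtype.ext (hid t₁ (Ioo_subset_Icc_self h₁'))
  have h4 := hψ (t₁, m) (s (t₁, m))
  have h5 : ψ (t₁, m) = 1 := (h1 _ ⟨t₁, Ioo_subset_Icc_self h₁', by simp only [hq1]⟩).self_of_nhds
  rw [h5, one_smul] at h4
  rw [h4]
  refine Finset.sum_eq_zero fun i _ => ?_
  have h6 : y i (q t₁, m) = 0 := congrFun huniq i
  rw [hq1] at h6
  have h7 : κ i (t₁, m) (s (t₁, m)) = 0 := h6
  rw [h7, zero_smul]

end Parallel

/-! ### Existence of solutions in the time direction -/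

section ParallelExistence

variable {EM M : Type*} [NormedAddCommGroup EM] [NormedSpace ℝ EM] [FiniteDimensional ℝ EM]
  [TopologicalSpace M] [ChartedSpace EM M] [IsManifold 𝓘(ℝ, EM) ∞ M] [T2Space M]
  {J : TopologicalSpace.Opens ℝ}
  {FA : Type*} [NormedAddCommGroup FA] [NormedSpace ℝ FA] [FiniteDimensional ℝ FA]
  {A : M → Type*} [TopologicalSpace (TotalSpace FA A)] [∀ x, AddCommGroup (A x)]
  [∀ x, Module ℝ (A x)] [∀ x, TopologicalSpace (A x)] [FiberBundle FA A] [VectorBundle ℝ FA A]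
  [ContMDiffVectorBundle ∞ FA A 𝓘(ℝ, EM)]
  {lA : LieAlgebroid 𝓘(ℝ, EM) FA A}
  {FV : Type*} [NormedAddCommGroup FV] [NormedSpace ℝ FV] [FiniteDimensional ℝ FV]
  {V : J × M → Type*} [TopologicalSpace (TotalSpace FV V)] [∀ x, AddCommGroup (V x)]
  [∀ x, Module ℝ (V x)] [∀ x, TopologicalSpace (V x)] [FiberBundle FV V] [VectorBundle ℝ FV V]
  [ContMDiffVectorBundle ∞ FV V (𝓘(ℝ, ℝ).prod 𝓘(ℝ, EM))]

/-- A smooth function of time and the chart coordinates, cut off outside of the chart. -/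
lemma contMDiff_cutoff_chart {f : ℝ × EM → ℝ} (hf : ContDiff ℝ ∞ f) {m₁ : M}
    {ρ : C^∞⟮𝓘(ℝ, EM), M; ℝ⟯} (hρ : tsupport ρ ⊆ (chartAt EM m₁).source) :
    ContMDiff (𝓘(ℝ, ℝ).prod 𝓘(ℝ, EM)) 𝓘(ℝ, ℝ) ∞
      (fun p : J × M => ρ p.2 * f (p.1, chartAt EM m₁ p.2)) := by
  intro p
  by_cases hp : p.2 ∈ (chartAt EM m₁).source
  · refine (ρ.contMDiff.comp contMDiff_snd).contMDiffAt.mul ?_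
    have h1 : ContMDiffAt (𝓘(ℝ, ℝ).prod 𝓘(ℝ, EM)) 𝓘(ℝ, ℝ) ∞ (fun p : J × M => (p.1 : ℝ)) p :=
      (contMDiff_subtype_val.comp contMDiff_fst).contMDiffAt
    have h2 : ContMDiffAt (𝓘(ℝ, ℝ).prod 𝓘(ℝ, EM)) 𝓘(ℝ, EM) ∞
        (fun p : J × M => chartAt EM m₁ p.2) p :=
      ((contMDiffOn_chart (I := 𝓘(ℝ, EM)) (x := m₁)).contMDiffAt
        ((chartAt EM m₁).open_source.mem_nhds hp)).comp p contMDiffAt_snd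
    exact hf.contMDiff.contMDiffAt.comp p (h1.prodMk_space h2)
  · have h4 : ∀ᶠ x : J × M in 𝓝 p, ρ x.2 = 0 := by
      have h5 := continuous_snd.continuousAt.preimage_mem_nhds
        ((isClosed_tsupport ρ).isOpen_compl.mem_nhds fun h => hp (hρ h))
      filter_upwards [h5] with x hx
      exact image_eq_zero_of_notMem_tsupport hx
    refine (contMDiffAt_const (c := (0 : ℝ))).congr_of_eventuallyEq ?_
    filter_upwards [h4] with x hx
    rw [hx, zero_mul]

/-- Local existence of solutions of `∇_∂t s = g`, on time intervals of arbitrary length in `J`. -/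
lemma Connection.exists_local_solution (hJ : (J : Set ℝ).OrdConnected)
    (D : Connection (lA.intervalProd J) FV V) (g : Cₛ^∞⟮𝓘(ℝ, ℝ).prod 𝓘(ℝ, EM); FV, V⟯)
    (t₀ : J) {s₀ : ∀ m, V (t₀, m)}
    (hs₀ : ContMDiff 𝓘(ℝ, EM) ((𝓘(ℝ, ℝ).prod 𝓘(ℝ, EM)).prod 𝓘(ℝ, FV)) ∞
      (fun m => (⟨(t₀, m), s₀ m⟩ : TotalSpace FV V))) (t₁ : J) (m₁ : M) :
    ∃ (s : Cₛ^∞⟮𝓘(ℝ, ℝ).prod 𝓘(ℝ, EM); FV, V⟯) (a b : ℝ) (W : Set M), W ∈ 𝓝 m₁ ∧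
      (t₀ : ℝ) ∈ Ioo a b ∧ (t₁ : ℝ) ∈ Ioo a b ∧ (∀ m ∈ W, s (t₀, m) = s₀ m) ∧
      ∀ t : J, (t : ℝ) ∈ Ioo a b → ∀ m ∈ W, D.ddt s (t, m) = g (t, m) := by
  obtain ⟨a, b, q, hq, h₀, h₁, hid⟩ := exists_time_retract hJ t₀ t₁
  obtain ⟨r, hr, hr1⟩ := exists_chart_retract (EM := EM) m₁
  have hqc := hq.continuous
  have hid' : ∀ t : J, (t : ℝ) ∈ Icc a b → q t = t := fun t ht => Subtype.ext (hid t ht)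
  obtain ⟨n, e, κ, ψ, hκ, h1, hψ⟩ := exists_compact_frame (𝓘(ℝ, ℝ).prod 𝓘(ℝ, EM)) FV V
    ((isCompact_Icc (a := a) (b := b)).image (f := fun t => (q t, m₁)) (by fun_prop))
  obtain ⟨ρ, hρ1, hρ⟩ := exists_bump (IM := 𝓘(ℝ, EM))
    ((chartAt EM m₁).open_source.mem_nhds (mem_chart_source EM m₁))
  -- a neighbourhood of the initial point on which everything holds
  obtain ⟨U, W₀, -, hW₀, hU, hmW, hUW⟩ := generalized_tube_lemma
    ((isCompact_Icc (a := a) (b := b)).image hqc) (isCompact_singleton (x := m₁))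
    (n := {p : J × M | ∀ᶠ x in 𝓝 p, ψ x = 1}) isOpen_setOfPred_eventually_nhds (by
      rintro ⟨_, _⟩ ⟨⟨τ, hτ, rfl⟩, rfl⟩
      exact h1 _ ⟨τ, hτ, rfl⟩)
  let W : Set M := {m | m ∈ W₀ ∧ (∀ᶠ x in 𝓝 m, ρ x = 1) ∧ ∀ᶠ x in 𝓝 m, r (chartAt EM m₁ x) = x}
  have hW : W ∈ 𝓝 m₁ := by
    filter_upwards [hW₀.mem_nhds (hmW rfl), hρ1.eventually_nhds, hr1.eventually_nhds]
      with m hm1 hm2 hm3 using ⟨hm1, hm2, hm3⟩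
  have hψ1 : ∀ t : J, (t : ℝ) ∈ Icc a b → ∀ m ∈ W, ψ (t, m) = 1 := fun t ht m hm => by
    have h : ((t, m) : J × M) ∈ U ×ˢ W₀ := ⟨hU ⟨t, ht, hid' t ht⟩, hm.1⟩
    exact (hUW h).self_of_nhds
  -- The system is `x' = C x + d` with `C = -κ (∇_∂t e)` and `d = κ g`. Unlike in the uniqueness
  -- argument, no relation on the coordinates is needed: for any solution `x` the section `∑ x i • e
  -- i` has derivative `g`, whether or not `x` is its coordinate vector.
  let c : Fin n → Fin n → C^∞⟮𝓘(ℝ, ℝ).prod 𝓘(ℝ, EM), J × M; ℝ⟯ := fun i j =>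
    ⟨fun p => - κ i p (D.ddt (e j) p), ((hκ i).comp (D.ddt (e j)).contMDiff).neg⟩
  let d : Fin n → C^∞⟮𝓘(ℝ, ℝ).prod 𝓘(ℝ, EM), J × M; ℝ⟯ := fun i =>
    ⟨fun p => κ i p (g p), (hκ i).comp g.contMDiff⟩
  -- Composition with the retractions `q` and `r` defines the coefficients on all of `ℝ × EM`, where
  -- the global theorem on linear equations applies.
  have hpull : ∀ u : C^∞⟮𝓘(ℝ, ℝ).prod 𝓘(ℝ, EM), J × M; ℝ⟯,
      ContDiff ℝ ∞ (fun p : ℝ × EM => u (q p.1, r p.2)) := fun u => by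
    rw [← contMDiff_iff_contDiff]
    exact u.contMDiff.comp ((hq.comp contDiff_fst.contMDiff).prodMk (hr.comp contDiff_snd.contMDiff))
  let C : ℝ × EM → (Fin n → ℝ) →L[ℝ] (Fin n → ℝ) := fun p =>
    ContinuousLinearMap.pi fun i => ∑ j, c i j (q p.1, r p.2) • ContinuousLinearMap.proj j
  have hCapp : ∀ p x i, C p x i = ∑ j, c i j (q p.1, r p.2) * x j := fun p x i => by simp [C]
  have hC : ContDiff ℝ ∞ C := by
    refine contDiff_clm_apply_iff.2 fun v => contDiff_pi.2 fun i => ?_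
    simp only [hCapp]
    exact ContDiff.sum fun j _ => (hpull (c i j)).mul contDiff_const
  have hx₀ : ContDiff ℝ ∞ (fun (y : EM) (i : Fin n) => κ i (t₀, r y) (s₀ (r y))) := by
    refine contDiff_pi.2 fun i => ?_
    rw [← contMDiff_iff_contDiff]
    exact (hκ i).comp (hs₀.comp hr)
  obtain ⟨x, hx, hx0, hxd⟩ := exists_linearODE_solution hC
    (b := fun p i => d i (q p.1, r p.2)) (contDiff_pi.2 fun i => hpull (d i)) hx₀ t₀
  let y : Fin n → C^∞⟮𝓘(ℝ, ℝ).prod 𝓘(ℝ, EM), J × M; ℝ⟯ := fun i =>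
    ⟨fun p => ρ p.2 * x (p.1, chartAt EM m₁ p.2) i, contMDiff_cutoff_chart
      (f := fun p => x p i) (contDiff_pi.1 hx i) hρ⟩
  have hy : ∀ (t : J), ∀ m ∈ W, ∀ i, y i (t, m) = x (t, chartAt EM m₁ m) i := fun t m hm i => by
    change ρ m * _ = _
    rw [hm.2.1.self_of_nhds, one_mul]
  refine ⟨∑ i, fsmul (y i) (e i), a, b, W, hW, h₀, h₁, fun m hm => ?_, fun t ht m hm => ?_⟩
  · rw [section_sum_apply]
    simp only [fsmul_apply, hy _ m hm, hx0]
    have h2 := hψ (t₀, m) (s₀ m)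
    rw [hψ1 t₀ (Ioo_subset_Icc_self h₀) m hm, one_smul] at h2
    rw [h2, hm.2.2.self_of_nhds]
  · have ht' := Ioo_subset_Icc_self ht
    have hdy : ∀ i, timeDerivFun (y i) (t, m) =
        ∑ j, c i j (t, m) * y j (t, m) + κ i (t, m) (g (t, m)) := fun i => by
      have h2 := hasDerivAt_slice (y i) t m (q := q) (by
        filter_upwards [Ioo_mem_nhds ht.1 ht.2] with τ hτ using hid τ (Ioo_subset_Icc_self hτ))
      have h3 := (hasDerivAt_pi.1 (hxd t (chartAt EM m₁ m))) i
      have h4 : (fun τ => y i (q τ, m)) =ᶠ[𝓝 (t : ℝ)] fun τ => x (τ, chartAt EM m₁ m) i := by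
        filter_upwards [Ioo_mem_nhds ht.1 ht.2] with τ hτ
        rw [hy _ m hm, hid τ (Ioo_subset_Icc_self hτ)]
      have h5 := h2.unique (h3.congr_of_eventuallyEq h4)
      rw [h5, Pi.add_apply, hCapp, hm.2.2.self_of_nhds, hid' t ht']
      simp only [hy _ m hm]
      rfl
    rw [map_sum, section_sum_apply]
    simp only [D.ddt_fsmul, hdy, add_smul, Finset.sum_add_distrib]
    have hψt := hψ1 t ht' m hm
    have h6 : ∑ i, κ i (t, m) (g (t, m)) • e i (t, m) = g (t, m) := by
      rw [← hψ, hψt, one_smul]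
    have h7 : ∑ i, (∑ j, c i j (t, m) * y j (t, m)) • e i (t, m) =
        - ∑ j, y j (t, m) • D.ddt (e j) (t, m) := by
      simp only [Finset.sum_smul]
      rw [Finset.sum_comm, ← Finset.sum_neg_distrib]
      refine Finset.sum_congr rfl fun j _ => ?_
      have h8 := hψ (t, m) (D.ddt (e j) (t, m))
      rw [hψt, one_smul] at h8
      rw [h8, Finset.smul_sum, ← Finset.sum_neg_distrib]
      refine Finset.sum_congr rfl fun i _ => ?_
      change (- κ i (t, m) (D.ddt (e j) (t, m)) * y j (t, m)) • _ = _
      module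
    rw [h6, h7]
    abel

/-- Existence of solutions of `∇_∂t s = g` with given initial values at time `t₀`. -/
theorem Connection.exists_solution (hJ : (J : Set ℝ).OrdConnected)
    (D : Connection (lA.intervalProd J) FV V) (g : Cₛ^∞⟮𝓘(ℝ, ℝ).prod 𝓘(ℝ, EM); FV, V⟯)
    (t₀ : J) {s₀ : ∀ m, V (t₀, m)}
    (hs₀ : ContMDiff 𝓘(ℝ, EM) ((𝓘(ℝ, ℝ).prod 𝓘(ℝ, EM)).prod 𝓘(ℝ, FV)) ∞
      (fun m => (⟨(t₀, m), s₀ m⟩ : TotalSpace FV V))) :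
    ∃ s : Cₛ^∞⟮𝓘(ℝ, ℝ).prod 𝓘(ℝ, EM); FV, V⟯, D.ddt s = g ∧ ∀ m, s (t₀, m) = s₀ m := by
  choose σ a b W hW h₀ h₁ hi hd using D.exists_local_solution hJ g t₀ hs₀
  -- All the time intervals contain `t₀`, so local solutions agree on overlaps by uniqueness. The
  -- diagonal choice `σ t m (t, m)` therefore coincides near each point with a single local
  -- solution, which makes it smooth and a solution.
  have key : ∀ t₁ m₁, ∀ (t : J), (t : ℝ) ∈ Ioo (a t₁ m₁) (b t₁ m₁) → ∀ m ∈ W t₁ m₁,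
      σ t m (t, m) = σ t₁ m₁ (t, m) := by
    intro t₁ m₁ t ht m hm
    have hm' : m ∈ W t m := mem_of_mem_nhds (hW t m)
    have h := D.eq_zero_of_ddt_eq_zero hJ (s := σ t m - σ t₁ m₁) (m := m) (t₀ := t₀) (t₁ := t)
      (a := max (a t m) (a t₁ m₁)) (b := min (b t m) (b t₁ m₁))
      ⟨max_lt (h₀ _ _).1 (h₀ _ _).1, lt_min (h₀ _ _).2 (h₀ _ _).2⟩
      ⟨max_lt (h₁ _ _).1 ht.1, lt_min (h₁ _ _).2 ht.2⟩ (fun τ hτ => by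
        have e1 := hd t m τ ⟨(le_max_left _ _).trans_lt hτ.1, hτ.2.trans_le (min_le_left _ _)⟩ m hm'
        have e2 := hd t₁ m₁ τ
          ⟨(le_max_right _ _).trans_lt hτ.1, hτ.2.trans_le (min_le_right _ _)⟩ m hm
        rw [map_sub]
        exact (congrArg₂ (· - ·) e1 e2).trans (sub_self _))
      ((congrArg₂ (· - ·) (hi t m m hm') (hi t₁ m₁ m hm)).trans (sub_self _))
    exact sub_eq_zero.1 h
  have hnear : ∀ t₁ m₁, ∀ᶠ p : J × M in 𝓝 (t₁, m₁), σ p.1 p.2 p = σ t₁ m₁ p := by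
    intro t₁ m₁
    have hc : ContinuousAt (fun t : J => (t : ℝ)) t₁ := by fun_prop
    have hI := hc.preimage_mem_nhds (Ioo_mem_nhds (h₁ t₁ m₁).1 (h₁ t₁ m₁).2)
    filter_upwards [prod_mem_nhds hI (hW t₁ m₁)] with p hp
    exact key t₁ m₁ p.1 hp.1 p.2 hp.2
  let s : Cₛ^∞⟮𝓘(ℝ, ℝ).prod 𝓘(ℝ, EM); FV, V⟯ := ⟨fun p => σ p.1 p.2 p, fun p => by
    refine ((σ p.1 p.2).contMDiff p).congr_of_eventuallyEq ?_
    filter_upwards [hnear p.1 p.2] with x hx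
    rw [hx]⟩
  refine ⟨s, ContMDiffSection.ext fun p => ?_, fun m => ?_⟩
  · have h : D.ddt s p = D.ddt (σ p.1 p.2) p := D.congr_right _ (hnear p.1 p.2)
    rw [h]
    exact hd p.1 p.2 p.1 (h₁ _ _) p.2 (mem_of_mem_nhds (hW _ _))
  · exact hi t₀ m m (mem_of_mem_nhds (hW _ _))

/-- Sections with the same `∇_∂t` along `J × {m}` and the same value at one point of it agree
along it. -/
lemma Connection.eq_of_ddt_eq (hJ : (J : Set ℝ).OrdConnected)
    (D : Connection (lA.intervalProd J) FV V) {s s' : Cₛ^∞⟮𝓘(ℝ, ℝ).prod 𝓘(ℝ, EM); FV, V⟯} {m : M}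
    {t₀ : J} (hD : ∀ t : J, D.ddt s (t, m) = D.ddt s' (t, m)) (hs : s (t₀, m) = s' (t₀, m))
    (t : J) : s (t, m) = s' (t, m) := by
  refine sub_eq_zero.1 (D.eq_zero_of_ddt_eq_zero hJ (s := s - s') (t₀ := t₀)
    (a := min (t₀ : ℝ) t - 1) (b := max (t₀ : ℝ) t + 1)
    ⟨?_, ?_⟩ ⟨?_, ?_⟩ (fun τ _ => ?_) (sub_eq_zero.2 hs))
  · linarith [min_le_left (t₀ : ℝ) t]
  · linarith [le_max_left (t₀ : ℝ) t]
  · linarith [min_le_right (t₀ : ℝ) t]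
  · linarith [le_max_right (t₀ : ℝ) t]
  · rw [map_sub]
    exact sub_eq_zero.2 (hD τ)

end ParallelExistence

/-! ### Signed sums over deleted arguments of alternating maps -/

section Alternating

variable {V W : Type*} [AddCommGroup V] [Module ℝ V] [AddCommGroup W] [Module ℝ W]

lemma map_sum_smul {k n : ℕ} (α : V [⋀^Fin k]→ₗ[ℝ] W) (c : Fin k → Fin n → ℝ)
    (w : Fin k → Fin n → V) :
    α (fun i => ∑ q, c i q • w i q) =
      ∑ r : Fin k → Fin n, (∏ i, c i (r i)) • α (fun i => w i (r i)) := by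
  refine (α.toMultilinearMap.map_sum (fun i q => c i q • w i q)).trans ?_
  exact Finset.sum_congr rfl fun r _ =>
    α.toMultilinearMap.map_smul_univ (fun i => c i (r i)) (fun i => w i (r i))

/-- On `V × ℝ` alternatize the map that multiplies `α` of the first components by the real component
of the remaining argument. With `(X, 1)` at the places `i` and `j` and `(a r, 0)` elsewhere the
result is zero, because two arguments coincide, and only the terms deleting `i` or `j` survive. -/
lemma map_update_succAbove_swap {k : ℕ} (α : V [⋀^Fin k]→ₗ[ℝ] W) (a : Fin (k + 1) → V) (X : V)
    {i j : Fin (k + 1)} (hij : i ≠ j) :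
    (-1 : ℝ) ^ (j : ℕ) • α (fun l => Function.update a i X (j.succAbove l)) =
      - ((-1 : ℝ) ^ (i : ℕ) • α (fun l => Function.update a j X (i.succAbove l))) := by
  let f : (V × ℝ) →ₗ[ℝ] (V × ℝ) [⋀^Fin k]→ₗ[ℝ] W :=
    (LinearMap.snd ℝ V ℝ).smulRight (α.compLinearMap (LinearMap.fst ℝ V ℝ))
  let w : Fin (k + 1) → V × ℝ := fun r => if r = i ∨ r = j then (X, 1) else (a r, 0)
  have h0 : AlternatingMap.alternatizeUncurryFin f w = 0 :=
    AlternatingMap.map_eq_zero_of_eq _ w (i := i) (j := j) (by simp [w]) hij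
  rw [AlternatingMap.alternatizeUncurryFin_apply] at h0
  have h1 : ∀ r, f (w r) (r.removeNth w) = (w r).2 • α (fun l => (w (r.succAbove l)).1) :=
    fun r => rfl
  simp only [h1] at h0
  rw [← Finset.sum_subset (Finset.subset_univ {i, j}) (fun r _ hr => by
    have : (w r).2 = 0 := by
      simp only [Finset.mem_insert, Finset.mem_singleton] at hr
      simp [w, hr]
    simp [this]), Finset.sum_pair hij] at h0
  have h2 : (fun l => (w (i.succAbove l)).1) = fun l => Function.update a j X (i.succAbove l) := by
    funext l
    have : i.succAbove l ≠ i := Fin.succAbove_ne i l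
    by_cases h : i.succAbove l = j <;> simp [w, h, this]
  have h3 : (fun l => (w (j.succAbove l)).1) = fun l => Function.update a i X (j.succAbove l) := by
    funext l
    have : j.succAbove l ≠ j := Fin.succAbove_ne j l
    by_cases h : j.succAbove l = i <;> simp [w, h, this]
  rw [h2, h3] at h0
  have h4 : (w i).2 = 1 := by simp [w]
  have h5 : (w j).2 = 1 := by simp [w]
  rw [h4, h5, one_smul, one_smul] at h0
  simp only [← Int.cast_smul_eq_zsmul ℝ] at h0
  push_cast at h0
  exact eq_neg_of_add_eq_zero_right h0

/-- The replacement of the `i`-th argument by `X` after deletion of the `j`-th one. -/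
def replaceTerm {k : ℕ} (α : V [⋀^Fin k]→ₗ[ℝ] W) (a : Fin (k + 1) → V)
    (X : Fin (k + 1) → Fin (k + 1) → V) (j i : Fin (k + 1)) : W :=
  if i = j then 0 else
    (-1 : ℝ) ^ (j : ℕ) • α (fun l => Function.update a i (X j i) (j.succAbove l))

lemma sum_replaceTerm {k : ℕ} (α : V [⋀^Fin k]→ₗ[ℝ] W) (a : Fin (k + 1) → V)
    (X : Fin (k + 1) → Fin (k + 1) → V) (j : Fin (k + 1)) :
    ∑ i, replaceTerm α a X j i = (-1 : ℝ) ^ (j : ℕ) • ∑ l, α (Function.update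
      (fun i => a (j.succAbove i)) l (X j (j.succAbove l))) := by
  rw [Fin.sum_univ_succAbove _ j, Finset.smul_sum]
  have : replaceTerm α a X j j = 0 := if_pos rfl
  rw [this, zero_add]
  refine Finset.sum_congr rfl fun l _ => ?_
  rw [replaceTerm, if_neg (Fin.succAbove_ne j l)]
  congr 2
  funext i
  by_cases h : i = l
  · subst h; simp
  · rw [Function.update_of_ne h, Function.update_of_ne fun h' => h (Fin.succAbove_right_injective h')]

lemma replaceTerm_swap {k : ℕ} (α : V [⋀^Fin k]→ₗ[ℝ] W) (a : Fin (k + 1) → V)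
    (X : Fin (k + 1) → Fin (k + 1) → V) (j i : Fin (k + 1)) :
    replaceTerm α a X j i = - replaceTerm α a (fun i j => X j i) i j := by
  unfold replaceTerm
  by_cases h : i = j
  · simp [h]
  · rw [if_neg h, if_neg (Ne.symm h)]
    exact map_update_succAbove_swap α a (X j i) h

/-- Exchanging the deleted and the replaced index changes the sign of a term, so for symmetric `X`
the double sum is its own negative. This removes the derivatives of coefficients from the
differential of a pulled back form. -/
lemma sum_update_eq_zero_of_symm {k : ℕ} (α : V [⋀^Fin k]→ₗ[ℝ] W) (a : Fin (k + 1) → V)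
    {X : Fin (k + 1) → Fin (k + 1) → V} (hX : ∀ i j, X i j = X j i) :
    ∑ j : Fin (k + 1), (-1 : ℝ) ^ (j : ℕ) • ∑ l, α (Function.update
      (fun i => a (j.succAbove i)) l (X j (j.succAbove l))) = 0 := by
  have hX' : (fun i j => X j i) = X := by funext i j; exact hX j i
  simp only [← sum_replaceTerm]
  have h : ∑ j, ∑ i, replaceTerm α a X j i = - ∑ j, ∑ i, replaceTerm α a X j i := by
    conv_lhs => rw [Finset.sum_comm]
    simp only [← Finset.sum_neg_distrib]
    refine Finset.sum_congr rfl fun i _ => Finset.sum_congr rfl fun j _ => ?_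
    rw [replaceTerm_swap, hX']
  have h' : (2 : ℝ) • ∑ j, ∑ i, replaceTerm α a X j i = 0 := by
    rw [two_smul]
    exact add_eq_zero_iff_eq_neg.2 h
  exact (smul_eq_zero.1 h').resolve_left two_ne_zero

/-- For antisymmetric `X` the term deleting `j` and replacing `i` is symmetric in `i` and `j` and
zero on the diagonal, so the sum over `j < i` is half of the full sum. The overall sign arises
because for `j < i` the replaced argument stands at place `i - 1` once `j` is deleted, and is moved
from there to the front. -/
lemma sum_update_eq_sum_lt {k : ℕ} (α : V [⋀^Fin (k + 1)]→ₗ[ℝ] W) (a : Fin (k + 2) → V)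
    {X : Fin (k + 2) → Fin (k + 2) → V} (hX : ∀ i j, X i j = - X j i) :
    ∑ j : Fin (k + 2), ∑ l : Fin (k + 1), (if j < j.succAbove l then
        (-1 : ℝ) ^ ((j : ℕ) + (j.succAbove l : ℕ)) •
          α (Fin.cons (X j (j.succAbove l)) (fun i => a (j.succAbove (l.succAbove i))) :
            Fin (k + 1) → V) else 0) =
      - (1 / 2 : ℝ) • ∑ j : Fin (k + 2), (-1 : ℝ) ^ (j : ℕ) • ∑ l, α (Function.update
        (fun i => a (j.succAbove i)) l (X j (j.succAbove l))) := by
  have hneg : ∀ i j, replaceTerm α a (fun i j => X j i) i j = - replaceTerm α a X i j := by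
    intro i j
    unfold replaceTerm
    split_ifs with h
    · simp
    · have e : (fun l => Function.update a j (X j i) (i.succAbove l)) =
          fun l => Function.update a j (-X i j) (i.succAbove l) := by rw [hX j i]
      rw [e]
      obtain ⟨l, rfl⟩ := Fin.exists_succAbove_eq h
      have e2 : ∀ Y, (fun r => Function.update a (i.succAbove l) Y (i.succAbove r)) =
          Function.update (fun r => a (i.succAbove r)) l Y := by
        intro Y
        funext r
        by_cases h : r = l
        · subst h; simp
        · rw [Function.update_of_ne h,
            Function.update_of_ne fun h' => h (Fin.succAbove_right_injective h')]
      rw [e2, e2, α.map_update_neg, smul_neg]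
  have hsymm : ∀ i j, replaceTerm α a X i j = replaceTerm α a X j i := fun i j => by
    rw [replaceTerm_swap, hneg, neg_neg]
  have hdiag : ∀ i, replaceTerm α a X i i = 0 := fun i => if_pos rfl
  simp only [← sum_replaceTerm]
  have h1 : ∀ (j : Fin (k + 2)) (l : Fin (k + 1)), (if j < j.succAbove l then (-1 : ℝ) ^ ((j : ℕ) + (j.succAbove l : ℕ)) •
          α (Fin.cons (X j (j.succAbove l)) (fun i => a (j.succAbove (l.succAbove i))) :
            Fin (k + 1) → V) else 0) =
      - (if j < j.succAbove l then replaceTerm α a X j (j.succAbove l) else 0) := by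
    intro j l
    split_ifs with h
    · have hl : ((j.succAbove l : Fin (k + 2)) : ℕ) = l + 1 := by
        rw [Fin.succAbove_of_le_castSucc _ _ ((Fin.lt_succAbove_iff_le_castSucc _ _).1 h)]
        simp
      rw [replaceTerm, if_neg (Fin.succAbove_ne j l)]
      have e2 : (fun r => Function.update a (j.succAbove l) (X j (j.succAbove l)) (j.succAbove r)) =
          l.insertNth (X j (j.succAbove l)) (fun i => a (j.succAbove (l.succAbove i))) := by
        funext r
        refine Fin.succAboveCases l ?_ (fun r => ?_) r
        · simp
        · rw [Fin.insertNth_apply_succAbove, Function.update_of_ne fun h' =>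
            Fin.succAbove_ne l r (Fin.succAbove_right_injective h')]
      rw [e2, hl]
      have h3 := α.map_insertNth l (X j (j.succAbove l))
        (fun i => a (j.succAbove (l.succAbove i)))
      rw [← Int.cast_smul_eq_zsmul ℝ] at h3
      push_cast at h3
      rw [h3, smul_smul, ← neg_smul]
      have e3 : (-1 : ℝ) ^ ((l : ℕ) + l) = 1 := (Even.add_self _).neg_one_pow
      rw [show (-1 : ℝ) ^ ((j : ℕ) + (l + 1)) = -((-1 : ℝ) ^ (j : ℕ) * (-1 : ℝ) ^ (l : ℕ)) by ring]
      rfl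
    · simp
  simp only [h1, Finset.sum_neg_distrib, neg_smul]
  congr 1
  have h2 : ∀ j : Fin (k + 2), ∑ l, (if j < j.succAbove l then replaceTerm α a X j (j.succAbove l) else 0) =
      ∑ i, (if j < i then replaceTerm α a X j i else 0) := fun j => by
    rw [Fin.sum_univ_succAbove _ j]; simp
  simp only [h2]
  have h3 : ∑ j, ∑ i, replaceTerm α a X j i =
      ∑ j, ∑ i, (if j < i then replaceTerm α a X j i else 0) +
        ∑ j, ∑ i, (if i < j then replaceTerm α a X j i else 0) := by
    simp only [← Finset.sum_add_distrib]
    refine Finset.sum_congr rfl fun j _ => Finset.sum_congr rfl fun i _ => ?_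
    rcases lt_trichotomy i j with h | rfl | h
    · simp [h, h.not_gt]
    · simp [hdiag]
    · simp [h, h.not_gt]
  have h4 : ∑ j, ∑ i, (if i < j then replaceTerm α a X j i else 0) =
      ∑ j, ∑ i, (if j < i then replaceTerm α a X j i else 0) := by
    rw [Finset.sum_comm]
    refine Finset.sum_congr rfl fun j _ => Finset.sum_congr rfl fun i _ => ?_
    rw [hsymm]
  rw [h3, h4, ← two_smul ℝ, smul_smul]
  norm_num

/-- A multi-index on `k + 1` places is its entry at `j` and a multi-index on the others. This
separates the direction of differentiation from the arguments of the form. -/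
lemma sum_fun_succAbove {k n : ℕ} (j : Fin (k + 1)) (c : Fin (k + 1) → Fin n → ℝ)
    (T : Fin n → (Fin k → Fin n) → W) :
    ∑ R : Fin (k + 1) → Fin n, (∏ i, c i (R i)) • T (R j) (fun i => R (j.succAbove i)) =
      ∑ p, ∑ r : Fin k → Fin n, (c j p * ∏ i, c (j.succAbove i) (r i)) • T p r := by
  rw [← Equiv.sum_comp (Fin.insertNthEquiv (fun _ => Fin n) j), Fintype.sum_prod_type]
  refine Finset.sum_congr rfl fun p _ => Finset.sum_congr rfl fun r _ => ?_
  rw [Fin.prod_univ_succAbove _ j]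
  simp [Fin.insertNthEquiv]

end Alternating

/-! ### The Koszul formula at a point -/

section KoszulApply

variable {EM HM M : Type*} [NormedAddCommGroup EM] [NormedSpace ℝ EM] [TopologicalSpace HM]
  {IM : ModelWithCorners ℝ EM HM} [TopologicalSpace M] [ChartedSpace HM M] [IsManifold IM ∞ M]
  {FA : Type*} [NormedAddCommGroup FA] [NormedSpace ℝ FA]
  {A : M → Type*} [TopologicalSpace (TotalSpace FA A)] [∀ x, AddCommGroup (A x)]
  [∀ x, Module ℝ (A x)] [∀ x, TopologicalSpace (A x)] [FiberBundle FA A] [VectorBundle ℝ FA A]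
  {FV : Type*} [NormedAddCommGroup FV] [NormedSpace ℝ FV]
  {V : M → Type*} [TopologicalSpace (TotalSpace FV V)] [∀ x, AddCommGroup (V x)]
  [∀ x, Module ℝ (V x)] [∀ x, TopologicalSpace (V x)] [FiberBundle FV V] [VectorBundle ℝ FV V]
  {lA : LieAlgebroid IM FA A}

/-- The value of a form at a point. -/
def Form.at {k : ℕ} (α : Form IM FA A FV V k) (m : M) : A m [⋀^Fin k]→ₗ[ℝ] V m := α.1 m

/-- Half the sum over all pairs removes the ordering of the indices and the case distinction on the
degree. Each bracket now sits in the slot of its second entry, so that the bracket with `a j` acts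
like a derivation on the other arguments. -/
lemma LieAlgebroid.koszulBracket_apply (lA : LieAlgebroid IM FA A) {k : ℕ}
    (α : Form IM FA A FV V k) (a : Fin (k + 1) → Cₛ^∞⟮IM; FA, A⟯) (m : M) :
    lA.koszulBracket α a m = - (1 / 2 : ℝ) • ∑ j : Fin (k + 1), (-1 : ℝ) ^ (j : ℕ) •
      ∑ l, α.at m (Function.update (fun i => a (j.succAbove i) m) l
        (lA.bracket (a j) (a (j.succAbove l)) m)) := by
  cases k with
  | zero => simp [LieAlgebroid.koszulBracket]
  | succ k =>
    rw [← sum_update_eq_sum_lt (α.at m) (fun i => a i m)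
      (X := fun i j => lA.bracket (a i) (a j) m) (fun i j => by
        rw [lA.bracket_symm]; rfl), LieAlgebroid.koszulBracket, section_sum_apply]
    refine Finset.sum_congr rfl fun j _ => ?_
    rw [section_sum_apply]
    refine Finset.sum_congr rfl fun l _ => ?_
    split_ifs
    · have : (fun i => (Fin.cons (lA.bracket (a j) (a (j.succAbove l)))
          (fun i => a (j.succAbove (l.succAbove i))) : Fin (k + 1) → Cₛ^∞⟮IM; FA, A⟯) i m) =
        (Fin.cons (lA.bracket (a j) (a (j.succAbove l)) m)
          (fun i => a (j.succAbove (l.succAbove i)) m) : Fin (k + 1) → A m) := by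
        funext i
        refine Fin.cases ?_ (fun i => ?_) i <;> simp
      rw [← this]
      rfl
    · rfl

/-- The Koszul formula with the bracket terms written as derivations. -/
lemma Connection.koszul_apply (D : Connection lA FV V) {k : ℕ}
    (α : Form IM FA A FV V k) (a : Fin (k + 1) → Cₛ^∞⟮IM; FA, A⟯) (m : M) :
    D.koszul k α a m = ∑ j : Fin (k + 1), (-1 : ℝ) ^ (j : ℕ) •
      (D.toFun (a j) (α.eval fun i => a (j.succAbove i)) m - (1 / 2 : ℝ) •
        ∑ l, α.at m (Function.update (fun i => a (j.succAbove i) m) l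
          (lA.bracket (a j) (a (j.succAbove l)) m))) := by
  have h : D.koszul k α a m = (∑ j : Fin (k + 1), (-1 : ℝ) ^ (j : ℕ) •
    D.toFun (a j) (α.eval fun i => a (j.succAbove i))) m + lA.koszulBracket α a m := rfl
  rw [h, section_sum_apply, lA.koszulBracket_apply, neg_smul, ← sub_eq_add_neg, Finset.smul_sum,
    ← Finset.sum_sub_distrib]
  refine Finset.sum_congr rfl fun j _ => ?_
  rw [smul_sub, smul_comm]
  rfl

/-- The product rule, with an `update` marking the differentiated factor, to match the multilinear
expansion of a form with one argument replaced. -/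
lemma dirDeriv_prod_fin {ι : Type*} [Fintype ι] [DecidableEq ι] (f : ι → C^∞⟮IM, M; ℝ⟯) (m : M)
    (v : TangentSpace IM m) :
    dirDeriv IM (fun x => ∏ i, f i x) m v =
      ∑ l, ∏ i, Function.update (fun i => f i m) l (dirDeriv IM (f l) m v) i := by
  have key : ∀ S : Finset ι, dirDeriv IM (fun x => ∏ i ∈ S, f i x) m v =
      ∑ l ∈ S, (∏ i ∈ S.erase l, f i m) * dirDeriv IM (f l) m v := by
    intro S
    induction S using Finset.induction_on with
    | empty => simpa using dirDeriv_const 1 m v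
    | insert a S ha ih =>
      have h1 : MDifferentiableAt IM 𝓘(ℝ, ℝ) (fun x => ∏ i ∈ S, f i x) m :=
        (contMDiff_finsetProd (n := ∞) fun i _ => (f i).contMDiff).mdifferentiableAt (by simp)
      have h2 : MDifferentiableAt IM 𝓘(ℝ, ℝ) (f a) m :=
        (f a).contMDiff.mdifferentiableAt (by simp)
      simp only [Finset.prod_insert ha, Finset.sum_insert ha]
      rw [dirDeriv_mul h2 h1, ih, Finset.erase_insert ha, add_comm, Finset.mul_sum]
      congr 1
      refine Finset.sum_congr rfl fun l hl => ?_
      have hne : a ≠ l := fun h => ha (h ▸ hl)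
      rw [Finset.erase_insert_of_ne hne, Finset.prod_insert (by simp [ha]), mul_assoc]
  rw [key]
  refine Finset.sum_congr rfl fun l _ => ?_
  rw [Finset.prod_update_of_mem (Finset.mem_univ l), mul_comm, Finset.sdiff_singleton_eq_erase]

end KoszulApply

/-! ### The Koszul differential of a pulled back form -/

section PullbackKoszul

variable {EM HM M : Type*} [NormedAddCommGroup EM] [NormedSpace ℝ EM] [TopologicalSpace HM]
  {IM : ModelWithCorners ℝ EM HM} [TopologicalSpace M] [ChartedSpace HM M] [IsManifold IM ∞ M]
  {EN HN N : Type*} [NormedAddCommGroup EN] [NormedSpace ℝ EN] [TopologicalSpace HN]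
  {IN : ModelWithCorners ℝ EN HN} [TopologicalSpace N] [ChartedSpace HN N] [IsManifold IN ∞ N]
  {FA : Type*} [NormedAddCommGroup FA] [NormedSpace ℝ FA]
  {A : M → Type*} [TopologicalSpace (TotalSpace FA A)] [∀ x, AddCommGroup (A x)]
  [∀ x, Module ℝ (A x)] [∀ x, TopologicalSpace (A x)] [FiberBundle FA A] [VectorBundle ℝ FA A]
  {FB : Type*} [NormedAddCommGroup FB] [NormedSpace ℝ FB] [FiniteDimensional ℝ FB]
  {B : N → Type*} [TopologicalSpace (TotalSpace FB B)] [∀ x, AddCommGroup (B x)]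
  [∀ x, Module ℝ (B x)] [∀ x, TopologicalSpace (B x)] [FiberBundle FB B] [VectorBundle ℝ FB B]
  [ContMDiffVectorBundle ∞ FB B IN]
  {FE : Type*} [NormedAddCommGroup FE] [NormedSpace ℝ FE] [FiniteDimensional ℝ FE]
  {E : N → Type*} [TopologicalSpace (TotalSpace FE E)] [∀ x, AddCommGroup (E x)]
  [∀ x, Module ℝ (E x)] [∀ x, TopologicalSpace (E x)] [FiberBundle FE E] [VectorBundle ℝ FE E]
  [ContMDiffVectorBundle ∞ FE E IN]
  [FiniteDimensional ℝ EN] [T2Space N]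
  {lA : LieAlgebroid IM FA A} {lB : LieAlgebroid IN FB B}

/-- The value of the pullback connection on a pullback section, for a direction which is a
combination of pullback sections. -/
lemma Connection.pullback_apply_sum (D : Connection lB FE E) (Φ : AnchoredHom lA lB) {n : ℕ}
    (a : Cₛ^∞⟮IM; FA, A⟯) (e : Cₛ^∞⟮IN; FE, E⟯) (c : Fin n → ℝ) (b : Fin n → Cₛ^∞⟮IN; FB, B⟯)
    (m : M) (h : Φ.fiber m (a m) = ∑ p, c p • b p (Φ.base m)) :
    ((D.pullback Φ).toFun a (pullbackSection Φ.base e) m : E (Φ.base m)) =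
      ∑ p, c p • D.toFun (b p) e (Φ.base m) := by
  have h1 := D.pullback_apply Φ a e (∑ p, c p • b p) m (by rw [h, section_sum_apply]; rfl)
  refine h1.trans ?_
  rw [map_sum, LinearMap.sum_apply, section_sum_apply]
  refine Finset.sum_congr rfl fun p _ => ?_
  rw [map_smul]
  rfl

/-- The covariant derivative of a contraction of a pulled back form. -/
lemma Connection.pullback_toFun_eval (D : Connection lB FE E) (Φ : AnchoredHom lA lB) {k n : ℕ}
    (α : Form IN FB B FE E k) (a₀ : Cₛ^∞⟮IM; FA, A⟯) (a : Fin k → Cₛ^∞⟮IM; FA, A⟯)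
    (c : Fin n → ℝ) (f : Fin k → Fin n → C^∞⟮IM, M; ℝ⟯) (b : Fin n → Cₛ^∞⟮IN; FB, B⟯) (m : M)
    (h₀ : Φ.fiber m (a₀ m) = ∑ p, c p • b p (Φ.base m))
    (h : ∀ i x, Φ.fiber x (a i x) = ∑ p, f i p x • b p (Φ.base x)) :
    ((D.pullback Φ).toFun a₀ ((Φ.pullbackForm k α).eval a) m : E (Φ.base m)) =
      ∑ p, ∑ r : Fin k → Fin n, (c p * ∏ i, f i (r i) m) •
          D.toFun (b p) (α.eval fun i => b (r i)) (Φ.base m) +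
        ∑ l, α.at (Φ.base m) (Function.update (fun i => Φ.fiber m (a i m)) l
          (∑ p, dirDeriv IM (f l p) m (lA.anchor m (a₀ m)) • b p (Φ.base m))) := by
  let G : (Fin k → Fin n) → C^∞⟮IM, M; ℝ⟯ := fun r =>
    ⟨fun x => ∏ i, f i (r i) x, contMDiff_finsetProd fun i _ => (f i (r i)).contMDiff⟩
  have h1 : (Φ.pullbackForm k α).eval a = ∑ r : Fin k → Fin n,
      fsmul (G r) (pullbackSection Φ.base (α.eval fun i => b (r i))) := by
    ext x
    rw [section_sum_apply]
    have e1 : (Φ.pullbackForm k α).eval a x = α.at (Φ.base x) (fun i => Φ.fiber x (a i x)) := rfl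
    rw [e1, show (fun i => Φ.fiber x (a i x)) = fun i => ∑ p, f i p x • b p (Φ.base x) from
      funext fun i => h i x]
    exact map_sum_smul _ _ _
  rw [h1, map_sum, section_sum_apply]
  have h2 : ∀ r, ((D.pullback Φ).toFun a₀ (fsmul (G r)
      (pullbackSection Φ.base (α.eval fun i => b (r i)))) m : E (Φ.base m)) =
      ∑ p, (c p * ∏ i, f i (r i) m) • D.toFun (b p) (α.eval fun i => b (r i)) (Φ.base m) +
      ∑ l, (∏ i, Function.update (fun i => f i (r i) m) l
        (dirDeriv IM (f l (r l)) m (lA.anchor m (a₀ m))) i) •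
          α.at (Φ.base m) (fun i => b (r i) (Φ.base m)) := by
    intro r
    refine ((D.pullback Φ).leibniz _ _ _ _).trans ?_
    have e2 := D.pullback_apply_sum Φ a₀ (α.eval fun i => b (r i)) c b m h₀
    have e3 := dirDeriv_prod_fin (fun i => f i (r i)) m (lA.anchor m (a₀ m))
    rw [← Finset.sum_smul, ← e3]
    refine congrArg₂ (fun x y : E (Φ.base m) => x + y) ?_ rfl
    refine (congrArg (fun x : E (Φ.base m) => (∏ i, f i (r i) m) • x) e2).trans ?_
    rw [Finset.smul_sum]
    refine Finset.sum_congr rfl fun p _ => ?_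
    rw [smul_smul, mul_comm]
  refine (show _ = ∑ r : Fin k → Fin n,
      (∑ p, (c p * ∏ i, f i (r i) m) • D.toFun (b p) (α.eval fun i => b (r i)) (Φ.base m) +
      ∑ l, (∏ i, Function.update (fun i => f i (r i) m) l
        (dirDeriv IM (f l (r l)) m (lA.anchor m (a₀ m))) i) •
          α.at (Φ.base m) (fun i => b (r i) (Φ.base m))) from
    Finset.sum_congr rfl fun r _ => h2 r).trans ?_
  rw [Finset.sum_add_distrib, Finset.sum_comm]
  congr 1
  rw [Finset.sum_comm]
  refine Finset.sum_congr rfl fun l _ => ?_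
  -- Summed over all multi-indices, the product rule terms are the expansion of the form with its
  -- `l`-th argument replaced by the combination with differentiated coefficients.
  have e4 : Function.update (fun i => Φ.fiber m (a i m)) l
      (∑ p, dirDeriv IM (f l p) m (lA.anchor m (a₀ m)) • b p (Φ.base m)) =
      fun i => ∑ p, Function.update (fun i p => f i p m) l
        (fun p => dirDeriv IM (f l p) m (lA.anchor m (a₀ m))) i p • b p (Φ.base m) := by
    funext i
    by_cases hi : i = l
    · subst hi; simp
    · simp [Function.update_of_ne hi, h]
  rw [e4, map_sum_smul]
  refine Finset.sum_congr rfl fun r _ => ?_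
  congr 1
  refine Finset.prod_congr rfl fun i _ => ?_
  by_cases hi : i = l
  · subst hi; simp
  · simp [Function.update_of_ne hi]

/-- Expansion of a bracket term in combinations of sections. -/
lemma sum_update_bracket {k n : ℕ} {U W : Type*} [AddCommGroup U] [Module ℝ U] [AddCommGroup W]
    [Module ℝ W] (α : U [⋀^Fin k]→ₗ[ℝ] W) (c₀ : Fin n → ℝ) (c : Fin k → Fin n → ℝ) (b : Fin n → U)
    (X : Fin n → Fin n → U) (l : Fin k) :
    α (Function.update (fun i => ∑ p, c i p • b p) l (∑ p, ∑ q, (c₀ p * c l q) • X p q)) =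
      ∑ p, ∑ r : Fin k → Fin n, (c₀ p * ∏ i, c i (r i)) •
        α (Function.update (fun i => b (r i)) l (X p (r l))) := by
  rw [α.map_update_sum]
  refine Finset.sum_congr rfl fun p _ => ?_
  have h1 : ∑ q, (c₀ p * c l q) • X p q = c₀ p • ∑ q, c l q • X p q := by
    rw [Finset.smul_sum]
    exact Finset.sum_congr rfl fun q _ => mul_smul _ _ _
  have h2 : Function.update (fun i => ∑ p, c i p • b p) l (∑ q, c l q • X p q) =
      fun i => ∑ q, c i q • (if i = l then X p q else b q) := by
    funext i
    by_cases hi : i = l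
    · subst hi; simp
    · simp [hi]
  rw [h1, α.map_update_smul, h2, map_sum_smul, Finset.smul_sum]
  refine Finset.sum_congr rfl fun r _ => ?_
  rw [smul_smul]
  congr 2
  funext i
  by_cases hi : i = l
  · subst hi; simp
  · simp [hi]

/-- The Koszul differential of a pulled back form, in terms of combinations of pullback
sections. -/
lemma Connection.koszul_pullbackForm (D : Connection lB FE E) {Φ : AnchoredHom lA lB}
    (hΦ : Φ.IsLieAlgebroidHom) {k n : ℕ} (α : Form IN FB B FE E k)
    (a : Fin (k + 1) → Cₛ^∞⟮IM; FA, A⟯) (f : Fin (k + 1) → Fin n → C^∞⟮IM, M; ℝ⟯)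
    (b : Fin n → Cₛ^∞⟮IN; FB, B⟯)
    (h : ∀ i x, Φ.fiber x (a i x) = ∑ p, f i p x • b p (Φ.base x)) (m : M) :
    ((D.pullback Φ).koszul k (Φ.pullbackForm k α) a m : E (Φ.base m)) =
      ∑ r : Fin (k + 1) → Fin n, (∏ i, f i (r i) m) •
        D.koszul k α (fun i => b (r i)) (Φ.base m) := by
  -- `Ξ j i` differentiates the coefficients of the `i`-th argument along the `j`-th one, and `Br j
  -- i` is the part of the bracket that is bilinear in the coefficients. The image of the bracket is
  -- `Br j i + Ξ j i - Ξ i j`, by the morphism condition.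
  let Ξ : Fin (k + 1) → Fin (k + 1) → B (Φ.base m) := fun j i =>
    ∑ p, dirDeriv IM (f i p) m (lA.anchor m (a j m)) • b p (Φ.base m)
  let w : Fin (k + 1) → B (Φ.base m) := fun i => Φ.fiber m (a i m)
  let Br : Fin (k + 1) → Fin (k + 1) → B (Φ.base m) := fun j i =>
    ∑ p, ∑ q, (f j p m * f i q m) • lB.bracket (b p) (b q) (Φ.base m)
  have hbr : ∀ j i, Φ.fiber m (lA.bracket (a j) (a i) m) = Br j i + Ξ j i - Ξ i j := fun j i =>
    hΦ (a j) (a i) n n (f j) b (f i) b (h j) (h i) m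
  let Q : Fin (k + 1) → E (Φ.base m) := fun j =>
    (D.pullback Φ).toFun (a j) ((Φ.pullbackForm k α).eval fun i => a (j.succAbove i)) m
  have h1 : ((D.pullback Φ).koszul k (Φ.pullbackForm k α) a m : E (Φ.base m)) =
      ∑ j : Fin (k + 1), (-1 : ℝ) ^ (j : ℕ) •
      (Q j - (1 / 2 : ℝ) •
        ∑ l, α.at (Φ.base m) (Function.update (fun i => w (j.succAbove i)) l
          (Br j (j.succAbove l) + Ξ j (j.succAbove l) - Ξ (j.succAbove l) j))) := by
    refine ((D.pullback Φ).koszul_apply _ _ _).trans ?_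
    refine Finset.sum_congr rfl fun j _ => ?_
    congr 3
    refine Finset.sum_congr rfl fun l _ => ?_
    rw [← hbr]
    refine congrArg (α.at (Φ.base m)) ?_
    funext i
    by_cases hi : i = l
    · subst hi; simp
    · simp [Function.update_of_ne hi, w]
  rw [h1]
  have h2 : ∑ j : Fin (k + 1), (-1 : ℝ) ^ (j : ℕ) • ∑ l, α.at (Φ.base m)
      (Function.update (fun i => w (j.succAbove i)) l
        (Ξ j (j.succAbove l) + Ξ (j.succAbove l) j)) = 0 :=
    sum_update_eq_zero_of_symm (α.at (Φ.base m)) w (X := fun j i => Ξ j i + Ξ i j)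
      fun i j => add_comm _ _
  let T : Fin n → (Fin k → Fin n) → E (Φ.base m) := fun p r =>
    D.toFun (b p) (α.eval fun i => b (r i)) (Φ.base m) - (1 / 2 : ℝ) •
      ∑ l, α.at (Φ.base m) (Function.update (fun i => b (r i) (Φ.base m)) l
        (lB.bracket (b p) (b (r l)) (Φ.base m)))
  -- The covariant derivative contributes `Ξ j i` and the bracket contributes `-(Ξ j i - Ξ i j) /
  -- 2`. What remains is half of the symmetric expression `Ξ j i + Ξ i j`, whose signed sum vanishes
  -- by `h2`.
  have h3 : ∀ j : Fin (k + 1), ∑ R : Fin (k + 1) → Fin n, (∏ i, f i (R i) m) •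
      T (R j) (fun i => R (j.succAbove i)) =
      Q j - (1 / 2 : ℝ) •
        ∑ l, α.at (Φ.base m) (Function.update (fun i => w (j.succAbove i)) l
          (Br j (j.succAbove l) + Ξ j (j.succAbove l) - Ξ (j.succAbove l) j))
      - (1 / 2 : ℝ) • ∑ l, α.at (Φ.base m) (Function.update (fun i => w (j.succAbove i)) l
        (Ξ j (j.succAbove l) + Ξ (j.succAbove l) j)) := by
    intro j
    rw [sum_fun_succAbove j (fun i q => f i q m) T]
    have e0 : Q j = _ := D.pullback_toFun_eval Φ α (a j) (fun i => a (j.succAbove i)) (fun p => f j p m)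
      (fun i => f (j.succAbove i)) b m (h j m) (fun i => h (j.succAbove i))
    rw [e0]
    have e1 : ∀ l, α.at (Φ.base m) (Function.update (fun i => w (j.succAbove i)) l
        (Br j (j.succAbove l))) = ∑ p, ∑ r : Fin k → Fin n,
        (f j p m * ∏ i, f (j.succAbove i) (r i) m) • α.at (Φ.base m) (Function.update
          (fun i => b (r i) (Φ.base m)) l (lB.bracket (b p) (b (r l)) (Φ.base m))) := by
      intro l
      have e2 : (fun i => w (j.succAbove i)) = fun i => ∑ p, f (j.succAbove i) p m •
        b p (Φ.base m) := funext fun i => h (j.succAbove i) m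
      rw [e2]
      exact sum_update_bracket (α.at (Φ.base m)) (fun p => f j p m)
        (fun i p => f (j.succAbove i) p m) (fun p => b p (Φ.base m))
        (fun p q => lB.bracket (b p) (b q) (Φ.base m)) l
    have e3 : ∑ p, ∑ r : Fin k → Fin n, (f j p m * ∏ i, f (j.succAbove i) (r i) m) • T p r =
        ∑ p, ∑ r : Fin k → Fin n, (f j p m * ∏ i, f (j.succAbove i) (r i) m) •
          D.toFun (b p) (α.eval fun i => b (r i)) (Φ.base m) -
        (1 / 2 : ℝ) • ∑ l, α.at (Φ.base m) (Function.update (fun i => w (j.succAbove i)) l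
        (Br j (j.succAbove l))) := by
      have e4 : ∑ l, α.at (Φ.base m) (Function.update (fun i => w (j.succAbove i)) l
        (Br j (j.succAbove l))) = ∑ p, ∑ r : Fin k → Fin n,
        (f j p m * ∏ i, f (j.succAbove i) (r i) m) • ∑ l, α.at (Φ.base m) (Function.update
          (fun i => b (r i) (Φ.base m)) l (lB.bracket (b p) (b (r l)) (Φ.base m))) := by
        simp only [e1, Finset.smul_sum]
        rw [Finset.sum_comm]
        refine Finset.sum_congr rfl fun p _ => ?_
        rw [Finset.sum_comm]
      rw [e4]
      simp only [T, smul_sub, Finset.sum_sub_distrib, Finset.smul_sum]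
      congr 1
      refine Finset.sum_congr rfl fun p _ => Finset.sum_congr rfl fun r _ =>
        Finset.sum_congr rfl fun l _ => ?_
      rw [smul_comm]
    rw [e3]
    have e5 : ∀ l, α.at (Φ.base m) (Function.update (fun i => w (j.succAbove i)) l
          (Br j (j.succAbove l) + Ξ j (j.succAbove l) - Ξ (j.succAbove l) j)) =
        α.at (Φ.base m) (Function.update (fun i => w (j.succAbove i)) l (Br j (j.succAbove l))) +
        α.at (Φ.base m) (Function.update (fun i => w (j.succAbove i)) l (Ξ j (j.succAbove l))) -
        α.at (Φ.base m) (Function.update (fun i => w (j.succAbove i)) l (Ξ (j.succAbove l) j)) :=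
      fun l => by rw [AlternatingMap.map_update_sub, AlternatingMap.map_update_add]
    have e6 : ∀ l, α.at (Φ.base m) (Function.update (fun i => w (j.succAbove i)) l
          (Ξ j (j.succAbove l) + Ξ (j.succAbove l) j)) =
        α.at (Φ.base m) (Function.update (fun i => w (j.succAbove i)) l (Ξ j (j.succAbove l))) +
        α.at (Φ.base m) (Function.update (fun i => w (j.succAbove i)) l (Ξ (j.succAbove l) j)) :=
      fun l => by rw [AlternatingMap.map_update_add]
    simp only [e5, e6, Finset.sum_add_distrib, Finset.sum_sub_distrib]
    change _ = _ + ∑ l, α.at (Φ.base m) (Function.update (fun i => w (j.succAbove i)) l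
      (Ξ j (j.succAbove l))) - _ - _
    module
  have h4 : ∀ r : Fin (k + 1) → Fin n, D.koszul k α (fun i => b (r i)) (Φ.base m) =
      ∑ j : Fin (k + 1), (-1 : ℝ) ^ (j : ℕ) • T (r j) (fun i => r (j.succAbove i)) :=
    fun r => D.koszul_apply _ _ _
  simp only [h4, Finset.smul_sum]
  rw [Finset.sum_comm]
  have h5 : ∀ j : Fin (k + 1), ∑ r : Fin (k + 1) → Fin n, (∏ i, f i (r i) m) •
      (-1 : ℝ) ^ (j : ℕ) • T (r j) (fun i => r (j.succAbove i)) = (-1 : ℝ) ^ (j : ℕ) •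
      ∑ R : Fin (k + 1) → Fin n, (∏ i, f i (R i) m) • T (R j) (fun i => R (j.succAbove i)) := by
    intro j
    rw [Finset.smul_sum]
    exact Finset.sum_congr rfl fun r _ => smul_comm _ _ _
  simp only [h5, h3]
  simp only [smul_sub _ (_ - _) _, Finset.sum_sub_distrib (f := fun j => _ • (_ - _)),
    smul_comm _ (1 / 2 : ℝ) (∑ l, _)]
  rw [← Finset.smul_sum, h2, smul_zero, sub_zero]
  simp only [Finset.smul_sum]
  rfl

end PullbackKoszul

/-! ### The identity morphism -/

section IdHom

variable {EM HM M : Type*} [NormedAddCommGroup EM] [NormedSpace ℝ EM] [TopologicalSpace HM]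
  {IM : ModelWithCorners ℝ EM HM} [TopologicalSpace M] [ChartedSpace HM M] [IsManifold IM ∞ M]
  {FA : Type*} [NormedAddCommGroup FA] [NormedSpace ℝ FA]
  {A : M → Type*} [TopologicalSpace (TotalSpace FA A)] [∀ x, AddCommGroup (A x)]
  [∀ x, Module ℝ (A x)] [∀ x, TopologicalSpace (A x)] [FiberBundle FA A] [VectorBundle ℝ FA A]

/-- The identity morphism of a Lie algebroid. -/
def AnchoredHom.id (lA : LieAlgebroid IM FA A) : AnchoredHom lA lA where
  base := ContMDiffMap.id
  fiber _ := LinearMap.id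
  contMDiff_fiber := contMDiff_id
  anchor_fiber m v := by
    have h : mfderiv IM IM (ContMDiffMap.id : C^∞⟮IM, M; IM, M⟯) m =
      ContinuousLinearMap.id ℝ (TangentSpace IM m) := mfderiv_id
    rw [h]
    rfl

/-- The Leibniz rule in both arguments. The right-hand side has the shape of the morphism condition,
which is thereby checked for the identity and for the inclusions of slices. -/
lemma LieAlgebroid.bracket_sum_fsmul (lA : LieAlgebroid IM FA A) {p q : ℕ}
    (f : Fin p → C^∞⟮IM, M; ℝ⟯) (b : Fin p → Cₛ^∞⟮IM; FA, A⟯)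
    (g : Fin q → C^∞⟮IM, M; ℝ⟯) (c : Fin q → Cₛ^∞⟮IM; FA, A⟯) (m : M) :
    lA.bracket (∑ i, fsmul (f i) (b i)) (∑ j, fsmul (g j) (c j)) m =
      ∑ i, ∑ j, (f i m * g j m) • lA.bracket (b i) (c j) m
      + ∑ j, dirDeriv IM (g j) m (lA.anchor m ((∑ i, fsmul (f i) (b i)) m)) • c j m
      - ∑ i, dirDeriv IM (f i) m (lA.anchor m ((∑ j, fsmul (g j) (c j)) m)) • b i m := by
  have h : ∀ i j, lA.bracket (fsmul (f i) (b i)) (fsmul (g j) (c j)) m =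
      (f i m * g j m) • lA.bracket (b i) (c j) m
      + (f i m * dirDeriv IM (g j) m (lA.anchor m (b i m))) • c j m
      - (g j m * dirDeriv IM (f i) m (lA.anchor m (c j m))) • b i m := by
    intro i j
    rw [lA.leibniz_left, lA.leibniz]
    simp only [fsmul_apply, map_smul, smul_eq_mul]
    module
  simp only [map_sum, LinearMap.sum_apply, section_sum_apply, h, Finset.sum_add_distrib,
    Finset.sum_sub_distrib, fsmul_apply, map_smul, Finset.sum_smul, smul_eq_mul]
  exact congrArg₂ (· - ·) (congrArg₂ (· + ·) Finset.sum_comm rfl) Finset.sum_comm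

/-- Makes the pullback formula available for the identity, where it expresses tensoriality of the
differential. -/
lemma AnchoredHom.id_isLieAlgebroidHom (lA : LieAlgebroid IM FA A) :
    (AnchoredHom.id lA).IsLieAlgebroidHom := by
  intro a₁ a₂ p q f₁ b₁ f₂ b₂ h₁ h₂ m
  have e₁ : a₁ = ∑ i, fsmul (f₁ i) (b₁ i) := ContMDiffSection.ext fun x =>
    (h₁ x).trans (section_sum_apply Finset.univ (fun i => fsmul (f₁ i) (b₁ i)) x).symm
  have e₂ : a₂ = ∑ i, fsmul (f₂ i) (b₂ i) := ContMDiffSection.ext fun x =>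
    (h₂ x).trans (section_sum_apply Finset.univ (fun i => fsmul (f₂ i) (b₂ i)) x).symm
  have h := lA.bracket_sum_fsmul f₁ b₁ f₂ b₂ m
  rw [← e₁, ← e₂] at h
  exact h

end IdHom

/-! ### Tensoriality of the Koszul differential -/

section Tensorial

variable {EM HM M : Type*} [NormedAddCommGroup EM] [NormedSpace ℝ EM] [TopologicalSpace HM]
  {IM : ModelWithCorners ℝ EM HM} [TopologicalSpace M] [ChartedSpace HM M] [IsManifold IM ∞ M]
  {FA : Type*} [NormedAddCommGroup FA] [NormedSpace ℝ FA] [FiniteDimensional ℝ FA]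
  {A : M → Type*} [TopologicalSpace (TotalSpace FA A)] [∀ x, AddCommGroup (A x)]
  [∀ x, Module ℝ (A x)] [∀ x, TopologicalSpace (A x)] [FiberBundle FA A] [VectorBundle ℝ FA A]
  [ContMDiffVectorBundle ∞ FA A IM]
  {FV : Type*} [NormedAddCommGroup FV] [NormedSpace ℝ FV] [FiniteDimensional ℝ FV]
  {V : M → Type*} [TopologicalSpace (TotalSpace FV V)] [∀ x, AddCommGroup (V x)]
  [∀ x, Module ℝ (V x)] [∀ x, TopologicalSpace (V x)] [FiberBundle FV V] [VectorBundle ℝ FV V]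
  [ContMDiffVectorBundle ∞ FV V IM]
  [FiniteDimensional ℝ EM] [T2Space M]
  {lA : LieAlgebroid IM FA A}

/-- The instance of `Connection.koszul_pullbackForm` for the identity, along which the pullback of
`D` acts as `D` itself. -/
lemma Connection.koszul_sum_fsmul (D : Connection lA FV V) {k n : ℕ}
    (α : Form IM FA A FV V k)
    (a : Fin (k + 1) → Cₛ^∞⟮IM; FA, A⟯) (f : Fin (k + 1) → Fin n → C^∞⟮IM, M; ℝ⟯)
    (b : Fin n → Cₛ^∞⟮IM; FA, A⟯) (h : ∀ i x, a i x = ∑ p, f i p x • b p x) (m : M) :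
    D.koszul k α a m = ∑ r : Fin (k + 1) → Fin n, (∏ i, f i (r i) m) •
        D.koszul k α (fun i => b (r i)) m := by
  have h1 := D.koszul_pullbackForm (AnchoredHom.id_isLieAlgebroidHom lA) α a f b h m
  refine Eq.trans ?_ h1
  rw [D.koszul_apply]
  refine Eq.trans ?_ ((D.pullback (AnchoredHom.id lA)).koszul_apply _ _ _).symm
  refine Finset.sum_congr rfl fun j _ => ?_
  have h2 := D.pullback_apply (AnchoredHom.id lA) (a j) (α.eval fun i => a (j.succAbove i)) (a j)
    m rfl
  exact congrArg (fun z : V m => (-1 : ℝ) ^ (j : ℕ) • (z - (1 / 2 : ℝ) •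
    ∑ l, α.at m (Function.update (fun i => a (j.succAbove i) m) l
      (lA.bracket (a j) (a (j.succAbove l)) m)))) h2.symm

/-- The Koszul differential at a point, in terms of sections framing the bundle there. -/
lemma Connection.koszul_eq_sum (D : Connection lA FV V) {k : ℕ} (α : Form IM FA A FV V k) (m : M) :
    ∃ (n : ℕ) (s : Fin n → Cₛ^∞⟮IM; FA, A⟯) (κ : Fin n → A m →ₗ[ℝ] ℝ),
      (∀ v, v = ∑ p, κ p v • s p m) ∧
      ∀ a : Fin (k + 1) → Cₛ^∞⟮IM; FA, A⟯, D.koszul k α a m =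
        ∑ r : Fin (k + 1) → Fin n, (∏ i, κ (r i) (a i m)) • D.koszul k α (fun i => s (r i)) m := by
  obtain ⟨n, s, κ, ψ, hκ, h1, hψ⟩ := exists_compact_frame IM FA A (isCompact_singleton (x := m))
  have hm : ψ m = 1 := (h1 m rfl).self_of_nhds
  refine ⟨n, s, fun p => κ p m, fun v => ?_, fun a => ?_⟩
  · rw [← hψ, hm, one_smul]
  -- The differential on the sections `ψ • a i` is expanded twice: in the frame, and in the family
  -- `a` itself with coefficient `ψ` for `p = i` and `0` otherwise. In the second expansion only the
  -- multi-index `id` survives, with coefficient `1` at `m`.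
  · have e1 := D.koszul_sum_fsmul α (fun i => fsmul ψ (a i))
      (fun i p => ⟨fun x => κ p x (a i x), (hκ p).comp (a i).contMDiff⟩) s
      (fun i x => hψ x (a i x)) m
    have e2 := D.koszul_sum_fsmul α (fun i => fsmul ψ (a i))
      (fun i p => if i = p then ψ else 0) a (fun i x => by
        rw [Finset.sum_eq_single i (fun p _ hp => by rw [if_neg hp.symm]; exact zero_smul ℝ _)
          (fun h => absurd (Finset.mem_univ _) h), if_pos rfl]
        rfl) m
    rw [Finset.sum_eq_single id (fun r _ hr => by
        obtain ⟨i, hi⟩ := Function.ne_iff.1 hr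
        rw [Finset.prod_eq_zero (Finset.mem_univ i), zero_smul]
        rw [if_neg fun h => hi h.symm]
        rfl) (fun h => absurd (Finset.mem_univ _) h)] at e2
    have e3 : ∏ i : Fin (k + 1), (if i = id i then ψ else 0) m = 1 :=
      Finset.prod_eq_one fun i _ => by
        rw [if_pos (show i = id i from rfl), hm]
    rw [e3, one_smul] at e2
    exact e2.symm.trans e1

/-- The Koszul differential is tensorial. -/
lemma Connection.koszul_congr (D : Connection lA FV V) {k : ℕ} (α : Form IM FA A FV V k)
    {a a' : Fin (k + 1) → Cₛ^∞⟮IM; FA, A⟯} {m : M} (h : ∀ i, a i m = a' i m) :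
    D.koszul k α a m = D.koszul k α a' m := by
  obtain ⟨n, s, κ, -, hs⟩ := D.koszul_eq_sum α m
  rw [hs a, hs a']
  simp only [h]

lemma exists_section_eq (m : M) (v : A m) : ∃ a : Cₛ^∞⟮IM; FA, A⟯, a m = v := by
  obtain ⟨n, s, κ, -, hs⟩ := exists_frame IM FA A m
  refine ⟨∑ i, κ i m v • s i, ?_⟩
  rw [section_sum_apply]
  exact (hs.self_of_nhds v).symm

end Tensorial

/-! ### Pullback commutes with the differentials -/

section ChainMap

variable {EM HM M : Type*} [NormedAddCommGroup EM] [NormedSpace ℝ EM] [TopologicalSpace HM]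
  {IM : ModelWithCorners ℝ EM HM} [TopologicalSpace M] [ChartedSpace HM M] [IsManifold IM ∞ M]
  [FiniteDimensional ℝ EM] [T2Space M]
  {EN HN N : Type*} [NormedAddCommGroup EN] [NormedSpace ℝ EN] [TopologicalSpace HN]
  {IN : ModelWithCorners ℝ EN HN} [TopologicalSpace N] [ChartedSpace HN N] [IsManifold IN ∞ N]
  {FA : Type*} [NormedAddCommGroup FA] [NormedSpace ℝ FA] [FiniteDimensional ℝ FA]
  {A : M → Type*} [TopologicalSpace (TotalSpace FA A)] [∀ x, AddCommGroup (A x)]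
  [∀ x, Module ℝ (A x)] [∀ x, TopologicalSpace (A x)] [FiberBundle FA A] [VectorBundle ℝ FA A]
  [ContMDiffVectorBundle ∞ FA A IM]
  {FB : Type*} [NormedAddCommGroup FB] [NormedSpace ℝ FB] [FiniteDimensional ℝ FB]
  {B : N → Type*} [TopologicalSpace (TotalSpace FB B)] [∀ x, AddCommGroup (B x)]
  [∀ x, Module ℝ (B x)] [∀ x, TopologicalSpace (B x)] [FiberBundle FB B] [VectorBundle ℝ FB B]
  [ContMDiffVectorBundle ∞ FB B IN]
  {FE : Type*} [NormedAddCommGroup FE] [NormedSpace ℝ FE] [FiniteDimensional ℝ FE]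
  {E : N → Type*} [TopologicalSpace (TotalSpace FE E)] [∀ x, AddCommGroup (E x)]
  [∀ x, Module ℝ (E x)] [∀ x, TopologicalSpace (E x)] [FiberBundle FE E] [VectorBundle ℝ FE E]
  [ContMDiffVectorBundle ∞ FE E IN]
  [FiniteDimensional ℝ EN] [T2Space N]
  {lA : LieAlgebroid IM FA A} {lB : LieAlgebroid IN FB B}

/-- The pullback of forms along a Lie algebroid morphism commutes with the differentials. -/
theorem Connection.koszul_pullbackForm_apply (D : Connection lB FE E) {Φ : AnchoredHom lA lB}
    (hΦ : Φ.IsLieAlgebroidHom) {k : ℕ} (α : Form IN FB B FE E k)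
    (a : Fin (k + 1) → Cₛ^∞⟮IM; FA, A⟯) (b : Fin (k + 1) → Cₛ^∞⟮IN; FB, B⟯) (m : M)
    (h : ∀ i, Φ.fiber m (a i m) = b i (Φ.base m)) :
    ((D.pullback Φ).koszul k (Φ.pullbackForm k α) a m : E (Φ.base m)) =
      D.koszul k α b (Φ.base m) := by
  obtain ⟨n, s, κ, ψ, hκ, h1, hψ⟩ := exists_compact_frame IN FB B
    (isCompact_singleton (x := Φ.base m))
  have hm : ψ (Φ.base m) = 1 := (h1 _ rfl).self_of_nhds
  -- The frame reproduces vectors only near `Φ.base m`. Multiplying by the pulled back cut-off turns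
  -- the images of the `a i` into global combinations of pullback sections; by tensoriality nothing
  -- changes at `m`.
  let g : C^∞⟮IM, M; ℝ⟯ := ψ.comp Φ.base
  let f : Fin (k + 1) → Fin n → C^∞⟮IM, M; ℝ⟯ := fun i p =>
    ⟨fun x => κ p (Φ.base x) (Φ.fiber x (a i x)),
      (hκ p).comp (Φ.contMDiff_fiber.comp (a i).contMDiff)⟩
  have e1 := D.koszul_pullbackForm hΦ α (fun i => fsmul g (a i)) f s (fun i x => by
    rw [fsmul_apply, map_smul]
    exact hψ _ _) m
  have e2 := D.koszul_sum_fsmul α (fun i => fsmul ψ (b i))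
      (fun i p => ⟨fun x => κ p x (b i x), (hκ p).comp (b i).contMDiff⟩) s
      (fun i x => hψ x (b i x)) (Φ.base m)
  rw [D.koszul_congr α (a := fun i => fsmul ψ (b i)) (a' := b) (fun i => by
    rw [fsmul_apply, hm, one_smul])] at e2
  rw [e2]
  refine Eq.trans ?_ (e1.trans ?_)
  · exact (D.pullback Φ).koszul_congr _ fun i => by
      rw [fsmul_apply, show g m = 1 from hm, one_smul]
  · refine Finset.sum_congr rfl fun r _ => ?_
    congr 1
    refine Finset.prod_congr rfl fun i _ => ?_
    exact congrArg (κ (r i) (Φ.base m)) (h i)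

end ChainMap

/-! ### Curvature and the covariant differential of a section -/

section Curvature

variable {EM HM M : Type*} [NormedAddCommGroup EM] [NormedSpace ℝ EM] [TopologicalSpace HM]
  {IM : ModelWithCorners ℝ EM HM} [TopologicalSpace M] [ChartedSpace HM M] [IsManifold IM ∞ M]
  {FA : Type*} [NormedAddCommGroup FA] [NormedSpace ℝ FA] [FiniteDimensional ℝ FA]
  {A : M → Type*} [TopologicalSpace (TotalSpace FA A)] [∀ x, AddCommGroup (A x)]
  [∀ x, Module ℝ (A x)] [∀ x, TopologicalSpace (A x)] [FiberBundle FA A] [VectorBundle ℝ FA A]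
  [ContMDiffVectorBundle ∞ FA A IM]
  {FV : Type*} [NormedAddCommGroup FV] [NormedSpace ℝ FV]
  {V : M → Type*} [TopologicalSpace (TotalSpace FV V)] [∀ x, AddCommGroup (V x)]
  [∀ x, Module ℝ (V x)] [∀ x, TopologicalSpace (V x)] [FiberBundle FV V] [VectorBundle ℝ FV V]
  [FiniteDimensional ℝ EM] [T2Space M]
  {lA : LieAlgebroid IM FA A}

/-- The curvature operator of a connection. -/
def Connection.curvature (D : Connection lA FV V) (a b : Cₛ^∞⟮IM; FA, A⟯) :
    Cₛ^∞⟮IM; FV, V⟯ →ₗ[ℝ] Cₛ^∞⟮IM; FV, V⟯ :=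
  D.toFun a ∘ₗ D.toFun b - D.toFun b ∘ₗ D.toFun a - D.toFun (lA.bracket a b)

lemma Connection.curvature_apply (D : Connection lA FV V) (a b : Cₛ^∞⟮IM; FA, A⟯)
    (s : Cₛ^∞⟮IM; FV, V⟯) (m : M) : D.curvature a b s m =
      D.toFun a (D.toFun b s) m - D.toFun b (D.toFun a s) m - D.toFun (lA.bracket a b) s m := rfl

lemma Connection.toFun_fsmul (D : Connection lA FV V) (a : Cₛ^∞⟮IM; FA, A⟯)
    (f : C^∞⟮IM, M; ℝ⟯) (s : Cₛ^∞⟮IM; FV, V⟯) :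
    D.toFun a (fsmul f s) = fsmul f (D.toFun a s) + fsmul (lA.act a f) s := by
  ext m
  exact D.leibniz a s f m

/-- The second derivatives of `f` cancel because the anchor preserves brackets, and the mixed
first-order terms cancel in pairs. -/
lemma Connection.curvature_fsmul (D : Connection lA FV V) (a b : Cₛ^∞⟮IM; FA, A⟯)
    (f : C^∞⟮IM, M; ℝ⟯) (s : Cₛ^∞⟮IM; FV, V⟯) (m : M) :
    D.curvature a b (fsmul f s) m = f m • D.curvature a b s m := by
  have h := lA.anchor_bracket a b f m
  have h' : lA.act (lA.bracket a b) f m = lA.act a (lA.act b f) m - lA.act b (lA.act a f) m := h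
  simp only [D.curvature_apply, D.toFun_fsmul, map_add, ContMDiffSection.coe_add, Pi.add_apply,
    fsmul_apply, h']
  module

lemma Connection.curvature_congr (D : Connection lA FV V) (a b : Cₛ^∞⟮IM; FA, A⟯)
    {s s' : Cₛ^∞⟮IM; FV, V⟯} {m : M} (h : ∀ᶠ x in 𝓝 m, s x = s' x) :
    D.curvature a b s m = D.curvature a b s' m := by
  have h1 : ∀ c, ∀ᶠ x in 𝓝 m, D.toFun c s x = D.toFun c s' x := fun c =>
    h.eventually_nhds.mono fun x hx => D.congr_right c hx
  rw [D.curvature_apply, D.curvature_apply, D.congr_right a (h1 b), D.congr_right b (h1 a),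
    D.congr_right _ h]

variable (IM FA) in
/-- A section with a given value at a point. -/
def sectionThrough (m : M) (v : A m) : Cₛ^∞⟮IM; FA, A⟯ :=
  (exists_section_eq (IM := IM) (FA := FA) m v).choose

@[simp] lemma sectionThrough_apply (m : M) (v : A m) : sectionThrough IM FA m v m = v :=
  (exists_section_eq (IM := IM) (FA := FA) m v).choose_spec

/-- The covariant differential of a section. -/
def Connection.dSection (D : Connection lA FV V) (s : Cₛ^∞⟮IM; FV, V⟯) : Form IM FA A FV V 1 :=
  let L : ∀ m, A m →ₗ[ℝ] V m := fun m =>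
    { toFun v := D.toFun (sectionThrough IM FA m v) s m
      map_add' v w := (D.congr_left (b' := sectionThrough IM FA m v + sectionThrough IM FA m w) s
          (by simp only [ContMDiffSection.coe_add, Pi.add_apply, sectionThrough_apply])).trans
        (by rw [map_add]; rfl)
      map_smul' r v := (D.congr_left (b' := r • sectionThrough IM FA m v) s
          (by simp only [ContMDiffSection.coe_smul, Pi.smul_apply, sectionThrough_apply])).trans
        (by rw [map_smul]; rfl) }
  ⟨fun m => AlternatingMap.ofSubsingleton ℝ (A m) (V m) (0 : Fin 1) (L m), fun a => by
    refine (D.toFun (a 0) s).contMDiff.congr fun m => ?_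
    exact congrArg (TotalSpace.mk' FV m) (D.congr_left s (sectionThrough_apply m (a 0 m)))⟩

lemma Connection.dSection_eval (D : Connection lA FV V) (s : Cₛ^∞⟮IM; FV, V⟯)
    (a : Fin 1 → Cₛ^∞⟮IM; FA, A⟯) : (D.dSection s).eval a = D.toFun (a 0) s := by
  ext m
  exact D.congr_left s (sectionThrough_apply m (a 0 m))

/-- For the covariant differential of a section this expression is the curvature, so flatness
becomes a statement about Koszul differentials and can be pulled back with forms. -/
lemma Connection.koszul_one (D : Connection lA FV V) (α : Form IM FA A FV V 1)
    (a b : Cₛ^∞⟮IM; FA, A⟯) (m : M) :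
    D.koszul 1 α ![a, b] m = D.toFun a (α.eval ![b]) m - D.toFun b (α.eval ![a]) m -
      α.eval ![lA.bracket a b] m := by
  have e0 : (fun i : Fin 1 => (![a, b] : Fin 2 → Cₛ^∞⟮IM; FA, A⟯) ((0 : Fin 2).succAbove i)) =
      ![b] := by
    funext i; fin_cases i; rfl
  have e1 : (fun i : Fin 1 => (![a, b] : Fin 2 → Cₛ^∞⟮IM; FA, A⟯) ((1 : Fin 2).succAbove i)) =
      ![a] := by
    funext i; fin_cases i; rfl
  have e2 : ∀ v : A m, ∀ w : Fin 1 → A m, Function.update w 0 v = fun _ => v := by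
    intro v w; funext i; fin_cases i; rfl
  have e3 : ∀ c : Cₛ^∞⟮IM; FA, A⟯, α.eval ![c] m = α.at m fun _ => c m := by
    intro c
    refine congrArg (α.at m) ?_
    funext i; fin_cases i; rfl
  rw [D.koszul_apply, Fin.sum_univ_two, e0, e1]
  simp only [Finset.univ_unique, Finset.sum_singleton, Fin.default_eq_zero, e2, e3]
  have e4 : α.at m (fun _ => lA.bracket b a m) = - α.at m (fun _ => lA.bracket a b m) := by
    rw [lA.bracket_symm b a]
    have := (α.at m).map_update_smul (fun _ => lA.bracket a b m) 0 (-1) (lA.bracket a b m)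
    rw [e2, e2, neg_one_smul, neg_one_smul] at this
    exact this
  change (-1 : ℝ) ^ 0 • (D.toFun a (α.eval ![b]) m - (1 / 2 : ℝ) • α.at m (fun _ => lA.bracket a b m)) +
    (-1 : ℝ) ^ 1 • (D.toFun b (α.eval ![a]) m - (1 / 2 : ℝ) • α.at m (fun _ => lA.bracket b a m)) = _
  rw [e4]
  module

end Curvature

/-! ### Flatness and functoriality of pullback connections -/

section PullbackFlat

variable {EM HM M : Type*} [NormedAddCommGroup EM] [NormedSpace ℝ EM] [TopologicalSpace HM]
  {IM : ModelWithCorners ℝ EM HM} [TopologicalSpace M] [ChartedSpace HM M] [IsManifold IM ∞ M]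
  [FiniteDimensional ℝ EM] [T2Space M]
  {EN HN N : Type*} [NormedAddCommGroup EN] [NormedSpace ℝ EN] [TopologicalSpace HN]
  {IN : ModelWithCorners ℝ EN HN} [TopologicalSpace N] [ChartedSpace HN N] [IsManifold IN ∞ N]
  {EP HP P : Type*} [NormedAddCommGroup EP] [NormedSpace ℝ EP] [TopologicalSpace HP]
  {IP : ModelWithCorners ℝ EP HP} [TopologicalSpace P] [ChartedSpace HP P] [IsManifold IP ∞ P]
  [FiniteDimensional ℝ EP] [T2Space P]
  {FA : Type*} [NormedAddCommGroup FA] [NormedSpace ℝ FA] [FiniteDimensional ℝ FA]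
  {A : M → Type*} [TopologicalSpace (TotalSpace FA A)] [∀ x, AddCommGroup (A x)]
  [∀ x, Module ℝ (A x)] [∀ x, TopologicalSpace (A x)] [FiberBundle FA A] [VectorBundle ℝ FA A]
  [ContMDiffVectorBundle ∞ FA A IM]
  {FB : Type*} [NormedAddCommGroup FB] [NormedSpace ℝ FB] [FiniteDimensional ℝ FB]
  {B : N → Type*} [TopologicalSpace (TotalSpace FB B)] [∀ x, AddCommGroup (B x)]
  [∀ x, Module ℝ (B x)] [∀ x, TopologicalSpace (B x)] [FiberBundle FB B] [VectorBundle ℝ FB B]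
  [ContMDiffVectorBundle ∞ FB B IN]
  {FC : Type*} [NormedAddCommGroup FC] [NormedSpace ℝ FC] [FiniteDimensional ℝ FC]
  {C : P → Type*} [TopologicalSpace (TotalSpace FC C)] [∀ x, AddCommGroup (C x)]
  [∀ x, Module ℝ (C x)] [∀ x, TopologicalSpace (C x)] [FiberBundle FC C] [VectorBundle ℝ FC C]
  [ContMDiffVectorBundle ∞ FC C IP]
  {FE : Type*} [NormedAddCommGroup FE] [NormedSpace ℝ FE] [FiniteDimensional ℝ FE]
  {E : N → Type*} [TopologicalSpace (TotalSpace FE E)] [∀ x, AddCommGroup (E x)]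
  [∀ x, Module ℝ (E x)] [∀ x, TopologicalSpace (E x)] [FiberBundle FE E] [VectorBundle ℝ FE E]
  [ContMDiffVectorBundle ∞ FE E IN]
  [FiniteDimensional ℝ EN] [T2Space N]
  {lA : LieAlgebroid IM FA A} {lB : LieAlgebroid IN FB B} {lC : LieAlgebroid IP FC C}

/-- A section of a pullback bundle is locally a combination of pullback sections. -/
lemma exists_pullbackSection_sum (φ : C^∞⟮IM, M; IN, N⟯) (s : Cₛ^∞⟮IM; FE, φ *ᵖ E⟯) (m : M) :
    ∃ (n : ℕ) (c : Fin n → C^∞⟮IM, M; ℝ⟯) (t : Fin n → Cₛ^∞⟮IN; FE, E⟯),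
      ∀ᶠ x in 𝓝 m, s x = (∑ j, fsmul (c j) (pullbackSection φ (t j))) x := by
  obtain ⟨n, t, κ, hκ, ht⟩ := exists_frame IN FE E (φ m)
  refine ⟨n, fun j => ⟨fun x => κ j (φ x) (s x),
    (hκ j).comp (contMDiff_pullback_section.1 s.contMDiff)⟩, t, ?_⟩
  filter_upwards [φ.contMDiff.continuous.continuousAt.eventually ht] with x hx
  rw [section_sum_apply]
  exact hx (s x)

/-- The pullback of a flat connection along a Lie algebroid morphism is flat. -/
theorem Connection.IsFlat.pullback {D : Connection lB FE E} (hD : D.IsFlat)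
    {Φ : AnchoredHom lA lB} (hΦ : Φ.IsLieAlgebroidHom) : (D.pullback Φ).IsFlat := by
  -- On a pullback section the curvature is the differential of the pulled back 1-form `∇e`, hence
  -- the pullback of the differential of `∇e`, which is zero. Other sections are local combinations
  -- of pullback sections, and curvature is tensorial in the section.
  have h1 : ∀ e a b m, (D.pullback Φ).curvature a b (pullbackSection Φ.base e) m = 0 := by
    intro e a b m
    obtain ⟨a', ha⟩ := exists_section_eq (IM := IN) (FA := FB) (Φ.base m) (Φ.fiber m (a m))
    obtain ⟨b', hb⟩ := exists_section_eq (IM := IN) (FA := FB) (Φ.base m) (Φ.fiber m (b m))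
    have h2 := D.koszul_pullbackForm_apply hΦ (D.dSection e) ![a, b] ![a', b'] m (fun i => by
      fin_cases i
      · exact ha.symm
      · exact hb.symm)
    have h3 : ∀ c : Cₛ^∞⟮IM; FA, A⟯, (Φ.pullbackForm 1 (D.dSection e)).eval ![c] =
        (D.pullback Φ).toFun c (pullbackSection Φ.base e) := by
      intro c
      ext x
      obtain ⟨c', hc⟩ := exists_section_eq (IM := IN) (FA := FB) (Φ.base x) (Φ.fiber x (c x))
      refine Eq.trans ?_ (D.pullback_apply Φ c e c' x hc.symm).symm
      refine Eq.trans ?_ (congrArg (fun σ : Cₛ^∞⟮IN; FE, E⟯ => σ (Φ.base x))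
        (D.dSection_eval e ![c']))
      have h4 : (fun i => Φ.fiber x ((![c] : Fin 1 → Cₛ^∞⟮IM; FA, A⟯) i x)) =
          fun i => (![c'] : Fin 1 → Cₛ^∞⟮IN; FB, B⟯) i (Φ.base x) := by
        funext i
        fin_cases i
        exact hc.symm
      exact congrArg ((D.dSection e).at (Φ.base x)) h4
    have h4 : D.koszul 1 (D.dSection e) ![a', b'] (Φ.base m) = 0 := by
      rw [D.koszul_one, D.dSection_eval, D.dSection_eval, D.dSection_eval]
      exact congrArg (fun σ : Cₛ^∞⟮IN; FE, E⟯ => σ (Φ.base m)) (hD a' b' e)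
    have h5 := (D.pullback Φ).koszul_one (Φ.pullbackForm 1 (D.dSection e)) a b m
    rw [h3, h3, h3] at h5
    exact h5.symm.trans (h2.trans h4)
  intro a b s
  change (D.pullback Φ).curvature a b s = 0
  ext m
  obtain ⟨n, c, t, hs⟩ := exists_pullbackSection_sum Φ.base s m
  rw [(D.pullback Φ).curvature_congr a b hs, map_sum, section_sum_apply]
  refine Finset.sum_eq_zero fun j _ => ?_
  rw [Connection.curvature_fsmul, h1, smul_zero]

/-- Functoriality of the pullback of connections. -/
theorem Connection.pullback_pullback (D : Connection lB FE E) (Φ : AnchoredHom lC lB)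
    (Ψ : AnchoredHom lA lC) (a : Cₛ^∞⟮IM; FA, A⟯)
    (s : Cₛ^∞⟮IM; FE, Ψ.base *ᵖ (Φ.base *ᵖ E)⟯) (s' : Cₛ^∞⟮IM; FE, (Φ.comp Ψ).base *ᵖ E⟯)
    (h : ∀ x, (s x : E (Φ.base (Ψ.base x))) = s' x) (m : M) :
    (((D.pullback Φ).pullback Ψ).toFun a s m : E (Φ.base (Ψ.base m))) =
      (D.pullback (Φ.comp Ψ)).toFun a s' m := by
  obtain ⟨n, c, t, hs⟩ := exists_pullbackSection_sum (Φ.comp Ψ).base s' m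
  have hs1 : ∀ᶠ x in 𝓝 m, s x =
      (∑ j, fsmul (c j) (pullbackSection Ψ.base (pullbackSection Φ.base (t j)))) x := by
    filter_upwards [hs] with x hx
    refine (h x).trans (hx.trans ?_)
    rw [section_sum_apply, section_sum_apply]
    rfl
  obtain ⟨X, hX⟩ := exists_section_eq (IM := IP) (FA := FC) (Ψ.base m) (Ψ.fiber m (a m))
  obtain ⟨b, hb⟩ := exists_section_eq (IM := IN) (FA := FB) (Φ.base (Ψ.base m))
    (Φ.fiber (Ψ.base m) (X (Ψ.base m)))
  rw [((D.pullback Φ).pullback Ψ).congr_right a hs1, (D.pullback (Φ.comp Ψ)).congr_right a hs,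
    map_sum, map_sum, section_sum_apply, section_sum_apply]
  refine Finset.sum_congr rfl fun j _ => ?_
  refine (((D.pullback Φ).pullback Ψ).leibniz _ _ _ _).trans (Eq.trans ?_
    ((D.pullback (Φ.comp Ψ)).leibniz _ _ _ _).symm)
  have e1 := (D.pullback Φ).pullback_apply Ψ a (pullbackSection Φ.base (t j)) X m hX.symm
  have e2 := D.pullback_apply Φ X (t j) b (Ψ.base m) hb.symm
  have e3 := D.pullback_apply (Φ.comp Ψ) a (t j) b m (by
    rw [hX] at hb
    exact hb.symm)
  exact congrArg (fun z : E (Φ.base (Ψ.base m)) => c j m • z +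
    dirDeriv IM (c j) m (lA.anchor m (a m)) • (t j (Φ.base (Ψ.base m))))
    ((e1.trans e2).trans e3.symm)

/-- Lets the connection on a slice be computed on `J × M`, on sections extending the given ones. -/
theorem Connection.pullback_comp_apply (D : Connection lB FE E) (Φ : AnchoredHom lC lB)
    (Ψ : AnchoredHom lA lC) (a : Cₛ^∞⟮IM; FA, A⟯) (X : Cₛ^∞⟮IP; FC, C⟯)
    (s : Cₛ^∞⟮IP; FE, Φ.base *ᵖ E⟯) (m : M) (h : Ψ.fiber m (a m) = X (Ψ.base m)) :
    ((D.pullback (Φ.comp Ψ)).toFun a (Φ.restrictSection Ψ s) m : E (Φ.base (Ψ.base m))) =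
      (D.pullback Φ).toFun X s (Ψ.base m) :=
  (D.pullback_pullback Φ Ψ a (pullbackSection Ψ.base s) _ (fun _ => rfl) m).symm.trans
    ((D.pullback Φ).pullback_apply Ψ a s X m h)

/-- Restriction is pullback along `Ψ` once `ψ^!φ^!E` and `(φ ∘ ψ)^!E`, which have the same fibres,
are identified. The connections agree by functoriality, and the bracket terms involve no connection.
-/
theorem Connection.koszul_restrictForm_apply (D : Connection lB FE E) (Φ : AnchoredHom lC lB)
    {Ψ : AnchoredHom lA lC} (hΨ : Ψ.IsLieAlgebroidHom) {k : ℕ}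
    (α : Form IP FC C FE (Φ.base *ᵖ E) k) (a : Fin (k + 1) → Cₛ^∞⟮IM; FA, A⟯)
    (X : Fin (k + 1) → Cₛ^∞⟮IP; FC, C⟯) (m : M)
    (h : ∀ i, Ψ.fiber m (a i m) = X i (Ψ.base m)) :
    ((D.pullback (Φ.comp Ψ)).koszul k (Φ.restrictForm Ψ k α) a m : E (Φ.base (Ψ.base m))) =
      (D.pullback Φ).koszul k α X (Ψ.base m) := by
  refine Eq.trans ?_ ((D.pullback Φ).koszul_pullbackForm_apply hΨ α a X m h)
  refine ((D.pullback (Φ.comp Ψ)).koszul_apply _ _ _).trans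
    (Eq.trans ?_ (((D.pullback Φ).pullback Ψ).koszul_apply _ _ _).symm)
  refine Finset.sum_congr rfl fun j _ => ?_
  let U : Fin k → E (Φ.base (Ψ.base m)) := fun l =>
    (Φ.restrictForm Ψ k α).at m (Function.update (fun i => a (j.succAbove i) m) l
      (lA.bracket (a j) (a (j.succAbove l)) m))
  exact congrArg (fun z : E (Φ.base (Ψ.base m)) => (-1 : ℝ) ^ (j : ℕ) • (z - (1 / 2 : ℝ) • ∑ l, U l))
    (D.pullback_pullback Φ Ψ (a j) ((Ψ.pullbackForm k α).eval fun i => a (j.succAbove i))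
      ((Φ.restrictForm Ψ k α).eval fun i => a (j.succAbove i)) (fun _ => rfl) m).symm

end PullbackFlat

/-! ### Inclusions of slices are morphisms -/

section InclHom

variable {EM M : Type*} [NormedAddCommGroup EM] [NormedSpace ℝ EM] [FiniteDimensional ℝ EM]
  [TopologicalSpace M] [ChartedSpace EM M] [IsManifold 𝓘(ℝ, EM) ∞ M] [T2Space M]
  {J : TopologicalSpace.Opens ℝ}
  {FA : Type*} [NormedAddCommGroup FA] [NormedSpace ℝ FA] [FiniteDimensional ℝ FA]
  {A : M → Type*} [TopologicalSpace (TotalSpace FA A)] [∀ x, AddCommGroup (A x)]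
  [∀ x, Module ℝ (A x)] [∀ x, TopologicalSpace (A x)] [FiberBundle FA A] [VectorBundle ℝ FA A]
  [ContMDiffVectorBundle ∞ FA A 𝓘(ℝ, EM)]

/-- The coefficients of `∂_t` vanish on the slice, so the terms with time derivatives drop out of
the product bracket. These coefficients are themselves differentiated only along the slice, where
they are zero. -/
lemma LieAlgebroid.intervalProd_bracket_slice (lA : LieAlgebroid 𝓘(ℝ, EM) FA A)
    (X Y : PSec EM J FA A) (a b : Cₛ^∞⟮𝓘(ℝ, EM); FA, A⟯) (t : J)
    (hX : ∀ m, X (t, m) = ((0 : ℝ), a m)) (hY : ∀ m, Y (t, m) = ((0 : ℝ), b m)) (m : M) :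
    (lA.intervalProd J).bracket X Y (t, m) = ((0 : ℝ), lA.bracket a b m) := by
  have hX1 : ∀ m, PSec.coeff X (t, m) = 0 := fun m => congrArg Prod.fst (hX m)
  have hY1 : ∀ m, PSec.coeff Y (t, m) = 0 := fun m => congrArg Prod.fst (hY m)
  have hX2 : sliceSection (PSec.part X) t = a := ContMDiffSection.ext fun m =>
    congrArg Prod.snd (hX m)
  have hY2 : sliceSection (PSec.part Y) t = b := ContMDiffSection.ext fun m =>
    congrArg Prod.snd (hY m)
  have key : ∀ Z W : PSec EM J FA A, (∀ m, PSec.coeff Z (t, m) = 0) →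
      (∀ m, PSec.coeff W (t, m) = 0) → pAct lA Z (PSec.coeff W) (t, m) = 0 := by
    intro Z W hZ hW
    have h1 : pAct lA Z (PSec.coeff W) (t, m) =
        PSec.coeff Z (t, m) * timeDerivFun (PSec.coeff W) (t, m) +
        lA.act (sliceSection (PSec.part Z) t) (sliceFun (PSec.coeff W) t) m := rfl
    have h2 : sliceFun (PSec.coeff W) t = 0 := by
      ext x
      exact hW x
    rw [h1, hZ, h2, zero_mul, zero_add]
    exact dirDeriv_const 0 m _
  refine Prod.ext ?_ ?_
  · change pAct lA X (PSec.coeff Y) (t, m) - pAct lA Y (PSec.coeff X) (t, m) = 0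
    rw [key X Y hX1 hY1, key Y X hY1 hX1, sub_zero]
  · let x : A m := tDeriv (PSec.part X) (t, m)
    let y : A m := tDeriv (PSec.part Y) (t, m)
    change lA.bracket (sliceSection (PSec.part X) t) (sliceSection (PSec.part Y) t) m +
      PSec.coeff X (t, m) • y - PSec.coeff Y (t, m) • x = lA.bracket a b m
    rw [hX1, hY1, hX2, hY2, zero_smul, zero_smul, add_zero, sub_zero]

/-- The inclusions `A → TJ × A` are Lie algebroid morphisms. -/
theorem LieAlgebroid.incl_isLieAlgebroidHom (lA : LieAlgebroid 𝓘(ℝ, EM) FA A) (t : J) :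
    (lA.incl t).IsLieAlgebroidHom := by
  intro a₁ a₂ p q f₁ b₁ f₂ b₂ h₁ h₂ m
  -- Extending the coefficients constantly in time turns the decompositions over the slice into
  -- sections of `TJ × A` with known restriction. Their bracket is computed once by the Leibniz rule
  -- and once on the slice.
  let F : C^∞⟮𝓘(ℝ, EM), M; ℝ⟯ → C^∞⟮𝓘(ℝ, ℝ).prod 𝓘(ℝ, EM), J × M; ℝ⟯ := fun f =>
    ⟨fun p => f p.2, f.contMDiff.comp contMDiff_snd⟩
  have e : ∀ {n : ℕ} (f : Fin n → C^∞⟮𝓘(ℝ, EM), M; ℝ⟯) (b : Fin n → PSec EM J FA A)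
      (a : Cₛ^∞⟮𝓘(ℝ, EM); FA, A⟯),
      (∀ m, (lA.incl t).fiber m (a m) = ∑ i, f i m • b i ((lA.incl t).base m)) →
      ∀ m, (∑ i, fsmul (F (f i)) (b i)) (t, m) = ((0 : ℝ), a m) := by
    intro n f b a h m
    rw [section_sum_apply]
    exact (h m).symm
  have h3 := (lA.intervalProd J).bracket_sum_fsmul (fun i => F (f₁ i)) b₁ (fun i => F (f₂ i)) b₂
    (t, m)
  have h4 : ∀ (a : Cₛ^∞⟮𝓘(ℝ, EM); FA, A⟯) (X : TProd EM J A (t, m)), X = ((0 : ℝ), a m) →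
      ∀ (f : C^∞⟮𝓘(ℝ, EM), M; ℝ⟯), dirDeriv (𝓘(ℝ, ℝ).prod 𝓘(ℝ, EM)) (F f) (t, m)
        ((lA.intervalProd J).anchor (t, m) X) = dirDeriv 𝓘(ℝ, EM) f m (lA.anchor m (a m)) := by
    rintro a X rfl f
    refine (dirDeriv_prod (F f) t m 0 (lA.anchor m (a m))).trans ?_
    rw [zero_mul, zero_add]
    rfl
  simp only [h4 a₁ _ (e f₁ b₁ a₁ h₁ m), h4 a₂ _ (e f₂ b₂ a₂ h₂ m)] at h3
  exact (lA.intervalProd_bracket_slice _ _ a₁ a₂ t (e f₁ b₁ a₁ h₁) (e f₂ b₂ a₂ h₂) m).symm.trans h3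

end InclHom

/-! ### Contraction and Cartan's formula -/

section Cartan

variable {EM HM M : Type*} [NormedAddCommGroup EM] [NormedSpace ℝ EM] [TopologicalSpace HM]
  {IM : ModelWithCorners ℝ EM HM} [TopologicalSpace M] [ChartedSpace HM M] [IsManifold IM ∞ M]
  {FA : Type*} [NormedAddCommGroup FA] [NormedSpace ℝ FA]
  {A : M → Type*} [TopologicalSpace (TotalSpace FA A)] [∀ x, AddCommGroup (A x)]
  [∀ x, Module ℝ (A x)] [∀ x, TopologicalSpace (A x)] [FiberBundle FA A] [VectorBundle ℝ FA A]
  {FV : Type*} [NormedAddCommGroup FV] [NormedSpace ℝ FV]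
  {V : M → Type*} [TopologicalSpace (TotalSpace FV V)] [∀ x, AddCommGroup (V x)]
  [∀ x, Module ℝ (V x)] [∀ x, TopologicalSpace (V x)] [FiberBundle FV V] [VectorBundle ℝ FV V]
  {lA : LieAlgebroid IM FA A} {k : ℕ}

lemma Form.eval_apply (α : Form IM FA A FV V k) (a : Fin k → Cₛ^∞⟮IM; FA, A⟯) (m : M) :
    α.eval a m = α.at m fun i => a i m := rfl

lemma Form.eval_update (α : Form IM FA A FV V k) (a : Fin k → Cₛ^∞⟮IM; FA, A⟯) (l : Fin k)
    (b : Cₛ^∞⟮IM; FA, A⟯) (m : M) : α.eval (Function.update a l b) m =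
      α.at m (Function.update (fun i => a i m) l (b m)) := by
  rw [Form.eval_apply]
  congr 1
  funext i
  by_cases h : i = l
  · subst h; simp
  · simp [h]

lemma Connection.koszul_eq (D : Connection lA FV V) (α : Form IM FA A FV V k)
    (a : Fin (k + 1) → Cₛ^∞⟮IM; FA, A⟯) :
    D.koszul k α a = ∑ j : Fin (k + 1), (-1 : ℝ) ^ (j : ℕ) •
      (D.toFun (a j) (α.eval fun i => a (j.succAbove i)) - (1 / 2 : ℝ) •
        ∑ l, α.eval (Function.update (fun i => a (j.succAbove i)) l
          (lA.bracket (a j) (a (j.succAbove l))))) := by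
  ext m
  rw [D.koszul_apply, section_sum_apply]
  refine Finset.sum_congr rfl fun j _ => ?_
  simp only [ContMDiffSection.coe_smul, ContMDiffSection.coe_sub, Pi.smul_apply, Pi.sub_apply,
    section_sum_apply, Form.eval_update]

/-- The contraction of a form with a section. -/
def Form.contract (X : Cₛ^∞⟮IM; FA, A⟯) (α : Form IM FA A FV V (k + 1)) : Form IM FA A FV V k :=
  ⟨fun m => (α.at m).curryLeft (X m), fun a => by
    refine (α.eval (Fin.cons X a)).contMDiff.congr fun m => ?_
    refine congrArg (TotalSpace.mk' FV m) (congrArg (α.at m) ?_)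
    funext i
    refine Fin.cases rfl (fun i => rfl) i⟩

lemma Form.contract_eval (X : Cₛ^∞⟮IM; FA, A⟯) (α : Form IM FA A FV V (k + 1))
    (a : Fin k → Cₛ^∞⟮IM; FA, A⟯) : (α.contract X).eval a = α.eval (Fin.cons X a) := by
  ext m
  refine congrArg (α.at m) ?_
  funext i
  refine Fin.cases rfl (fun i => rfl) i

/-- Cartan's formula, for sections commuting with the contracted one. -/
lemma Connection.koszul_cons (D : Connection lA FV V) (α : Form IM FA A FV V (k + 1))
    (X : Cₛ^∞⟮IM; FA, A⟯) (a : Fin (k + 1) → Cₛ^∞⟮IM; FA, A⟯) (h : ∀ i, lA.bracket X (a i) = 0)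
    (m : M) : D.koszul (k + 1) α (Fin.cons X a) m =
      D.toFun X (α.eval a) m - D.koszul k (α.contract X) a m := by
  have h' : ∀ i, lA.bracket (a i) X = 0 := fun i => by rw [lA.bracket_symm, h, neg_zero]
  have e1 : ∀ j : Fin (k + 1), (fun i => (Fin.cons X a : Fin (k + 2) → Cₛ^∞⟮IM; FA, A⟯)
      (j.succ.succAbove i)) = Fin.cons X fun i => a (j.succAbove i) := by
    intro j
    funext i
    refine Fin.cases ?_ (fun i => ?_) i
    · rw [Fin.succ_succAbove_zero]; rfl
    · rw [Fin.succ_succAbove_succ]; rfl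
  -- The term deleting `X` differentiates along `X`, and its brackets vanish. The others keep `X` in
  -- first place: the bracket that would replace `X` vanishes, and the rest is, up to the shift of
  -- sign, the differential of the contraction.
  rw [D.koszul_eq, D.koszul_eq, section_sum_apply, section_sum_apply, Fin.sum_univ_succ]
  refine Eq.trans (congrArg₂ (· + ·) ?_ ?_) ((congrArg _ (Finset.sum_neg_distrib _)).trans
    (sub_eq_add_neg _ _).symm)
  · have e2 : ∀ l : Fin (k + 1), α.eval (Function.update (fun i =>
        (Fin.cons X a : Fin (k + 2) → Cₛ^∞⟮IM; FA, A⟯) ((0 : Fin (k + 2)).succAbove i)) l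
          (lA.bracket X (a l))) m = 0 := fun l => by
      rw [Form.eval_update, h]
      exact (α.at m).map_update_zero _ _
    simp only [Fin.val_zero, pow_zero, one_smul, Fin.cons_zero, Fin.succAbove_zero, Fin.cons_succ]
      at e2 ⊢
    simp only [ContMDiffSection.coe_smul, ContMDiffSection.coe_sub, Pi.smul_apply, Pi.sub_apply,
      section_sum_apply, e2, Finset.sum_const_zero, smul_zero, sub_zero]
  · refine Finset.sum_congr rfl fun j _ => ?_
    have e3 : ∀ l : Fin k, α.eval (Function.update (Fin.cons X fun i => a (j.succAbove i)) l.succ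
        (lA.bracket (a j) (a (j.succAbove l)))) = (α.contract X).eval
          (Function.update (fun i => a (j.succAbove i)) l
            (lA.bracket (a j) (a (j.succAbove l)))) := by
      intro l
      rw [Form.contract_eval, Fin.cons_update]
    have e4 : α.eval (Function.update (Fin.cons X fun i => a (j.succAbove i)) 0
        (lA.bracket (a j) X)) m = 0 := by
      rw [Form.eval_update, h']
      exact (α.at m).map_update_zero _ _
    have e5 : ∑ l : Fin (k + 1), α.eval (Function.update (Fin.cons X fun i => a (j.succAbove i)) l
        (lA.bracket (a j) ((Fin.cons X fun i => a (j.succAbove i) :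
          Fin (k + 1) → Cₛ^∞⟮IM; FA, A⟯) l))) m = ∑ l : Fin k, (α.contract X).eval
          (Function.update (fun i => a (j.succAbove i)) l
            (lA.bracket (a j) (a (j.succAbove l)))) m := by
      rw [Fin.sum_univ_succ, Fin.cons_zero, e4, zero_add]
      simp only [Fin.cons_succ, e3]
    have e6 : ∀ l, (Fin.cons X a : Fin (k + 2) → Cₛ^∞⟮IM; FA, A⟯) (j.succ.succAbove l) =
      (Fin.cons X fun i => a (j.succAbove i) : Fin (k + 1) → Cₛ^∞⟮IM; FA, A⟯) l :=
      fun l => congrFun (e1 j) l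
    simp only [Fin.cons_succ, e6, Form.contract_eval] at e5 ⊢
    simp only [ContMDiffSection.coe_smul, ContMDiffSection.coe_sub, Pi.smul_apply, Pi.sub_apply,
      section_sum_apply]
    rw [e5, Fin.val_succ, pow_succ]
    module

/-- The differential of a form annihilated by `X`, evaluated on sections one of which is `X`. -/
lemma Connection.koszul_of_eq (D : Connection lA FV V) (α : Form IM FA A FV V k)
    (X : Cₛ^∞⟮IM; FA, A⟯) (hα : ∀ m (v : Fin k → A m) i, v i = X m → α.at m v = 0)
    (a : Fin (k + 1) → Cₛ^∞⟮IM; FA, A⟯) (h : ∀ i, lA.bracket X (a i) = 0) {j₀ : Fin (k + 1)}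
    (hj : a j₀ = X) : D.koszul k α a =
      (-1 : ℝ) ^ (j₀ : ℕ) • D.toFun X (α.eval fun i => a (j₀.succAbove i)) := by
  have hz : ∀ (b : Fin k → Cₛ^∞⟮IM; FA, A⟯) i, b i = 0 → α.eval b = 0 := fun b i hi => by
    ext m
    exact (α.at m).map_coord_zero i (by rw [hi]; rfl)
  have hx : ∀ (b : Fin k → Cₛ^∞⟮IM; FA, A⟯) i, b i = X → α.eval b = 0 := fun b i hi => by
    ext m
    exact hα m _ i (by rw [hi])
  -- A term deleting another index has `X` among its arguments, or has it replaced by a bracket with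
  -- `X`, which is zero. In the term deleting `j₀` every bracket is one with `X`.
  rw [D.koszul_eq, Finset.sum_eq_single j₀ (fun j _ hj' => ?_)
    (fun h => absurd (Finset.mem_univ _) h)]
  · rw [Finset.sum_eq_zero fun l _ => hz _ l (by rw [Function.update_self, hj, h]), smul_zero,
      sub_zero, hj]
  · obtain ⟨i₀, hi₀⟩ := Fin.exists_succAbove_eq hj'.symm
    rw [hx _ i₀ (by rw [hi₀, hj]), map_zero, Finset.sum_eq_zero fun l _ => ?_, smul_zero,
      sub_zero, smul_zero]
    by_cases hl : i₀ = l
    · exact hz _ l (by rw [Function.update_self, ← hl, hi₀, hj, lA.bracket_symm, h, neg_zero])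
    · exact hx _ i₀ (by rw [Function.update_of_ne hl, hi₀, hj])

/-- Puts the value of a form into the shape produced by `Connection.koszul_of_eq`, for comparison
after contraction with `∂_t`. -/
lemma Form.eval_succAbove (α : Form IM FA A FV V (k + 1)) (a : Fin (k + 1) → Cₛ^∞⟮IM; FA, A⟯)
    (j : Fin (k + 1)) : α.eval a =
      (-1 : ℝ) ^ (j : ℕ) • (α.contract (a j)).eval fun i => a (j.succAbove i) := by
  ext m
  have h := (α.at m).map_insertNth j (a j m) (fun i => a (j.succAbove i) m)
  rw [← Int.cast_smul_eq_zsmul ℝ] at h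
  push_cast at h
  rw [show j.insertNth (a j m) (fun i => a (j.succAbove i) m) = fun i => a i m from
    Fin.insertNth_self_removeNth j fun i => a i m] at h
  exact h

end Cartan

/-! ### Time-independent sections -/

section ConstSections

variable {EM M : Type*} [NormedAddCommGroup EM] [NormedSpace ℝ EM] [FiniteDimensional ℝ EM]
  [TopologicalSpace M] [ChartedSpace EM M] [IsManifold 𝓘(ℝ, EM) ∞ M] [T2Space M]
  {J : TopologicalSpace.Opens ℝ}
  {FA : Type*} [NormedAddCommGroup FA] [NormedSpace ℝ FA] [FiniteDimensional ℝ FA]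
  {A : M → Type*} [TopologicalSpace (TotalSpace FA A)] [∀ x, AddCommGroup (A x)]
  [∀ x, Module ℝ (A x)] [∀ x, TopologicalSpace (A x)] [FiberBundle FA A] [VectorBundle ℝ FA A]
  [ContMDiffVectorBundle ∞ FA A 𝓘(ℝ, EM)]

variable (J) in
/-- The time-independent section `(0, a)` of `TJ × A`. -/
def constPSec (a : Cₛ^∞⟮𝓘(ℝ, EM); FA, A⟯) : PSec EM J FA A := mkPSec 0 (constSection J a)

/-- The second section has zero time derivative and both coefficients of `∂_t` are constant, so each
term of the product bracket vanishes. -/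
lemma LieAlgebroid.bracket_ddt_const (lA : LieAlgebroid 𝓘(ℝ, EM) FA A)
    (a : Cₛ^∞⟮𝓘(ℝ, EM); FA, A⟯) :
    (lA.intervalProd J).bracket (ddtSection EM J FA A) (constPSec J a) = 0 := by
  change pBracketFun lA (mkPSec 1 0) (mkPSec 0 (constSection J a)) = 0
  refine PSec.ext' ?_ ?_
  · ext p
    have h : ∀ (X : PSec EM J FA A) (c : ℝ), pAct lA X (ContMDiffMap.const c) p = 0 := by
      intro X c
      rw [pAct_apply]
      exact dirDeriv_const c p _
    exact (congrArg₂ (· - ·) (h _ 0) (h _ 1)).trans (sub_zero 0)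
  · change tBracket lA 0 (constSection J a) + fsmul 1 (tDeriv (constSection J a)) -
      fsmul 0 (tDeriv 0) = 0
    rw [map_zero, LinearMap.zero_apply, tDeriv_const, map_zero]
    ext p
    simp

lemma LieAlgebroid.bracket_const (lA : LieAlgebroid 𝓘(ℝ, EM) FA A)
    (a b : Cₛ^∞⟮𝓘(ℝ, EM); FA, A⟯) :
    (lA.intervalProd J).bracket (constPSec J a) (constPSec J b) = constPSec J (lA.bracket a b) := by
  refine ContMDiffSection.ext fun p => ?_
  exact lA.intervalProd_bracket_slice (constPSec J a) (constPSec J b) a b p.1 (fun _ => rfl) (fun _ => rfl) p.2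

end ConstSections

/-! ### Forms with prescribed derivative in time -/

section Extension

variable {EM M : Type*} [NormedAddCommGroup EM] [NormedSpace ℝ EM] [FiniteDimensional ℝ EM]
  [TopologicalSpace M] [ChartedSpace EM M] [IsManifold 𝓘(ℝ, EM) ∞ M] [T2Space M]
  [SigmaCompactSpace M]
  {J : TopologicalSpace.Opens ℝ}
  {FA : Type*} [NormedAddCommGroup FA] [NormedSpace ℝ FA] [FiniteDimensional ℝ FA]
  {A : M → Type*} [TopologicalSpace (TotalSpace FA A)] [∀ x, AddCommGroup (A x)]
  [∀ x, Module ℝ (A x)] [∀ x, TopologicalSpace (A x)] [FiberBundle FA A] [VectorBundle ℝ FA A]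
  [ContMDiffVectorBundle ∞ FA A 𝓘(ℝ, EM)]
  {lA : LieAlgebroid 𝓘(ℝ, EM) FA A}
  {FV : Type*} [NormedAddCommGroup FV] [NormedSpace ℝ FV] [FiniteDimensional ℝ FV]
  {V : J × M → Type*} [TopologicalSpace (TotalSpace FV V)] [∀ x, AddCommGroup (V x)]
  [∀ x, Module ℝ (V x)] [∀ x, TopologicalSpace (V x)] [FiberBundle FV V] [VectorBundle ℝ FV V]
  [ContMDiffVectorBundle ∞ FV V (𝓘(ℝ, ℝ).prod 𝓘(ℝ, EM))]
  {k : ℕ}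

/-- Solution of `i_∂t ζ = 0`, `L_∂t ζ = β` with prescribed value at time `t₀`. -/
lemma Connection.exists_form (hJ : (J : Set ℝ).OrdConnected)
    (D : Connection (lA.intervalProd J) FV V)
    (β : Form (𝓘(ℝ, ℝ).prod 𝓘(ℝ, EM)) (ℝ × FA) (TProd EM J A) FV V k) (t₀ : J)
    (η : ∀ m, A m [⋀^Fin k]→ₗ[ℝ] V (t₀, m))
    (hη : ∀ a : Fin k → Cₛ^∞⟮𝓘(ℝ, EM); FA, A⟯, ContMDiff 𝓘(ℝ, EM)
      ((𝓘(ℝ, ℝ).prod 𝓘(ℝ, EM)).prod 𝓘(ℝ, FV)) ∞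
      fun m => (⟨(t₀, m), η m fun i => a i m⟩ : TotalSpace FV V)) :
    ∃ ζ : Form (𝓘(ℝ, ℝ).prod 𝓘(ℝ, EM)) (ℝ × FA) (TProd EM J A) FV V k,
      (∀ a : Fin k → Cₛ^∞⟮𝓘(ℝ, EM); FA, A⟯, D.ddt (ζ.eval fun i => constPSec J (a i)) =
        β.eval fun i => constPSec J (a i)) ∧
      (∀ p (v : Fin k → TProd EM J A p) i, (v i).2 = 0 → ζ.at p v = 0) ∧
      ∀ m v, ζ.at (t₀, m) (fun i => ((0 : ℝ), v i)) = η m v := by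
  choose S hS1 hS2 using fun a : Fin k → Cₛ^∞⟮𝓘(ℝ, EM); FA, A⟯ =>
    D.exists_solution hJ (β.eval fun i => constPSec J (a i)) t₀ (hη a)
  -- A section with the same equation and initial value along the single line `J × {m}` agrees with
  -- `S a` there. Hence `S a` over `m` depends only on the vectors `a i m`, and multilinearity and
  -- alternation pass from `β` and `η` to `S`.
  have char : ∀ (a : Fin k → Cₛ^∞⟮𝓘(ℝ, EM); FA, A⟯) (s : Cₛ^∞⟮𝓘(ℝ, ℝ).prod 𝓘(ℝ, EM); FV, V⟯)
      (m : M), (∀ t : J, D.ddt s (t, m) = β.at (t, m) fun i => ((0 : ℝ), a i m)) →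
      s (t₀, m) = (η m fun i => a i m) → ∀ t : J, S a (t, m) = s (t, m) := by
    intro a s m h1 h2 t
    refine D.eq_of_ddt_eq hJ (t₀ := t₀) (fun t => ?_) ?_ t
    · rw [hS1, h1]; rfl
    · rw [hS2, h2]
  have hcongr : ∀ (a a' : Fin k → Cₛ^∞⟮𝓘(ℝ, EM); FA, A⟯) (m : M), (∀ i, a i m = a' i m) →
      ∀ t : J, S a (t, m) = S a' (t, m) := by
    intro a a' m h
    refine char a (S a') m (fun t => ?_) ?_
    · rw [hS1]
      simp only [h]
      rfl
    · rw [hS2]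
      simp only [h]
  let e : ∀ m, A m → Cₛ^∞⟮𝓘(ℝ, EM); FA, A⟯ := fun m v => sectionThrough 𝓘(ℝ, EM) FA m v
  have he : ∀ m v, e m v m = v := fun m v => sectionThrough_apply m v
  have hup : ∀ (m : M) (t : J) (v : Fin k → A m) (i : Fin k) (x : A m),
      (fun j => ((0 : ℝ), e m (Function.update v i x j) m)) =
        fun j => (Function.update (fun j => ((0 : ℝ), v j)) i ((0 : ℝ), x)) j := by
    intro m t v i x
    funext j
    by_cases h : j = i
    · subst h; simp [he]
    · simp [h, he]
  let β' : ∀ (t : J) m, (ℝ × A m) [⋀^Fin k]→ₗ[ℝ] V (t, m) := fun t m => β.at (t, m)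
  let Z : ∀ p : J × M, A p.2 [⋀^Fin k]→ₗ[ℝ] V p := fun p =>
    { toFun v := S (fun i => e p.2 (v i)) p
      map_update_add' := by
        intro inst v i x y
        obtain rfl := Subsingleton.elim inst (instDecidableEqFin k)
        have h := char (fun j => e p.2 (Function.update v i (x + y) j))
          (S (fun j => e p.2 (Function.update v i x j)) +
            S (fun j => e p.2 (Function.update v i y j))) p.2 (fun t => by
          rw [map_add, ContMDiffSection.coe_add, Pi.add_apply, hS1, hS1]
          change β' t p.2 (fun j => ((0 : ℝ), e p.2 (Function.update v i x j) p.2)) +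
            β' t p.2 (fun j => ((0 : ℝ), e p.2 (Function.update v i y j) p.2)) =
            β' t p.2 (fun j => ((0 : ℝ), e p.2 (Function.update v i (x + y) j) p.2))
          rw [hup p.2 t, hup p.2 t, hup p.2 t,
            show ((0 : ℝ), x + y) = ((0 : ℝ), x) + ((0 : ℝ), y) by simp]
          exact ((β' t p.2).map_update_add _ i _ _).symm) (by
          rw [ContMDiffSection.coe_add, Pi.add_apply, hS2, hS2]
          simp only [he]
          exact ((η p.2).map_update_add v i x y).symm) p.1
        exact h
      map_update_smul' := by
        intro inst v i c x
        obtain rfl := Subsingleton.elim inst (instDecidableEqFin k)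
        have h := char (fun j => e p.2 (Function.update v i (c • x) j))
          (c • S (fun j => e p.2 (Function.update v i x j))) p.2 (fun t => by
          rw [map_smul, ContMDiffSection.coe_smul, Pi.smul_apply, hS1]
          change c • β' t p.2 (fun j => ((0 : ℝ), e p.2 (Function.update v i x j) p.2)) =
            β' t p.2 (fun j => ((0 : ℝ), e p.2 (Function.update v i (c • x) j) p.2))
          rw [hup p.2 t, hup p.2 t, show ((0 : ℝ), c • x) = c • ((0 : ℝ), x) by simp]
          exact ((β' t p.2).map_update_smul _ i _ _).symm) (by
          rw [ContMDiffSection.coe_smul, Pi.smul_apply, hS2]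
          simp only [he]
          exact ((η p.2).map_update_smul v i c x).symm) p.1
        exact h
      map_eq_zero_of_eq' := by
        intro v i j hij hne
        refine char (fun i => e p.2 (v i)) 0 p.2 (fun t => ?_) ?_ p.1
        · rw [map_zero]
          change 0 = β' t p.2 (fun i => ((0 : ℝ), e p.2 (v i) p.2))
          exact ((β' t p.2).map_eq_zero_of_eq _ (by rw [hij]) hne).symm
        · exact ((η p.2).map_eq_zero_of_eq _ (by rw [he, he, hij]) hne).symm }
  have hZ : ∀ p v, Z p v = S (fun i => e p.2 (v i)) p := fun _ _ => rfl
  have hZS : ∀ (a : Fin k → Cₛ^∞⟮𝓘(ℝ, EM); FA, A⟯) p, Z p (fun i => a i p.2) = S a p := by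
    intro a p
    rw [hZ]
    exact hcongr _ _ p.2 (fun i => he _ _) p.1
  -- The projection to `A` makes the form vanish whenever an argument is a multiple of `∂_t`.
  -- Smoothness is read off in a local frame of time-independent sections, on which the values are
  -- the smooth solutions `S`.
  let ζ : Form (𝓘(ℝ, ℝ).prod 𝓘(ℝ, EM)) (ℝ × FA) (TProd EM J A) FV V k :=
    ⟨fun p => (Z p).compLinearMap (LinearMap.snd ℝ ℝ (A p.2)), fun X p₀ => by
      obtain ⟨n, s, κ, hκ, hs⟩ := exists_frame 𝓘(ℝ, EM) FA A p₀.2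
      let f : Fin k → Fin n → C^∞⟮𝓘(ℝ, ℝ).prod 𝓘(ℝ, EM), J × M; ℝ⟯ := fun i q =>
        ⟨fun p => κ q p.2 (PSec.part (X i) p), (hκ q).comp
          (contMDiff_pullback_section.1 (PSec.part (X i)).contMDiff)⟩
      let G : (Fin k → Fin n) → C^∞⟮𝓘(ℝ, ℝ).prod 𝓘(ℝ, EM), J × M; ℝ⟯ := fun r =>
        ⟨fun p => ∏ i, f i (r i) p, contMDiff_finsetProd fun i _ => (f i (r i)).contMDiff⟩
      let T : Cₛ^∞⟮𝓘(ℝ, ℝ).prod 𝓘(ℝ, EM); FV, V⟯ :=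
        ∑ r : Fin k → Fin n, fsmul (G r) (S fun i => s (r i))
      refine (T.contMDiff p₀).congr_of_eventuallyEq ?_
      filter_upwards [continuous_snd.continuousAt.eventually hs] with p hp
      refine congrArg (TotalSpace.mk' FV p) ?_
      have h1 : (fun i => (X i p).2) = fun i => ∑ q, f i q p • s q p.2 :=
        funext fun i => hp (X i p).2
      change Z p (fun i => (X i p).2) = T p
      rw [h1, map_sum_smul, section_sum_apply]
      refine Finset.sum_congr rfl fun r _ => ?_
      rw [hZS (fun i => s (r i))]
      rfl⟩
  have hζ : ∀ p v, ζ.at p v = Z p (fun i => (v i).2) := fun _ _ => rfl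
  refine ⟨ζ, fun a => ?_, fun p v i hv => ?_, fun m v => ?_⟩
  · have h1 : (ζ.eval fun i => constPSec J (a i)) = S a := by
      ext p
      exact hZS a p
    rw [h1, hS1]
  · rw [hζ]
    exact (Z p).map_coord_zero i hv
  · refine (hS2 (fun i => e m (v i)) m).trans ?_
    simp only [he]

end Extension

/-! ### Primitives by integration in time -/

section Primitive

variable {EM M : Type*} [NormedAddCommGroup EM] [NormedSpace ℝ EM] [FiniteDimensional ℝ EM]
  [TopologicalSpace M] [ChartedSpace EM M] [IsManifold 𝓘(ℝ, EM) ∞ M] [T2Space M]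
  [SigmaCompactSpace M]
  {J : TopologicalSpace.Opens ℝ}
  {FA : Type*} [NormedAddCommGroup FA] [NormedSpace ℝ FA] [FiniteDimensional ℝ FA]
  {A : M → Type*} [TopologicalSpace (TotalSpace FA A)] [∀ x, AddCommGroup (A x)]
  [∀ x, Module ℝ (A x)] [∀ x, TopologicalSpace (A x)] [FiberBundle FA A] [VectorBundle ℝ FA A]
  [ContMDiffVectorBundle ∞ FA A 𝓘(ℝ, EM)]
  {lA : LieAlgebroid 𝓘(ℝ, EM) FA A}
  {FV : Type*} [NormedAddCommGroup FV] [NormedSpace ℝ FV] [FiniteDimensional ℝ FV]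
  {V : J × M → Type*} [TopologicalSpace (TotalSpace FV V)] [∀ x, AddCommGroup (V x)]
  [∀ x, Module ℝ (V x)] [∀ x, TopologicalSpace (V x)] [FiberBundle FV V] [VectorBundle ℝ FV V]
  [ContMDiffVectorBundle ∞ FV V (𝓘(ℝ, ℝ).prod 𝓘(ℝ, EM))]
  {k : ℕ}

/-- Two tensorial expressions `dζ` and `γ` agree if they agree on `∂_t` and time-independent
sections. -/
lemma Connection.koszul_eq_eval_of_const (D : Connection (lA.intervalProd J) FV V)
    (ζ : Form (𝓘(ℝ, ℝ).prod 𝓘(ℝ, EM)) (ℝ × FA) (TProd EM J A) FV V k)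
    (γ : Form (𝓘(ℝ, ℝ).prod 𝓘(ℝ, EM)) (ℝ × FA) (TProd EM J A) FV V (k + 1))
    (h : ∀ Y : Fin (k + 1) → PSec EM J FA A,
      (∀ i, Y i = ddtSection EM J FA A ∨ ∃ a, Y i = constPSec J a) → D.koszul k ζ Y = γ.eval Y)
    (X : Fin (k + 1) → PSec EM J FA A) : D.koszul k ζ X = γ.eval X := by
  refine ContMDiffSection.ext fun p => ?_
  obtain ⟨n, s, κ, -, hs⟩ := exists_frame 𝓘(ℝ, EM) FA A p.2
  have hs := hs.self_of_nhds
  -- `∂_t` and time-independent sections span the fibre at `p`. Both sides depend only on the values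
  -- of the arguments at `p`, so constant coefficients suffice.
  let b : Fin (n + 1) → PSec EM J FA A :=
    Fin.cons (ddtSection EM J FA A) fun q => constPSec J (s q)
  let c : Fin (k + 1) → Fin (n + 1) → ℝ := fun i => Fin.cons (X i p).1 fun q => κ q p.2 (X i p).2
  have hX : ∀ i, X i p = ∑ q, c i q • b q p := by
    intro i
    let x : ℝ := (X i p).1
    let y : A p.2 := (X i p).2
    have e1 : ∑ q, c i q • b q p = x • ((1 : ℝ), (0 : A p.2)) +
        ∑ q, κ q p.2 (X i p).2 • ((0 : ℝ), s q p.2) := Fin.sum_univ_succ _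
    have e2 : ∑ q, κ q p.2 (X i p).2 • ((0 : ℝ), s q p.2) =
        ((0 : ℝ), ∑ q, κ q p.2 (X i p).2 • s q p.2) := by
      refine Prod.ext ?_ ?_
      · simp [Prod.fst_sum]
      · simp [Prod.snd_sum]
    rw [e1, e2, ← hs (X i p).2]
    exact Prod.ext (by change x = x * 1 + 0; ring)
      (by change y = x • (0 : A p.2) + y; rw [smul_zero, zero_add])
  have hb : ∀ q, b q = ddtSection EM J FA A ∨ ∃ a, b q = constPSec J a := fun q =>
    Fin.cases (Or.inl rfl) (fun q => Or.inr ⟨s q, rfl⟩) q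
  have h1 := D.koszul_sum_fsmul ζ (fun i => ∑ q, fsmul (ContMDiffMap.const (c i q)) (b q))
    (fun i q => ContMDiffMap.const (c i q)) b (fun i x => section_sum_apply _ _ _) p
  rw [D.koszul_congr ζ (a' := X) fun i => by
    rw [section_sum_apply, hX]
    rfl] at h1
  have h2 : γ.eval X p = ∑ r : Fin (k + 1) → Fin (n + 1), (∏ i, c i (r i)) •
      γ.at p (fun i => b (r i) p) := by
    rw [Form.eval_apply, show (fun i => X i p) = fun i => ∑ q, c i q • b q p from funext hX]
    exact map_sum_smul _ _ _
  rw [h1, h2]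
  refine Finset.sum_congr rfl fun r _ => ?_
  rw [h _ fun i => hb (r i)]
  rfl

lemma update_constPSec {n : ℕ} (b : Fin n → Cₛ^∞⟮𝓘(ℝ, EM); FA, A⟯) (l : Fin n)
    (c : Cₛ^∞⟮𝓘(ℝ, EM); FA, A⟯) :
    Function.update (fun i => constPSec J (b i)) l (constPSec J c) =
      fun i => constPSec J (Function.update b l c i) := by
  funext i
  by_cases h : i = l
  · subst h; simp
  · simp [h]

/-- Flatness, combined with the vanishing of the bracket of `∂_t` with a time-independent section.
-/
lemma Connection.IsFlat.ddt_toFun_const {D : Connection (lA.intervalProd J) FV V} (hD : D.IsFlat)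
    (b : Cₛ^∞⟮𝓘(ℝ, EM); FA, A⟯) (s : Cₛ^∞⟮𝓘(ℝ, ℝ).prod 𝓘(ℝ, EM); FV, V⟯) :
    D.ddt (D.toFun (constPSec J b) s) = D.toFun (constPSec J b) (D.ddt s) := by
  have := hD (ddtSection EM J FA A) (constPSec J b) s
  rw [lA.bracket_ddt_const, map_zero, LinearMap.zero_apply, sub_zero] at this
  exact sub_eq_zero.1 this

/-- The Koszul formula consists of covariant derivatives along time-independent sections, which
commute with `∇_∂t`, and of values of the form on time-independent sections, since their brackets
are again time-independent. -/
lemma Connection.IsFlat.ddt_koszul_const {D : Connection (lA.intervalProd J) FV V} (hD : D.IsFlat)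
    {ζ β : Form (𝓘(ℝ, ℝ).prod 𝓘(ℝ, EM)) (ℝ × FA) (TProd EM J A) FV V k}
    (h : ∀ a : Fin k → Cₛ^∞⟮𝓘(ℝ, EM); FA, A⟯, D.ddt (ζ.eval fun i => constPSec J (a i)) =
        β.eval fun i => constPSec J (a i)) (a : Fin (k + 1) → Cₛ^∞⟮𝓘(ℝ, EM); FA, A⟯) :
    D.ddt (D.koszul k ζ fun i => constPSec J (a i)) =
      D.koszul k β fun i => constPSec J (a i) := by
  have h1 : ∀ j : Fin (k + 1), D.ddt (D.toFun (constPSec J (a j))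
      (ζ.eval fun i => constPSec J (a (j.succAbove i)))) = D.toFun (constPSec J (a j))
        (β.eval fun i => constPSec J (a (j.succAbove i))) := fun j =>
    (hD.ddt_toFun_const _ _).trans (congrArg _ (h fun i => a (j.succAbove i)))
  have h2 : ∀ (j : Fin (k + 1)) l, D.ddt (ζ.eval (Function.update
      (fun i => constPSec J (a (j.succAbove i))) l ((lA.intervalProd J).bracket
        (constPSec J (a j)) (constPSec J (a (j.succAbove l)))))) =
      β.eval (Function.update (fun i => constPSec J (a (j.succAbove i))) l
        ((lA.intervalProd J).bracket (constPSec J (a j)) (constPSec J (a (j.succAbove l))))) := by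
    intro j l
    have e := lA.bracket_const (J := J) (a j) (a (j.succAbove l))
    have e' := update_constPSec (J := J) (fun i => a (j.succAbove i)) l
      (lA.bracket (a j) (a (j.succAbove l)))
    rw [e, e']
    exact h _
  refine (congrArg D.ddt (D.koszul_eq _ _)).trans ((map_sum _ _ _).trans
    (Eq.trans ?_ (D.koszul_eq β _).symm))
  refine Finset.sum_congr rfl fun j _ => ?_
  refine (map_smul _ _ _).trans (congrArg _ ((map_sub _ _ _).trans
    (congrArg₂ (· - ·) (h1 j) ((map_smul _ _ _).trans (congrArg _ ((map_sum _ _ _).trans ?_))))))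
  exact Finset.sum_congr rfl fun l _ => h2 j l

/-- Extension of primitives from the slice at time `t₀`. -/
theorem Connection.exists_primitive (hJ : (J : Set ℝ).OrdConnected)
    {D : Connection (lA.intervalProd J) FV V} (hD : D.IsFlat)
    {γ : Form (𝓘(ℝ, ℝ).prod 𝓘(ℝ, EM)) (ℝ × FA) (TProd EM J A) FV V (k + 1)}
    (hγ : γ ∈ D.closedForms (k + 1)) (t₀ : J)
    (η : ∀ m, A m [⋀^Fin k]→ₗ[ℝ] V (t₀, m))
    (hη : ∀ a : Fin k → Cₛ^∞⟮𝓘(ℝ, EM); FA, A⟯, ContMDiff 𝓘(ℝ, EM)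
      ((𝓘(ℝ, ℝ).prod 𝓘(ℝ, EM)).prod 𝓘(ℝ, FV)) ∞
      fun m => (⟨(t₀, m), η m fun i => a i m⟩ : TotalSpace FV V)) :
    ∃ ζ : Form (𝓘(ℝ, ℝ).prod 𝓘(ℝ, EM)) (ℝ × FA) (TProd EM J A) FV V k,
      (∀ a : Fin k → Cₛ^∞⟮𝓘(ℝ, EM); FA, A⟯, D.ddt (ζ.eval fun i => constPSec J (a i)) =
        (γ.contract (ddtSection EM J FA A)).eval fun i => constPSec J (a i)) ∧
      (∀ m v, ζ.at (t₀, m) (fun i => ((0 : ℝ), v i)) = η m v) ∧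
      ((∀ (a : Fin (k + 1) → Cₛ^∞⟮𝓘(ℝ, EM); FA, A⟯) m,
        D.koszul k ζ (fun i => constPSec J (a i)) (t₀, m) =
          γ.eval (fun i => constPSec J (a i)) (t₀, m)) →
        ∀ X, D.koszul k ζ X = γ.eval X) := by
  set T := ddtSection EM J FA A with hT
  obtain ⟨ζ, hζ1, hζ2, hζ3⟩ := D.exists_form hJ (γ.contract T) t₀ η hη
  refine ⟨ζ, hζ1, hζ3, fun h0 => D.koszul_eq_eval_of_const ζ γ fun Y hY => ?_⟩
  have hTc : ∀ a, (lA.intervalProd J).bracket T (constPSec J a) = 0 := lA.bracket_ddt_const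
  have hT0 : ∀ p (v : Fin k → TProd EM J A p) i, v i = T p → ζ.at p v = 0 := fun p v i hv =>
    hζ2 p v i (by rw [hv]; rfl)
  -- If `∂_t` is among the arguments, what remains of `dζ` is `∇_∂t` of the value of `ζ` on the
  -- others, which is `i_∂t γ` by construction. If it occurs twice, both sides are zero.
  by_cases hT1 : ∃ j₀, Y j₀ = T
  · obtain ⟨j₀, hj₀⟩ := hT1
    have hTY : ∀ i, (lA.intervalProd J).bracket T (Y i) = 0 := fun i => by
      rcases hY i with h | ⟨a, h⟩
      · rw [h]; exact (lA.intervalProd J).bracket_self T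
      · rw [h, hTc]
    rw [D.koszul_of_eq ζ T hT0 Y hTY hj₀, γ.eval_succAbove Y j₀, hj₀]
    congr 1
    by_cases h2 : ∃ i, Y (j₀.succAbove i) = T
    · obtain ⟨i, hi⟩ := h2
      have e1 : (ζ.eval fun i => Y (j₀.succAbove i)) = 0 := ContMDiffSection.ext fun p =>
        hT0 p _ i (congrArg (fun X : PSec EM J FA A => X p) hi)
      have e2 : ((γ.contract T).eval fun i => Y (j₀.succAbove i)) = 0 :=
        ContMDiffSection.ext fun p => (γ.at p).map_eq_zero_of_eq _ (i := 0) (j := i.succ)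
          (congrArg (fun X : PSec EM J FA A => X p) hi.symm) (Fin.succ_ne_zero i).symm
      rw [e1, e2, map_zero]
    · have h3 : ∀ i, ∃ a, Y (j₀.succAbove i) = constPSec J a := fun i =>
        (hY (j₀.succAbove i)).resolve_left fun h => h2 ⟨i, h⟩
      choose a ha using h3
      simp only [ha]
      exact hζ1 a
  · have h3 : ∀ i, ∃ a, Y i = constPSec J a := fun i =>
      (hY i).resolve_left fun h => hT1 ⟨i, h⟩
    choose a ha using h3
    obtain rfl : Y = fun i => constPSec J (a i) := funext ha
    -- On time-independent arguments `dζ` and `γ` have the same time derivative `d i_∂t γ`: the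
    -- first because `∇_∂t` commutes with the differential there, the second by Cartan's formula for
    -- the closed form `γ`. Equality at time `t₀` then propagates.
    have e1 : D.ddt (D.koszul k ζ fun i => constPSec J (a i)) =
        D.koszul k (γ.contract T) fun i => constPSec J (a i) :=
      hD.ddt_koszul_const hζ1 a
    have e2 : D.ddt (γ.eval fun i => constPSec J (a i)) =
        D.koszul k (γ.contract T) fun i => constPSec J (a i) := by
      refine ContMDiffSection.ext fun p => ?_
      have h := D.koszul_cons γ T (fun i => constPSec J (a i)) (fun i => hTc _) p
      have h' : D.koszul (k + 1) γ = 0 := hγ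
      rw [h'] at h
      exact sub_eq_zero.1 h.symm
    refine ContMDiffSection.ext fun p => ?_
    exact D.eq_of_ddt_eq hJ (t₀ := t₀) (fun t => by rw [e1, e2]) (h0 a p.2) p.1

end Primitive

/-! ### Maps induced in cohomology -/

section Induced

variable {EM HM M : Type*} [NormedAddCommGroup EM] [NormedSpace ℝ EM] [TopologicalSpace HM]
  {IM : ModelWithCorners ℝ EM HM} [TopologicalSpace M] [ChartedSpace HM M] [IsManifold IM ∞ M]
  {EN HN N : Type*} [NormedAddCommGroup EN] [NormedSpace ℝ EN] [TopologicalSpace HN]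
  {IN : ModelWithCorners ℝ EN HN} [TopologicalSpace N] [ChartedSpace HN N] [IsManifold IN ∞ N]
  {FA : Type*} [NormedAddCommGroup FA] [NormedSpace ℝ FA]
  {A : M → Type*} [TopologicalSpace (TotalSpace FA A)] [∀ x, AddCommGroup (A x)]
  [∀ x, Module ℝ (A x)] [∀ x, TopologicalSpace (A x)] [FiberBundle FA A] [VectorBundle ℝ FA A]
  {lA : LieAlgebroid IM FA A}
  {FV : Type*} [NormedAddCommGroup FV] [NormedSpace ℝ FV]
  {V : M → Type*} [TopologicalSpace (TotalSpace FV V)] [∀ x, AddCommGroup (V x)]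
  [∀ x, Module ℝ (V x)] [∀ x, TopologicalSpace (V x)] [FiberBundle FV V] [VectorBundle ℝ FV V]
  {FB : Type*} [NormedAddCommGroup FB] [NormedSpace ℝ FB]
  {B : N → Type*} [TopologicalSpace (TotalSpace FB B)] [∀ x, AddCommGroup (B x)]
  [∀ x, Module ℝ (B x)] [∀ x, TopologicalSpace (B x)] [FiberBundle FB B] [VectorBundle ℝ FB B]
  {lB : LieAlgebroid IN FB B}
  {FW : Type*} [NormedAddCommGroup FW] [NormedSpace ℝ FW]
  {W : N → Type*} [TopologicalSpace (TotalSpace FW W)] [∀ x, AddCommGroup (W x)]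
  [∀ x, Module ℝ (W x)] [∀ x, TopologicalSpace (W x)] [FiberBundle FW W] [VectorBundle ℝ FW W]

lemma exists_inducedBy {D : Connection lA FV V} {D' : Connection lB FW W} {k : ℕ}
    (f : Form IM FA A FV V k →ₗ[ℝ] Form IN FB B FW W k)
    (hc : ∀ α ∈ D.closedForms k, f α ∈ D'.closedForms k)
    (he : ∀ α ∈ D.exactForms k, f α ∈ D'.exactForms k) :
    ∃ F : D.Cohomology k →ₗ[ℝ] D'.Cohomology k, InducedBy F f :=
  ⟨Submodule.mapQ _ _ (f.restrict hc) fun _ hα => he _ hα, fun α h => ⟨hc α h, rfl⟩⟩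

lemma Connection.cohomologyClass_eq_zero {D : Connection lA FV V} {k : ℕ}
    {α : Form IM FA A FV V k} (h : α ∈ D.closedForms k) :
    D.cohomologyClass α h = 0 ↔ α ∈ D.exactForms k :=
  Submodule.Quotient.mk_eq_zero _

lemma Connection.mem_closedForms {D : Connection lA FV V} {k : ℕ} {α : Form IM FA A FV V k} :
    α ∈ D.closedForms k ↔ ∀ a, D.koszul k α a = 0 := by
  rw [Connection.closedForms, LinearMap.mem_ker, funext_iff]
  rfl

/-- Injectivity on classes is the reflection of exactness. Surjectivity is asked of closed forms
themselves rather than of classes, which is what parallel extension provides. -/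
lemma exists_equiv_inducedBy {D : Connection lA FV V} {D' : Connection lB FW W} {k : ℕ}
    (f : Form IM FA A FV V k →ₗ[ℝ] Form IN FB B FW W k)
    (hc : ∀ α ∈ D.closedForms k, f α ∈ D'.closedForms k)
    (he : ∀ α ∈ D.exactForms k, f α ∈ D'.exactForms k)
    (hinj : ∀ α ∈ D.closedForms k, f α ∈ D'.exactForms k → α ∈ D.exactForms k)
    (hsurj : ∀ η ∈ D'.closedForms k, ∃ ζ ∈ D.closedForms k, f ζ = η) :
    ∃ I : D.Cohomology k ≃ₗ[ℝ] D'.Cohomology k, InducedBy I f := by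
  obtain ⟨F, hF⟩ := exists_inducedBy f hc he
  refine ⟨LinearEquiv.ofBijective F ⟨?_, ?_⟩, hF⟩
  · refine (injective_iff_map_eq_zero F).2 fun c hc => ?_
    obtain ⟨⟨α, hα⟩, rfl⟩ := Submodule.Quotient.mk_surjective _ c
    obtain ⟨h', e⟩ := hF α hα
    have h1 : D'.cohomologyClass _ h' = 0 := e.symm.trans hc
    exact (Connection.cohomologyClass_eq_zero hα).2
      (hinj α hα ((Connection.cohomologyClass_eq_zero h').1 h1))
  · intro c
    obtain ⟨⟨η, hη⟩, rfl⟩ := Submodule.Quotient.mk_surjective _ c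
    obtain ⟨ζ, hζ, rfl⟩ := hsurj η hη
    obtain ⟨h', e⟩ := hF ζ hζ
    exact ⟨_, e⟩

end Induced

/-! ### Comparison of two quasi-isomorphisms -/

section Roof

variable
  {E₀ H₀ M₀ : Type*} [NormedAddCommGroup E₀] [NormedSpace ℝ E₀] [TopologicalSpace H₀]
  {I₀ : ModelWithCorners ℝ E₀ H₀} [TopologicalSpace M₀] [ChartedSpace H₀ M₀]
  [IsManifold I₀ ∞ M₀]
  {F₀ : Type*} [NormedAddCommGroup F₀] [NormedSpace ℝ F₀]
  {A₀ : M₀ → Type*} [TopologicalSpace (TotalSpace F₀ A₀)] [∀ x, AddCommGroup (A₀ x)]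
  [∀ x, Module ℝ (A₀ x)] [∀ x, TopologicalSpace (A₀ x)] [FiberBundle F₀ A₀]
  [VectorBundle ℝ F₀ A₀]
  {l₀ : LieAlgebroid I₀ F₀ A₀}
  {G₀ : Type*} [NormedAddCommGroup G₀] [NormedSpace ℝ G₀]
  {V₀ : M₀ → Type*} [TopologicalSpace (TotalSpace G₀ V₀)] [∀ x, AddCommGroup (V₀ x)]
  [∀ x, Module ℝ (V₀ x)] [∀ x, TopologicalSpace (V₀ x)] [FiberBundle G₀ V₀]
  [VectorBundle ℝ G₀ V₀]
  {E₁ H₁ M₁ : Type*} [NormedAddCommGroup E₁] [NormedSpace ℝ E₁] [TopologicalSpace H₁]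
  {I₁ : ModelWithCorners ℝ E₁ H₁} [TopologicalSpace M₁] [ChartedSpace H₁ M₁]
  [IsManifold I₁ ∞ M₁]
  {F₁ : Type*} [NormedAddCommGroup F₁] [NormedSpace ℝ F₁]
  {A₁ : M₁ → Type*} [TopologicalSpace (TotalSpace F₁ A₁)] [∀ x, AddCommGroup (A₁ x)]
  [∀ x, Module ℝ (A₁ x)] [∀ x, TopologicalSpace (A₁ x)] [FiberBundle F₁ A₁]
  [VectorBundle ℝ F₁ A₁]
  {l₁ : LieAlgebroid I₁ F₁ A₁}
  {G₁ : Type*} [NormedAddCommGroup G₁] [NormedSpace ℝ G₁]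
  {V₁ : M₁ → Type*} [TopologicalSpace (TotalSpace G₁ V₁)] [∀ x, AddCommGroup (V₁ x)]
  [∀ x, Module ℝ (V₁ x)] [∀ x, TopologicalSpace (V₁ x)] [FiberBundle G₁ V₁]
  [VectorBundle ℝ G₁ V₁]
  {E₂ H₂ M₂ : Type*} [NormedAddCommGroup E₂] [NormedSpace ℝ E₂] [TopologicalSpace H₂]
  {I₂ : ModelWithCorners ℝ E₂ H₂} [TopologicalSpace M₂] [ChartedSpace H₂ M₂]
  [IsManifold I₂ ∞ M₂]
  {F₂ : Type*} [NormedAddCommGroup F₂] [NormedSpace ℝ F₂]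
  {A₂ : M₂ → Type*} [TopologicalSpace (TotalSpace F₂ A₂)] [∀ x, AddCommGroup (A₂ x)]
  [∀ x, Module ℝ (A₂ x)] [∀ x, TopologicalSpace (A₂ x)] [FiberBundle F₂ A₂]
  [VectorBundle ℝ F₂ A₂]
  {l₂ : LieAlgebroid I₂ F₂ A₂}
  {G₂ : Type*} [NormedAddCommGroup G₂] [NormedSpace ℝ G₂]
  {V₂ : M₂ → Type*} [TopologicalSpace (TotalSpace G₂ V₂)] [∀ x, AddCommGroup (V₂ x)]
  [∀ x, Module ℝ (V₂ x)] [∀ x, TopologicalSpace (V₂ x)] [FiberBundle G₂ V₂]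
  [VectorBundle ℝ G₂ V₂]
  {E₃ H₃ M₃ : Type*} [NormedAddCommGroup E₃] [NormedSpace ℝ E₃] [TopologicalSpace H₃]
  {I₃ : ModelWithCorners ℝ E₃ H₃} [TopologicalSpace M₃] [ChartedSpace H₃ M₃]
  [IsManifold I₃ ∞ M₃]
  {F₃ : Type*} [NormedAddCommGroup F₃] [NormedSpace ℝ F₃]
  {A₃ : M₃ → Type*} [TopologicalSpace (TotalSpace F₃ A₃)] [∀ x, AddCommGroup (A₃ x)]
  [∀ x, Module ℝ (A₃ x)] [∀ x, TopologicalSpace (A₃ x)] [FiberBundle F₃ A₃]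
  [VectorBundle ℝ F₃ A₃]
  {l₃ : LieAlgebroid I₃ F₃ A₃}
  {G₃ : Type*} [NormedAddCommGroup G₃] [NormedSpace ℝ G₃]
  {V₃ : M₃ → Type*} [TopologicalSpace (TotalSpace G₃ V₃)] [∀ x, AddCommGroup (V₃ x)]
  [∀ x, Module ℝ (V₃ x)] [∀ x, TopologicalSpace (V₃ x)] [FiberBundle G₃ V₃]
  [VectorBundle ℝ G₃ V₃]

/-- The comparison in cohomology of two quasi-isomorphisms `r₂` and `r₃` of forms. -/
lemma InducedBy.exists_comparison {D₀ : Connection l₀ G₀ V₀} {D₁ : Connection l₁ G₁ V₁}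
    {D₂ : Connection l₂ G₂ V₂} {D₃ : Connection l₃ G₃ V₃} {k : ℕ}
    {p : Form I₀ F₀ A₀ G₀ V₀ k →ₗ[ℝ] Form I₁ F₁ A₁ G₁ V₁ k}
    {p₂ : Form I₀ F₀ A₀ G₀ V₀ k →ₗ[ℝ] Form I₂ F₂ A₂ G₂ V₂ k}
    {p₃ : Form I₀ F₀ A₀ G₀ V₀ k →ₗ[ℝ] Form I₃ F₃ A₃ G₃ V₃ k}
    {r₂ : Form I₁ F₁ A₁ G₁ V₁ k →ₗ[ℝ] Form I₂ F₂ A₂ G₂ V₂ k}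
    {r₃ : Form I₁ F₁ A₁ G₁ V₁ k →ₗ[ℝ] Form I₃ F₃ A₃ G₃ V₃ k}
    {T : Form I₂ F₂ A₂ G₂ V₂ k →ₗ[ℝ] Form I₃ F₃ A₃ G₃ V₃ k}
    {R₂ : D₁.Cohomology k ≃ₗ[ℝ] D₂.Cohomology k} {R₃ : D₁.Cohomology k ≃ₗ[ℝ] D₃.Cohomology k}
    (hR₂ : InducedBy R₂ r₂) (hR₃ : InducedBy R₃ r₃)
    (hc : ∀ α ∈ D₀.closedForms k, p α ∈ D₁.closedForms k)
    (he : ∀ α ∈ D₀.exactForms k, p α ∈ D₁.exactForms k)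
    (h₂ : ∀ α, r₂ (p α) = p₂ α) (h₃ : ∀ α, r₃ (p α) = p₃ α)
    (hT : ∀ η ∈ D₂.closedForms k, ∃ ζ ∈ D₁.closedForms k, r₂ ζ = η ∧ T η = r₃ ζ) :
    ∃ (P₂ : D₀.Cohomology k →ₗ[ℝ] D₂.Cohomology k) (P₃ : D₀.Cohomology k →ₗ[ℝ] D₃.Cohomology k)
      (S : D₂.Cohomology k ≃ₗ[ℝ] D₃.Cohomology k),
      InducedBy P₂ p₂ ∧ InducedBy P₃ p₃ ∧ InducedBy S T ∧
        (∀ c, P₃ c = R₃ (R₂.symm (P₂ c))) ∧ ∀ c, R₃ (R₂.symm c) = S c := by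
  obtain ⟨P, hP⟩ := exists_inducedBy p hc he
  -- Both maps out of `D₀` factor through `D₁`, so their comparison is the cancellation of `R₂`.
  -- That the comparison is induced by `T` is seen on the lift `ζ` of a closed form along `r₂`.
  refine ⟨R₂.toLinearMap ∘ₗ P, R₃.toLinearMap ∘ₗ P, R₂.symm.trans R₃, fun α hα => ?_,
    fun α hα => ?_, fun α hα => ?_, fun c => ?_, fun c => rfl⟩
  · obtain ⟨h, e⟩ := hP α hα
    obtain ⟨h', e'⟩ := hR₂ _ h
    exact h₂ α ▸ ⟨h', (congrArg R₂ e).trans e'⟩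
  · obtain ⟨h, e⟩ := hP α hα
    obtain ⟨h', e'⟩ := hR₃ _ h
    exact h₃ α ▸ ⟨h', (congrArg R₃ e).trans e'⟩
  · obtain ⟨ζ, hζ, rfl, h⟩ := hT α hα
    obtain ⟨_, e⟩ := hR₂ ζ hζ
    obtain ⟨h', e'⟩ := hR₃ ζ hζ
    rw [h]
    refine ⟨h', ?_⟩
    rw [← e, LinearEquiv.trans_apply, LinearEquiv.symm_apply_apply, e']
  · exact (congrArg R₃ (R₂.symm_apply_apply (P c))).symm

end Roof

/-! ### Smoothness of fibrewise linear maps -/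

section BundleMaps

variable {EM HM M : Type*} [NormedAddCommGroup EM] [NormedSpace ℝ EM] [TopologicalSpace HM]
  {IM : ModelWithCorners ℝ EM HM} [TopologicalSpace M] [ChartedSpace HM M] [IsManifold IM ∞ M]
  [FiniteDimensional ℝ EM] [T2Space M]
  {FV : Type*} [NormedAddCommGroup FV] [NormedSpace ℝ FV] [FiniteDimensional ℝ FV]
  {V : M → Type*} [TopologicalSpace (TotalSpace FV V)] [∀ x, AddCommGroup (V x)]
  [∀ x, Module ℝ (V x)] [∀ x, TopologicalSpace (V x)] [FiberBundle FV V] [VectorBundle ℝ FV V]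
  [ContMDiffVectorBundle ∞ FV V IM]
  {FW : Type*} [NormedAddCommGroup FW] [NormedSpace ℝ FW]
  {W : M → Type*} [TopologicalSpace (TotalSpace FW W)] [∀ x, AddCommGroup (W x)]
  [∀ x, Module ℝ (W x)] [∀ x, TopologicalSpace (W x)] [FiberBundle FW W] [VectorBundle ℝ FW W]

/-- A fibrewise linear map is smooth if it maps smooth sections to smooth sections. -/
lemma contMDiff_of_sections (L : ∀ m, V m →ₗ[ℝ] W m)
    (hL : ∀ s : Cₛ^∞⟮IM; FV, V⟯, ∃ s' : Cₛ^∞⟮IM; FW, W⟯, ∀ m, s' m = L m (s m)) :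
    ContMDiff (IM.prod 𝓘(ℝ, FV)) (IM.prod 𝓘(ℝ, FW)) ∞
      (fun v : TotalSpace FV V => (⟨v.1, L v.1 v.2⟩ : TotalSpace FW W)) := by
  intro v₀
  obtain ⟨n, s, κ, hκ, hs⟩ := exists_frame IM FV V v₀.1
  choose s' hs' using fun i => hL (s i)
  let pr : C^∞⟮IM.prod 𝓘(ℝ, FV), TotalSpace FV V; IM, M⟯ := ⟨fun v => v.1, contMDiff_proj V⟩
  let T : Cₛ^∞⟮IM.prod 𝓘(ℝ, FV); FW, pr *ᵖ W⟯ :=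
    ∑ i, fsmul ⟨fun v => κ i v.1 v.2, hκ i⟩ (pullbackSection pr (s' i))
  refine (contMDiff_pullback_section.1 T.contMDiff v₀).congr_of_eventuallyEq ?_
  filter_upwards [pr.contMDiff.continuous.continuousAt.eventually hs] with v hv
  refine congrArg (TotalSpace.mk' FW v.1) ?_
  have h1 : T v = ∑ i, κ i v.1 v.2 • s' i v.1 := section_sum_apply _ _ _
  refine Eq.trans ?_ h1.symm
  conv_lhs => rw [hv v.2, map_sum]
  refine Finset.sum_congr rfl fun i _ => ?_
  rw [map_smul, hs']
  rfl

end BundleMaps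

/-! ### Parallel transport in time -/

section Transport

variable {EM M : Type*} [NormedAddCommGroup EM] [NormedSpace ℝ EM] [FiniteDimensional ℝ EM]
  [TopologicalSpace M] [ChartedSpace EM M] [IsManifold 𝓘(ℝ, EM) ∞ M] [T2Space M]
  [SigmaCompactSpace M]
  {J : TopologicalSpace.Opens ℝ}
  {FA : Type*} [NormedAddCommGroup FA] [NormedSpace ℝ FA] [FiniteDimensional ℝ FA]
  {A : M → Type*} [TopologicalSpace (TotalSpace FA A)] [∀ x, AddCommGroup (A x)]
  [∀ x, Module ℝ (A x)] [∀ x, TopologicalSpace (A x)] [FiberBundle FA A] [VectorBundle ℝ FA A]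
  [ContMDiffVectorBundle ∞ FA A 𝓘(ℝ, EM)]
  {lA : LieAlgebroid 𝓘(ℝ, EM) FA A}
  {FV : Type*} [NormedAddCommGroup FV] [NormedSpace ℝ FV] [FiniteDimensional ℝ FV]
  {V : J × M → Type*} [TopologicalSpace (TotalSpace FV V)] [∀ x, AddCommGroup (V x)]
  [∀ x, Module ℝ (V x)] [∀ x, TopologicalSpace (V x)] [FiberBundle FV V] [VectorBundle ℝ FV V]
  [ContMDiffVectorBundle ∞ FV V (𝓘(ℝ, ℝ).prod 𝓘(ℝ, EM))]

/-- Every vector is a value of a parallel section, so statements about transport need only be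
checked on such values. -/
lemma Connection.exists_parallel (hJ : (J : Set ℝ).OrdConnected)
    (D : Connection (lA.intervalProd J) FV V) (t : J) (m : M) (x : V (t, m)) :
    ∃ s, D.ddt s = 0 ∧ s (t, m) = x := by
  obtain ⟨σ, hσ⟩ := exists_section_eq (IM := 𝓘(ℝ, ℝ).prod 𝓘(ℝ, EM)) (FA := FV) (t, m) x
  obtain ⟨s, h1, h2⟩ := D.exists_solution hJ 0 t (s₀ := fun m => σ (t, m))
    (σ.contMDiff.comp (contMDiff_const.prodMk contMDiff_id))
  exact ⟨s, h1, (h2 m).trans hσ⟩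

/-- Parallel transport along `J × {m}`. -/
def Connection.transportFun (hJ : (J : Set ℝ).OrdConnected)
    (D : Connection (lA.intervalProd J) FV V) (t t' : J) (m : M) (x : V (t, m)) : V (t', m) :=
  (D.exists_parallel hJ t m x).choose (t', m)

/-- By uniqueness every parallel section computes the transport, not only the chosen one. Linearity
and invertibility follow, since parallel sections form a linear space and serve both directions. -/
lemma Connection.transportFun_apply (hJ : (J : Set ℝ).OrdConnected)
    (D : Connection (lA.intervalProd J) FV V) (t t' : J) (m : M)
    {s : Cₛ^∞⟮𝓘(ℝ, ℝ).prod 𝓘(ℝ, EM); FV, V⟯} (hs : D.ddt s = 0) :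
    D.transportFun hJ t t' m (s (t, m)) = s (t', m) := by
  obtain ⟨h1, h2⟩ := (D.exists_parallel hJ t m (s (t, m))).choose_spec
  exact D.eq_of_ddt_eq hJ (t₀ := t) (fun τ => by rw [h1, hs]) h2 t'

/-- Parallel transport as a linear isomorphism. -/
def Connection.transport (hJ : (J : Set ℝ).OrdConnected)
    (D : Connection (lA.intervalProd J) FV V) (t t' : J) (m : M) : V (t, m) ≃ₗ[ℝ] V (t', m) where
  toFun := D.transportFun hJ t t' m
  invFun := D.transportFun hJ t' t m
  map_add' x y := by
    obtain ⟨s, h1, rfl⟩ := D.exists_parallel hJ t m x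
    obtain ⟨s', h1', rfl⟩ := D.exists_parallel hJ t m y
    rw [D.transportFun_apply hJ t t' m h1, D.transportFun_apply hJ t t' m h1']
    exact D.transportFun_apply hJ t t' m (s := s + s') (by rw [map_add, h1, h1', add_zero])
  map_smul' r x := by
    obtain ⟨s, h1, rfl⟩ := D.exists_parallel hJ t m x
    rw [D.transportFun_apply hJ t t' m h1]
    exact D.transportFun_apply hJ t t' m (s := r • s) (by rw [map_smul, h1, smul_zero])
  left_inv x := by
    obtain ⟨s, h1, rfl⟩ := D.exists_parallel hJ t m x
    rw [D.transportFun_apply hJ t t' m h1, D.transportFun_apply hJ t' t m h1]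
  right_inv x := by
    obtain ⟨s, h1, rfl⟩ := D.exists_parallel hJ t' m x
    rw [D.transportFun_apply hJ t' t m h1, D.transportFun_apply hJ t t' m h1]

lemma Connection.transport_apply (hJ : (J : Set ℝ).OrdConnected)
    (D : Connection (lA.intervalProd J) FV V) (t t' : J) (m : M)
    {s : Cₛ^∞⟮𝓘(ℝ, ℝ).prod 𝓘(ℝ, EM); FV, V⟯} (hs : D.ddt s = 0) :
    D.transport hJ t t' m (s (t, m)) = s (t', m) :=
  D.transportFun_apply hJ t t' m hs

lemma Connection.transport_symm_apply (hJ : (J : Set ℝ).OrdConnected)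
    (D : Connection (lA.intervalProd J) FV V) (t t' : J) (m : M)
    {s : Cₛ^∞⟮𝓘(ℝ, ℝ).prod 𝓘(ℝ, EM); FV, V⟯} (hs : D.ddt s = 0) :
    (D.transport hJ t t' m).symm (s (t', m)) = s (t, m) :=
  D.transportFun_apply hJ t' t m hs

/-- A closed form of degree zero is parallel in all directions, in particular along `∂_t`, and so is
determined by one slice. In degree zero this replaces the construction of a primitive. -/
lemma Connection.eq_zero_of_mem_closedForms_zero (hJ : (J : Set ℝ).OrdConnected)
    {D : Connection (lA.intervalProd J) FV V} {t : J}
    {α : Form (𝓘(ℝ, ℝ).prod 𝓘(ℝ, EM)) (ℝ × FA) (TProd EM J A) FV V 0}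
    (hα : α ∈ D.closedForms 0) (h : ∀ m, α.at (t, m) Fin.elim0 = 0) : α = 0 := by
  have h1 : D.ddt (α.eval Fin.elim0) = 0 := by
    have h2 := Connection.mem_closedForms.1 hα fun _ => ddtSection EM J FA A
    rw [Connection.koszul_eq, Fin.sum_univ_succ, Fin.sum_univ_zero] at h2
    simp only [Finset.univ_eq_empty, Finset.sum_empty, smul_zero, add_zero, sub_zero,
      Fin.val_zero, pow_zero, one_smul] at h2
    refine Eq.trans ?_ h2
    exact congrArg (fun b => D.ddt (α.eval b)) (Subsingleton.elim _ _)
  refine Subtype.ext <| funext fun p => AlternatingMap.ext fun v => ?_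
  obtain rfl : v = fun i => (Fin.elim0 i : PSec EM J FA A) p := Subsingleton.elim _ _
  refine D.eq_of_ddt_eq hJ (s := α.eval Fin.elim0) (s' := 0) (m := p.2) (t₀ := t)
    (fun τ => by rw [h1, map_zero]) ?_ p.1
  refine Eq.trans ?_ (h p.2)
  exact congrArg (α.at (t, p.2)) (Subsingleton.elim _ _)

end Transport

/-! ### Closed and exact forms under pullback and restriction -/

section ChainMaps

variable {EM HM M : Type*} [NormedAddCommGroup EM] [NormedSpace ℝ EM] [TopologicalSpace HM]
  {IM : ModelWithCorners ℝ EM HM} [TopologicalSpace M] [ChartedSpace HM M] [IsManifold IM ∞ M]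
  [FiniteDimensional ℝ EM] [T2Space M]
  {EN HN N : Type*} [NormedAddCommGroup EN] [NormedSpace ℝ EN] [TopologicalSpace HN]
  {IN : ModelWithCorners ℝ EN HN} [TopologicalSpace N] [ChartedSpace HN N] [IsManifold IN ∞ N]
  {EP HP P : Type*} [NormedAddCommGroup EP] [NormedSpace ℝ EP] [TopologicalSpace HP]
  {IP : ModelWithCorners ℝ EP HP} [TopologicalSpace P] [ChartedSpace HP P] [IsManifold IP ∞ P]
  [FiniteDimensional ℝ EP] [T2Space P]
  {FA : Type*} [NormedAddCommGroup FA] [NormedSpace ℝ FA] [FiniteDimensional ℝ FA]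
  {A : M → Type*} [TopologicalSpace (TotalSpace FA A)] [∀ x, AddCommGroup (A x)]
  [∀ x, Module ℝ (A x)] [∀ x, TopologicalSpace (A x)] [FiberBundle FA A] [VectorBundle ℝ FA A]
  [ContMDiffVectorBundle ∞ FA A IM]
  {FB : Type*} [NormedAddCommGroup FB] [NormedSpace ℝ FB] [FiniteDimensional ℝ FB]
  {B : N → Type*} [TopologicalSpace (TotalSpace FB B)] [∀ x, AddCommGroup (B x)]
  [∀ x, Module ℝ (B x)] [∀ x, TopologicalSpace (B x)] [FiberBundle FB B] [VectorBundle ℝ FB B]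
  [ContMDiffVectorBundle ∞ FB B IN]
  {FC : Type*} [NormedAddCommGroup FC] [NormedSpace ℝ FC] [FiniteDimensional ℝ FC]
  {C : P → Type*} [TopologicalSpace (TotalSpace FC C)] [∀ x, AddCommGroup (C x)]
  [∀ x, Module ℝ (C x)] [∀ x, TopologicalSpace (C x)] [FiberBundle FC C] [VectorBundle ℝ FC C]
  [ContMDiffVectorBundle ∞ FC C IP]
  {FE : Type*} [NormedAddCommGroup FE] [NormedSpace ℝ FE] [FiniteDimensional ℝ FE]
  {E : N → Type*} [TopologicalSpace (TotalSpace FE E)] [∀ x, AddCommGroup (E x)]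
  [∀ x, Module ℝ (E x)] [∀ x, TopologicalSpace (E x)] [FiberBundle FE E] [VectorBundle ℝ FE E]
  [ContMDiffVectorBundle ∞ FE E IN]
  [FiniteDimensional ℝ EN] [T2Space N]
  {lA : LieAlgebroid IM FA A} {lB : LieAlgebroid IN FB B} {lC : LieAlgebroid IP FC C}

lemma pullbackForm_mem_closedForms {D : Connection lB FE E} {Φ : AnchoredHom lA lB}
    (hΦ : Φ.IsLieAlgebroidHom) {k : ℕ} {α : Form IN FB B FE E k} (hα : α ∈ D.closedForms k) :
    Φ.pullbackForm k α ∈ (D.pullback Φ).closedForms k := by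
  refine Connection.mem_closedForms.2 fun a => ContMDiffSection.ext fun m => ?_
  refine (D.koszul_pullbackForm_apply hΦ α a
    (fun i => sectionThrough IN FB (Φ.base m) (Φ.fiber m (a i m))) m
    fun i => (sectionThrough_apply _ _).symm).trans ?_
  rw [Connection.mem_closedForms.1 hα]
  rfl

lemma pullbackForm_mem_exactForms {D : Connection lB FE E} {Φ : AnchoredHom lA lB}
    (hΦ : Φ.IsLieAlgebroidHom) {k : ℕ} {α : Form IN FB B FE E k} (hα : α ∈ D.exactForms k) :
    Φ.pullbackForm k α ∈ (D.pullback Φ).exactForms k := by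
  cases k with
  | zero =>
    obtain rfl : α = 0 := hα
    rw [map_zero]
    exact Submodule.zero_mem _
  | succ k =>
    obtain ⟨η, hη⟩ := hα
    refine ⟨Φ.pullbackForm k η, fun a => ContMDiffSection.ext fun m => ?_⟩
    let b : Fin (k + 1) → Cₛ^∞⟮IN; FB, B⟯ := fun i =>
      sectionThrough IN FB (Φ.base m) (Φ.fiber m (a i m))
    have hb : ∀ i, Φ.fiber m (a i m) = b i (Φ.base m) := fun i => (sectionThrough_apply _ _).symm
    refine Eq.trans ?_ (D.koszul_pullbackForm_apply hΦ η a b m hb).symm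
    rw [← hη b]
    exact congrArg (α.at (Φ.base m)) (funext hb)

lemma restrictForm_mem_closedForms {D : Connection lB FE E} {Φ : AnchoredHom lC lB}
    {Ψ : AnchoredHom lA lC} (hΨ : Ψ.IsLieAlgebroidHom) {k : ℕ}
    {α : Form IP FC C FE (Φ.base *ᵖ E) k} (hα : α ∈ (D.pullback Φ).closedForms k) :
    Φ.restrictForm Ψ k α ∈ (D.pullback (Φ.comp Ψ)).closedForms k := by
  refine Connection.mem_closedForms.2 fun a => ContMDiffSection.ext fun m => ?_
  refine (D.koszul_restrictForm_apply Φ hΨ α a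
    (fun i => sectionThrough IP FC (Ψ.base m) (Ψ.fiber m (a i m))) m
    fun i => (sectionThrough_apply _ _).symm).trans ?_
  rw [Connection.mem_closedForms.1 hα]
  rfl

lemma restrictForm_mem_exactForms {D : Connection lB FE E} {Φ : AnchoredHom lC lB}
    {Ψ : AnchoredHom lA lC} (hΨ : Ψ.IsLieAlgebroidHom) {k : ℕ}
    {α : Form IP FC C FE (Φ.base *ᵖ E) k} (hα : α ∈ (D.pullback Φ).exactForms k) :
    Φ.restrictForm Ψ k α ∈ (D.pullback (Φ.comp Ψ)).exactForms k := by
  cases k with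
  | zero =>
    obtain rfl : α = 0 := hα
    rw [map_zero]
    exact Submodule.zero_mem _
  | succ k =>
    obtain ⟨η, hη⟩ := hα
    refine ⟨Φ.restrictForm Ψ k η, fun a => ContMDiffSection.ext fun m => ?_⟩
    let X : Fin (k + 1) → Cₛ^∞⟮IP; FC, C⟯ := fun i =>
      sectionThrough IP FC (Ψ.base m) (Ψ.fiber m (a i m))
    have hX : ∀ i, Ψ.fiber m (a i m) = X i (Ψ.base m) := fun i => (sectionThrough_apply _ _).symm
    refine Eq.trans ?_ (D.koszul_restrictForm_apply Φ hΨ η a X m hX).symm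
    rw [← hη X]
    exact congrArg (α.at (Ψ.base m)) (funext hX)

end ChainMaps

/-! ### Slices of a homotopy and the flow between them -/

section Homotopy

set_option maxHeartbeats 1000000

variable {EM M : Type*} [NormedAddCommGroup EM] [NormedSpace ℝ EM] [FiniteDimensional ℝ EM]
  [TopologicalSpace M] [ChartedSpace EM M] [IsManifold 𝓘(ℝ, EM) ∞ M] [T2Space M]
  [SigmaCompactSpace M]
  {EN N : Type*} [NormedAddCommGroup EN] [NormedSpace ℝ EN] [FiniteDimensional ℝ EN]
  [TopologicalSpace N] [ChartedSpace EN N] [IsManifold 𝓘(ℝ, EN) ∞ N] [T2Space N]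
  {FA : Type*} [NormedAddCommGroup FA] [NormedSpace ℝ FA] [FiniteDimensional ℝ FA]
  {A : M → Type*} [TopologicalSpace (TotalSpace FA A)] [∀ x, AddCommGroup (A x)]
  [∀ x, Module ℝ (A x)] [∀ x, TopologicalSpace (A x)] [FiberBundle FA A] [VectorBundle ℝ FA A]
  [ContMDiffVectorBundle ∞ FA A 𝓘(ℝ, EM)]
  {FB : Type*} [NormedAddCommGroup FB] [NormedSpace ℝ FB] [FiniteDimensional ℝ FB]
  {B : N → Type*} [TopologicalSpace (TotalSpace FB B)] [∀ x, AddCommGroup (B x)]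
  [∀ x, Module ℝ (B x)] [∀ x, TopologicalSpace (B x)] [FiberBundle FB B] [VectorBundle ℝ FB B]
  [ContMDiffVectorBundle ∞ FB B 𝓘(ℝ, EN)]
  {FE : Type*} [NormedAddCommGroup FE] [NormedSpace ℝ FE] [FiniteDimensional ℝ FE]
  {E : N → Type*} [TopologicalSpace (TotalSpace FE E)] [∀ x, AddCommGroup (E x)]
  [∀ x, Module ℝ (E x)] [∀ x, TopologicalSpace (E x)] [FiberBundle FE E] [VectorBundle ℝ FE E]
  [ContMDiffVectorBundle ∞ FE E 𝓘(ℝ, EN)]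
  {lA : LieAlgebroid 𝓘(ℝ, EM) FA A} {lB : LieAlgebroid 𝓘(ℝ, EN) FB B}
  {J : TopologicalSpace.Opens ℝ} {Φ : AnchoredHom (lA.intervalProd J) lB}

/-- A section of `φ_t^!E` and the same family of vectors in `φ^!E` have the same components in the
trivializations of `E`; only the base map differs. -/
lemma contMDiff_slice_section (t : J)
    (s : Cₛ^∞⟮𝓘(ℝ, EM); FE, (Φ.comp (lA.incl t)).base *ᵖ E⟯) :
    ContMDiff 𝓘(ℝ, EM) ((𝓘(ℝ, ℝ).prod 𝓘(ℝ, EM)).prod 𝓘(ℝ, FE)) ∞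
      fun m => (⟨(t, m), s m⟩ : TotalSpace FE (Φ.base *ᵖ E)) := by
  intro m
  have h := contMDiff_pullback_section.1 s.contMDiff m
  rw [contMDiffAt_totalSpace] at h ⊢
  exact ⟨contMDiffAt_const.prodMk contMDiffAt_id, h.2⟩

lemma exists_parallel_restrictSection (hJ : (J : Set ℝ).OrdConnected) (D : Connection lB FE E)
    (t : J) (s₀ : Cₛ^∞⟮𝓘(ℝ, EM); FE, (Φ.comp (lA.incl t)).base *ᵖ E⟯) :
    ∃ s : Cₛ^∞⟮𝓘(ℝ, ℝ).prod 𝓘(ℝ, EM); FE, Φ.base *ᵖ E⟯,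
      (D.pullback Φ).ddt s = 0 ∧ Φ.restrictSection (lA.incl t) s = s₀ := by
  obtain ⟨s, h1, h2⟩ := (D.pullback Φ).exists_solution hJ 0 t (contMDiff_slice_section t s₀)
  exact ⟨s, h1, ContMDiffSection.ext h2⟩

/-- Extension of primitives from the slice at time `t`. -/
lemma exists_primitive_restrictForm (hJ : (J : Set ℝ).OrdConnected) (hΦ : Φ.IsLieAlgebroidHom)
    {D : Connection lB FE E} (hD : D.IsFlat) (t : J) {k : ℕ}
    {γ : Form (𝓘(ℝ, ℝ).prod 𝓘(ℝ, EM)) (ℝ × FA) (TProd EM J A) FE (Φ.base *ᵖ E) (k + 1)}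
    (hγ : γ ∈ (D.pullback Φ).closedForms (k + 1))
    (η : Form 𝓘(ℝ, EM) FA A FE ((Φ.comp (lA.incl t)).base *ᵖ E) k)
    (hη : ∀ a, (Φ.restrictForm (lA.incl t) (k + 1) γ).eval a =
      (D.pullback (Φ.comp (lA.incl t))).koszul k η a) :
    ∃ ζ : Form (𝓘(ℝ, ℝ).prod 𝓘(ℝ, EM)) (ℝ × FA) (TProd EM J A) FE (Φ.base *ᵖ E) k,
      (∀ a : Fin k → Cₛ^∞⟮𝓘(ℝ, EM); FA, A⟯,
        (D.pullback Φ).ddt (ζ.eval fun i => constPSec J (a i)) =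
          (γ.contract (ddtSection EM J FA A)).eval fun i => constPSec J (a i)) ∧
      Φ.restrictForm (lA.incl t) k ζ = η ∧ ∀ X, γ.eval X = (D.pullback Φ).koszul k ζ X := by
  obtain ⟨ζ, h1, h2, h3⟩ := Connection.exists_primitive hJ (hD.pullback hΦ) hγ t
    (fun m => η.at m) (fun a => contMDiff_slice_section t (η.eval a))
  have h4 : Φ.restrictForm (lA.incl t) k ζ = η :=
    Subtype.ext <| funext fun m => AlternatingMap.ext fun v => h2 m v
  -- On the slice `dζ` is the differential of the restriction of `ζ`, namely `dη`, and this is the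
  -- restriction of `γ`. That is the initial condition for `dζ = γ`.
  refine ⟨ζ, h1, h4, fun X => (h3 (fun a m => ?_) X).symm⟩
  have h5 := D.koszul_restrictForm_apply Φ (lA.incl_isLieAlgebroidHom t) ζ a
    (fun i => constPSec J (a i)) m fun i => rfl
  rw [h4] at h5
  refine h5.symm.trans ?_
  rw [← hη a]
  rfl

/-- Closed forms on the slice at time `t` extend to closed forms which are parallel in the
direction `∂_t`. -/
lemma exists_closed_restrictForm (hJ : (J : Set ℝ).OrdConnected) (hΦ : Φ.IsLieAlgebroidHom)
    {D : Connection lB FE E} (hD : D.IsFlat) (t : J) {k : ℕ}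
    {η : Form 𝓘(ℝ, EM) FA A FE ((Φ.comp (lA.incl t)).base *ᵖ E) k}
    (hη : η ∈ (D.pullback (Φ.comp (lA.incl t))).closedForms k) :
    ∃ ζ ∈ (D.pullback Φ).closedForms k, Φ.restrictForm (lA.incl t) k ζ = η ∧
      ∀ a : Fin k → Cₛ^∞⟮𝓘(ℝ, EM); FA, A⟯,
        (D.pullback Φ).ddt (ζ.eval fun i => constPSec J (a i)) = 0 := by
  -- This is the extension of primitives for `γ = 0`: closedness of `η` says that it is a primitive
  -- of zero on the slice.
  obtain ⟨ζ, h1, h2, h3⟩ := exists_primitive_restrictForm hJ hΦ hD t (Submodule.zero_mem _) η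
    fun a => by
      rw [Connection.mem_closedForms.1 hη, map_zero]
      rfl
  exact ⟨ζ, Connection.mem_closedForms.2 fun X => (h3 X).symm, h2, h1⟩

/-- Injectivity of the restriction in cohomology. A primitive on the slice extends to a primitive;
in degree zero only `0` is exact, and a closed form vanishing on a slice vanishes. -/
lemma mem_exactForms_of_restrictForm (hJ : (J : Set ℝ).OrdConnected) (hΦ : Φ.IsLieAlgebroidHom)
    {D : Connection lB FE E} (hD : D.IsFlat) (t : J) {k : ℕ}
    {α : Form (𝓘(ℝ, ℝ).prod 𝓘(ℝ, EM)) (ℝ × FA) (TProd EM J A) FE (Φ.base *ᵖ E) k}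
    (hα : α ∈ (D.pullback Φ).closedForms k)
    (h : Φ.restrictForm (lA.incl t) k α ∈ (D.pullback (Φ.comp (lA.incl t))).exactForms k) :
    α ∈ (D.pullback Φ).exactForms k := by
  cases k with
  | zero =>
    have h0 : Φ.restrictForm (lA.incl t) 0 α = 0 := h
    refine Connection.eq_zero_of_mem_closedForms_zero hJ hα (t := t) fun m => ?_
    have h3 := congrArg (fun β : Form 𝓘(ℝ, EM) FA A FE ((Φ.comp (lA.incl t)).base *ᵖ E) 0 =>
      β.at m Fin.elim0) h0
    refine Eq.trans ?_ h3
    exact congrArg (α.at (t, m)) (Subsingleton.elim _ _)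
  | succ k =>
    obtain ⟨η, hη⟩ := h
    obtain ⟨ζ, -, -, h3⟩ := exists_primitive_restrictForm hJ hΦ hD t hα η hη
    exact ⟨ζ, h3⟩

/-- The restriction to the slice at time `t` is an isomorphism in cohomology. -/
theorem exists_restrictForm_equiv (hJ : (J : Set ℝ).OrdConnected) (hΦ : Φ.IsLieAlgebroidHom)
    {D : Connection lB FE E} (hD : D.IsFlat) (t : J) (k : ℕ) :
    ∃ I : (D.pullback Φ).Cohomology k ≃ₗ[ℝ] (D.pullback (Φ.comp (lA.incl t))).Cohomology k,
      InducedBy I (Φ.restrictForm (lA.incl t) k) := by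
  refine exists_equiv_inducedBy _
    (fun _ => restrictForm_mem_closedForms (lA.incl_isLieAlgebroidHom t))
    (fun _ => restrictForm_mem_exactForms (lA.incl_isLieAlgebroidHom t))
    (fun _ hα => mem_exactForms_of_restrictForm hJ hΦ hD t hα) fun η hη => ?_
  obtain ⟨ζ, hζ, h, -⟩ := exists_closed_restrictForm hJ hΦ hD t hη
  exact ⟨ζ, hζ, h⟩

/-- The transported section is the restriction of a smooth parallel extension to another slice,
hence smooth. This gives smoothness of the flow and of its inverse as bundle maps. -/
lemma exists_restrictSection_transport (hJ : (J : Set ℝ).OrdConnected) (D : Connection lB FE E)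
    (t t' : J) (s₀ : Cₛ^∞⟮𝓘(ℝ, EM); FE, (Φ.comp (lA.incl t)).base *ᵖ E⟯) :
    ∃ s' : Cₛ^∞⟮𝓘(ℝ, EM); FE, (Φ.comp (lA.incl t')).base *ᵖ E⟯, ∀ m,
      (s' m : (Φ.base *ᵖ E) (t', m)) = (D.pullback Φ).transport hJ t t' m (s₀ m) := by
  obtain ⟨s, h1, rfl⟩ := exists_parallel_restrictSection hJ D t s₀
  exact ⟨Φ.restrictSection (lA.incl t') s, fun m =>
    ((D.pullback Φ).transport_apply hJ t t' m h1).symm⟩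

/-- The flow of `(Φ^*∇)_(∂_t, 0)` from time `t` to time `t'`. -/
def flowIso (hJ : (J : Set ℝ).OrdConnected) (Φ : AnchoredHom (lA.intervalProd J) lB)
    (D : Connection lB FE E) (t t' : J) :
    BundleIso 𝓘(ℝ, EM) FE ((Φ.comp (lA.incl t)).base *ᵖ E) FE
      ((Φ.comp (lA.incl t')).base *ᵖ E) where
  fiber m := (D.pullback Φ).transport hJ t t' m
  contMDiff_fiber := contMDiff_of_sections
    (V := (Φ.comp (lA.incl t)).base *ᵖ E) (W := (Φ.comp (lA.incl t')).base *ᵖ E)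
    (fun m => ((D.pullback Φ).transport hJ t t' m).toLinearMap)
    fun s => exists_restrictSection_transport hJ D t t' s
  contMDiff_symm := contMDiff_of_sections
    (V := (Φ.comp (lA.incl t')).base *ᵖ E) (W := (Φ.comp (lA.incl t)).base *ᵖ E)
    (fun m => ((D.pullback Φ).transport hJ t t' m).symm.toLinearMap)
    fun s => exists_restrictSection_transport hJ D t' t s

lemma flowIso_mapSection (hJ : (J : Set ℝ).OrdConnected) (D : Connection lB FE E) (t t' : J)
    {s : Cₛ^∞⟮𝓘(ℝ, ℝ).prod 𝓘(ℝ, EM); FE, Φ.base *ᵖ E⟯} (hs : (D.pullback Φ).ddt s = 0) :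
    (flowIso hJ Φ D t t').mapSection (Φ.restrictSection (lA.incl t) s) =
      Φ.restrictSection (lA.incl t') s :=
  ContMDiffSection.ext fun m => (D.pullback Φ).transport_apply hJ t t' m hs

/-- By flatness the derivative of a parallel section along a time-independent section is again
parallel. Its values on the two slices are the two pulled back derivatives, so the flow carries one
to the other. -/
lemma flowIso_isGaugeEquivalence (hJ : (J : Set ℝ).OrdConnected) (hΦ : Φ.IsLieAlgebroidHom)
    {D : Connection lB FE E} (hD : D.IsFlat) (t t' : J) :
    (flowIso hJ Φ D t t').IsGaugeEquivalence (D.pullback (Φ.comp (lA.incl t)))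
      (D.pullback (Φ.comp (lA.incl t'))) := by
  intro a e m
  obtain ⟨s, h1, rfl⟩ := exists_parallel_restrictSection hJ D t e
  rw [flowIso_mapSection hJ D t t' h1]
  have h2 : (D.pullback Φ).ddt ((D.pullback Φ).toFun (constPSec J a) s) = 0 := by
    rw [(hD.pullback hΦ).ddt_toFun_const, h1, map_zero]
  have e1 := D.pullback_comp_apply Φ (lA.incl t) a (constPSec J a) s m rfl
  have e2 := D.pullback_comp_apply Φ (lA.incl t') a (constPSec J a) s m rfl
  refine e1.trans (Eq.trans ?_ (congrArg ((D.pullback Φ).transport hJ t t' m).symm e2).symm)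
  exact ((D.pullback Φ).transport_symm_apply hJ t t' m h2).symm

/-- The values of the form on time-independent sections are parallel, so transport carries one
restriction to the other. The slices are thus compared by the flow on forms, before passing to
cohomology. -/
lemma flowIso_mapForm (hJ : (J : Set ℝ).OrdConnected) (D : Connection lB FE E) (t t' : J) {k : ℕ}
    {ζ : Form (𝓘(ℝ, ℝ).prod 𝓘(ℝ, EM)) (ℝ × FA) (TProd EM J A) FE (Φ.base *ᵖ E) k}
    (hζ : ∀ a : Fin k → Cₛ^∞⟮𝓘(ℝ, EM); FA, A⟯,
        (D.pullback Φ).ddt (ζ.eval fun i => constPSec J (a i)) = 0) :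
    (flowIso hJ Φ D t t').mapForm k (Φ.restrictForm (lA.incl t) k ζ) =
      Φ.restrictForm (lA.incl t') k ζ := by
  refine Subtype.ext <| funext fun m => AlternatingMap.ext fun v => ?_
  have hv : v = fun i => sectionThrough 𝓘(ℝ, EM) FA m (v i) m :=
    funext fun i => (sectionThrough_apply _ _).symm
  rw [hv]
  exact (D.pullback Φ).transport_apply hJ t t' m (hζ fun i => sectionThrough 𝓘(ℝ, EM) FA m (v i))

/-- Comparison of the cohomologies of the slices at times `t` and `t'`. -/
lemma exists_cohomology_comparison (hJ : (J : Set ℝ).OrdConnected) (hΦ : Φ.IsLieAlgebroidHom)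
    {D : Connection lB FE E} (hD : D.IsFlat) (t t' : J) (k : ℕ)
    {R : (D.pullback Φ).Cohomology k ≃ₗ[ℝ] (D.pullback (Φ.comp (lA.incl t))).Cohomology k}
    {R' : (D.pullback Φ).Cohomology k ≃ₗ[ℝ] (D.pullback (Φ.comp (lA.incl t'))).Cohomology k}
    (hR : InducedBy R (Φ.restrictForm (lA.incl t) k))
    (hR' : InducedBy R' (Φ.restrictForm (lA.incl t') k)) :
    ∃ (P : D.Cohomology k →ₗ[ℝ] (D.pullback (Φ.comp (lA.incl t))).Cohomology k)
      (P' : D.Cohomology k →ₗ[ℝ] (D.pullback (Φ.comp (lA.incl t'))).Cohomology k)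
      (S : (D.pullback (Φ.comp (lA.incl t))).Cohomology k ≃ₗ[ℝ]
        (D.pullback (Φ.comp (lA.incl t'))).Cohomology k),
      InducedBy P ((Φ.comp (lA.incl t)).pullbackForm k) ∧
      InducedBy P' ((Φ.comp (lA.incl t')).pullbackForm k) ∧
      InducedBy S ((flowIso hJ Φ D t t').mapForm k) ∧
      (∀ c, P' c = R' (R.symm (P c))) ∧ ∀ c, R' (R.symm c) = S c := by
  refine InducedBy.exists_comparison hR hR' (p := Φ.pullbackForm k)
    (fun _ => pullbackForm_mem_closedForms hΦ) (fun _ => pullbackForm_mem_exactForms hΦ)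
    (fun _ => rfl) (fun _ => rfl) fun η hη => ?_
  obtain ⟨ζ, hζ, rfl, h⟩ := exists_closed_restrictForm hJ hΦ hD t hη
  exact ⟨ζ, hζ, rfl, flowIso_mapForm hJ D t t' h⟩

lemma exists_slices_cohomology_comparison (hJ : (J : Set ℝ).OrdConnected) (hΦ : Φ.IsLieAlgebroidHom)
    {D : Connection lB FE E} (hD : D.IsFlat) (t t' : J) (k : ℕ) :
    ∃ (P : D.Cohomology k →ₗ[ℝ] (D.pullback (Φ.comp (lA.incl t))).Cohomology k)
      (P' : D.Cohomology k →ₗ[ℝ] (D.pullback (Φ.comp (lA.incl t'))).Cohomology k)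
      (R : ∀ τ : J, (D.pullback Φ).Cohomology k ≃ₗ[ℝ]
        (D.pullback (Φ.comp (lA.incl τ))).Cohomology k)
      (S : (D.pullback (Φ.comp (lA.incl t))).Cohomology k ≃ₗ[ℝ]
        (D.pullback (Φ.comp (lA.incl t'))).Cohomology k),
      InducedBy P ((Φ.comp (lA.incl t)).pullbackForm k) ∧
      InducedBy P' ((Φ.comp (lA.incl t')).pullbackForm k) ∧
      (∀ τ, InducedBy (R τ) (Φ.restrictForm (lA.incl τ) k)) ∧
      InducedBy S ((flowIso hJ Φ D t t').mapForm k) ∧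
      (∀ c, P' c = R t' ((R t).symm (P c))) ∧ ∀ c, R t' ((R t).symm c) = S c :=
  (Classical.axiomOfChoice fun τ => exists_restrictForm_equiv hJ hΦ hD τ k).elim fun R hR =>
    (exists_cohomology_comparison hJ hΦ hD t t' k (hR t) (hR t')).elim fun P h =>
      h.elim fun P' h => h.elim fun S h =>
        ⟨P, P', R, S, h.1, h.2.1, hR, h.2.2.1, h.2.2.2.1, h.2.2.2.2⟩

end Homotopy

end LA

end

/-! ### The homotopy theorem -/

set_option maxHeartbeats 1000000 in
theorem theorem3p7
    {EM M : Type*} [NormedAddCommGroup EM] [NormedSpace ℝ EM] [FiniteDimensional ℝ EM]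
    [TopologicalSpace M] [ChartedSpace EM M] [IsManifold 𝓘(ℝ, EM) ∞ M] [T2Space M]
    [SigmaCompactSpace M]
    {EN N : Type*} [NormedAddCommGroup EN] [NormedSpace ℝ EN] [FiniteDimensional ℝ EN]
    [TopologicalSpace N] [ChartedSpace EN N] [IsManifold 𝓘(ℝ, EN) ∞ N] [T2Space N]
    [SigmaCompactSpace N]
    {FA : Type*} [NormedAddCommGroup FA] [NormedSpace ℝ FA] [FiniteDimensional ℝ FA]
    {A : M → Type*} [TopologicalSpace (TotalSpace FA A)] [∀ x, AddCommGroup (A x)]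
    [∀ x, Module ℝ (A x)] [∀ x, TopologicalSpace (A x)] [FiberBundle FA A] [VectorBundle ℝ FA A]
    [ContMDiffVectorBundle ∞ FA A 𝓘(ℝ, EM)]
    {FB : Type*} [NormedAddCommGroup FB] [NormedSpace ℝ FB] [FiniteDimensional ℝ FB]
    {B : N → Type*} [TopologicalSpace (TotalSpace FB B)] [∀ x, AddCommGroup (B x)]
    [∀ x, Module ℝ (B x)] [∀ x, TopologicalSpace (B x)] [FiberBundle FB B] [VectorBundle ℝ FB B]
    [ContMDiffVectorBundle ∞ FB B 𝓘(ℝ, EN)]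
    {FE : Type*} [NormedAddCommGroup FE] [NormedSpace ℝ FE] [FiniteDimensional ℝ FE]
    {E : N → Type*} [TopologicalSpace (TotalSpace FE E)] [∀ x, AddCommGroup (E x)]
    [∀ x, Module ℝ (E x)] [∀ x, TopologicalSpace (E x)] [FiberBundle FE E] [VectorBundle ℝ FE E]
    [ContMDiffVectorBundle ∞ FE E 𝓘(ℝ, EN)]
    (lA : LieAlgebroid 𝓘(ℝ, EM) FA A) (lB : LieAlgebroid 𝓘(ℝ, EN) FB B)
    (J : TopologicalSpace.Opens ℝ) (hJ : (J : Set ℝ).OrdConnected)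
    (h0 : (0 : ℝ) ∈ J) (h1 : (1 : ℝ) ∈ J)
    (Φ : AnchoredHom (lA.intervalProd J) lB) (hΦ : Φ.IsLieAlgebroidHom)
    (D : Connection lB FE E) (hD : D.IsFlat) :
    let Φt : J → AnchoredHom lA lB := fun t => Φ.comp (lA.incl t)
    let z : J := ⟨0, h0⟩
    let o : J := ⟨1, h1⟩
    ∃ θ : BundleIso 𝓘(ℝ, EM) FE ((Φt z).base *ᵖ E) FE ((Φt o).base *ᵖ E),
      -- `θ` is a gauge equivalence from `Φ₀^*∇` to `Φ₁^*∇`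
      θ.IsGaugeEquivalence (D.pullback (Φt z)) (D.pullback (Φt o)) ∧
      -- `θ` is the flow of `(Φ^*∇)_(∂_t, 0)` from time `0` to time `1`
      (∀ s : Cₛ^∞⟮𝓘(ℝ, ℝ).prod 𝓘(ℝ, EM); FE, Φ.base *ᵖ E⟯,
        (D.pullback Φ).toFun (ddtSection EM J FA A) s = 0 →
          θ.mapSection (Φ.restrictSection (lA.incl z) s) = Φ.restrictSection (lA.incl o) s) ∧
      (∀ s₀ : Cₛ^∞⟮𝓘(ℝ, EM); FE, (Φt z).base *ᵖ E⟯,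
        ∃ s : Cₛ^∞⟮𝓘(ℝ, ℝ).prod 𝓘(ℝ, EM); FE, Φ.base *ᵖ E⟯,
          (D.pullback Φ).toFun (ddtSection EM J FA A) s = 0 ∧
            Φ.restrictSection (lA.incl z) s = s₀) ∧
      ∀ k : ℕ,
        ∃ (F₀ : D.Cohomology k →ₗ[ℝ] (D.pullback (Φt z)).Cohomology k)
          (F₁ : D.Cohomology k →ₗ[ℝ] (D.pullback (Φt o)).Cohomology k)
          (I : ∀ t : J, (D.pullback Φ).Cohomology k ≃ₗ[ℝ] (D.pullback (Φt t)).Cohomology k)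
          (T : (D.pullback (Φt z)).Cohomology k ≃ₗ[ℝ] (D.pullback (Φt o)).Cohomology k),
          InducedBy F₀ ((Φt z).pullbackForm k) ∧
          InducedBy F₁ ((Φt o).pullbackForm k) ∧
          (∀ t, InducedBy (I t) (Φ.restrictForm (lA.incl t) k)) ∧
          InducedBy T (θ.mapForm k) ∧
          (∀ c, F₁ c = (I o) ((I z).symm (F₀ c))) ∧
          (∀ c, (I o) ((I z).symm c) = T c) := by
  intro Φt z o
  exact ⟨flowIso hJ Φ D z o, flowIso_isGaugeEquivalence hJ hΦ hD z o,
    fun s hs => flowIso_mapSection hJ D z o hs,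
    fun s₀ => exists_parallel_restrictSection hJ D z s₀,
    fun k => exists_slices_cohomology_comparison hJ hΦ hD z o k⟩
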